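/- Let $\ell$ be a prime and let $E/\mathbb{Q}_\ell$ be a finite extension with ring of integers $\mathcal{O}$ and residue field $\mathbb{F}$. Let $L$ be a finite extension of some $\mathbb{Q}_p$ with residue field of order $q$, let $G_L=\mathrm{Gal}(\overline L/L)$ with inertia subgroup $I_L$, and let $\widetilde P_L\subseteq I_L$ be the kernel of the maximal pro-$\ell$ quotient of $I_L$. Let $\varphi\in G_L$ be a lift of the arithmetic Frobenius and let $\sigma\in I_L$ be an element whose image topologically generates $I_L/\widetilde P_L$. Assume that $q$ is banal (for $n=4$), i.e. $q\not\equiv 0$ and $q^i\not\equiv 1 \pmod \ell$ for $i=1,2,3,4$. Let $\bar r:G_L\to \mathrm{GL}_4(\mathbb{F})$ be a continuous representation with $\bar r(\widetilde P_L)=1$ and $\bar r(\sigma)$ unipotent, and assume that $\mathbb{F}$ contains all eigenvalues of $\bar r(\varphi)$. The functor of continuous lifts of $\bar r$ to $\mathrm{GL}_4(A)$, for Artinian local $\mathcal{O}$-algebras $A$ with residue field $\mathbb{F}$, is pro-represented by a complete Noetherian local $\mathcal{O}$-algebra $R^\square(\bar r)$ with residue field $\mathbb{F}$. Every $\mathcal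 O$-algebra homomorphism $x:R^\square(\bar r)\to\overline E$ gives a representation $r_x:G_L\to\mathrm{GL}_4(\overline E)$. For a partition $\underline m$ of $4$, let $N_{\underline m}$ be the nilpotent matrix in Jordan form with blocks of sizes $\underline m$, and let $R^\square(\bar r,\mathrm{st}_{\underline m})$ be the quotient of $R^\square(\bar r)$ by the ideal of all elements that vanish at every $x$ for which the Weil--Deligne representation of $r_x$ is trivial on $I_L$ and has monodromy operator conjugate to $N_{\underline m}$ (so $\operatorname{Spec}R^\square(\bar r,\mathrm{st}_{\underline m})$ is the Zariski closure of the set of these points; it is empty, and the ring is $0$, if there are none). Let $\widehat R^{2,2}(\mathrm{st}_{2,2})$ be the completion, at the ideal generated by the variables, of the graded ring $\mathcal{O}[A,B,C,D,S,T,U,X,Y,Z]$ modulo the relations $$\begin{pmatrix}S&T\\U&-S\end{pmatrix}\begin{pmatrix}A&B\\C&D\end{pmatrix}=\begin{pmatrix}A&B\\C&D\end{pmatrix}\begin{pmatrix}X&Y\\Z&-X\end{pmatrix},\qquad S^2+TU=X^2+YZ,$$ and let $\widehat R^{1,2,1}(\mathrm{st}_{2,2})$ be the completion, at the ideal generated by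 the variables, of the graded ring $\mathcal{O}[A,B,C,D,R,X,Y,Z]$ modulo the relations $$\begin{pmatrix}A&B\end{pmatrix}\begin{pmatrix}X&Y\\Z&-X\end{pmatrix}=R\begin{pmatrix}A&B\end{pmatrix},\quad \begin{pmatrix}X&Y\\Z&-X\end{pmatrix}\begin{pmatrix}C\\D\end{pmatrix}=-R\begin{pmatrix}C\\D\end{pmatrix},\quad AC+BD=0,\quad R^2=X^2+YZ.$$ Then, with all isomorphisms being isomorphisms of $\mathcal{O}$-algebras: 1. Either $R^\square(\bar r,\mathrm{st}_{1,1,1,1})=0$ or $R^\square(\bar r,\mathrm{st}_{1,1,1,1})\cong\mathcal{O}[[t_1,\dots,t_{16}]]$. 2. Either $R^\square(\bar r,\mathrm{st}_4)=0$ or $R^\square(\bar r,\mathrm{st}_4)\cong\mathcal{O}[[t_1,\dots,t_{16}]]$. 3. If $\bar r(\sigma)=1$ and $\bar r(\varphi)$ is conjugate in $\mathrm{GL}_4(\overline{\mathbb{F}})$ to $\bar\lambda\,\mathrm{diag}(q,q,1,1)$ for some $\bar\lambda\in\overline{\mathbb{F}}^\times$, then $R^\square(\bar r,\mathrm{st}_{2,2})\cong\widehat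 R^{2,2}(\mathrm{st}_{2,2})[[t_1,\dots,t_9]]$. 4. If $\bar r(\sigma)=1$ and $\bar r(\varphi)$ is conjugate in $\mathrm{GL}_4(\overline{\mathbb{F}})$ to $\bar\lambda\,\mathrm{diag}(q^2,q,q,1)$ for some $\bar\lambda\in\overline{\mathbb{F}}^\times$, then $R^\square(\bar r,\mathrm{st}_{2,2})\cong\widehat R^{1,2,1}(\mathrm{st}_{2,2})[[t_1,\dots,t_{11}]]$. 5. If $\bar r$ satisfies neither the condition of 3 nor that of 4, then either $R^\square(\bar r,\mathrm{st}_{2,2})=0$ or $R^\square(\bar r,\mathrm{st}_{2,2})\cong\mathcal{O}[[t_1,\dots,t_{16}]]$. -/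

import Mathlib

open ValuativeRel IsLocalRing

universe u v

noncomputable section

namespace Banal

/-! ### The absolute Galois group of a local field and its inertia subgroup -/

section Galois

variable (L : Type v) [Field L] [ValuativeRel L]

/-- The absolute Galois group `G_L = Gal(Lbar / L)`, with the Krull topology. -/
abbrev AbsGal : Type v := AlgebraicClosure L ≃ₐ[L] AlgebraicClosure L

/-- The ring of integers of `Lbar`. -/
abbrev IntegersBar : Subalgebra 𝒪[L] (AlgebraicClosure L) :=
  integralClosure 𝒪[L] (AlgebraicClosure L)

/-- The maximal ideal of the (local) ring of integers of `Lbar`, written as the intersection of all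
its maximal ideals. -/
def maxIdealBar : Ideal (IntegersBar L) := (⊥ : Ideal (IntegersBar L)).jacobson

/-- The order `q` of the residue field of `L`. -/
def resCard : ℕ := Nat.card 𝓀[L]

/-- The inertia subgroup `I_L`: the automorphisms that act trivially on the residue field of
`Lbar`. -/
def inertia : Subgroup (AbsGal L) := (maxIdealBar L).inertia (AbsGal L)

/-- `φ` is a lift of the arithmetic Frobenius: it acts as `x ↦ x ^ q` on the residue field of
`Lbar`. -/
def IsFrobeniusLift (φ : AbsGal L) : Prop :=
  ∀ x : IntegersBar L, φ • x - x ^ resCard L ∈ maxIdealBar L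

/-- The kernel of the maximal pro-`ℓ` quotient of `I_L`: the intersection of all open normal
subgroups of `I_L` of `ℓ`-power index. -/
def proEllKernel (ℓ : ℕ) : Subgroup (inertia L) :=
  sInf {U | U.Normal ∧ IsOpen (U : Set (inertia L)) ∧ ∃ k : ℕ, U.index = ℓ ^ k}

/-- The image of `σ` topologically generates the maximal pro-`ℓ` quotient of `I_L`. -/
def IsTameGenerator (ℓ : ℕ) (σ : inertia L) : Prop :=
  Dense ((Subgroup.zpowers σ ⊔ proEllKernel L ℓ : Subgroup (inertia L)) : Set (inertia L))

end Galois

/-- `q` is banal for `GL_n` at `ℓ`. -/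
def IsBanal (n ℓ q : ℕ) : Prop :=
  ¬ q ≡ 0 [MOD ℓ] ∧ ∀ i ∈ Finset.Icc 1 n, ¬ q ^ i ≡ 1 [MOD ℓ]

/-! ### Framed deformations -/

section Deformations

variable {G : Type v} [Group G] [TopologicalSpace G] {n : ℕ}

/-- Continuity of `ρ : G → GL_n(A)` for the topology on the local ring `A` defined by the powers of
its maximal ideal (the discrete topology if `A` is Artinian, in particular if `A` is a field). -/
def IsAdicContinuous {A : Type u} [CommRing A] [IsLocalRing A]
    (ρ : G →* Matrix.GeneralLinearGroup (Fin n) A) : Prop :=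
  ∀ k : ℕ, IsOpen {g : G | ∀ i j,
    (ρ g : Matrix (Fin n) (Fin n) A) i j - (1 : Matrix (Fin n) (Fin n) A) i j ∈
      maximalIdeal A ^ k}

variable {O : Type u} [CommRing O] [IsLocalRing O]

/-- `A` has the same residue field as `O`. -/
def SameResidueField (O A : Type u) [CommRing O] [CommRing A] [IsLocalRing A]
    [Algebra O A] : Prop :=
  Function.Surjective (algebraMap O (ResidueField A))

/-- `ρ : G → GL_n(A)` reduces to `ρbar` modulo the maximal ideal of `A`. -/
def IsLift (ρbar : G →* Matrix.GeneralLinearGroup (Fin n) (ResidueField O))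
    {A : Type u} [CommRing A] [IsLocalRing A] [Algebra O A] [IsLocalHom (algebraMap O A)]
    (ρ : G →* Matrix.GeneralLinearGroup (Fin n) A) : Prop :=
  ∀ g, Matrix.GeneralLinearGroup.map (residue A) (ρ g) =
    Matrix.GeneralLinearGroup.map (ResidueField.map (algebraMap O A)) (ρbar g)

/-- `R` is the framed deformation ring of `ρbar`, with universal lift `ρuniv`: it is a complete
Noetherian local `O`-algebra with the residue field of `O`, and it pro-represents the functor of
continuous lifts of `ρbar` on Artinian local `O`-algebras with the residue field of `O`. -/
structure IsFramedDeformationRing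
    (ρbar : G →* Matrix.GeneralLinearGroup (Fin n) (ResidueField O))
    (R : Type u) [CommRing R] [IsLocalRing R] [Algebra O R] [IsLocalHom (algebraMap O R)]
    (ρuniv : G →* Matrix.GeneralLinearGroup (Fin n) R) : Prop where
  noetherian : IsNoetherianRing R
  complete : IsAdicComplete (maximalIdeal R) R
  sameResidueField : SameResidueField O R
  continuous : IsAdicContinuous ρuniv
  lift : IsLift ρbar ρuniv
  universal : ∀ (A : Type u) [CommRing A] [IsLocalRing A] [IsArtinianRing A] [Algebra O A]
    [IsLocalHom (algebraMap O A)], SameResidueField O A →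
    ∀ ρ : G →* Matrix.GeneralLinearGroup (Fin n) A, IsAdicContinuous ρ → IsLift ρbar ρ →
      ∃! f : R →ₐ[O] A, (Matrix.GeneralLinearGroup.map (f : R →+* A)).comp ρuniv = ρ

end Deformations

/-! ### Inertial types and fixed type deformation rings -/

/-- The exponential of a nilpotent `n × n` matrix. -/
def nilExp {n : ℕ} {K : Type u} [Field K] (N : Matrix (Fin n) (Fin n) K) :
    Matrix (Fin n) (Fin n) K :=
  ∑ k ∈ Finset.range (n + 1), ((k.factorial : K)⁻¹) • N ^ k

/-- The nilpotent matrix in Jordan form, with ones above the diagonal, whose successive Jordan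
blocks have the sizes listed in `m` (a list of positive integers with sum `n`). -/
def jordanNilpotent (n : ℕ) (m : List ℕ) (K : Type u) [Field K] : Matrix (Fin n) (Fin n) K :=
  Matrix.of fun i j =>
    if j.val = i.val + 1 ∧ j.val ∉ m.scanl (fun a b => a + b) 0 then 1 else 0

section Types

variable {L : Type v} [Field L] [ValuativeRel L]
variable {E : Type u} [Field E] [TopologicalSpace E] {n : ℕ}

/-- `ρ : G_L → GL_n(Ebar)` has inertial type `(rτ, Nτ)`. Here `t` is a nonzero continuous
homomorphism `I_L → E` (all of them are proportional to the `ℓ`-adic tame character), `N` is the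
monodromy operator of `ρ`, so that `ρ = exp (t N)` on an open subgroup of inertia, and the
restriction to inertia of the Weil--Deligne representation of `ρ` is `g ↦ ρ(g) exp (-t(g) N)`,
with monodromy `N`; the pair has to be conjugate to `(rτ, Nτ)`. -/
def HasInertialType (ρ : AbsGal L →* Matrix.GeneralLinearGroup (Fin n) (AlgebraicClosure E))
    (rτ : inertia L →* Matrix.GeneralLinearGroup (Fin n) (AlgebraicClosure E))
    (Nτ : Matrix (Fin n) (Fin n) (AlgebraicClosure E)) : Prop :=
  ∃ t : inertia L →* Multiplicative E, Continuous t ∧ t ≠ 1 ∧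
    ∃ N : Matrix (Fin n) (Fin n) (AlgebraicClosure E), IsNilpotent N ∧
      (∃ U : Subgroup (inertia L), IsOpen (U : Set (inertia L)) ∧
        ∀ g ∈ U, (ρ g : Matrix (Fin n) (Fin n) (AlgebraicClosure E)) =
          nilExp ((t g).toAdd • N)) ∧
      ∃ P : Matrix.GeneralLinearGroup (Fin n) (AlgebraicClosure E),
        (∀ g : inertia L,
          (ρ g : Matrix (Fin n) (Fin n) (AlgebraicClosure E)) * nilExp (-((t g).toAdd • N)) =
            (P * rτ g * P⁻¹ : Matrix.GeneralLinearGroup (Fin n) (AlgebraicClosure E))) ∧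
        N = P.val * Nτ * P⁻¹.val

/-- `ρ` has the unipotent inertial type `τ_m = (1, N_m)` attached to the partition `m` of `n`. -/
def HasUnipotentType (m : List ℕ)
    (ρ : AbsGal L →* Matrix.GeneralLinearGroup (Fin n) (AlgebraicClosure E)) : Prop :=
  HasInertialType ρ 1 (jordanNilpotent n m (AlgebraicClosure E))

/-- The ideal of functions on `Spec R` that vanish at all `Ebar`-points `x` for which `r_x`, the
push-forward of `ρuniv` along `x`, has type `τ_m`. -/
def typeIdeal (E : Type u) [Field E] [TopologicalSpace E] [ValuativeRel E] (m : List ℕ)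
    {R : Type u} [CommRing R] [Algebra 𝒪[E] R]
    (ρuniv : AbsGal L →* Matrix.GeneralLinearGroup (Fin n) R) : Ideal R :=
  ⨅ x ∈ {x : R →ₐ[𝒪[E]] AlgebraicClosure E | HasUnipotentType m
    ((Matrix.GeneralLinearGroup.map (x : R →+* AlgebraicClosure E)).comp ρuniv)},
    RingHom.ker x

/-- The fixed type deformation ring `R(ρbar, st_m)`: the coordinate ring of the Zariski closure of
the set of `Ebar`-points of type `τ_m`, where `(R, ρuniv)` is the framed deformation ring. -/
abbrev FixedTypeRing (E : Type u) [Field E] [TopologicalSpace E] [ValuativeRel E] (m : List ℕ)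
    {R : Type u} [CommRing R] [Algebra 𝒪[E] R]
    (ρuniv : AbsGal L →* Matrix.GeneralLinearGroup (Fin n) R) : Type u :=
  R ⧸ typeIdeal E m ρuniv

end Types

/-! ### The two model rings -/

section Models

variable (O : Type u) [CommRing O]

open MvPolynomial in
/-- The equations of the graded ring `R^{2,2}(st_{2,2})` in the variables
`A, B, C, D, S, T, U, X, Y, Z`, numbered `0, …, 9`. -/
def ideal22 : Ideal (MvPolynomial (Fin 10) O) :=
  let N : Matrix (Fin 2) (Fin 2) (MvPolynomial (Fin 10) O) := !![X 0, X 1; X 2, X 3]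
  let X₁ : Matrix (Fin 2) (Fin 2) (MvPolynomial (Fin 10) O) := !![X 4, X 5; X 6, -X 4]
  let X₂ : Matrix (Fin 2) (Fin 2) (MvPolynomial (Fin 10) O) := !![X 7, X 8; X 9, -X 7]
  Ideal.span ({f | ∃ i j, f = (X₁ * N - N * X₂) i j} ∪
    {(X 4 ^ 2 + X 5 * X 6) - (X 7 ^ 2 + X 8 * X 9)})

open MvPolynomial in
/-- The equations of the graded ring `R^{1,2,1}(st_{2,2})` in the variables
`A, B, C, D, R, X, Y, Z`, numbered `0, …, 7`. -/
def ideal121 : Ideal (MvPolynomial (Fin 8) O) :=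
  let N₁ : Matrix (Fin 1) (Fin 2) (MvPolynomial (Fin 8) O) := !![X 0, X 1]
  let N₂ : Matrix (Fin 2) (Fin 1) (MvPolynomial (Fin 8) O) := !![X 2; X 3]
  let X₂ : Matrix (Fin 2) (Fin 2) (MvPolynomial (Fin 8) O) := !![X 5, X 6; X 7, -X 5]
  Ideal.span ({f | ∃ i j, f = (N₁ * X₂ - (X 4 : MvPolynomial (Fin 8) O) • N₁) i j} ∪
    {f | ∃ i j, f = (X₂ * N₂ + (X 4 : MvPolynomial (Fin 8) O) • N₂) i j} ∪
    {X 0 * X 2 + X 1 * X 3, X 4 ^ 2 - (X 5 ^ 2 + X 6 * X 7)})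

/-- The completion of a graded quotient `O[x_1, …, x_d] / J` of a polynomial ring (variables in
degree one) as a graded `O`-algebra, that is, at the ideal generated by the variables. -/
abbrev GradedCompletion {d : ℕ} (J : Ideal (MvPolynomial (Fin d) O)) : Type u :=
  AdicCompletion
    (Ideal.span (Set.range fun i : Fin d => Ideal.Quotient.mk J (MvPolynomial.X i)))
    (MvPolynomial (Fin d) O ⧸ J)

/-- The complete ring `R^{2,2}(st_{2,2})`. -/
abbrev Rhat22 : Type u := GradedCompletion O (ideal22 O)

/-- The complete ring `R^{1,2,1}(st_{2,2})`. -/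
abbrev Rhat121 : Type u := GradedCompletion O (ideal121 O)

end Models

/-- `M` is conjugate to `c • diag(d)` over an algebraic closure of `k`, for some `c ≠ 0`. -/
def IsConjScalarDiag {n : ℕ} {k : Type u} [Field k]
    (M : Matrix.GeneralLinearGroup (Fin n) k) (d : Fin n → k) : Prop :=
  ∃ c : AlgebraicClosure k, c ≠ 0 ∧
    ∃ P : Matrix.GeneralLinearGroup (Fin n) (AlgebraicClosure k),
      P.val * M.val.map (algebraMap k (AlgebraicClosure k)) * P⁻¹.val =
        c • Matrix.diagonal fun i => algebraMap k (AlgebraicClosure k) (d i)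

end Banal

end

open Banal

set_option linter.unusedSectionVars false
set_option linter.overlappingInstances false

noncomputable section

namespace Banal

/-! ### Complete Noetherian local algebras -/

section AdicLift

variable {O S A : Type*} [CommRing O] [CommRing S] [CommRing A] [Algebra O S] [Algebra O A]

/-- An algebra homomorphism that is continuous for adic topologies extends to the completion. -/
theorem exists_adicCompletion_lift (I : Ideal S) (J : Ideal A) [IsAdicComplete J A] (g : S →ₐ[O] A)
    (hg : ∀ x ∈ I, g x ∈ J) :
    ∃ h : AdicCompletion I S →ₐ[O] A, ∀ x, h (AdicCompletion.of I S x) = g x := by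
  have hpow : ∀ n, I ^ n ≤ (J ^ n).comap g := fun n => by
    refine le_trans ?_ (Ideal.le_comap_pow _ n)
    exact Ideal.pow_right_mono hg n
  let f : (n : ℕ) → AdicCompletion I S →ₐ[O] A ⧸ J ^ n := fun n =>
    (Ideal.quotientMapₐ (J ^ n) g (hpow n)).comp ((AdicCompletion.evalₐ I n).restrictScalars O)
  have hf : ∀ {m n : ℕ} (hle : m ≤ n),
      (Ideal.Quotient.factorₐ O (Ideal.pow_le_pow_right hle)).comp (f n) = f m := by
    intro m n hle
    ext x
    obtain ⟨x, rfl⟩ := AdicCompletion.mk_surjective I S x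
    simp only [f, AlgHom.comp_apply, AlgHom.restrictScalars_apply]
    rw [AdicCompletion.evalₐ_mk, AdicCompletion.evalₐ_mk]
    simp only [Ideal.quotient_map_mkₐ, Ideal.Quotient.factorₐ_apply_mk, Ideal.Quotient.mkₐ_eq_mk]
    rw [Ideal.Quotient.eq, ← map_sub]
    refine Ideal.mem_comap.mp (hpow m ?_)
    rw [← Ideal.Quotient.eq]
    exact AdicCompletion.Ideal.mk_eq_mk I hle x
  refine ⟨IsAdicComplete.liftAlgHom J f hf, fun x => ?_⟩
  rw [IsHausdorff.eq_iff_smodEq (I := J)]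
  intro n
  rw [SModEq.sub_mem, smul_eq_mul, Ideal.mul_top, ← Ideal.Quotient.eq,
    IsAdicComplete.mk_liftAlgHom]
  simp [f]

/-- Evaluation of a power series with coefficients in `O` at elements of an ideal for which the
target is complete. -/
theorem exists_powerSeries_lift {σ : Type*} [Finite σ] (J : Ideal A) [IsAdicComplete J A]
    (a : σ → A) (ha : ∀ i, a i ∈ J) :
    ∃ h : MvPowerSeries σ O →ₐ[O] A, ∀ i, h (MvPowerSeries.X i) = a i := by
  obtain ⟨h, hh⟩ := exists_adicCompletion_lift (MvPolynomial.idealOfVars σ O) J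
    (MvPolynomial.aeval (R := O) a) (fun x hx => by
      have : MvPolynomial.idealOfVars σ O ≤ J.comap (MvPolynomial.aeval (R := O) a) := by
        rw [MvPolynomial.idealOfVars, Ideal.span_le]
        rintro _ ⟨i, rfl⟩
        simpa using ha i
      exact this hx)
  refine ⟨h.comp (((MvPowerSeries.toAdicCompletionAlgEquiv σ O).restrictScalars O :
    MvPowerSeries σ O ≃ₐ[O] _) : MvPowerSeries σ O →ₐ[O] _), fun i => ?_⟩
  have := MvPowerSeries.toAdicCompletion_coe (R := O) (MvPolynomial.X i : MvPolynomial σ O)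
  rw [MvPolynomial.coe_X] at this
  simp [this, hh]

end AdicLift

/-- `A` is a complete Noetherian local `O`-algebra with the residue field of `O`. -/
class IsCNL (O A : Type u) [CommRing O] [IsLocalRing O] [CommRing A] [IsLocalRing A]
    [Algebra O A] : Prop where
  noetherian : IsNoetherianRing A
  complete : IsAdicComplete (maximalIdeal A) A
  localHom : IsLocalHom (algebraMap O A)
  residue_surjective : Function.Surjective (algebraMap O (ResidueField A))

section CNL

variable {O : Type u} [CommRing O] [IsLocalRing O]

attribute [instance] IsCNL.localHom

theorem map_mem_maximalIdeal {A B : Type*} [CommRing A] [IsLocalRing A] [CommRing B]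
    [IsLocalRing B] [Algebra O A] [Algebra O B]
    (hB : Function.Surjective (algebraMap O (ResidueField B))) (f : A →ₐ[O] B) {x : A}
    (hx : x ∈ maximalIdeal A) : f x ∈ maximalIdeal B := by
  have hs : Function.Surjective ((residue B).comp (f : A →+* B)) := by
    intro y
    obtain ⟨o, rfl⟩ := hB y
    refine ⟨algebraMap O A o, ?_⟩
    simp only [RingHom.comp_apply, RingHom.coe_coe, AlgHom.commutes]
    rfl
  have hm := RingHom.ker_isMaximal_of_surjective _ hs
  rw [← IsLocalRing.eq_maximalIdeal hm, RingHom.mem_ker] at hx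
  exact (residue_eq_zero_iff _).mp hx

theorem exists_sub_algebraMap_mem {A : Type*} [CommRing A] [IsLocalRing A] [Algebra O A]
    (hA : Function.Surjective (algebraMap O (ResidueField A))) (x : A) :
    ∃ o : O, x - algebraMap O A o ∈ maximalIdeal A := by
  obtain ⟨o, ho⟩ := hA (residue A x)
  refine ⟨o, ?_⟩
  rw [← residue_eq_zero_iff, map_sub, sub_eq_zero, ← ho]
  rfl

theorem algebraMap_mem_maximalIdeal (A : Type u) [CommRing A] [IsLocalRing A] [Algebra O A]
    [IsLocalHom (algebraMap O A)] {o : O} (ho : o ∈ maximalIdeal O) :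
    algebraMap O A o ∈ maximalIdeal A := fun h =>
  ho (isUnit_of_map_unit (algebraMap O A) o h)

theorem IsCNL.of_surjective {A B : Type u} [CommRing A] [IsLocalRing A] [CommRing B]
    [IsLocalRing B] [Algebra O A] [Algebra O B] [IsCNL O A] (f : A →ₐ[O] B)
    (hf : Function.Surjective f) : IsCNL O B := by
  have := IsCNL.noetherian (O := O) (A := A)
  have hN : IsNoetherianRing B := isNoetherianRing_of_surjective A B f hf
  have hres : Function.Surjective (algebraMap O (ResidueField B)) := by
    intro y
    obtain ⟨b, rfl⟩ := IsLocalRing.residue_surjective y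
    obtain ⟨a, rfl⟩ := hf b
    obtain ⟨o, ho⟩ := exists_sub_algebraMap_mem (IsCNL.residue_surjective (O := O) (A := A)) a
    refine ⟨o, ?_⟩
    have hl : IsLocalHom (f : A →+* B) := IsLocalHom.of_surjective _ hf
    have h2 : f (a - algebraMap O A o) ∈ maximalIdeal B := by
      have := ((IsLocalRing.local_hom_TFAE (f : A →+* B)).out 0 2).mp hl
      exact this (Ideal.mem_map_of_mem _ ho)
    rw [← residue_eq_zero_iff, map_sub, map_sub, sub_eq_zero, AlgHom.commutes] at h2
    exact h2.symm
  have hmap : (maximalIdeal A).map (f : A →+* B) = maximalIdeal B := by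
    apply le_antisymm
    · rw [Ideal.map_le_iff_le_comap]
      exact fun x hx => map_mem_maximalIdeal hres f hx
    · intro b hb
      obtain ⟨a, rfl⟩ := hf b
      refine Ideal.mem_map_of_mem _ ?_
      by_contra h
      rw [IsLocalRing.mem_maximalIdeal, mem_nonunits_iff, not_not] at h
      exact (IsLocalRing.mem_maximalIdeal _).mp hb (h.map f)
  refine ⟨hN, ?_, ?_, hres⟩
  · refine { toIsHausdorff := inferInstance, prec' := fun g hg => ?_ }
    choose s hs using hf
    have hd : ∀ n, ∃ d ∈ maximalIdeal A ^ n, f d = g (n + 1) - g n := by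
      intro n
      have h1 := hg (Nat.le_succ n)
      rw [SModEq.sub_mem, smul_eq_mul, Ideal.mul_top, ← hmap, ← Ideal.map_pow] at h1
      obtain ⟨d, hd, hd'⟩ := (Ideal.mem_map_iff_of_surjective (f : A →+* B)
        (fun b => ⟨s b, hs b⟩)).mp h1
      exact ⟨-d, neg_mem hd, by rw [map_neg, ← neg_sub (g n)]; exact congrArg _ hd'⟩
    choose d hdm hdf using hd
    let G : ℕ → A := fun n => s (g 0) + ∑ i ∈ Finset.range n, d i
    have hG : ∀ n, f (G n) = g n := by
      intro n
      induction n with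
      | zero => simp [G, hs]
      | succ n ih =>
        have : G (n + 1) = G n + d n := by simp [G, Finset.sum_range_succ, add_assoc]
        rw [this, map_add, ih, hdf]; ring
    have hC : ∀ {m n : ℕ}, m ≤ n → G m ≡ G n [SMOD (maximalIdeal A ^ m • ⊤ : Submodule A A)] := by
      intro m n hmn
      rw [SModEq.sub_mem, smul_eq_mul, Ideal.mul_top, ← neg_mem_iff, neg_sub]
      have : G n - G m = ∑ i ∈ Finset.Ico m n, d i := by
        simp only [G, Finset.sum_Ico_eq_sub _ hmn]; ring
      rw [this]
      refine Ideal.sum_mem _ fun i hi => ?_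
      exact Ideal.pow_le_pow_right (Finset.mem_Ico.mp hi).1 (hdm i)
    obtain ⟨x, hx⟩ := (IsCNL.complete (O := O) (A := A)).prec hC
    refine ⟨f x, fun n => ?_⟩
    have h1 := hx n
    rw [SModEq.sub_mem, smul_eq_mul, Ideal.mul_top] at h1 ⊢
    rw [← hG, ← map_sub, ← hmap, ← Ideal.map_pow]
    exact Ideal.mem_map_of_mem (f : A →+* B) h1
  · constructor
    intro o ho
    by_contra h
    have h1 : o ∈ maximalIdeal O := h
    have h2 : algebraMap O A o ∈ maximalIdeal A := algebraMap_mem_maximalIdeal A h1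
    have h3 := map_mem_maximalIdeal hres f h2
    rw [AlgHom.commutes] at h3
    exact h3 ho

theorem IsCNL.eq_of_forall_sub_mem {A : Type u} [CommRing A] [IsLocalRing A] [Algebra O A]
    [IsCNL O A] {x y : A} (h : ∀ n, x - y ∈ maximalIdeal A ^ n) : x = y := by
  have : IsHausdorff (maximalIdeal A) A := (IsCNL.complete (O := O) (A := A)).toIsHausdorff
  rw [IsHausdorff.eq_iff_smodEq (I := maximalIdeal A)]
  intro n
  rw [SModEq.sub_mem, smul_eq_mul, Ideal.mul_top]
  exact h n

/-- The maximal ideal of `B` is generated by the maximal ideal of `O` and the elements `b i`. -/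
def Generates (O : Type u) [CommRing O] [IsLocalRing O] {B : Type u} [CommRing B] [IsLocalRing B]
    [Algebra O B] {ι : Type*} (b : ι → B) : Prop :=
  maximalIdeal B ≤ (maximalIdeal O).map (algebraMap O B) ⊔ Ideal.span (Set.range b)

theorem Generates.surjective {A B : Type u} [CommRing A] [IsLocalRing A] [CommRing B]
    [IsLocalRing B] [Algebra O A] [Algebra O B] [IsCNL O A] [IsCNL O B] {ι : Type*} {b : ι → B}
    (hb : Generates O b) (hbm : ∀ i, b i ∈ maximalIdeal B) (f : A →ₐ[O] B)
    (hf : ∀ i, ∃ a, f a = b i) : Function.Surjective f := by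
  have hmap : (maximalIdeal A).map (f : A →+* B) = maximalIdeal B := by
    apply le_antisymm
    · rw [Ideal.map_le_iff_le_comap]
      exact fun x hx => map_mem_maximalIdeal (IsCNL.residue_surjective) f hx
    · refine hb.trans (sup_le ?_ ?_)
      · rw [Ideal.map_le_iff_le_comap]
        intro o ho
        rw [Ideal.mem_comap, ← AlgHom.commutes f]
        exact Ideal.mem_map_of_mem (f : A →+* B) (algebraMap_mem_maximalIdeal A ho)
      · rw [Ideal.span_le]
        rintro _ ⟨i, rfl⟩
        obtain ⟨a, ha⟩ := hf i
        rw [SetLike.mem_coe, ← ha]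
        refine Ideal.mem_map_of_mem (f : A →+* B) ?_
        by_contra h
        rw [IsLocalRing.mem_maximalIdeal, mem_nonunits_iff, not_not] at h
        exact (IsLocalRing.mem_maximalIdeal _).mp (hbm i) (ha ▸ h.map f)
  have hH : IsHausdorff ((maximalIdeal A).map (f : A →+* B)) B := by
    rw [hmap]; exact (IsCNL.complete (O := O) (A := B)).toIsHausdorff
  have hP : IsPrecomplete (maximalIdeal A) A := (IsCNL.complete (O := O) (A := A)).toIsPrecomplete
  apply surjective_of_mk_map_comp_surjective (I := maximalIdeal A) (f : A →+* B)
  intro y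
  obtain ⟨y, rfl⟩ := Ideal.Quotient.mk_surjective y
  obtain ⟨o, ho⟩ := exists_sub_algebraMap_mem (IsCNL.residue_surjective (O := O) (A := B)) y
  refine ⟨algebraMap O A o, ?_⟩
  simp only [RingHom.comp_apply, RingHom.coe_coe, AlgHom.commutes]
  rw [eq_comm, Ideal.Quotient.eq, hmap]
  exact ho

theorem Generates.exists_sub_mem_pow {B : Type u} [CommRing B] [IsLocalRing B] [Algebra O B]
    [IsCNL O B] {ι : Type*} {b : ι → B} (hb : Generates O b) (S : Subalgebra O B)
    (hbm : ∀ i, b i ∈ maximalIdeal B) (hS : ∀ i, b i ∈ S) (n : ℕ) (x : B) :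
    ∃ y ∈ S, x - y ∈ maximalIdeal B ^ n := by
  have hspan : ∀ n, maximalIdeal B ^ n ≤
      Ideal.span ((S : Set B) ∩ (maximalIdeal B ^ n : Ideal B)) := by
    intro n
    induction n with
    | zero =>
      rw [pow_zero, Ideal.one_eq_top, Set.inter_eq_left.mpr (by simp)]
      rw [top_le_iff, Ideal.eq_top_iff_one]
      exact Ideal.subset_span S.one_mem
    | succ n ih =>
      have h1 : maximalIdeal B ≤ Ideal.span ((S : Set B) ∩ (maximalIdeal B : Ideal B)) := by
        refine hb.trans (sup_le ?_ ?_)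
        · rw [Ideal.map_le_iff_le_comap]
          exact fun o ho => Ideal.subset_span
            ⟨S.algebraMap_mem o, algebraMap_mem_maximalIdeal B ho⟩
        · rw [Ideal.span_le]
          rintro _ ⟨i, rfl⟩
          exact Ideal.subset_span ⟨hS i, hbm i⟩
      rw [pow_succ]
      refine (Ideal.mul_mono ih h1).trans ?_
      rw [Ideal.span_mul_span']
      refine Ideal.span_mono ?_
      rintro _ ⟨x, hx, y, hy, rfl⟩
      exact ⟨S.mul_mem hx.1 hy.1, Ideal.mul_mem_mul hx.2 hy.2⟩
  induction n with
  | zero => exact ⟨0, S.zero_mem, by simp⟩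
  | succ n ih =>
    obtain ⟨y, hy, hxy⟩ := ih
    suffices H : ∀ z ∈ Ideal.span ((S : Set B) ∩ (maximalIdeal B ^ n : Ideal B)),
        ∃ w ∈ S, z - w ∈ maximalIdeal B ^ (n + 1) by
      obtain ⟨w, hw, hzw⟩ := H _ (hspan n hxy)
      exact ⟨y + w, S.add_mem hy hw, by rwa [← sub_sub]⟩
    intro z hz
    induction hz using Submodule.span_induction with
    | mem z hz => exact ⟨z, hz.1, by simp⟩
    | zero => exact ⟨0, S.zero_mem, by simp⟩
    | add z z' _ _ h h' =>
      obtain ⟨w, hw, h⟩ := h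
      obtain ⟨w', hw', h'⟩ := h'
      exact ⟨w + w', S.add_mem hw hw', by rw [add_sub_add_comm]; exact add_mem h h'⟩
    | smul c z _ h =>
      obtain ⟨w, hw, h⟩ := h
      obtain ⟨o, ho⟩ := exists_sub_algebraMap_mem (IsCNL.residue_surjective (O := O) (A := B)) c
      by_cases hz : z ∈ maximalIdeal B ^ n
      · refine ⟨algebraMap O B o * w, S.mul_mem (S.algebraMap_mem o) hw, ?_⟩
        have : c • z - algebraMap O B o * w =
            (c - algebraMap O B o) * z + algebraMap O B o * (z - w) := by
          rw [smul_eq_mul]; ring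
        rw [this]
        refine add_mem ?_ (Ideal.mul_mem_left _ _ h)
        rw [pow_succ']
        exact Ideal.mul_mem_mul ho hz
      · refine absurd ?_ hz
        refine (Ideal.span_le.mpr (fun t ht => ht.2) : Ideal.span
          ((S : Set B) ∩ (maximalIdeal B ^ n : Ideal B)) ≤ _) ‹_›

theorem Generates.algHom_ext {A B : Type u} [CommRing A] [IsLocalRing A] [CommRing B]
    [IsLocalRing B] [Algebra O A] [Algebra O B] [IsCNL O A] [IsCNL O B] {ι : Type*} {b : ι → B}
    (hb : Generates O b) (hbm : ∀ i, b i ∈ maximalIdeal B) {f g : B →ₐ[O] A}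
    (h : ∀ i, f (b i) = g (b i)) : f = g := by
  ext x
  refine IsCNL.eq_of_forall_sub_mem (O := O) fun n => ?_
  obtain ⟨y, hy, hxy⟩ := hb.exists_sub_mem_pow (AlgHom.equalizer f g) hbm h n x
  have hy : f y = g y := hy
  have hp : ∀ e : B →ₐ[O] A, ∀ z ∈ maximalIdeal B ^ n, e z ∈ maximalIdeal A ^ n := by
    intro e z hz
    have : maximalIdeal B ^ n ≤ (maximalIdeal A ^ n).comap (e : B →+* A) :=
      le_trans (Ideal.pow_right_mono (fun t ht =>
        map_mem_maximalIdeal (IsCNL.residue_surjective) e ht) n) (Ideal.le_comap_pow _ n)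
    exact this hz
  have : f x - g x = f (x - y) - g (x - y) := by rw [map_sub, map_sub, hy]; ring
  rw [this]
  exact sub_mem (hp f _ hxy) (hp g _ hxy)

end CNL

/-! ### Power series rings -/

section PowerSeries

variable {O : Type u} [CommRing O] [IsLocalRing O]
variable {C : Type u} [CommRing C] [IsLocalRing C] [Algebra O C]
variable {ι : Type} [Finite ι]

open MvPowerSeries in
theorem mem_maximalIdeal_powerSeries_iff {f : MvPowerSeries ι C} :
    f ∈ maximalIdeal (MvPowerSeries ι C) ↔ constantCoeff f ∈ maximalIdeal C := by
  rw [IsLocalRing.mem_maximalIdeal, IsLocalRing.mem_maximalIdeal, mem_nonunits_iff,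
    mem_nonunits_iff, isUnit_iff_constantCoeff]

open MvPowerSeries in
theorem C_mem_pow {n : ℕ} {c : C} (hc : c ∈ maximalIdeal C ^ n) :
    (MvPowerSeries.C c : MvPowerSeries ι C) ∈ maximalIdeal (MvPowerSeries ι C) ^ n := by
  have : maximalIdeal C ≤ (maximalIdeal (MvPowerSeries ι C)).comap (MvPowerSeries.C (σ := ι)) := by
    intro x hx
    rw [Ideal.mem_comap, mem_maximalIdeal_powerSeries_iff]
    simpa using hx
  exact (le_trans (Ideal.pow_right_mono this n) (Ideal.le_comap_pow _ n)) hc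

open MvPowerSeries in
theorem span_X_le_maximalIdeal :
    Ideal.span (Set.range (X : ι → MvPowerSeries ι C)) ≤ maximalIdeal (MvPowerSeries ι C) := by
  rw [Ideal.span_le]
  rintro _ ⟨i, rfl⟩
  rw [SetLike.mem_coe, mem_maximalIdeal_powerSeries_iff]
  simp

open MvPowerSeries in
theorem monomial_mem_pow (x : ι →₀ ℕ) {n : ℕ} {c : C}
    (hc : c ∈ maximalIdeal C ^ (n - x.degree)) :
    monomial x c ∈ maximalIdeal (MvPowerSeries ι C) ^ n := by
  classical
  have h1 : (monomial x c : MvPowerSeries ι C) = MvPowerSeries.C c * monomial x 1 := by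
    rw [← monomial_zero_eq_C_apply, monomial_mul_monomial]; simp
  have h2 : (monomial x (1 : C) : MvPowerSeries ι C) ∈
      maximalIdeal (MvPowerSeries ι C) ^ x.degree := by
    have hx : (monomial x (1 : C) : MvPowerSeries ι C) =
        ((MvPolynomial.monomial x (1 : C) : MvPolynomial ι C) : MvPowerSeries ι C) := by
      rw [MvPolynomial.coe_monomial]
    rw [hx, MvPolynomial.monomial_eq]
    have : Fintype ι := Fintype.ofFinite ι
    simp only [map_one, one_mul]
    rw [Finsupp.prod_fintype _ _ (by simp)]
    rw [Finsupp.degree_eq_sum, ← Finset.prod_pow_eq_pow_sum]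
    have : (((∏ i, MvPolynomial.X i ^ x i : MvPolynomial ι C)) : MvPowerSeries ι C) =
        ∏ i, (X i : MvPowerSeries ι C) ^ x i := by
      rw [← MvPolynomial.coeToMvPowerSeries.ringHom_apply, map_prod]
      simp
    rw [this]
    refine Ideal.prod_mem_prod fun i _ => Ideal.pow_mem_pow ?_ _
    exact span_X_le_maximalIdeal (Ideal.subset_span ⟨i, rfl⟩)
  rw [h1]
  have h3 := Ideal.mul_mem_mul (C_mem_pow (ι := ι) hc) h2
  rw [← pow_add] at h3
  exact Ideal.pow_le_pow_right (by omega) h3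

open MvPowerSeries in
theorem coeff_mem_of_mem_pow {n : ℕ} {f : MvPowerSeries ι C}
    (hf : f ∈ maximalIdeal (MvPowerSeries ι C) ^ n) (x : ι →₀ ℕ) :
    coeff x f ∈ maximalIdeal C ^ (n - x.degree) := by
  classical
  induction n generalizing f x with
  | zero => simp
  | succ n ih =>
    rw [pow_succ] at hf
    refine Submodule.mul_induction_on hf (fun g hg h hh => ?_) (fun g h hg hh => ?_)
    · rw [coeff_mul]
      refine Ideal.sum_mem _ fun p hp => ?_
      have hp' := Finset.HasAntidiagonal.mem_antidiagonal.mp hp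
      have hd : x.degree = p.1.degree + p.2.degree := by rw [← hp', map_add]
      have h1 := ih hg p.1
      by_cases h2 : p.2 = 0
      · have h3 : coeff p.2 h ∈ maximalIdeal C := by
          rw [h2, coeff_zero_eq_constantCoeff_apply]
          exact mem_maximalIdeal_powerSeries_iff.mp hh
        have h4 := Ideal.mul_mem_mul h1 h3
        rw [← pow_succ] at h4
        exact Ideal.pow_le_pow_right (by rw [h2, map_zero] at hd; omega) h4
      · have : p.2.degree ≠ 0 := by rwa [Ne, Finsupp.degree_eq_zero_iff]
        exact Ideal.pow_le_pow_right (by omega) (Ideal.mul_mem_right _ _ h1)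
    · rw [map_add]
      exact add_mem hg hh

theorem finite_degree_lt (n : ℕ) : {x : ι →₀ ℕ | x.degree < n}.Finite :=
  Finsupp.finite_of_degree_lt n

open MvPowerSeries in
theorem mem_span_X_pow_of_coeff_eq_zero {C : Type*} [CommRing C] {n : ℕ} {f : MvPowerSeries ι C}
    (hcoeff : ∀ x : ι →₀ ℕ, x.degree < n → coeff x f = 0) :
    f ∈ Ideal.span (Set.range (X : ι → MvPowerSeries ι C)) ^ n := by
  let e := toAdicCompletionAlgEquiv ι C
  let I := MvPolynomial.idealOfVars ι C
  have h0 : e f ∈ I ^ n • (⊤ : Submodule (MvPolynomial ι C)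
      (AdicCompletion I (MvPolynomial ι C))) := by
    rw [AdicCompletion.pow_smul_top_eq_ker_eval (MvPolynomial.idealOfVars_fg ι C),
      LinearMap.mem_ker, AdicCompletion.eval_apply]
    change Submodule.Quotient.mk (truncTotal n f) = 0
    have : truncTotal n f = 0 := by
      ext x
      by_cases hx : x.degree < n
      · rw [coeff_truncTotal _ hx, hcoeff x hx]; simp
      · rw [coeff_truncTotal_eq_zero _ (not_lt.mp hx)]; simp
    rw [this, Submodule.Quotient.mk_zero]
  have h1 : f ∈ I ^ n • (⊤ : Submodule (MvPolynomial ι C) (MvPowerSeries ι C)) := by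
    have := Submodule.mem_map_of_mem (f := e.symm.toLinearEquiv.toLinearMap) h0
    rw [Submodule.map_smul''] at this
    have h5 : e.symm.toLinearEquiv.toLinearMap (e f) = f :=
      e.symm_apply_apply _
    rw [h5] at this
    exact Submodule.smul_mono le_rfl le_top this
  rw [Ideal.smul_top_eq_map] at h1
  have h2 : f ∈ (I ^ n).map (algebraMap (MvPolynomial ι C) (MvPowerSeries ι C)) := h1
  rw [Ideal.map_pow] at h2
  refine Ideal.pow_right_mono ?_ n h2
  rw [Ideal.map_le_iff_le_comap, show I = Ideal.span (Set.range MvPolynomial.X) from rfl,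
    Ideal.span_le]
  rintro _ ⟨i, rfl⟩
  refine Ideal.subset_span ⟨i, ?_⟩
  rw [MvPowerSeries.algebraMap_apply']
  simp

open MvPowerSeries in
theorem mem_pow_of_coeff_mem {n : ℕ} {f : MvPowerSeries ι C}
    (hf : ∀ x : ι →₀ ℕ, coeff x f ∈ maximalIdeal C ^ (n - x.degree)) :
    f ∈ maximalIdeal (MvPowerSeries ι C) ^ n := by
  classical
  let s := (finite_degree_lt (ι := ι) n).toFinset
  let g : MvPowerSeries ι C := ∑ x ∈ s, monomial x (coeff x f)
  have hg : g ∈ maximalIdeal (MvPowerSeries ι C) ^ n :=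
    Ideal.sum_mem _ fun x _ => monomial_mem_pow x (hf x)
  have hcoeff : ∀ x : ι →₀ ℕ, x.degree < n → coeff x (f - g) = 0 := by
    intro x hx
    rw [map_sub, sub_eq_zero, map_sum]
    rw [Finset.sum_eq_single x]
    · simp
    · intro y _ hy
      rw [coeff_monomial_ne hy.symm]
    · intro h
      exact absurd ((finite_degree_lt (ι := ι) n).mem_toFinset.mpr hx) h
  have h2 : f - g ∈ maximalIdeal (MvPowerSeries ι C) ^ n := by
    have h3 : f - g ∈ Ideal.span (Set.range (X : ι → MvPowerSeries ι C)) ^ n := by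
      exact mem_span_X_pow_of_coeff_eq_zero hcoeff
    exact Ideal.pow_right_mono span_X_le_maximalIdeal n h3
  rw [← sub_add_cancel f g]
  exact add_mem h2 hg

open MvPowerSeries in
instance powerSeries_isCNL [IsCNL O C] : IsCNL O (MvPowerSeries ι C) := by
  have hN := IsCNL.noetherian (O := O) (A := C)
  have hc := IsCNL.complete (O := O) (A := C)
  refine ⟨inferInstance, ?_, ?_, ?_⟩
  · refine { toIsHausdorff := inferInstance, prec' := fun g hg => ?_ }
    have hg' : ∀ {m n : ℕ}, m ≤ n → g m - g n ∈ maximalIdeal (MvPowerSeries ι C) ^ m := by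
      intro m n hmn
      have := hg hmn
      rwa [SModEq.sub_mem, smul_eq_mul, Ideal.mul_top] at this
    have hx : ∀ x : ι →₀ ℕ, ∃ c : C, ∀ n,
        coeff x (g (n + x.degree)) - c ∈ maximalIdeal C ^ n := by
      intro x
      obtain ⟨c, hc⟩ := hc.toIsPrecomplete.prec (f := fun n => coeff x (g (n + x.degree)))
        (fun {m n} hmn => by
          rw [SModEq.sub_mem, smul_eq_mul, Ideal.mul_top, ← map_sub]
          have := coeff_mem_of_mem_pow (hg' (Nat.add_le_add_right hmn x.degree)) x
          rwa [Nat.add_sub_cancel] at this)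
      refine ⟨c, fun n => ?_⟩
      have := hc n
      rwa [SModEq.sub_mem, smul_eq_mul, Ideal.mul_top] at this
    choose c hc using hx
    let F : MvPowerSeries ι C := c
    refine ⟨F, fun n => ?_⟩
    rw [SModEq.sub_mem, smul_eq_mul, Ideal.mul_top]
    refine mem_pow_of_coeff_mem fun x => ?_
    rw [map_sub]
    have h1 := hc x n
    have h2 := coeff_mem_of_mem_pow (hg' (Nat.le_add_right n x.degree)) x
    rw [map_sub] at h2
    have h3 := add_mem h2 (Ideal.pow_le_pow_right (Nat.sub_le n x.degree) h1)
    rw [sub_add_sub_cancel] at h3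
    exact h3
  · constructor
    intro o ho
    rw [isUnit_iff_constantCoeff] at ho
    have h2 : constantCoeff (algebraMap O (MvPowerSeries ι C) o) = algebraMap O C o := by
      rw [MvPowerSeries.algebraMap_apply]; simp
    rw [h2] at ho
    exact isUnit_of_map_unit (algebraMap O C) o ho
  · intro y
    obtain ⟨f, rfl⟩ := IsLocalRing.residue_surjective y
    obtain ⟨o, ho⟩ := exists_sub_algebraMap_mem (IsCNL.residue_surjective (O := O) (A := C))
      (constantCoeff f)
    refine ⟨o, ?_⟩
    have : f - algebraMap O (MvPowerSeries ι C) o ∈ maximalIdeal (MvPowerSeries ι C) := by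
      rw [mem_maximalIdeal_powerSeries_iff, map_sub, MvPowerSeries.algebraMap_apply]
      simpa using ho
    rw [← residue_eq_zero_iff, map_sub, sub_eq_zero] at this
    exact this.symm

theorem self_isCNL [IsNoetherianRing O] [IsAdicComplete (maximalIdeal O) O] : IsCNL O O :=
  ⟨inferInstance, inferInstance, inferInstance, IsLocalRing.residue_surjective⟩

open MvPowerSeries in
theorem generates_powerSeries [IsCNL O C] {κ : Type*} {c : κ → C} (hc : Generates O c) :
    Generates O (Sum.elim (fun k => MvPowerSeries.C (c k)) (X : ι → MvPowerSeries ι C)) := by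
  intro f hf
  have h1 : f - MvPowerSeries.C (constantCoeff f) ∈
      Ideal.span (Set.range (X : ι → MvPowerSeries ι C)) := by
    have h3 := mem_span_X_pow_of_coeff_eq_zero (n := 1) (f := f - MvPowerSeries.C (constantCoeff f))
      (fun x hx => by
        have : x = 0 := by rw [← Finsupp.degree_eq_zero_iff]; omega
        simp [this])
    rwa [pow_one] at h3
  have h2 : (MvPowerSeries.C (constantCoeff f) : MvPowerSeries ι C) ∈
      ((maximalIdeal O).map (algebraMap O C) ⊔ Ideal.span (Set.range c)).map
        (MvPowerSeries.C (σ := ι)) :=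
    Ideal.mem_map_of_mem _ (hc (mem_maximalIdeal_powerSeries_iff.mp hf))
  rw [Ideal.map_sup, Ideal.map_map, Ideal.map_span] at h2
  rw [← sub_add_cancel f (MvPowerSeries.C (constantCoeff f))]
  refine add_mem (Ideal.mem_sup_right (Ideal.span_mono ?_ h1)) ?_
  · rintro _ ⟨i, rfl⟩
    exact ⟨Sum.inr i, rfl⟩
  · have h3 : Ideal.span (MvPowerSeries.C (σ := ι) '' Set.range c) ≤ Ideal.span (Set.range
        (Sum.elim (fun k => MvPowerSeries.C (c k)) (X : ι → MvPowerSeries ι C))) := by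
      refine Ideal.span_mono ?_
      rintro _ ⟨_, ⟨k, rfl⟩, rfl⟩
      exact ⟨Sum.inl k, rfl⟩
    have h4 : (MvPowerSeries.C (σ := ι)).comp (algebraMap O C) = algebraMap O _ := by
      ext1 o
      rw [MvPowerSeries.algebraMap_apply]; rfl
    rw [h4] at h2
    exact sup_le_sup_left h3 _ h2

/-- A nonzero power series over a complete discrete valuation ring does not vanish at some point
with coordinates in the maximal ideal. -/
theorem exists_eval_ne_zero [IsDomain O] [IsDiscreteValuationRing O] [Infinite O]
    [IsAdicComplete (maximalIdeal O) O] {f : MvPowerSeries ι O} (hf : f ≠ 0) :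
    ∃ h : MvPowerSeries ι O →ₐ[O] O, h f ≠ 0 := by
  classical
  have hex : ∃ d, ∃ x : ι →₀ ℕ, x.degree = d ∧ MvPowerSeries.coeff x f ≠ 0 := by
    by_contra! h
    exact hf (MvPowerSeries.ext fun x => by simpa using h _ x rfl)
  let d := Nat.find hex
  obtain ⟨x₀, hx₀, hfx₀⟩ := Nat.find_spec hex
  have hlow : ∀ x : ι →₀ ℕ, x.degree < d → MvPowerSeries.coeff x f = 0 := by
    intro x hx
    by_contra h
    exact Nat.find_min hex hx ⟨x, rfl, h⟩
  let s := (Finsupp.finite_of_degree_eq (σ := ι) d).toFinset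
  have hs : ∀ x, x ∈ s ↔ x.degree = d := fun x => by simp [s]
  let g : MvPolynomial ι O := ∑ x ∈ s, MvPolynomial.monomial x (MvPowerSeries.coeff x f)
  have hgc : ∀ x, g.coeff x = if x.degree = d then MvPowerSeries.coeff x f else 0 := by
    intro x
    simp only [g, MvPolynomial.coeff_sum, MvPolynomial.coeff_monomial]
    rw [Finset.sum_ite_eq' s x]
    simp [hs]
  have hg : g ≠ 0 := by
    intro h
    have := hgc x₀
    rw [h, if_pos hx₀] at this
    exact hfx₀ (by simpa using this.symm)
  obtain ⟨c, hc⟩ : ∃ c : ι → O, MvPolynomial.eval c g ≠ 0 := by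
    by_contra! h
    exact hg (MvPolynomial.funext fun c => by simp [h c])
  obtain ⟨ϖ, hϖ⟩ := IsDiscreteValuationRing.exists_irreducible O
  have hm := (IsDiscreteValuationRing.irreducible_iff_uniformizer ϖ).mp hϖ
  obtain ⟨k, hk⟩ : ∃ k, MvPolynomial.eval c g ∉ maximalIdeal O ^ k := by
    by_contra! h
    refine hc (IsHausdorff.haus (inferInstance : IsHausdorff (maximalIdeal O) O) _ fun n => ?_)
    rw [SModEq.zero, smul_eq_mul, Ideal.mul_top]
    exact h n
  have hk0 : k ≠ 0 := by rintro rfl; simp at hk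
  obtain ⟨h, hh⟩ := exists_powerSeries_lift (O := O) (maximalIdeal O) (fun i => ϖ ^ k * c i)
    (fun i => by
      rw [hm]
      exact Ideal.mul_mem_right _ _ (Ideal.pow_mem_of_mem _ (Ideal.mem_span_singleton_self ϖ) k
        (Nat.pos_of_ne_zero hk0)))
  refine ⟨h, fun h0 => hk ?_⟩
  have hdiff : f - (g : MvPowerSeries ι O) ∈
      Ideal.span (Set.range (MvPowerSeries.X : ι → MvPowerSeries ι O)) ^ (d + 1) := by
    refine mem_span_X_pow_of_coeff_eq_zero fun x hx => ?_
    rw [map_sub, MvPolynomial.coeff_coe, hgc]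
    by_cases hxd : x.degree = d
    · simp [hxd]
    · rw [if_neg hxd, hlow x (by omega), sub_zero]
  have hev : h (f - (g : MvPowerSeries ι O)) ∈ Ideal.span {ϖ ^ k} ^ (d + 1) := by
    have hle : Ideal.span (Set.range (MvPowerSeries.X : ι → MvPowerSeries ι O)) ≤
        (Ideal.span {ϖ ^ k}).comap (h : MvPowerSeries ι O →+* O) := by
      rw [Ideal.span_le]
      rintro _ ⟨i, rfl⟩
      rw [SetLike.mem_coe, Ideal.mem_comap, RingHom.coe_coe, hh]
      exact Ideal.mul_mem_right _ _ (Ideal.mem_span_singleton_self _)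
    exact (le_trans (Ideal.pow_right_mono hle (d + 1)) (Ideal.le_comap_pow _ _)) hdiff
  have hgv : h (g : MvPowerSeries ι O) = (ϖ ^ k) ^ d * MvPolynomial.eval c g := by
    have h1 : ∀ p : MvPolynomial ι O, h (p : MvPowerSeries ι O) =
        MvPolynomial.eval (fun i => ϖ ^ k * c i) p := by
      intro p
      have : (h.comp (MvPolynomial.coeToMvPowerSeries.algHom O)) =
          MvPolynomial.aeval (fun i => ϖ ^ k * c i) := by
        apply MvPolynomial.algHom_ext
        intro i
        simp [hh]
      have h2 := DFunLike.congr_fun this p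
      simpa [MvPolynomial.coe_aeval_eq_eval] using h2
    rw [h1]
    rw [MvPolynomial.eval_eq, MvPolynomial.eval_eq, Finset.mul_sum]
    refine Finset.sum_congr rfl fun x hx => ?_
    have hxd : x.degree = d := by
      by_contra h
      exact (MvPolynomial.mem_support_iff.mp hx) (by rw [hgc, if_neg h])
    have : Fintype ι := Fintype.ofFinite ι
    rw [← hxd]
    simp only [mul_pow, Finset.prod_mul_distrib]
    rw [Finset.prod_pow_eq_pow_sum, ← Finsupp.degree_apply]
    ring
  rw [map_sub, h0, zero_sub, neg_mem_iff, hgv, Ideal.span_singleton_pow,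
    Ideal.mem_span_singleton, pow_succ] at hev
  have hne : (ϖ ^ k) ^ d ≠ 0 := pow_ne_zero _ (pow_ne_zero _ hϖ.ne_zero)
  rw [hm, Ideal.span_singleton_pow, Ideal.mem_span_singleton]
  exact (mul_dvd_mul_iff_left hne).mp hev

end PowerSeries

section Contraction

variable {O A : Type u} [CommRing O] [IsLocalRing O] [CommRing A] [IsLocalRing A] [Algebra O A]

/-- A self-map of `A ^ κ` that is contracting for the adic topology has a fixed point. -/
theorem exists_fixedPoint [IsCNL O A] {κ : Type*} (F : (κ → A) → κ → A)
    (hF : ∀ n x y, (∀ i, x i - y i ∈ maximalIdeal A ^ n) →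
      ∀ i, F x i - F y i ∈ maximalIdeal A ^ (n + 1)) : ∃ x, F x = x := by
  let s : ℕ → κ → A := fun n => F^[n] 0
  have hs : ∀ n, s (n + 1) = F (s n) := fun n => Function.iterate_succ_apply' F n 0
  have hstep : ∀ n i, s n i - s (n + 1) i ∈ maximalIdeal A ^ n := by
    intro n
    induction n with
    | zero => simp
    | succ n ih =>
      intro i
      rw [hs n, hs (n + 1)]
      exact hF n _ _ ih i
  have hC : ∀ i {m n : ℕ}, m ≤ n → s m i - s n i ∈ maximalIdeal A ^ m := by
    intro i m n hmn
    induction n, hmn using Nat.le_induction with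
    | base => simp
    | succ n hmn ih =>
      rw [← sub_add_sub_cancel _ (s n i)]
      exact add_mem ih (Ideal.pow_le_pow_right hmn (hstep n i))
  have hx : ∀ i, ∃ x : A, ∀ n, s n i - x ∈ maximalIdeal A ^ n := by
    intro i
    obtain ⟨x, hx⟩ := (IsCNL.complete (O := O) (A := A)).toIsPrecomplete.prec
      (f := fun n => s n i) (fun {m n} hmn => by
        rw [SModEq.sub_mem, smul_eq_mul, Ideal.mul_top]; exact hC i hmn)
    refine ⟨x, fun n => ?_⟩
    have := hx n
    rwa [SModEq.sub_mem, smul_eq_mul, Ideal.mul_top] at this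
  choose x hx using hx
  refine ⟨x, funext fun i => IsCNL.eq_of_forall_sub_mem (O := O) fun n => ?_⟩
  have h1 := hF n (s n) x (fun i => hx i n) i
  rw [← hs] at h1
  have h2 := hx i (n + 1)
  have h3 := sub_mem h2 h1
  rw [sub_sub_sub_cancel_left] at h3
  exact Ideal.pow_le_pow_right n.le_succ h3

end Contraction

/-! ### Block diagonalisation over complete local rings -/

section Block

variable {n : Type} [Fintype n] [DecidableEq n]

/-- `M` is supported on the pairs `(i, j)` with `e i = c * e j`. -/
def IsSupported {k A : Type*} [Mul k] [Zero A] (e : n → k) (c : k) (M : Matrix n n A) : Prop :=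
  ∀ i j, e i ≠ c * e j → M i j = 0

open Classical in
/-- The part of `M` supported on the pairs `(i, j)` with `e i = c * e j`. -/
def goodPart {k A : Type*} [Mul k] [Zero A] (e : n → k) (c : k) (M : Matrix n n A) : Matrix n n A :=
  Matrix.of fun i j => if e i = c * e j then M i j else 0

section supp

variable {k A : Type*} [CommRing k] [CommRing A] {e : n → k} {c : k}

theorem goodPart_isSupported (M : Matrix n n A) : IsSupported e c (goodPart e c M) :=
  fun i j h => by simp [goodPart, h]

theorem IsSupported.goodPart_eq {M : Matrix n n A} (h : IsSupported e c M) :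
    goodPart e c M = M := by
  ext i j
  by_cases hij : e i = c * e j
  · simp [goodPart, hij]
  · simp [goodPart, hij, h i j hij]

theorem goodPart_add (M N : Matrix n n A) :
    goodPart e c (M + N) = goodPart e c M + goodPart e c N := by
  ext i j; by_cases h : e i = c * e j <;> simp [goodPart, h]

theorem goodPart_sub (M N : Matrix n n A) :
    goodPart e c (M - N) = goodPart e c M - goodPart e c N := by
  ext i j; by_cases h : e i = c * e j <;> simp [goodPart, h]

theorem goodPart_smul (a : A) (M : Matrix n n A) :
    goodPart e c (a • M) = a • goodPart e c M := by
  ext i j; by_cases h : e i = c * e j <;> simp [goodPart, h]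

theorem goodPart_mem {I : Ideal A} {M : Matrix n n A} (h : ∀ i j, M i j ∈ I) (i j : n) :
    goodPart e c M i j ∈ I := by
  by_cases hij : e i = c * e j <;> simp [goodPart, hij, h]

theorem goodPart_block_mul {D : Matrix n n A} (hD : IsSupported e 1 D) (M : Matrix n n A) :
    goodPart e c (D * M) = D * goodPart e c M := by
  ext i j
  simp only [goodPart, Matrix.mul_apply, Matrix.of_apply]
  by_cases h : e i = c * e j
  · rw [if_pos h]
    refine Finset.sum_congr rfl fun l _ => ?_
    by_cases hl : e i = e l
    · rw [if_pos (hl ▸ h)]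
    · rw [hD i l (by simpa using hl)]; simp
  · rw [if_neg h]
    refine (Finset.sum_eq_zero fun l _ => ?_).symm
    by_cases hl : e i = e l
    · rw [if_neg (hl ▸ h), mul_zero]
    · rw [hD i l (by simpa using hl)]; simp

theorem goodPart_mul_block {D : Matrix n n A} (hD : IsSupported e 1 D) (M : Matrix n n A) :
    goodPart e c (M * D) = goodPart e c M * D := by
  ext i j
  simp only [goodPart, Matrix.mul_apply, Matrix.of_apply]
  by_cases h : e i = c * e j
  · rw [if_pos h]
    refine Finset.sum_congr rfl fun l _ => ?_
    by_cases hl : e l = e j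
    · rw [if_pos (hl ▸ h)]
    · rw [hD l j (by simpa using hl)]; simp
  · rw [if_neg h]
    refine (Finset.sum_eq_zero fun l _ => ?_).symm
    by_cases hl : e l = e j
    · rw [if_neg (by rw [hl]; exact h), zero_mul]
    · rw [hD l j (by simpa using hl)]; simp

theorem IsSupported.mul_block {D M : Matrix n n A} (hM : IsSupported e c M)
    (hD : IsSupported e 1 D) : IsSupported e c (M * D) := by
  rw [← hM.goodPart_eq, ← goodPart_mul_block hD]
  exact goodPart_isSupported _

theorem isSupported_one : IsSupported e 1 (1 : Matrix n n A) := by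
  intro i j h
  have : i ≠ j := by rintro rfl; simp at h
  simp [this]

theorem IsSupported.add {M N : Matrix n n A} (hM : IsSupported e c M) (hN : IsSupported e c N) :
    IsSupported e c (M + N) := fun i j h => by simp [hM i j h, hN i j h]

theorem IsSupported.sub {M N : Matrix n n A} (hM : IsSupported e c M) (hN : IsSupported e c N) :
    IsSupported e c (M - N) := fun i j h => by simp [hM i j h, hN i j h]

theorem IsSupported.smul (a : A) {M : Matrix n n A} (hM : IsSupported e c M) :
    IsSupported e c (a • M) := fun i j h => by simp [hM i j h]

theorem IsSupported.pow {M : Matrix n n A} (hM : IsSupported e 1 M) (m : ℕ) :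
    IsSupported e 1 (M ^ m) := by
  induction m with
  | zero => rw [pow_zero]; exact isSupported_one
  | succ m ih => rw [pow_succ]; exact ih.mul_block hM

end supp

/-- `M` is block diagonal for the level sets of `e`, and `e j` is the only eigenvalue of the block
containing `j`. -/
structure IsBlock {k : Type*} [Field k] (e : n → k) (M : Matrix n n k) : Prop where
  supp : IsSupported e 1 M
  nil : ∃ m : ℕ, ∀ i j, ((M - e j • 1) ^ m) i j = 0

theorem IsBlock.map {k k' : Type*} [Field k] [Field k'] {e : n → k} {M : Matrix n n k}
    (h : IsBlock e M) (f : k →+* k') : IsBlock (fun i => f (e i)) (M.map f) := by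
  obtain ⟨m, hm⟩ := h.nil
  refine ⟨fun i j hij => ?_, m, fun i j => ?_⟩
  · rw [Matrix.map_apply, h.supp i j (fun h' => hij (by simp [h'])), map_zero]
  · have : (M.map f - f (e j) • 1) ^ m = ((M - e j • 1) ^ m).map f := by
      have h1 : M.map f - f (e j) • 1 = f.mapMatrix (M - e j • 1) := by
        rw [map_sub]
        congr 1
        ext a b
        by_cases hab : a = b <;> simp [hab]
      rw [h1, ← map_pow]; rfl
    rw [this, Matrix.map_apply, hm, map_zero]

open Polynomial in
theorem IsBlock.sylvester {k : Type*} [Field k] {e : n → k} {M : Matrix n n k} (h : IsBlock e M)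
    {c : k} {Y : Matrix n n k} (hY : M * Y = c • (Y * M)) : IsSupported e c Y := by
  intro i j hij
  obtain ⟨m, hm⟩ := h.nil
  have hcomm : ∀ r : ℕ, (M - (c * e j) • 1) ^ r * Y = c ^ r • (Y * (M - e j • 1) ^ r) := by
    intro r
    induction r with
    | zero => simp
    | succ r ih =>
      have h1 : (M - (c * e j) • 1) * Y = c • (Y * (M - e j • 1)) := by
        rw [sub_mul, mul_sub, hY, smul_sub]
        simp [smul_smul]
      rw [pow_succ, mul_assoc, h1, Matrix.mul_smul, ← mul_assoc, ih, smul_mul_assoc, smul_smul,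
        mul_assoc, ← pow_succ, ← pow_succ']
  have hcol : ∀ a, ((M - (c * e j) • 1) ^ m * Y) a j = 0 := by
    intro a
    rw [hcomm, Matrix.smul_apply, Matrix.mul_apply]
    simp [hm]
  have hrow : ∀ b, ((M - e i • 1) ^ m) i b = 0 := by
    intro b
    by_cases hb : e i = e b
    · rw [hb]; exact hm i b
    · refine (IsSupported.pow (h.supp.sub (isSupported_one.smul _)) m) i b (by simpa using hb)
  have hcop : IsCoprime ((X - C (e i)) ^ m : k[X]) ((X - C (c * e j)) ^ m) :=
    (isCoprime_X_sub_C_of_isUnit_sub (sub_ne_zero.mpr hij).isUnit).pow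
  obtain ⟨a, b, hab⟩ := hcop
  have h1 := congrArg (aeval M) hab
  have e1 : ∀ t : k, aeval M (X - C t) = M - t • 1 := by
    intro t; simp [Algebra.algebraMap_eq_smul_one]
  rw [map_add, map_mul, map_mul, map_pow, map_pow, map_one, e1, e1] at h1
  have hc : aeval M a * (M - e i • 1) ^ m = (M - e i • 1) ^ m * aeval M a := by
    rw [← e1, ← map_pow, ← map_mul, ← map_mul, mul_comm]
  have h2 : Y i j =
      ((aeval M a * (M - e i • 1) ^ m + aeval M b * (M - (c * e j) • 1) ^ m) * Y) i j := by
    rw [h1, one_mul]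
  rw [h2, hc, add_mul, mul_assoc, mul_assoc, Matrix.add_apply, Matrix.mul_apply, Matrix.mul_apply]
  simp [hrow, hcol]

theorem linearMap_apply_mem {A : Type*} [CommRing A] {I : Ideal A}
    (T : Matrix n n A →ₗ[A] Matrix n n A) {Y : Matrix n n A}
    (hY : ∀ i j, Y i j ∈ I) (i j : n) : T Y i j ∈ I := by
  have h : T Y i j = ∑ a, ∑ b, Y a b * T (Matrix.single a b 1) i j := by
    conv_lhs => rw [Matrix.matrix_eq_sum_single Y]
    simp only [map_sum, Matrix.sum_apply]
    refine Finset.sum_congr rfl fun a _ => Finset.sum_congr rfl fun b _ => ?_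
    have : Matrix.single a b (Y a b) = Y a b • Matrix.single a b (1 : A) := by simp
    rw [this, map_smul, Matrix.smul_apply, smul_eq_mul]
  rw [h]
  exact Ideal.sum_mem _ fun a _ => Ideal.sum_mem _ fun b _ => Ideal.mul_mem_right _ _ (hY a b)

theorem mul_apply_mem_left {A : Type*} [CommRing A] {I : Ideal A} {M N : Matrix n n A}
    (hM : ∀ i j, M i j ∈ I) (i j : n) : (M * N) i j ∈ I := by
  rw [Matrix.mul_apply]
  exact Ideal.sum_mem _ fun a _ => Ideal.mul_mem_right _ _ (hM i a)

theorem mul_apply_mem_right {A : Type*} [CommRing A] {I : Ideal A} {M N : Matrix n n A}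
    (hN : ∀ i j, N i j ∈ I) (i j : n) : (M * N) i j ∈ I := by
  rw [Matrix.mul_apply]
  exact Ideal.sum_mem _ fun a _ => Ideal.mul_mem_left _ _ (hN a j)

theorem mul_apply_mem_mul {A : Type*} [CommRing A] {I J : Ideal A} {M N : Matrix n n A}
    (hM : ∀ i j, M i j ∈ I) (hN : ∀ i j, N i j ∈ J) (i j : n) : (M * N) i j ∈ I * J := by
  rw [Matrix.mul_apply]
  exact Ideal.sum_mem _ fun a _ => Ideal.mul_mem_mul (hM i a) (hN a j)

/-- The Sylvester operator `Y ↦ D Y - c Y D` of a block diagonal matrix, modified to be the identity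
on the matrices supported on the pairs `(i, j)` with `e i = c' * e j`. -/
def sylvesterMap {k A : Type*} [CommRing k] [CommRing A] (e : n → k) (c' : k) (c : A)
    (D : Matrix n n A) : Matrix n n A →ₗ[A] Matrix n n A where
  toFun Y := goodPart e c' Y + ((D * Y - c • (Y * D)) - goodPart e c' (D * Y - c • (Y * D)))
  map_add' Y Z := by
    have : D * (Y + Z) - c • ((Y + Z) * D) = (D * Y - c • (Y * D)) + (D * Z - c • (Z * D)) := by
      rw [mul_add, add_mul, smul_add]; abel
    rw [this, goodPart_add, goodPart_add]; abel
  map_smul' a Y := by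
    have : D * (a • Y) - c • ((a • Y) * D) = a • (D * Y - c • (Y * D)) := by
      rw [Matrix.mul_smul, smul_mul_assoc, smul_sub, smul_comm c a]
    rw [this, goodPart_smul, goodPart_smul, RingHom.id_apply, smul_add, smul_sub a (D * Y - _)]

theorem sylvesterMap_apply {k A : Type*} [CommRing k] [CommRing A] (e : n → k) (c' : k) (c : A)
    (D Y : Matrix n n A) : sylvesterMap e c' c D Y =
      goodPart e c' Y + ((D * Y - c • (Y * D)) - goodPart e c' (D * Y - c • (Y * D))) := rfl

theorem goodPart_map {k A B : Type*} [CommRing k] [CommRing A] [CommRing B] (e : n → k) (c : k)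
    (f : A →+* B) (Y : Matrix n n A) : (goodPart e c Y).map f = goodPart e c (Y.map f) := by
  ext i j; by_cases hij : e i = c * e j <;> simp [goodPart, hij]

theorem sylvesterMap_map {k A B : Type*} [CommRing k] [CommRing A] [CommRing B] (e : n → k) (c' : k)
    (c : A) (D : Matrix n n A) (f : A →+* B) (Y : Matrix n n A) :
    (sylvesterMap e c' c D Y).map f = sylvesterMap e c' (f c) (D.map f) (Y.map f) := by
  have h2 : (D * Y - c • (Y * D)).map f = D.map f * Y.map f - f c • (Y.map f * D.map f) := by
    ext i j
    simp [Matrix.map_apply, Matrix.mul_apply]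
  rw [sylvesterMap_apply, sylvesterMap_apply, ← h2, ← goodPart_map, ← goodPart_map]
  ext i j
  simp [Matrix.map_apply]

theorem goodPart_zero {k A : Type*} [CommRing k] [CommRing A] (e : n → k) (c : k) :
    goodPart e c (0 : Matrix n n A) = 0 := by
  ext i j; simp [goodPart]

theorem IsSupported.comp_iff {k k' A : Type*} [Field k] [Field k'] [CommRing A] {e : n → k} {c : k}
    (f : k →+* k') {M : Matrix n n A} :
    IsSupported (fun i => f (e i)) (f c) M ↔ IsSupported e c M := by
  simp only [IsSupported, ← map_mul, f.injective.ne_iff]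

theorem IsBlock.sylvesterMap_injective {k k' : Type*} [Field k] [Field k'] (f : k →+* k') {e : n → k}
    {c : k} {D : Matrix n n k'} (hD : IsBlock (fun i => f (e i)) D) :
    Function.Injective (sylvesterMap e c (f c) D) := by
  have hsupp : IsSupported e 1 D := by
    rw [← IsSupported.comp_iff f, map_one]; exact hD.supp
  rw [← LinearMap.ker_eq_bot, LinearMap.ker_eq_bot']
  intro Y hY
  rw [sylvesterMap_apply] at hY
  have hg : goodPart e c Y = 0 := by
    ext i j
    by_cases hij : e i = c * e j
    · have := congrFun (congrFun hY i) j
      simpa [goodPart, hij] using this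
    · simp [goodPart, hij]
  have hs : goodPart e c (D * Y - f c • (Y * D)) = 0 := by
    rw [goodPart_sub, goodPart_smul, goodPart_block_mul hsupp, goodPart_mul_block hsupp, hg]
    simp
  rw [hg, hs, zero_add, sub_zero, sub_eq_zero] at hY
  rw [← ((IsSupported.comp_iff f).mp (hD.sylvester hY)).goodPart_eq, hg]

section Local

variable {k : Type*} [Field k] {A : Type u} [CommRing A] [IsLocalRing A]

theorem sylvesterMap_bijective (f : k →+* ResidueField A) {e : n → k} {c' : k} {c : A}
    (hc : residue A c = f c') {D : Matrix n n A}
    (hres : IsBlock (fun i => f (e i)) (D.map (residue A))) :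
    Function.Bijective (sylvesterMap e c' c D) := by
  have hTsurj : Function.Surjective (sylvesterMap e c' (f c') (D.map (residue A))) :=
    LinearMap.surjective_of_injective (hres.sylvesterMap_injective f)
  have hsurj : Function.Surjective (sylvesterMap e c' c D) := by
    rw [← LinearMap.range_eq_top, ← top_le_iff]
    refine Submodule.le_of_le_smul_of_le_jacobson_bot (I := maximalIdeal A)
      Module.Finite.fg_top (IsLocalRing.maximalIdeal_le_jacobson _) ?_
    intro Y _
    obtain ⟨Z, hZ⟩ := hTsurj (Y.map (residue A))
    have hXs : ∃ W : Matrix n n A, W.map (residue A) = Z := by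
      choose s hs using IsLocalRing.residue_surjective (R := A)
      exact ⟨Z.map s, by ext i j; simp [hs]⟩
    obtain ⟨W, rfl⟩ := hXs
    rw [← hc, ← sylvesterMap_map] at hZ
    rw [← add_sub_cancel (sylvesterMap e c' c D W) Y]
    refine Submodule.add_mem_sup ⟨W, rfl⟩ ?_
    rw [Matrix.matrix_eq_sum_single (Y - sylvesterMap e c' c D W)]
    refine Submodule.sum_mem _ fun i _ => Submodule.sum_mem _ fun j _ => ?_
    have : Matrix.single i j ((Y - sylvesterMap e c' c D W) i j) =
      (Y - sylvesterMap e c' c D W) i j • Matrix.single i j (1 : A) := by simp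
    rw [this]
    refine Submodule.smul_mem_smul ?_ trivial
    rw [← residue_eq_zero_iff, Matrix.sub_apply, map_sub, sub_eq_zero]
    have := congrFun (congrFun hZ i) j
    exact this.symm
  exact ⟨OrzechProperty.injective_of_surjective_endomorphism _ hsurj, hsurj⟩

theorem isSupported_of_commute (f : k →+* ResidueField A) {e : n → k} {c' : k} {c : A}
    (hc : residue A c = f c') {D N : Matrix n n A} (hD : IsSupported e 1 D)
    (hres : IsBlock (fun i => f (e i)) (D.map (residue A)))
    (hN : D * N = c • (N * D)) : IsSupported e c' N := by
  have h1 : sylvesterMap e c' c D (N - goodPart e c' N) = 0 := by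
    have h2 : D * (N - goodPart e c' N) = c • ((N - goodPart e c' N) * D) := by
      rw [mul_sub, sub_mul, ← goodPart_block_mul hD, ← goodPart_mul_block hD, hN, goodPart_smul,
        smul_sub]
    rw [sylvesterMap_apply, h2, sub_self, goodPart_sub, (goodPart_isSupported N).goodPart_eq,
      sub_self, goodPart_zero]
    simp
  have h2 := (sylvesterMap_bijective f hc hres).1 (h1.trans (map_zero _).symm)
  rw [sub_eq_zero] at h2
  rw [h2]
  exact goodPart_isSupported _

end Local

section Diagonalise

variable {O A : Type u} [CommRing O] [IsLocalRing O] [CommRing A] [IsLocalRing A] [Algebra O A]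

/-- The matrix `M` over `A` is congruent to the matrix `M₀` over `O` modulo the maximal ideal. -/
def IsCongr (M : Matrix n n A) (M₀ : Matrix n n O) : Prop :=
  ∀ i j, M i j - algebraMap O A (M₀ i j) ∈ maximalIdeal A

theorem IsCongr.map_residue [IsLocalHom (algebraMap O A)] {M : Matrix n n A} {M₀ : Matrix n n O}
    (h : IsCongr M M₀) : M.map (residue A) =
      (M₀.map (residue O)).map (ResidueField.map (algebraMap O A)) := by
  ext i j
  have := h i j
  rw [← residue_eq_zero_iff, map_sub, sub_eq_zero] at this
  simpa using this

/-- `(Y, D)` block diagonalises `M`: `M (1 + Y) = (1 + Y) D` with `D` block diagonal and `Y` off the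
diagonal blocks. -/
structure IsDiagonalisation (e : n → ResidueField O) (M Y D : Matrix n n A) : Prop where
  off : goodPart e 1 Y = 0
  mem : ∀ i j, Y i j ∈ maximalIdeal A
  supp : IsSupported e 1 D
  eq : M * (1 + Y) = (1 + Y) * D

/-- The right hand side of the Sylvester equation satisfied by a block diagonalisation. -/
def diagonaliseAux (e : n → ResidueField O) (M Y : Matrix n n A) : Matrix n n A :=
  Y * goodPart e 1 ((M - goodPart e 1 M) * Y) -
    (((M - goodPart e 1 M) * Y) - goodPart e 1 ((M - goodPart e 1 M) * Y)) - (M - goodPart e 1 M)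

theorem diagonaliseAux_sub_mem {e : n → ResidueField O} {M : Matrix n n A}
    (hM : ∀ i j, (M - goodPart e 1 M) i j ∈ maximalIdeal A) {m : ℕ} {Y Z : Matrix n n A}
    (h : ∀ i j, (Y - Z) i j ∈ maximalIdeal A ^ m) (i j : n) :
    (diagonaliseAux e M Y - diagonaliseAux e M Z) i j ∈ maximalIdeal A ^ (m + 1) := by
  set P := M - goodPart e 1 M
  have e1 : diagonaliseAux e M Y - diagonaliseAux e M Z =
      (Y - Z) * goodPart e 1 (P * Y) + Z * goodPart e 1 (P * (Y - Z)) -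
        (P * (Y - Z) - goodPart e 1 (P * (Y - Z))) := by
    rw [mul_sub, goodPart_sub, mul_sub, sub_mul]
    simp only [diagonaliseAux]
    change (Y * goodPart e 1 (P * Y) - (P * Y - goodPart e 1 (P * Y)) - P) -
      (Z * goodPart e 1 (P * Z) - (P * Z - goodPart e 1 (P * Z)) - P) = _
    abel
  have h1 : ∀ i j, (P * (Y - Z)) i j ∈ maximalIdeal A ^ (m + 1) := by
    rw [pow_succ']; exact mul_apply_mem_mul hM h
  have h2 : ∀ i j, ((Y - Z) * goodPart e 1 (P * Y)) i j ∈ maximalIdeal A ^ (m + 1) := by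
    rw [pow_succ]; exact mul_apply_mem_mul h (goodPart_mem (mul_apply_mem_left hM))
  rw [e1]
  exact sub_mem (add_mem (h2 i j) (mul_apply_mem_right (goodPart_mem h1) i j))
    (sub_mem (h1 i j) (goodPart_mem h1 i j))

theorem IsDiagonalisation.sylvesterMap_eq {e : n → ResidueField O} {M Y D : Matrix n n A}
    (h : IsDiagonalisation e M Y D) :
    D = goodPart e 1 M + goodPart e 1 ((M - goodPart e 1 M) * Y) ∧
    sylvesterMap e 1 1 (goodPart e 1 M) Y = diagonaliseAux e M Y := by
  set P := M - goodPart e 1 M with hP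
  have hM : M = goodPart e 1 M + P := by rw [hP]; abel
  have hPg : goodPart e 1 P = 0 := by
    rw [hP, goodPart_sub, (goodPart_isSupported M).goodPart_eq, sub_self]
  have hMs : IsSupported e 1 (goodPart e 1 M) := goodPart_isSupported M
  have h1 := h.eq
  have h2 := congrArg (goodPart e 1) h1
  rw [hM, add_mul, mul_add, mul_add, add_mul, goodPart_add, goodPart_add, goodPart_add,
    goodPart_add, mul_one, mul_one, one_mul, goodPart_block_mul hMs, goodPart_mul_block h.supp,
    h.off, hPg, hMs.goodPart_eq, h.supp.goodPart_eq] at h2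
  simp only [mul_zero, add_zero, zero_mul, zero_add] at h2
  refine ⟨h2.symm, ?_⟩
  rw [sylvesterMap_apply, goodPart_sub, goodPart_smul, goodPart_block_mul hMs,
    goodPart_mul_block hMs, h.off, diagonaliseAux, ← hP]
  rw [hM, add_mul, mul_add, mul_add, add_mul, mul_one, mul_one, one_mul, ← h2, mul_add] at h1
  refine sub_eq_zero.mp (Eq.trans ?_ (sub_eq_zero.mpr h1))
  simp only [mul_zero, zero_mul, smul_zero, sub_zero, one_smul, zero_add]
  abel

theorem IsDiagonalisation.map {e : n → ResidueField O} {B : Type u} [CommRing B] [IsLocalRing B] [Algebra O B]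
    {M Y D : Matrix n n A} (h : IsDiagonalisation e M Y D) (f : A →ₐ[O] B)
    (hf : ∀ x ∈ maximalIdeal A, f x ∈ maximalIdeal B) :
    IsDiagonalisation e (M.map f) (Y.map f) (D.map f) := by
  refine ⟨?_, fun i j => hf _ (h.mem i j), fun i j hij => ?_, ?_⟩
  · change goodPart e 1 (Y.map (f : A →+* B)) = 0
    rw [← goodPart_map e 1 (f : A →+* B) Y, h.off]; ext; simp
  · rw [Matrix.map_apply, h.supp i j hij, map_zero]
  · have := congrArg (f : A →+* B).mapMatrix h.eq
    simpa [map_mul, map_add, map_one] using this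

variable [IsCNL O A] {e : n → ResidueField O} {M₀ : Matrix n n O}

theorem IsCongr.sub_goodPart_mem (he : IsBlock e (M₀.map (residue O))) {M : Matrix n n A}
    (hM : IsCongr M M₀) (i j : n) : (M - goodPart e 1 M) i j ∈ maximalIdeal A := by
  by_cases hij : e i = 1 * e j
  · simp [goodPart, hij]
  · have h1 := he.supp i j hij
    rw [Matrix.map_apply, residue_eq_zero_iff] at h1
    have h2 := add_mem (hM i j) (algebraMap_mem_maximalIdeal A h1)
    have h3 : (M - goodPart e 1 M) i j = M i j := by
      simp only [goodPart, Matrix.sub_apply, Matrix.of_apply, if_neg hij, sub_zero]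
    rwa [sub_add_cancel, ← h3] at h2

theorem IsCongr.isBlock_goodPart (he : IsBlock e (M₀.map (residue O))) {M : Matrix n n A}
    (hM : IsCongr M M₀) : IsBlock (fun i => ResidueField.map (algebraMap O A) (e i))
      ((goodPart e 1 M).map (residue A)) := by
  rw [goodPart_map, hM.map_residue, ← goodPart_map, he.supp.goodPart_eq]
  exact he.map _

theorem exists_isDiagonalisation (he : IsBlock e (M₀.map (residue O))) {M : Matrix n n A}
    (hM : IsCongr M M₀) : ∃ Y D, IsDiagonalisation e M Y D := by
  have hbij : Function.Bijective (sylvesterMap e 1 1 (goodPart e 1 M)) :=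
    sylvesterMap_bijective (ResidueField.map (algebraMap O A)) (by simp) (hM.isBlock_goodPart he)
  let T := LinearEquiv.ofBijective _ hbij
  obtain ⟨y, hy⟩ := exists_fixedPoint (O := O) (κ := n × n)
    (fun x p => T.symm (diagonaliseAux e M (Matrix.of fun i j => x (i, j))) p.1 p.2) (by
      intro m x y hxy p
      have h1 := diagonaliseAux_sub_mem (hM.sub_goodPart_mem he) (Y := Matrix.of fun i j => x (i, j))
        (Z := Matrix.of fun i j => y (i, j)) (m := m) (fun i j => by simpa using hxy (i, j))
      have h2 := linearMap_apply_mem (T.symm : Matrix n n A →ₗ[A] Matrix n n A) h1 p.1 p.2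
      rw [map_sub] at h2
      exact h2)
  set Y : Matrix n n A := Matrix.of fun i j => y (i, j) with hYdef
  have hY : T.symm (diagonaliseAux e M Y) = Y := by
    ext i j
    exact congrFun hy (i, j)
  have hTY : sylvesterMap e 1 1 (goodPart e 1 M) Y = diagonaliseAux e M Y := by
    rw [LinearEquiv.symm_apply_eq] at hY
    exact hY.symm
  set P := M - goodPart e 1 M with hP
  have hMe : M = goodPart e 1 M + P := by rw [hP]; abel
  have hPg : goodPart e 1 P = 0 := by
    rw [hP, goodPart_sub, (goodPart_isSupported M).goodPart_eq, sub_self]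
  have hMs : IsSupported e 1 (goodPart e 1 M) := goodPart_isSupported M
  have hPm : ∀ i j, P i j ∈ maximalIdeal A := hM.sub_goodPart_mem he
  have hg : goodPart e 1 Y = goodPart e 1 Y * goodPart e 1 (P * Y) := by
    have h1 := congrArg (goodPart e 1) hTY
    rw [sylvesterMap_apply, diagonaliseAux, ← hP] at h1
    simp only [goodPart_add, goodPart_sub, goodPart_mul_block (goodPart_isSupported (P * Y)),
      (goodPart_isSupported _).goodPart_eq, hPg, sub_self, add_zero, sub_zero] at h1
    exact h1
  have hoff : goodPart e 1 Y = 0 := by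
    have hpow : ∀ m : ℕ, ∀ i j, goodPart e 1 Y i j ∈ maximalIdeal A ^ m := by
      intro m
      induction m with
      | zero => simp
      | succ m ih =>
        intro i j
        rw [hg, pow_succ]
        exact mul_apply_mem_mul ih (goodPart_mem (mul_apply_mem_left hPm)) i j
    ext i j
    exact IsCNL.eq_of_forall_sub_mem (O := O) fun m => by simpa using hpow m i j
  have hmem : ∀ i j, Y i j ∈ maximalIdeal A := by
    rw [← hY]
    have h0 : ∀ i j, diagonaliseAux e M Y i j ∈ maximalIdeal A := by
      intro i j
      rw [diagonaliseAux, ← hP]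
      exact sub_mem (sub_mem (mul_apply_mem_right (goodPart_mem (mul_apply_mem_left hPm)) i j)
        (sub_mem (mul_apply_mem_left hPm i j) (goodPart_mem (mul_apply_mem_left hPm) i j)))
        (hPm i j)
    exact linearMap_apply_mem (T.symm : Matrix n n A →ₗ[A] Matrix n n A) h0
  refine ⟨Y, goodPart e 1 M + goodPart e 1 (P * Y), hoff, hmem,
    hMs.add (goodPart_isSupported _), ?_⟩
  rw [sylvesterMap_apply, goodPart_sub, goodPart_smul, goodPart_block_mul hMs,
    goodPart_mul_block hMs, hoff, diagonaliseAux, ← hP] at hTY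
  simp only [mul_zero, zero_mul, smul_zero, sub_zero, one_smul, zero_add] at hTY
  nth_rewrite 1 [hMe]
  refine sub_eq_zero.mp (Eq.trans ?_ (sub_eq_zero.mpr hTY))
  simp only [add_mul, mul_add, mul_one, one_mul]
  abel

theorem IsDiagonalisation.unique (he : IsBlock e (M₀.map (residue O))) {M : Matrix n n A}
    (hM : IsCongr M M₀) {Y D Y' D' : Matrix n n A} (h : IsDiagonalisation e M Y D)
    (h' : IsDiagonalisation e M Y' D') : Y = Y' ∧ D = D' := by
  have hbij : Function.Bijective (sylvesterMap e 1 1 (goodPart e 1 M)) :=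
    sylvesterMap_bijective (ResidueField.map (algebraMap O A)) (by simp) (hM.isBlock_goodPart he)
  let T := LinearEquiv.ofBijective _ hbij
  have hfix : ∀ {Y D}, IsDiagonalisation e M Y D → Y = T.symm (diagonaliseAux e M Y) := by
    intro Y D h
    rw [LinearEquiv.eq_symm_apply]
    exact h.sylvesterMap_eq.2
  have hpow : ∀ m : ℕ, ∀ i j, (Y - Y') i j ∈ maximalIdeal A ^ m := by
    intro m
    induction m with
    | zero => simp
    | succ m ih =>
      intro i j
      rw [hfix h, hfix h', ← map_sub]
      exact linearMap_apply_mem (T.symm : Matrix n n A →ₗ[A] Matrix n n A)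
        (diagonaliseAux_sub_mem (hM.sub_goodPart_mem he) ih) i j
  have hY : Y = Y' := by
    ext i j
    exact IsCNL.eq_of_forall_sub_mem (O := O) fun m => hpow m i j
  exact ⟨hY, by rw [h.sylvesterMap_eq.1, h'.sylvesterMap_eq.1, hY]⟩

theorem IsDiagonalisation.isCongr {M : Matrix n n A}
    (hM : IsCongr M M₀) {Y D : Matrix n n A} (h : IsDiagonalisation e M Y D) : IsCongr D M₀ := by
  intro i j
  have h1 : (M * Y - Y * D) i j ∈ maximalIdeal A :=
    sub_mem (mul_apply_mem_right h.mem i j) (mul_apply_mem_left h.mem i j)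
  have h2 : D = M + (M * Y - Y * D) := by
    have := h.eq
    rw [mul_add, add_mul, mul_one, one_mul] at this
    rw [← add_sub_assoc, this]; abel
  rw [h2, Matrix.add_apply, add_sub_right_comm]
  exact add_mem (hM i j) h1

end Diagonalise

end Block

/-! ### Truncated exponential and logarithm -/

section ExpLog

open Polynomial

variable {O : Type*} [CommRing O] {S : Type*} [Ring S] [Algebra O S]

/-- The exponential polynomial truncated at degree four; `c` is the inverse of `6`. -/
def expPoly (c : O) : O[X] := 1 + X + C (3 * c) * X ^ 2 + C c * X ^ 3

/-- The logarithm polynomial truncated at degree four; `c` is the inverse of `6`. -/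
def logPoly (c : O) : O[X] := (X - 1) - C (3 * c) * (X - 1) ^ 2 + C (2 * c) * (X - 1) ^ 3

/-- The exponential of an element whose fourth power vanishes. -/
def ex (c : O) (N : S) : S := aeval N (expPoly c)

/-- The logarithm of an element `Y` with `(Y - 1) ^ 4 = 0`. -/
def lg (c : O) (Y : S) : S := aeval Y (logPoly c)

theorem ex_eq (c : O) (N : S) : ex c N = 1 + N + (3 * c) • N ^ 2 + c • N ^ 3 := by
  simp [ex, expPoly, Algebra.smul_def]

theorem lg_eq (c : O) (Y : S) :
    lg c Y = (Y - 1) - (3 * c) • (Y - 1) ^ 2 + (2 * c) • (Y - 1) ^ 3 := by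
  simp [lg, logPoly, Algebra.smul_def]

theorem map_ex {T : Type*} [Ring T] [Algebra O T] (f : S →ₐ[O] T) (c : O) (N : S) :
    f (ex c N) = ex c (f N) := (aeval_algHom_apply f N _).symm

theorem map_lg {T : Type*} [Ring T] [Algebra O T] (f : S →ₐ[O] T) (c : O) (N : S) :
    f (lg c N) = lg c (f N) := (aeval_algHom_apply f N _).symm

theorem semiconjBy_aeval {P x y : S} (h : SemiconjBy P x y) (p : O[X]) :
    SemiconjBy P (aeval x p) (aeval y p) := by
  induction p using Polynomial.induction_on' with
  | add p q hp hq => rw [map_add, map_add]; exact hp.add_right hq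
  | monomial n a =>
    rw [aeval_monomial, aeval_monomial]
    exact SemiconjBy.mul_right (Algebra.commutes a P).symm (h.pow_right n)

theorem ex_zero (c : O) : ex c (0 : S) = 1 := by simp [ex_eq]

theorem lg_one (c : O) : lg c (1 : S) = 0 := by simp [lg_eq]

theorem ex_smul_mul_ex_smul {c : O} (hc : 6 * c = 1) {N : S} (hN : N ^ 4 = 0) (a b : O) :
    ex c (a • N) * ex c (b • N) = ex c ((a + b) • N) := by
  have h0 : ∀ t : O, ex c (t • N) = aeval N (1 + C t * X + C (3 * c) * (C t * X) ^ 2 +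
      C c * (C t * X) ^ 3) := by
    intro t; simp [ex_eq, Algebra.smul_def]
  have h1 : C (6 : O) * C c = 1 := by rw [← C_mul, hc, C_1]
  have key : (1 + C a * X + C (3 * c) * (C a * X) ^ 2 + C c * (C a * X) ^ 3) *
      (1 + C b * X + C (3 * c) * (C b * X) ^ 2 + C c * (C b * X) ^ 3) =
      (1 + C (a + b) * X + C (3 * c) * (C (a + b) * X) ^ 2 + C c * (C (a + b) * X) ^ 3) +
      (C (c * a ^ 3 * b + 9 * c ^ 2 * a ^ 2 * b ^ 2 + c * a * b ^ 3) +
        C (3 * c ^ 2 * (a ^ 3 * b ^ 2 + a ^ 2 * b ^ 3)) * X +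
        C (c ^ 2 * a ^ 3 * b ^ 3) * X ^ 2) * X ^ 4 := by
    simp only [map_add, map_mul, map_pow, map_ofNat] at h1 ⊢
    linear_combination (-(C a * C b * X ^ 2)) * h1
  rw [h0, h0, h0, ← map_mul, key, map_add, map_mul _ _ (X ^ 4), map_pow, aeval_X, hN, mul_zero,
    add_zero]

theorem ex_pow {c : O} (hc : 6 * c = 1) {N : S} (hN : N ^ 4 = 0) (m : ℕ) :
    ex c N ^ m = ex c ((m : O) • N) := by
  induction m with
  | zero => simp [ex_zero]
  | succ m ih =>
    have := ex_smul_mul_ex_smul hc hN (m : O) 1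
    rw [one_smul] at this
    rw [pow_succ, ih, this, Nat.cast_succ]

theorem lg_ex {c : O} (hc : 6 * c = 1) {N : S} (hN : N ^ 4 = 0) : lg c (ex c N) = N := by
  have h1 : C (6 : O) * C c = 1 := by rw [← C_mul, hc, C_1]
  have key : ∃ r : O[X], (logPoly c).comp (expPoly c) = X + r * X ^ 4 := by
    refine ⟨(12) * C c ^ 2 * X ^ 0
      + (-27) * C c ^ 3 * X ^ 0
      + (6) * C c ^ 2 * X ^ 1
      + (36) * C c ^ 3 * X ^ 1
      + (33) * C c ^ 3 * X ^ 2
      + (54) * C c ^ 4 * X ^ 2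
      + (6) * C c ^ 3 * X ^ 3
      + (54) * C c ^ 4 * X ^ 3
      + (18) * C c ^ 4 * X ^ 4
      + (2) * C c ^ 4 * X ^ 5, ?_⟩
    simp only [logPoly, expPoly, add_comp, sub_comp, mul_comp, pow_comp, X_comp, one_comp, C_comp]
    simp only [map_mul, map_ofNat] at h1 ⊢
    linear_combination (-(3 * C c * X ^ 3)) * h1
  obtain ⟨r, hr⟩ := key
  rw [lg, ex, ← aeval_comp, hr, map_add, map_mul, map_pow, aeval_X, hN, mul_zero, add_zero]

theorem ex_lg {c : O} (hc : 6 * c = 1) {Y : S} (hY : (Y - 1) ^ 4 = 0) : ex c (lg c Y) = Y := by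
  have h1 : C (6 : O) * C c = 1 := by rw [← C_mul, hc, C_1]
  have key : ∃ r : O[X], (expPoly c).comp (logPoly c) = X + r * (X - 1) ^ 4 := by
    refine ⟨(3) * C c ^ 2 * (X - 1) ^ 0
      + (27) * C c ^ 3 * (X - 1) ^ 0
      + (6) * C c ^ 2 * (X - 1) ^ 1
      + (-9) * C c ^ 3 * (X - 1) ^ 1
      + (-24) * C c ^ 3 * (X - 1) ^ 2
      + (-27) * C c ^ 4 * (X - 1) ^ 2
      + (12) * C c ^ 3 * (X - 1) ^ 3
      + (54) * C c ^ 4 * (X - 1) ^ 3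
      + (-36) * C c ^ 4 * (X - 1) ^ 4
      + (8) * C c ^ 4 * (X - 1) ^ 5, ?_⟩
    simp only [logPoly, expPoly, add_comp, sub_comp, mul_comp, pow_comp, X_comp, one_comp, C_comp]
    simp only [map_mul, map_ofNat] at h1 ⊢
    linear_combination (-(3 * C c * (X - 1) ^ 3)) * h1
  obtain ⟨r, hr⟩ := key
  rw [lg, ex, ← aeval_comp, hr, map_add, map_mul, map_pow, map_sub, aeval_X, map_one, hY, mul_zero,
    add_zero]

theorem ex_sub_one_pow {c : O} {N : S} (hN : N ^ 4 = 0) : (ex c N - 1) ^ 4 = 0 := by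
  have : (expPoly c - 1) ^ 4 = (1 + C (3 * c) * X + C c * X ^ 2) ^ 4 * X ^ 4 := by
    rw [expPoly]; ring
  have h := congrArg (aeval N) this
  rwa [map_pow, map_sub, map_one, map_mul, map_pow _ X, aeval_X, hN, mul_zero] at h

theorem lg_pow {c : O} {Y : S} (hY : (Y - 1) ^ 4 = 0) : lg c Y ^ 4 = 0 := by
  have : (logPoly c) ^ 4 =
      (1 - C (3 * c) * (X - 1) + C (2 * c) * (X - 1) ^ 2) ^ 4 * (X - 1) ^ 4 := by
    rw [logPoly]; ring
  have h := congrArg (aeval Y) this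
  rwa [map_pow, map_mul, map_pow _ (X - 1), map_sub, aeval_X, map_one, hY, mul_zero] at h

theorem lg_of_sq {c : O} {N : S} (hN : N ^ 2 = 0) : lg c (1 + N) = N := by
  rw [lg_eq, add_sub_cancel_left, hN, pow_succ, hN]; simp

theorem mul_ex_eq {c : O} (hc : 6 * c = 1) {q : ℕ} {P N : S} (hN : N ^ 4 = 0)
    (h : P * N = (q : O) • (N * P)) : P * ex c N = ex c N ^ q * P := by
  rw [ex_pow hc hN]
  refine semiconjBy_aeval (?_ : SemiconjBy P N ((q : O) • N)) _
  rw [SemiconjBy, h, smul_mul_assoc]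

theorem mul_lg_eq {c : O} (hc : 6 * c = 1) {q : ℕ} {P Y : S} (hY : (Y - 1) ^ 4 = 0)
    (h : P * Y = Y ^ q * P) : P * lg c Y = (q : O) • (lg c Y * P) := by
  have h1 : SemiconjBy P (lg c Y) (lg c (Y ^ q)) := semiconjBy_aeval (by exact h) _
  have h2 : lg c (Y ^ q) = (q : O) • lg c Y := by
    conv_lhs => rw [← ex_lg hc hY, ex_pow hc (lg_pow hY)]
    exact lg_ex hc (by rw [_root_.smul_pow, lg_pow hY, smul_zero])
  rw [h2] at h1
  rw [← smul_mul_assoc]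
  exact h1

end ExpLog

/-- Square matrices of size four. -/
abbrev Mat4 (A : Type*) := Matrix (Fin 4) (Fin 4) A

section Conj

variable (O : Type*) [CommRing O] {S : Type*} [Ring S] [Algebra O S]

/-- Conjugation by a unit. -/
def conjHom (U : Sˣ) : S →ₐ[O] S where
  toFun x := U.val * x * U⁻¹.val
  map_one' := by simp
  map_mul' x y := by
    have : U.val * (x * y) * U⁻¹.val = U.val * x * (U⁻¹.val * U.val) * y * U⁻¹.val := by
      rw [Units.inv_mul]; noncomm_ring
    rw [this]; noncomm_ring
  map_zero' := by simp
  map_add' x y := by noncomm_ring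
  commutes' a := by rw [← Algebra.commutes, mul_assoc, Units.mul_inv, mul_one]

theorem conjHom_apply (U : Sˣ) (x : S) : conjHom O U x = U.val * x * U⁻¹.val := rfl

@[simp] theorem conjHom_inv_conjHom (U : Sˣ) (x : S) : conjHom O U⁻¹ (conjHom O U x) = x := by
  simp [conjHom_apply, ← mul_assoc]

@[simp] theorem conjHom_conjHom_inv (U : Sˣ) (x : S) : conjHom O U (conjHom O U⁻¹ x) = x := by
  simp [conjHom_apply, ← mul_assoc]

theorem conjHom_eq_iff (U : Sˣ) (x y : S) : conjHom O U x = y ↔ U.val * x = y * U.val := by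
  rw [conjHom_apply, Units.mul_inv_eq_iff_eq_mul]

theorem map_conjHom {T : Type*} [Ring T] [Algebra O T] (f : S →ₐ[O] T) (U : Sˣ) (x : S) :
    f (conjHom O U x) = conjHom O (Units.map (f : S →* T) U) (f x) := by
  rw [conjHom_apply, map_mul, map_mul]; rfl

end Conj

section Congr

variable {n : Type} [Fintype n] [DecidableEq n]
variable {O A : Type u} [CommRing O] [IsLocalRing O] [CommRing A] [IsLocalRing A] [Algebra O A]

theorem isCongr_iff {M : Matrix n n A} {M₀ : Matrix n n O} :
    IsCongr M M₀ ↔ M.map (residue A) = M₀.map (fun x => residue A (algebraMap O A x)) := by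
  rw [← Matrix.ext_iff]
  refine forall_congr' fun i => forall_congr' fun j => ?_
  rw [Matrix.map_apply, Matrix.map_apply, ← sub_eq_zero, ← map_sub, residue_eq_zero_iff]

/-- Reduction of matrices. -/
def redMat (A : Type u) [CommRing A] [IsLocalRing A] [Algebra O A] :
    Matrix n n A →ₐ[O] Matrix n n (ResidueField A) :=
  (IsScalarTower.toAlgHom O A (ResidueField A)).mapMatrix

/-- Scalar extension of matrices. -/
def extMat (A : Type u) [CommRing A] [Algebra O A] :
    Matrix n n O →ₐ[O] Matrix n n A := (Algebra.ofId O A).mapMatrix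

theorem isCongr_iff_redMat {M : Matrix n n A} {M₀ : Matrix n n O} :
    IsCongr M M₀ ↔ redMat (O := O) A M = redMat (O := O) A (extMat A M₀) := isCongr_iff

theorem IsCongr.mul {M N : Matrix n n A} {M₀ N₀ : Matrix n n O} (hM : IsCongr M M₀)
    (hN : IsCongr N N₀) : IsCongr (M * N) (M₀ * N₀) := by
  rw [isCongr_iff_redMat] at *
  simp only [map_mul, hM, hN]

theorem IsCongr.ex (c : O) {M : Matrix n n A} {M₀ : Matrix n n O} (hM : IsCongr M M₀) :
    IsCongr (ex c M) (ex c M₀) := by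
  rw [isCongr_iff_redMat] at *
  simp only [map_ex, hM]

theorem IsCongr.lg (c : O) {M : Matrix n n A} {M₀ : Matrix n n O} (hM : IsCongr M M₀) :
    IsCongr (lg c M) (lg c M₀) := by
  rw [isCongr_iff_redMat] at *
  simp only [map_lg, hM]

theorem isCongr_extMat (M₀ : Matrix n n O) : IsCongr (extMat A M₀) M₀ := fun i j => by
  simp [extMat, Algebra.ofId_apply]

theorem IsCongr.trans [IsLocalHom (algebraMap O A)] {M : Matrix n n A} {M₀ M₁ : Matrix n n O}
    (h : IsCongr M M₀) (h' : IsCongr M₀ M₁) : IsCongr M M₁ := fun i j => by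
  have := algebraMap_mem_maximalIdeal A (h' i j)
  rw [map_sub] at this
  have h2 := add_mem (h i j) this
  rwa [Algebra.algebraMap_self, RingHom.id_apply, sub_add_sub_cancel] at h2

theorem IsCongr.symm {M₀ M₁ : Matrix n n O} (h : IsCongr M₀ M₁) : IsCongr M₁ M₀ := fun i j => by
  have := neg_mem (h i j)
  rwa [neg_sub] at this

theorem IsCongr.map {B : Type u} [CommRing B] [IsLocalRing B] [Algebra O B] {M : Matrix n n A}
    {M₀ : Matrix n n O} (h : IsCongr M M₀) (f : A →ₐ[O] B)
    (hf : ∀ x ∈ maximalIdeal A, f x ∈ maximalIdeal B) : IsCongr (f.mapMatrix M) M₀ := fun i j => by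
  have := hf _ (h i j)
  rwa [map_sub, AlgHom.commutes] at this

theorem aeval_sub_mem {κ : Type*} {v : κ → A} {v₀ : κ → O}
    (h : ∀ k, v k - algebraMap O A (v₀ k) ∈ maximalIdeal A) (g : MvPolynomial κ O) :
    MvPolynomial.aeval v g - algebraMap O A (MvPolynomial.aeval v₀ g) ∈ maximalIdeal A := by
  rw [← residue_eq_zero_iff, map_sub, sub_eq_zero]
  let r := IsScalarTower.toAlgHom O A (ResidueField A)
  have : r.comp (MvPolynomial.aeval v) =
      (r.comp (Algebra.ofId O A)).comp (MvPolynomial.aeval v₀) := by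
    ext k
    have := h k
    rw [← residue_eq_zero_iff, map_sub, sub_eq_zero] at this
    change residue A (MvPolynomial.aeval v (MvPolynomial.X k)) =
      residue A (algebraMap O A (MvPolynomial.aeval v₀ (MvPolynomial.X k)))
    rwa [MvPolynomial.aeval_X, MvPolynomial.aeval_X]
  exact DFunLike.congr_fun this g

theorem isUnit_one_add {Y : Matrix n n A} (h : ∀ i j, Y i j ∈ maximalIdeal A) :
    IsUnit (1 + Y) := by
  rw [Matrix.isUnit_iff_isUnit_det, ← IsLocalRing.residue_ne_zero_iff_isUnit, RingHom.map_det,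
    map_add, map_one]
  have : (residue A).mapMatrix Y = 0 := by
    ext i j
    exact (residue_eq_zero_iff _).mpr (h i j)
  rw [this, add_zero, Matrix.det_one]
  exact one_ne_zero

end Congr

/-! ### Universal pairs -/

section Universal

variable {O : Type u} [CommRing O] [IsLocalRing O]

/-- `(F, S)` is the universal deformation of the pair `(φ₀, σ₀)` with `F S = S ^ q F`. -/
structure IsUniversalPair (q : ℕ) (φ₀ σ₀ : Mat4 O) {R : Type u} [CommRing R] [IsLocalRing R]
    [Algebra O R] (F S : Mat4 R) : Prop where
  cnl : IsCNL O R
  congr_frob : IsCongr F φ₀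
  congr_tame : IsCongr S σ₀
  rel : F * S = S ^ q * F
  exists_hom : ∀ (A : Type u) [CommRing A] [IsLocalRing A] [Algebra O A] [IsCNL O A]
    (F' S' : Mat4 A), IsCongr F' φ₀ → IsCongr S' σ₀ → F' * S' = S' ^ q * F' →
    ∃ f : R →ₐ[O] A, f.mapMatrix F = F' ∧ f.mapMatrix S = S'
  hom_ext : ∀ (A : Type u) [CommRing A] [IsLocalRing A] [Algebra O A] [IsCNL O A]
    (f g : R →ₐ[O] A), f.mapMatrix F = g.mapMatrix F → f.mapMatrix S = g.mapMatrix S → f = g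

/-- Scalar extension of an invertible matrix. -/
def extUnit (A : Type u) [CommRing A] [Algebra O A] (P : (Mat4 O)ˣ) : (Mat4 A)ˣ :=
  Units.map ((extMat A : Mat4 O →ₐ[O] Mat4 A) : Mat4 O →* Mat4 A) P

theorem map_extUnit {A B : Type u} [CommRing A] [Algebra O A] [CommRing B] [Algebra O B]
    (f : A →ₐ[O] B) (P : (Mat4 O)ˣ) :
    Units.map ((f.mapMatrix : Mat4 A →ₐ[O] Mat4 B) : Mat4 A →* Mat4 B) (extUnit A P) = extUnit B P := by
  ext i j
  simp [extUnit, extMat, Algebra.ofId_apply]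

theorem IsCongr.conj {A : Type u} [CommRing A] [IsLocalRing A] [Algebra O A] {M : Mat4 A}
    {M₀ : Mat4 O} (h : IsCongr M M₀) (P : (Mat4 O)ˣ) :
    IsCongr (conjHom O (extUnit A P) M) (conjHom O P M₀) := by
  rw [conjHom_apply, conjHom_apply]
  exact ((isCongr_extMat P.val).mul h).mul (isCongr_extMat P⁻¹.val)

theorem extUnit_inv {A : Type u} [CommRing A] [Algebra O A] (P : (Mat4 O)ˣ) :
    extUnit A P⁻¹ = (extUnit A P)⁻¹ := map_inv _ _

theorem IsUniversalPair.conj {q : ℕ} {φ₀ σ₀ : Mat4 O} {R : Type u} [CommRing R] [IsLocalRing R]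
    [Algebra O R] {F S : Mat4 R} (h : IsUniversalPair q φ₀ σ₀ F S) (P : (Mat4 O)ˣ) :
    IsUniversalPair q (conjHom O P φ₀) (conjHom O P σ₀) (conjHom O (extUnit R P) F)
      (conjHom O (extUnit R P) S) where
  cnl := h.cnl
  congr_frob := h.congr_frob.conj P
  congr_tame := h.congr_tame.conj P
  rel := by rw [← map_mul, h.rel, map_mul, map_pow]
  exists_hom A _ _ _ _ F' S' hF hS hr := by
    have hF := hF.conj P⁻¹
    have hS := hS.conj P⁻¹
    rw [conjHom_inv_conjHom] at hF hS
    obtain ⟨f, hf1, hf2⟩ := h.exists_hom A _ _ hF hS (by rw [← map_mul, hr, map_mul, map_pow])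
    refine ⟨f, ?_, ?_⟩
    · rw [map_conjHom, map_extUnit, hf1, extUnit_inv, conjHom_conjHom_inv]
    · rw [map_conjHom, map_extUnit, hf2, extUnit_inv, conjHom_conjHom_inv]
  hom_ext A _ _ _ _ f g h1 h2 := by
    rw [map_conjHom, map_conjHom, map_extUnit, map_extUnit] at h1 h2
    have h1 := congrArg (conjHom O (extUnit A P)⁻¹) h1
    have h2 := congrArg (conjHom O (extUnit A P)⁻¹) h2
    simp only [conjHom_inv_conjHom] at h1 h2
    exact h.hom_ext A f g h1 h2

variable {K : Type u} [Field K] [Algebra O K]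

/-- The point `x` has a unipotent tame generator, whose logarithm satisfies `Ty`. -/
def IsTypePoint (c : O) (Ty : Mat4 K → Prop) {R : Type u} [CommRing R] [Algebra O R]
    (S : Mat4 R) (x : R →ₐ[O] K) : Prop :=
  (x.mapMatrix S - 1) ^ 4 = 0 ∧ Ty (lg c (x.mapMatrix S))

/-- The ideal of functions vanishing at all points of a given type. -/
def pointIdeal (c : O) (Ty : Mat4 K → Prop) {R : Type u} [CommRing R] [Algebra O R]
    (S : Mat4 R) : Ideal R :=
  ⨅ x ∈ {x : R →ₐ[O] K | IsTypePoint c Ty S x}, RingHom.ker x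

/-- The property `Ty` is invariant under conjugation. -/
def ConjInvariant (Ty : Mat4 K → Prop) : Prop := ∀ (U : (Mat4 K)ˣ) M, Ty M → Ty (conjHom K U M)

theorem conjHom_eq_conjHom (U : (Mat4 K)ˣ) (M : Mat4 K) : conjHom O U M = conjHom K U M := rfl

theorem isTypePoint_conj {c : O} {Ty : Mat4 K → Prop} (hTy : ConjInvariant Ty) {R : Type u}
    [CommRing R] [Algebra O R] {S : Mat4 R} (U : (Mat4 R)ˣ) {x : R →ₐ[O] K}
    (h : IsTypePoint c Ty S x) : IsTypePoint c Ty (conjHom O U S) x := by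
  rw [IsTypePoint, map_conjHom]
  constructor
  · rw [← map_one (conjHom O _), ← map_sub, ← map_pow, h.1, map_zero]
  · rw [← map_lg, conjHom_eq_conjHom]
    exact hTy _ _ h.2

theorem isTypePoint_conj_iff {c : O} {Ty : Mat4 K → Prop} (hTy : ConjInvariant Ty) {R : Type u}
    [CommRing R] [Algebra O R] {S : Mat4 R} (U : (Mat4 R)ˣ) {x : R →ₐ[O] K} :
    IsTypePoint c Ty (conjHom O U S) x ↔ IsTypePoint c Ty S x := by
  refine ⟨fun h => ?_, isTypePoint_conj hTy U⟩
  have := isTypePoint_conj hTy U⁻¹ h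
  rwa [conjHom_inv_conjHom] at this

theorem pointIdeal_conj {c : O} {Ty : Mat4 K → Prop} (hTy : ConjInvariant Ty) {R : Type u}
    [CommRing R] [Algebra O R] {S : Mat4 R} (U : (Mat4 R)ˣ) :
    pointIdeal c Ty (conjHom O U S) = pointIdeal c Ty S := by
  simp only [pointIdeal, isTypePoint_conj_iff hTy U]

theorem exists_quotient_equiv {R B : Type u} [CommRing R] [CommRing B] [Algebra O R] [Algebra O B]
    (f : R →ₐ[O] B) (hf : Function.Surjective f) (T : Set (R →ₐ[O] K))
    (h1 : ∀ x ∈ T, ∃ y : B →ₐ[O] K, y.comp f = x)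
    (h2 : ∀ b : B, b ≠ 0 → ∃ y : B →ₐ[O] K, y b ≠ 0 ∧ y.comp f ∈ T) :
    Nonempty ((R ⧸ ⨅ x ∈ T, RingHom.ker x) ≃ₐ[O] B) := by
  have : (⨅ x ∈ T, RingHom.ker x) = RingHom.ker f := by
    apply le_antisymm
    · intro a ha
      simp only [Submodule.mem_iInf, RingHom.mem_ker] at ha
      rw [RingHom.mem_ker]
      by_contra hb
      obtain ⟨y, hy, hyT⟩ := h2 _ hb
      exact hy (ha _ hyT)
    · intro a ha
      simp only [Submodule.mem_iInf, RingHom.mem_ker] at ha ⊢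
      intro x hx
      obtain ⟨y, rfl⟩ := h1 x hx
      rw [AlgHom.comp_apply, ha, map_zero]
  rw [this]
  exact ⟨Ideal.quotientKerAlgEquivOfSurjective hf⟩

end Universal

section PowerSeriesTools

variable {O : Type u} [CommRing O] [IsLocalRing O]

theorem exists_powerSeries_lift_over {A C : Type u} [CommRing A] [IsLocalRing A] [Algebra O A]
    [IsCNL O A] [CommRing C] [Algebra O C] {ι : Type} [Finite ι] (g : C →ₐ[O] A) (a : ι → A)
    (ha : ∀ i, a i ∈ maximalIdeal A) : ∃ h : MvPowerSeries ι C →ₐ[O] A,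
      (∀ x, h (MvPowerSeries.C x) = g x) ∧ ∀ i, h (MvPowerSeries.X i) = a i := by
  let _ : Algebra C A := g.toRingHom.toAlgebra
  have : IsAdicComplete (maximalIdeal A) A := IsCNL.complete (O := O)
  obtain ⟨h, hh⟩ := exists_powerSeries_lift (O := C) (maximalIdeal A) a ha
  have hC : ∀ x : C, h (MvPowerSeries.C x) = g x := fun x => h.commutes x
  refine ⟨{ h.toRingHom with commutes' := fun o => ?_ }, hC, hh⟩
  change h (algebraMap O (MvPowerSeries ι C) o) = _
  rw [MvPowerSeries.algebraMap_apply, hC, AlgHom.commutes]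

theorem exists_powerSeries_lift_local {A : Type u} [CommRing A] [IsLocalRing A] [Algebra O A]
    [IsCNL O A] {ι : Type} [Finite ι] (a : ι → A) (ha : ∀ i, a i ∈ maximalIdeal A) :
    ∃ h : MvPowerSeries ι O →ₐ[O] A, ∀ i, h (MvPowerSeries.X i) = a i := by
  have : IsAdicComplete (maximalIdeal A) A := IsCNL.complete (O := O)
  exact exists_powerSeries_lift (maximalIdeal A) a ha

theorem generates_X {ι : Type} [Finite ι] [IsCNL O O] :
    Generates O (MvPowerSeries.X : ι → MvPowerSeries ι O) := by
  have h0 : Generates O (fun i : Empty => (i.elim : O)) := by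
    rw [Generates, Algebra.algebraMap_self, Ideal.map_id]
    exact le_sup_left
  refine (generates_powerSeries (ι := ι) h0).trans (sup_le_sup_left (Ideal.span_mono ?_) _)
  rintro _ ⟨i | i, rfl⟩
  · exact i.elim
  · exact ⟨i, rfl⟩

theorem X_mem_maximalIdeal {C : Type u} [CommRing C] [IsLocalRing C] {ι : Type} [Finite ι] (i : ι) :
    (MvPowerSeries.X i : MvPowerSeries ι C) ∈ maximalIdeal _ := by
  rw [mem_maximalIdeal_powerSeries_iff]; simp

theorem C_mem_maximalIdeal {C : Type u} [CommRing C] [IsLocalRing C] {ι : Type} [Finite ι] {x : C}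
    (hx : x ∈ maximalIdeal C) :
    (MvPowerSeries.C x : MvPowerSeries ι C) ∈ maximalIdeal _ := by
  rw [mem_maximalIdeal_powerSeries_iff]; simpa using hx

/-- Power series in two sets of variables. -/
theorem exists_powerSeries_sum_equiv [IsCNL O O] (ι τ : Type) [Finite ι] [Finite τ] :
    Nonempty (MvPowerSeries ι (MvPowerSeries τ O) ≃ₐ[O] MvPowerSeries (ι ⊕ τ) O) := by
  obtain ⟨g, hg⟩ := exists_powerSeries_lift_local (O := O) (A := MvPowerSeries (ι ⊕ τ) O)
    (fun t : τ => MvPowerSeries.X (Sum.inr t)) (fun t => X_mem_maximalIdeal _)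
  obtain ⟨f, hf1, hf2⟩ := exists_powerSeries_lift_over g
    (fun i : ι => MvPowerSeries.X (Sum.inl i)) (fun t => X_mem_maximalIdeal _)
  obtain ⟨k, hk⟩ := exists_powerSeries_lift_local (O := O) (A := MvPowerSeries ι (MvPowerSeries τ O))
    (Sum.elim (fun i => MvPowerSeries.X i)
      (fun t : τ => MvPowerSeries.C (MvPowerSeries.X t))) (by
      rintro (i | t)
      · exact X_mem_maximalIdeal _
      · exact C_mem_maximalIdeal (X_mem_maximalIdeal _))
  refine ⟨AlgEquiv.ofAlgHom f k ?_ ?_⟩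
  · refine generates_X.algHom_ext X_mem_maximalIdeal ?_
    rintro (i | t) <;> simp [hk, hf1, hf2, hg]
  · refine (generates_powerSeries (ι := ι)
      (generates_X (ι := τ))).algHom_ext ?_ ?_
    · rintro (t | i)
      · exact C_mem_maximalIdeal (X_mem_maximalIdeal _)
      · exact X_mem_maximalIdeal _
    · rintro (i | t) <;> simp [hk, hf1, hf2, hg]

end PowerSeriesTools

open MvPolynomial in
/-- The point `p` satisfies the equations in `I`. -/
def Satisfies {O : Type u} [CommRing O] {κ : Type} (I : Ideal (MvPolynomial κ O)) {A : Type u}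
    [CommRing A] [Algebra O A] (p : κ → A) : Prop := ∀ g ∈ I, aeval p g = 0

theorem Satisfies.map {O : Type u} [CommRing O] {κ : Type} {I : Ideal (MvPolynomial κ O)}
    {A B : Type u} [CommRing A] [Algebra O A] [CommRing B] [Algebra O B] {p : κ → A}
    (h : Satisfies I p) (f : A →ₐ[O] B) : Satisfies I (fun k => f (p k)) := fun g hg => by
  have := congrArg f (h g hg)
  rwa [map_zero, ← AlgHom.comp_apply, MvPolynomial.comp_aeval] at this

theorem Satisfies.of_injective {O : Type u} [CommRing O] {κ : Type} {I : Ideal (MvPolynomial κ O)}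
    {A B : Type u} [CommRing A] [Algebra O A] [CommRing B] [Algebra O B] {p : κ → A}
    (f : A →ₐ[O] B) (hf : Function.Injective f) (h : Satisfies I (fun k => f (p k))) :
    Satisfies I p := fun g hg => by
  apply hf
  rw [map_zero, ← AlgHom.comp_apply, MvPolynomial.comp_aeval]
  exact h g hg

section Families

variable {O : Type u} [CommRing O] [IsLocalRing O]

/-- Evaluation of a matrix of polynomials. -/
def evalMat {κ : Type} {A : Type u} [CommRing A] [Algebra O A] (v : κ → A)
    (M : Mat4 (MvPolynomial κ O)) : Mat4 A := (MvPolynomial.aeval v).mapMatrix M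

theorem map_evalMat {κ : Type} {A B : Type u} [CommRing A] [Algebra O A] [CommRing B] [Algebra O B]
    (f : A →ₐ[O] B) (v : κ → A) (M : Mat4 (MvPolynomial κ O)) :
    f.mapMatrix (evalMat v M) = evalMat (fun k => f (v k)) M := by
  ext i j
  change f (MvPolynomial.aeval v (M i j)) = MvPolynomial.aeval (fun k => f (v k)) (M i j)
  rw [← AlgHom.comp_apply, MvPolynomial.comp_aeval]

theorem evalMat_apply {κ : Type} {A : Type u} [CommRing A] [Algebra O A] (v : κ → A)
    (M : Mat4 (MvPolynomial κ O)) (i j : Fin 4) :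
    evalMat v M i j = MvPolynomial.aeval v (M i j) := rfl

/-- Pairs of entries of two matrices. -/
def entries {A : Type*} (D N : Mat4 A) : (Fin 4 × Fin 4) ⊕ (Fin 4 × Fin 4) → A :=
  Sum.elim (fun p => D p.1 p.2) fun p => N p.1 p.2

variable (O) (K : Type u) [Field K] [Algebra O K]

/-- A parametrisation of the pairs `(D, N)` of matrices supported according to the labels `e`, with
`D N = q N D` and `N` in the closure of `Ty`, by free coordinates `α` and coordinates `κ` that are
subject to the equations `I`. -/
structure Family (q : ℕ) (Ty : Mat4 K → Prop) (e : Fin 4 → ResidueField O) where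
  α : Type
  κ : Type
  J : Type
  finite_α : Finite α
  I : Ideal (MvPolynomial κ O)
  D : Mat4 (MvPolynomial (α ⊕ κ) O)
  N : Mat4 (MvPolynomial (α ⊕ κ) O)
  co : α ⊕ κ → MvPolynomial ((Fin 4 × Fin 4) ⊕ (Fin 4 × Fin 4)) O
  nd : J → MvPolynomial (α ⊕ κ) O
  supp : IsSupported e 1 D
  comm : ∀ {A : Type u} [CommRing A] [Algebra O A] (v : α ⊕ κ → A),
    Satisfies I (fun k => v (Sum.inr k)) →
    evalMat v D * evalMat v N = (q : O) • (evalMat v N * evalMat v D) ∧ evalMat v N ^ 4 = 0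
  co_eval : ∀ {A : Type u} [CommRing A] [Algebra O A] (v : α ⊕ κ → A) (j : α ⊕ κ),
    MvPolynomial.aeval (entries (evalMat v D) (evalMat v N)) (co j) = v j
  typed : ∀ D' N' : Mat4 K, IsSupported e 1 D' → IsSupported e (q : ResidueField O) N' →
    D' * N' = (q : O) • (N' * D') → Ty N' →
    Satisfies I (fun k => MvPolynomial.aeval (entries D' N') (co (Sum.inr k))) ∧
    evalMat (fun j => MvPolynomial.aeval (entries D' N') (co j)) D = D' ∧
    evalMat (fun j => MvPolynomial.aeval (entries D' N') (co j)) N = N'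
  ty_iff : ∀ v : α ⊕ κ → K, Satisfies I (fun k => v (Sum.inr k)) →
    (Ty (evalMat v N) ↔ ∃ j, MvPolynomial.aeval v (nd j) ≠ 0)

attribute [instance] Family.finite_α

variable {O K}

/-- `(C, p)` is the universal deformation of the point `p₀` on the scheme defined by `I`. -/
structure IsLocalModel {κ : Type} (I : Ideal (MvPolynomial κ O)) (p₀ : κ → O) {C : Type u}
    [CommRing C] [IsLocalRing C] [Algebra O C] (p : κ → C) : Prop where
  rel : Satisfies I p
  sub_mem : ∀ k, p k - algebraMap O C (p₀ k) ∈ maximalIdeal C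
  gen : Generates O (fun k => p k - algebraMap O C (p₀ k))
  lift : ∀ (A : Type u) [CommRing A] [IsLocalRing A] [Algebra O A] [IsCNL O A] (p' : κ → A),
    Satisfies I p' → (∀ k, p' k - algebraMap O A (p₀ k) ∈ maximalIdeal A) →
    ∃ h : C →ₐ[O] A, ∀ k, h (p k) = p' k

/-- The positions outside the diagonal blocks. -/
abbrev Off (e : Fin 4 → ResidueField O) : Type := {p : Fin 4 × Fin 4 // e p.1 ≠ 1 * e p.2}

section Core

variable {q : ℕ} {Ty : Mat4 K → Prop} {e : Fin 4 → ResidueField O}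

open Classical in
/-- The matrix of off-diagonal variables. -/
def offMat (e : Fin 4 → ResidueField O) (α : Type) (C : Type u) [CommRing C] :
    Mat4 (MvPowerSeries (Off e ⊕ α) C) :=
  Matrix.of fun i j => if h : e i ≠ 1 * e j then MvPowerSeries.X (Sum.inl ⟨(i, j), h⟩) else 0

/-- The universal coordinates. -/
def genPoint (e : Fin 4 → ResidueField O) {α κ : Type} {C : Type u} [CommRing C] [Algebra O C]
    (s₀ : α → O) (p : κ → C) : α ⊕ κ → MvPowerSeries (Off e ⊕ α) C :=
  Sum.elim (fun i => algebraMap O _ (s₀ i) + MvPowerSeries.X (Sum.inr i))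
    fun k => MvPowerSeries.C (p k)

theorem map_one_add {A B : Type u} [CommRing A] [Algebra O A] [CommRing B] [Algebra O B]
    (f : A →ₐ[O] B) (Y : Mat4 A) : f.mapMatrix (1 + Y) = 1 + Y.map f := by
  rw [map_add, map_one]; rfl

theorem powerSeries_C_algebraMap {C : Type u} [CommRing C] [Algebra O C] {ι : Type} (o : O) :
    (MvPowerSeries.C (algebraMap O C o) : MvPowerSeries ι C) = algebraMap O _ o := by
  rw [MvPowerSeries.algebraMap_apply]

theorem genPoint_inl_sub {α κ : Type} {C : Type u} [CommRing C] [Algebra O C]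
    (s₀ : α → O) (p : κ → C) (i : α) :
    genPoint e s₀ p (Sum.inl i) - algebraMap O _ (s₀ i) = MvPowerSeries.X (Sum.inr i) := by
  simp [genPoint]

theorem isCongr_one_add {A : Type u} [CommRing A] [IsLocalRing A] [Algebra O A] {Y : Mat4 A}
    (h : ∀ i j, Y i j ∈ maximalIdeal A) : IsCongr (1 + Y) (1 : Mat4 O) := by
  intro i j
  have : (1 : Mat4 A) i j - algebraMap O A ((1 : Mat4 O) i j) = 0 := by
    rw [Matrix.one_apply, Matrix.one_apply]; split_ifs <;> simp
  rw [Matrix.add_apply, add_sub_right_comm, this, zero_add]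
  exact h i j

theorem Family.exists_coords {c : O} (hc : 6 * c = 1) {φ₀ σ₀ : Mat4 O}
    (he : IsBlock e (φ₀.map (residue O))) (fam : Family O K q Ty e) (hTy : ConjInvariant Ty)
    {A : Type u} [CommRing A] [IsLocalRing A] [Algebra O A] [IsCNL O A] (i : A →ₐ[O] K)
    (hi : Function.Injective i) {FA SA : Mat4 A} (hFA : IsCongr FA φ₀) (hSA : IsCongr SA σ₀)
    (hrel : FA * SA = SA ^ q * FA) (hx1 : (SA - 1) ^ 4 = 0) (hx2 : Ty (lg c (i.mapMatrix SA))) :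
    ∃ (YA : Mat4 A) (UA : (Mat4 A)ˣ) (w : fam.α ⊕ fam.κ → A),
      goodPart e 1 YA = 0 ∧ (∀ a b, YA a b ∈ maximalIdeal A) ∧ UA.val = 1 + YA ∧
      FA = conjHom O UA (evalMat w fam.D) ∧ lg c SA = conjHom O UA (evalMat w fam.N) ∧
      Satisfies fam.I (fun k => w (Sum.inr k)) ∧ IsCongr (evalMat w fam.D) φ₀ ∧
      IsCongr (evalMat w fam.N) (lg c σ₀) ∧ Ty (evalMat (fun j => i (w j)) fam.N) := by
  have hiM : Function.Injective (i.mapMatrix : Mat4 A →ₐ[O] Mat4 K) := fun M M' h => by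
    ext a b
    exact hi (congrFun (congrFun h a) b)
  obtain ⟨YA, DA, hdA⟩ := exists_isDiagonalisation he hFA
  obtain ⟨UA, hUA⟩ := isUnit_one_add hdA.mem
  have hDA : FA = conjHom O UA DA := by
    rw [eq_comm, conjHom_eq_iff, hUA]; exact hdA.eq.symm
  set NA := conjHom O UA⁻¹ (lg c (SA)) with hNA
  have hNA' : lg c (SA) = conjHom O UA NA := by rw [hNA, conjHom_conjHom_inv]
  have hcommA : DA * NA = (q : O) • (NA * DA) := by
    have h2 := mul_lg_eq hc hx1 hrel
    rw [hNA', hDA, ← map_mul, ← map_mul, ← map_smul] at h2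
    have h3 := congrArg (conjHom O UA⁻¹) h2
    simpa only [conjHom_inv_conjHom] using h3
  have hDcA : IsCongr DA φ₀ := hdA.isCongr hFA
  have hNs : IsSupported e (q : ResidueField O) NA := by
    refine isSupported_of_commute (ResidueField.map (algebraMap O A)) (c := (q : A)) (by simp)
      hdA.supp ?_ ?_
    · rw [hDcA.map_residue]; exact he.map _
    · rw [hcommA]; simp [Nat.cast_smul_eq_nsmul]
  have hNcA : IsCongr NA (lg c σ₀) := by
    have hU1 : IsCongr UA.val (1 : Mat4 O) := by
      rw [hUA]; exact isCongr_one_add hdA.mem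
    have h1 := hSA.lg c
    rw [isCongr_iff_redMat] at *
    rw [map_one, map_one] at hU1
    rw [hNA, map_conjHom, h1]
    have : Units.map ((redMat A : Mat4 A →ₐ[O] _) : Mat4 A →* Mat4 (ResidueField A)) UA = 1 := by
      ext1; exact hU1
    rw [map_inv, this, conjHom_apply]; simp
  set w : fam.α ⊕ fam.κ → A := fun j => MvPolynomial.aeval (entries DA NA) (fam.co j) with hw
  have hwi : ∀ j, i (w j) =
      MvPolynomial.aeval (entries (i.mapMatrix DA) (i.mapMatrix NA)) (fam.co j) := by
    intro j
    rw [hw, ← AlgHom.comp_apply, MvPolynomial.comp_aeval]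
    congr 2
    funext x
    rcases x with x | x <;> rfl
  have hTyN : Ty (i.mapMatrix NA) := by
    rw [hNA, map_conjHom, map_lg, conjHom_eq_conjHom]
    exact hTy _ _ hx2
  obtain ⟨t1, t2, t3⟩ := fam.typed (i.mapMatrix DA) (i.mapMatrix NA)
    (fun a b h => by
      change i (DA a b) = 0
      rw [hdA.supp a b h, map_zero])
    (fun a b h => by
      change i (NA a b) = 0
      rw [hNs a b h, map_zero])
    (by rw [← map_mul, hcommA, map_smul, map_mul]) hTyN
  simp only [← hwi] at t1 t2 t3
  rw [← map_evalMat] at t2 t3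
  have t2 := hiM t2
  have t3 := hiM t3
  have hrelA : Satisfies fam.I (fun k => w (Sum.inr k)) := Satisfies.of_injective i hi t1
  refine ⟨YA, UA, w, hdA.off, hdA.mem, hUA, ?_, ?_, hrelA, ?_, ?_, ?_⟩
  · rw [t2, hDA]
  · rw [t3, hNA']
  · rw [t2]; exact hDcA
  · rw [t3]; exact hNcA
  · rw [← map_evalMat, t3]; exact hTyN

theorem Family.exists_base {c : O} (hc : 6 * c = 1) {φ₀ σ₀ : Mat4 O}
    {R : Type u} [CommRing R] [IsLocalRing R] [Algebra O R] {F S : Mat4 R}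
    (U : IsUniversalPair q φ₀ σ₀ F S) (he : IsBlock e (φ₀.map (residue O)))
    (fam : Family O K q Ty e) (hTy : ConjInvariant Ty) {x : R →ₐ[O] K}
    (hx : IsTypePoint c Ty S x) : ∃ (s₀ : fam.α → O) (p₀ : fam.κ → O),
      IsCongr (evalMat (Sum.elim s₀ p₀) fam.D) φ₀ ∧
      IsCongr (evalMat (Sum.elim s₀ p₀) fam.N) (lg c σ₀) ∧ IsCongr (ex c (lg c σ₀)) σ₀ ∧
      ∀ g ∈ fam.I, MvPolynomial.aeval p₀ g ∈ maximalIdeal O := by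
  have hR := U.cnl
  have hprime : (RingHom.ker x).IsPrime := RingHom.ker_isPrime x
  have hloc : IsLocalRing (R ⧸ RingHom.ker x) :=
    IsLocalRing.of_surjective' (Ideal.Quotient.mk _) Ideal.Quotient.mk_surjective
  let A := R ⧸ RingHom.ker x
  let π : R →ₐ[O] A := Ideal.Quotient.mkₐ O _
  have hA : IsCNL O A := IsCNL.of_surjective π Ideal.Quotient.mk_surjective
  let i : A →ₐ[O] K := Ideal.kerLiftAlg x
  have hi : Function.Injective i := Ideal.kerLiftAlg_injective x
  have hlocal : ∀ x ∈ maximalIdeal R, π x ∈ maximalIdeal A :=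
    fun x hx => map_mem_maximalIdeal IsCNL.residue_surjective π hx
  have hx1 : (π.mapMatrix S - 1) ^ 4 = 0 := by
    have hiM : Function.Injective (i.mapMatrix : Mat4 A →ₐ[O] Mat4 K) := fun M M' h => by
      ext a b
      exact hi (congrFun (congrFun h a) b)
    apply hiM
    rw [map_pow, map_sub, map_one, map_zero]
    exact hx.1
  have hSA := U.congr_tame.map π hlocal
  obtain ⟨-, -, w, -, -, -, -, -, hrelA, hcD, hcN, -⟩ :=
    fam.exists_coords hc he hTy i hi (U.congr_frob.map π hlocal) hSA
      (by rw [← map_mul, U.rel, map_mul, map_pow]) hx1 hx.2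
  choose w₀ hw₀ using fun j => exists_sub_algebraMap_mem
    (IsCNL.residue_surjective (O := O) (A := A)) (w j)
  have hback : ∀ {a : O}, algebraMap O A a ∈ maximalIdeal A → a ∈ maximalIdeal O := fun ha hu =>
    ha (hu.map _)
  have hcong : ∀ (M : Mat4 (MvPolynomial (fam.α ⊕ fam.κ) O)) (M₀ : Mat4 O),
      IsCongr (evalMat w M) M₀ → IsCongr (evalMat w₀ M) M₀ := by
    intro M M₀ h a b
    apply hback
    have h1 := aeval_sub_mem hw₀ (M a b)
    have h2 := sub_mem (h a b) h1
    rwa [evalMat_apply, sub_sub_sub_cancel_left, ← map_sub] at h2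
  refine ⟨fun j => w₀ (Sum.inl j), fun k => w₀ (Sum.inr k), ?_, ?_, ?_, ?_⟩
  · have : Sum.elim (fun j => w₀ (Sum.inl j)) (fun k => w₀ (Sum.inr k)) = w₀ :=
      Sum.elim_comp_inl_inr w₀
    rw [this]; exact hcong _ _ hcD
  · have : Sum.elim (fun j => w₀ (Sum.inl j)) (fun k => w₀ (Sum.inr k)) = w₀ :=
      Sum.elim_comp_inl_inr w₀
    rw [this]; exact hcong _ _ hcN
  · intro a b
    apply hback
    have h1 := ((hSA.lg c).ex c) a b
    rw [ex_lg hc hx1] at h1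
    have h2 := sub_mem (hSA a b) h1
    rwa [sub_sub_sub_cancel_left, ← map_sub] at h2
  · intro g hg
    apply hback
    have h1 := aeval_sub_mem (fun k => hw₀ (Sum.inr k)) g
    rw [hrelA g hg, zero_sub] at h1
    rwa [← neg_mem_iff]

set_option maxHeartbeats 400000 in
theorem Family.exists_surjective {c : O} (hc : 6 * c = 1) {φ₀ σ₀ : Mat4 O}
    {R : Type u} [CommRing R] [IsLocalRing R] [Algebra O R] {F S : Mat4 R}
    (U : IsUniversalPair q φ₀ σ₀ F S) (he : IsBlock e (φ₀.map (residue O)))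
    (fam : Family O K q Ty e) (hTy : ConjInvariant Ty)
    (s₀ : fam.α → O) (p₀ : fam.κ → O) (hφ : IsCongr (evalMat (Sum.elim s₀ p₀) fam.D) φ₀)
    (hσ : IsCongr (evalMat (Sum.elim s₀ p₀) fam.N) (lg c σ₀)) (hσ₀ : IsCongr (ex c (lg c σ₀)) σ₀)
    {C : Type u} [CommRing C] [IsLocalRing C] [Algebra O C] [IsCNL O C] {p : fam.κ → C}
    (model : IsLocalModel fam.I p₀ p) :
    ∃ f : R →ₐ[O] MvPowerSeries (Off e ⊕ fam.α) C, Function.Surjective f ∧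
      (∀ x : R →ₐ[O] K, IsTypePoint c Ty S x → ∃ y : MvPowerSeries (Off e ⊕ fam.α) C →ₐ[O] K,
        y.comp f = x ∧ ∃ j, y (MvPolynomial.aeval (genPoint e s₀ p) (fam.nd j)) ≠ 0) ∧
      (∀ y : MvPowerSeries (Off e ⊕ fam.α) C →ₐ[O] K,
        (∃ j, y (MvPolynomial.aeval (genPoint e s₀ p) (fam.nd j)) ≠ 0) →
        IsTypePoint c Ty S (y.comp f)) := by
  have hR := U.cnl
  set B := MvPowerSeries (Off e ⊕ fam.α) C with hB
  set Y : Mat4 B := offMat e fam.α C with hYdef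
  set v : fam.α ⊕ fam.κ → B := genPoint e s₀ p with hv
  have hoff : goodPart e 1 Y = 0 := by
    ext i j
    by_cases h : e i = 1 * e j
    · simp only [goodPart, Matrix.of_apply, if_pos h, hYdef, offMat, Matrix.zero_apply]
      rw [dif_neg (not_not.mpr h)]
    · simp only [goodPart, Matrix.of_apply, if_neg h, Matrix.zero_apply]
  have hYm : ∀ i j, Y i j ∈ maximalIdeal B := by
    intro i j
    by_cases h : e i = 1 * e j
    · simp only [hYdef, offMat, Matrix.of_apply]
      rw [dif_neg (not_not.mpr h)]; exact zero_mem _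
    · simp only [hYdef, offMat, Matrix.of_apply]
      rw [dif_pos h]; exact X_mem_maximalIdeal _
  obtain ⟨UB, hUB⟩ := isUnit_one_add hYm
  have hrelB : Satisfies fam.I (fun k => v (Sum.inr k)) :=
    model.rel.map (B := B) ((IsScalarTower.toAlgHom O C B))
  set D := evalMat v fam.D with hD
  set N := evalMat v fam.N with hN
  obtain ⟨hcomm, hnil⟩ := fam.comm v hrelB
  have hvc : ∀ j, v j - algebraMap O B (Sum.elim s₀ p₀ j) ∈ maximalIdeal B := by
    rintro (i | k)
    · have := X_mem_maximalIdeal (C := C) (ι := Off e ⊕ fam.α) (Sum.inr i)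
      rw [← genPoint_inl_sub (e := e) s₀ p i] at this
      exact this
    · simp only [hv, genPoint, Sum.elim_inr]
      have := C_mem_maximalIdeal (ι := Off e ⊕ fam.α) (model.sub_mem k)
      rwa [map_sub, powerSeries_C_algebraMap] at this
  have hDc : IsCongr D φ₀ := IsCongr.trans (fun i j => aeval_sub_mem hvc _) hφ
  have hNc : IsCongr N (lg c σ₀) := IsCongr.trans (fun i j => aeval_sub_mem hvc _) hσ
  have hUc : IsCongr UB.val (1 : Mat4 O) := by
    rw [hUB]; exact isCongr_one_add hYm
  have hUc' : ∀ {M : Mat4 B} {M₀ : Mat4 O}, IsCongr M M₀ → IsCongr (conjHom O UB M) M₀ := by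
    intro M M₀ h
    rw [isCongr_iff_redMat] at *
    rw [map_one, map_one] at hUc
    rw [map_conjHom, h]
    have : Units.map ((redMat B : Mat4 B →ₐ[O] _) : Mat4 B →* Mat4 (ResidueField B)) UB = 1 := by
      ext1; exact hUc
    rw [this, conjHom_apply]; simp
  obtain ⟨f, hf1, hf2⟩ := U.exists_hom B (conjHom O UB D) (conjHom O UB (ex c N)) (hUc' hDc)
    (hUc' ((hNc.ex c).trans hσ₀))
    (by rw [← map_mul, mul_ex_eq hc hnil hcomm, map_mul, map_pow])
  have hdiagB : IsDiagonalisation e (conjHom O UB D) Y D := by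
    refine ⟨hoff, hYm, fun i j h => ?_, ?_⟩
    · rw [hD, evalMat_apply, fam.supp i j h, map_zero]
    · rw [← hUB]
      exact ((conjHom_eq_iff O UB D _).mp rfl).symm
  have hlocal : ∀ {A A' : Type u} [CommRing A] [IsLocalRing A] [Algebra O A] [CommRing A']
      [IsLocalRing A'] [Algebra O A'] [IsCNL O A'] (g : A →ₐ[O] A'),
      ∀ x ∈ maximalIdeal A, g x ∈ maximalIdeal A' :=
    fun g x hx => map_mem_maximalIdeal IsCNL.residue_surjective g hx
  have hunits : ∀ {A A' : Type u} [CommRing A] [Algebra O A] [CommRing A'] [Algebra O A']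
      (g : A →ₐ[O] A') {U₁ : (Mat4 A)ˣ} {U₂ : (Mat4 A')ˣ} {Y₁ : Mat4 A} {Y₂ : Mat4 A'},
      U₁.val = 1 + Y₁ → U₂.val = 1 + Y₂ → Y₁.map g = Y₂ →
      Units.map ((g.mapMatrix : Mat4 A →ₐ[O] Mat4 A') : Mat4 A →* Mat4 A') U₁ = U₂ := by
    intro A A' _ _ _ _ g U₁ U₂ Y₁ Y₂ h1 h2 h3
    ext1
    rw [h2, ← h3, ← map_one_add, ← h1]
    rfl
  refine ⟨f, ?_, ?_, ?_⟩
  · obtain ⟨YR, DR, hdR⟩ := exists_isDiagonalisation he U.congr_frob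
    obtain ⟨UR, hUR⟩ := isUnit_one_add hdR.mem
    have hd' := hdR.map f (hlocal f)
    have hf1' : F.map f = conjHom O UB D := hf1
    rw [hf1'] at hd'
    obtain ⟨hYe, hDe⟩ := hd'.unique he (hUc' hDc) hdiagB
    set NR := conjHom O UR⁻¹ (lg c S) with hNR
    have hNe : f.mapMatrix NR = N := by
      rw [hNR, map_conjHom, map_lg, hf2, map_inv, hunits f hUR hUB hYe, map_ex, lg_ex hc,
        conjHom_inv_conjHom]
      rw [← map_pow, hnil, map_zero]
    have hpt : ∀ j, f (MvPolynomial.aeval (entries DR NR) (fam.co j)) = v j := by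
      intro j
      rw [← fam.co_eval v j, ← AlgHom.comp_apply, MvPolynomial.comp_aeval]
      congr 2
      funext x
      rcases x with x | x
      · change f (DR x.1 x.2) = D x.1 x.2
        rw [← hDe]; rfl
      · change f (NR x.1 x.2) = N x.1 x.2
        rw [← hNe]; rfl
    refine (generates_powerSeries (ι := Off e ⊕ fam.α) model.gen).surjective ?_ f ?_
    · rintro (k | i)
      · exact C_mem_maximalIdeal (model.sub_mem k)
      · exact X_mem_maximalIdeal _
    · rintro (k | ⟨⟨i, j⟩, h⟩ | i)
      · refine ⟨MvPolynomial.aeval (entries DR NR) (fam.co (Sum.inr k)) - algebraMap O R (p₀ k), ?_⟩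
        rw [map_sub, hpt, AlgHom.commutes, Sum.elim_inl, map_sub, powerSeries_C_algebraMap]
        rfl
      · refine ⟨YR i j, ?_⟩
        have := congrFun (congrFun hYe i) j
        rw [Matrix.map_apply] at this
        rw [this, hYdef]
        simp only [offMat, Matrix.of_apply]
        rw [dif_pos h]; rfl
      · refine ⟨MvPolynomial.aeval (entries DR NR) (fam.co (Sum.inl i)) - algebraMap O R (s₀ i), ?_⟩
        rw [map_sub, hpt, AlgHom.commutes, Sum.elim_inr]
        exact genPoint_inl_sub s₀ p i
  · intro x hx
    have hprime : (RingHom.ker x).IsPrime := RingHom.ker_isPrime x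
    have hloc : IsLocalRing (R ⧸ RingHom.ker x) :=
      IsLocalRing.of_surjective' (Ideal.Quotient.mk _) Ideal.Quotient.mk_surjective
    let A := R ⧸ RingHom.ker x
    let π : R →ₐ[O] A := Ideal.Quotient.mkₐ O _
    have hA : IsCNL O A := IsCNL.of_surjective π Ideal.Quotient.mk_surjective
    let i : A →ₐ[O] K := Ideal.kerLiftAlg x
    have hi : Function.Injective i := Ideal.kerLiftAlg_injective x
    have hiπ : i.comp π = x := by ext r; rfl
    have hiM : Function.Injective (i.mapMatrix : Mat4 A →ₐ[O] Mat4 K) := fun M M' h => by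
      ext a b
      exact hi (congrFun (congrFun h a) b)
    have hx1 : (π.mapMatrix S - 1) ^ 4 = 0 := by
      apply hiM
      rw [map_pow, map_sub, map_one, map_zero]
      exact hx.1
    have hFA : IsCongr (π.mapMatrix F) φ₀ := U.congr_frob.map π (hlocal π)
    have hSA : IsCongr (π.mapMatrix S) σ₀ := U.congr_tame.map π (hlocal π)
    obtain ⟨YA, UA, w, hoffA, hmemA, hUA, hDA, hNA', hrelA, hcD, hcN, hTyN⟩ :=
      fam.exists_coords hc he hTy i hi hFA hSA
        (by rw [← map_mul, U.rel, map_mul, map_pow]) hx1 hx.2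
    have hwc : ∀ j, w j - algebraMap O A (Sum.elim s₀ p₀ j) ∈ maximalIdeal A := by
      intro j
      have h1 := aeval_sub_mem (v := entries (evalMat w fam.D) (evalMat w fam.N))
        (v₀ := entries (evalMat (Sum.elim s₀ p₀) fam.D) (evalMat (Sum.elim s₀ p₀) fam.N))
        (by
          rintro (x | x)
          · exact (hcD.trans hφ.symm) x.1 x.2
          · exact (hcN.trans hσ.symm) x.1 x.2) (fam.co j)
      rwa [fam.co_eval, fam.co_eval] at h1
    obtain ⟨g, hg⟩ := model.lift A (fun k => w (Sum.inr k)) hrelA (fun k => hwc (Sum.inr k))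
    obtain ⟨y, hy1, hy2⟩ := exists_powerSeries_lift_over g
      (Sum.elim (fun o : Off e => YA o.1.1 o.1.2)
        fun i => w (Sum.inl i) - algebraMap O A (s₀ i)) (by
        rintro (o | i)
        · exact hmemA _ _
        · exact hwc (Sum.inl i))
    have hyv : ∀ j, y (v j) = w j := by
      rintro (j | k)
      · simp only [hv, genPoint, Sum.elim_inl, map_add, AlgHom.commutes, hy2, Sum.elim_inr]
        ring
      · simp only [hv, genPoint, Sum.elim_inr, hy1, hg]
    have hyY : Y.map y = YA := by
      ext a b
      by_cases h : e a = 1 * e b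
      · have h1 := congrFun (congrFun hoffA a) b
        simp only [goodPart, Matrix.of_apply, if_pos h, Matrix.zero_apply] at h1
        simp only [hYdef, offMat, Matrix.of_apply, Matrix.map_apply]
        rw [dif_neg (not_not.mpr h), h1, map_zero]
      · simp only [hYdef, offMat, Matrix.of_apply, Matrix.map_apply]
        rw [dif_pos h, hy2]; rfl
    have hyU := hunits y hUB hUA hyY
    have hyD : y.mapMatrix D = evalMat w fam.D := by
      rw [hD, map_evalMat]; simp only [hyv]
    have hyN : y.mapMatrix N = evalMat w fam.N := by
      rw [hN, map_evalMat]; simp only [hyv]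
    have hcomp : y.comp f = π := by
      refine U.hom_ext A _ _ ?_ ?_
      · change y.mapMatrix (f.mapMatrix F) = _
        rw [hf1, map_conjHom, hyU, hyD, hDA]
      · change y.mapMatrix (f.mapMatrix S) = _
        rw [hf2, map_conjHom, hyU, map_ex, hyN, map_ex, ← hNA', ex_lg hc hx1]
    refine ⟨i.comp y, ?_, ?_⟩
    · rw [AlgHom.comp_assoc, hcomp, hiπ]
    · obtain ⟨j, hj⟩ := (fam.ty_iff (fun j => i (w j)) (hrelA.map i)).mp hTyN
      refine ⟨j, ?_⟩
      rw [← AlgHom.comp_apply, MvPolynomial.comp_aeval]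
      simpa only [AlgHom.comp_apply, ← hv, hyv] using hj
  · rintro y hy
    have hrel := hrelB.map y
    have hTyN : Ty (y.mapMatrix N) := by
      rw [hN, map_evalMat]
      refine (fam.ty_iff (fun j => y (v j)) hrel).mpr ?_
      obtain ⟨j, hj⟩ := hy
      refine ⟨j, ?_⟩
      rwa [← AlgHom.comp_apply, MvPolynomial.comp_aeval] at hj
    have hn4 : (y.mapMatrix N) ^ 4 = 0 :=
      (map_pow y.mapMatrix N 4).symm.trans ((congrArg y.mapMatrix hnil).trans (map_zero _))
    have h1 : (y.comp f).mapMatrix S = conjHom O (Units.map ((y.mapMatrix : Mat4 B →ₐ[O] Mat4 K) :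
        Mat4 B →* Mat4 K) UB) (ex c (y.mapMatrix N)) := by
      change y.mapMatrix (f.mapMatrix S) = _
      rw [hf2, map_conjHom, map_ex]
    refine ⟨?_, ?_⟩
    · rw [h1, ← map_one (conjHom O _), ← map_sub, ← map_pow, ex_sub_one_pow hn4, map_zero]
    · rw [h1, ← map_lg, lg_ex hc hn4, conjHom_eq_conjHom]
      exact hTy _ _ hTyN

variable [IsDomain O] [IsDiscreteValuationRing O] [Infinite O] [IsAdicComplete (maximalIdeal O) O]

theorem Family.equiv_of_ne_zero (hOK : Function.Injective (algebraMap O K)) {c : O}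
    (hc : 6 * c = 1) {φ₀ σ₀ : Mat4 O}
    {R : Type u} [CommRing R] [IsLocalRing R] [Algebra O R] {F S : Mat4 R}
    (U : IsUniversalPair q φ₀ σ₀ F S) (he : IsBlock e (φ₀.map (residue O)))
    (fam : Family O K q Ty e) (hTy : ConjInvariant Ty)
    (s₀ : fam.α → O) (p₀ : fam.κ → O) (hφ : IsCongr (evalMat (Sum.elim s₀ p₀) fam.D) φ₀)
    (hσ : IsCongr (evalMat (Sum.elim s₀ p₀) fam.N) (lg c σ₀)) (hσ₀ : IsCongr (ex c (lg c σ₀)) σ₀)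
    {C : Type u} [CommRing C] [IsLocalRing C] [Algebra O C] [IsCNL O C] {p : fam.κ → C}
    (model : IsLocalModel fam.I p₀ p) {τ : Type} [Finite τ] (θ : C →ₐ[O] MvPowerSeries τ O)
    (hθ : Function.Injective θ)
    (hnd : (∃ x : R →ₐ[O] K, IsTypePoint c Ty S x) ∨
      ∃ j, MvPolynomial.aeval (genPoint e s₀ p) (fam.nd j) ≠ 0) :
    Nonempty ((R ⧸ pointIdeal c Ty S) ≃ₐ[O] MvPowerSeries (Off e ⊕ fam.α) C) := by
  obtain ⟨f, hf, h1, h2⟩ := fam.exists_surjective hc U he hTy s₀ p₀ hφ hσ hσ₀ model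
  have hnd : ∃ j, MvPolynomial.aeval (genPoint e s₀ p) (fam.nd j) ≠ 0 := by
    rcases hnd with ⟨x, hx⟩ | h
    · obtain ⟨y, -, j, hj⟩ := h1 x hx
      exact ⟨j, fun h => hj (by rw [h, map_zero])⟩
    · exact h
  obtain ⟨j, hj⟩ := hnd
  refine exists_quotient_equiv f hf _ (fun x hx => ?_) fun b hb => ?_
  · obtain ⟨y, hy, -⟩ := h1 x hx
    exact ⟨y, hy⟩
  · have : IsCNL O O := self_isCNL
    obtain ⟨E⟩ := exists_powerSeries_sum_equiv (O := O) (Off e ⊕ fam.α) τ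
    let θ' : MvPowerSeries (Off e ⊕ fam.α) C →ₐ[O] MvPowerSeries (Off e ⊕ fam.α)
      (MvPowerSeries τ O) :=
      { MvPowerSeries.map (θ : C →+* MvPowerSeries τ O) with
        commutes' := fun o => by
          change MvPowerSeries.map (θ : C →+* MvPowerSeries τ O) (algebraMap O _ o) = _
          rw [← powerSeries_C_algebraMap, MvPowerSeries.map_C]
          exact (congrArg MvPowerSeries.C (θ.commutes o)).trans (powerSeries_C_algebraMap o) }
    have hθ' : Function.Injective θ' := by
      intro a b hab
      ext m
      have h3 : MvPowerSeries.coeff m (θ' a) = MvPowerSeries.coeff m (θ' b) := by rw [hab]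
      have h4 : ∀ z, MvPowerSeries.coeff m (θ' z) = θ (MvPowerSeries.coeff m z) := fun z =>
        MvPowerSeries.coeff_map _ _ _
      rw [h4, h4] at h3
      exact hθ h3
    have hne : E (θ' b * θ' (MvPolynomial.aeval (genPoint e s₀ p) (fam.nd j))) ≠ 0 := by
      rw [map_ne_zero_iff _ E.injective]
      exact mul_ne_zero ((map_ne_zero_iff _ hθ').mpr hb) ((map_ne_zero_iff _ hθ').mpr hj)
    obtain ⟨h, hh⟩ := exists_eval_ne_zero hne
    rw [map_mul, map_mul] at hh
    let y : MvPowerSeries (Off e ⊕ fam.α) C →ₐ[O] K :=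
      ((Algebra.ofId O K).comp h).comp ((E : _ →ₐ[O] _).comp θ')
    have hy : ∀ z, y z = algebraMap O K (h (E (θ' z))) := fun z => rfl
    refine ⟨y, ?_, h2 y ⟨j, ?_⟩⟩
    · rw [hy, map_ne_zero_iff _ hOK]; exact left_ne_zero_of_mul hh
    · rw [hy, map_ne_zero_iff _ hOK]; exact right_ne_zero_of_mul hh

end Core

end Families

/-! ### Nilpotent types -/

section Types

variable {K : Type u} [Field K]

/-- The zero matrix. -/
def TyZero (M : Mat4 K) : Prop := M = 0

/-- Matrices of square zero and rank two. -/
def TySquare (M : Mat4 K) : Prop :=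
  M * M = 0 ∧ ∃ i j k l, M i k * M j l - M i l * M j k ≠ 0

/-- Regular nilpotent matrices. -/
def TyRegular (M : Mat4 K) : Prop := M ^ 4 = 0 ∧ M ^ 3 ≠ 0

theorem conjHom_injective {S : Type*} [Ring S] [Algebra K S] (U : Sˣ) :
    Function.Injective (conjHom K U) :=
  Function.LeftInverse.injective (conjHom_inv_conjHom K U)

theorem tyZero_conjInvariant : ConjInvariant (TyZero (K := K)) := fun U M h => by
  rw [TyZero] at *; rw [h, map_zero]

theorem tyRegular_conjInvariant : ConjInvariant (TyRegular (K := K)) := fun U M h => by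
  rw [TyRegular, ← map_pow, ← map_pow, h.1, map_zero]
  exact ⟨rfl, (map_ne_zero_iff _ (conjHom_injective U)).mpr h.2⟩

theorem minor_eq_zero_of_mul {M : Mat4 K} (h : ∀ i j k l, M i k * M j l - M i l * M j k = 0)
    (P Q : Mat4 K) (i j k l : Fin 4) :
    (P * M * Q) i k * (P * M * Q) j l - (P * M * Q) i l * (P * M * Q) j k = 0 := by
  by_cases hM : M = 0
  · simp [hM]
  · obtain ⟨a, b, hab⟩ : ∃ a b, M a b ≠ 0 := by
      by_contra! h'
      exact hM (by ext a b; exact h' a b)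
    have hM' : M = Matrix.vecMulVec (fun c => M c b) (fun d => (M a b)⁻¹ * M a d) := by
      ext c d
      rw [Matrix.vecMulVec_apply, ← mul_assoc, mul_comm (M c b), mul_assoc, eq_inv_mul_iff_mul_eq₀ hab]
      linear_combination h a c b d
    rw [hM', Matrix.mul_vecMulVec, Matrix.vecMulVec_mul]
    simp only [Matrix.vecMulVec_apply]
    ring

theorem tySquare_conjInvariant : ConjInvariant (TySquare (K := K)) := fun U M h => by
  refine ⟨by rw [← map_mul, h.1, map_zero], ?_⟩
  by_contra! h'
  obtain ⟨i, j, k, l, hijkl⟩ := h.2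
  apply hijkl
  have := minor_eq_zero_of_mul h' U⁻¹.val U.val i j k l
  rwa [show U⁻¹.val * (conjHom K U) M * U.val = M from by
    simp [conjHom_apply, ← mul_assoc]] at this

/-- The matrix with the given columns. -/
def ofCols (w : Fin 4 → Fin 4 → K) : Mat4 K := Matrix.of fun i j => w j i

theorem exists_conj_of_cols {M J : Mat4 K} (w : Fin 4 → Fin 4 → K)
    (hw : LinearIndependent K w) (h : M * ofCols w = ofCols w * J) :
    ∃ P : (Mat4 K)ˣ, M = conjHom K P J := by
  have hu : IsUnit (ofCols w) := by
    rw [← Matrix.isUnit_transpose, ← Matrix.linearIndependent_rows_iff_isUnit]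
    exact hw
  obtain ⟨P, hP⟩ := hu
  refine ⟨P, ?_⟩
  rw [eq_comm, conjHom_eq_iff, hP, h]

theorem jordan_square : jordanNilpotent 4 [2, 2] K = !![0, 1, 0, 0; 0, 0, 0, 0; 0, 0, 0, 1; 0, 0, 0, 0] := by
  ext i j; fin_cases i <;> fin_cases j <;> simp [jordanNilpotent]

theorem jordan_regular :
    jordanNilpotent 4 [4] K = !![0, 1, 0, 0; 0, 0, 1, 0; 0, 0, 0, 1; 0, 0, 0, 0] := by
  ext i j; fin_cases i <;> fin_cases j <;> simp [jordanNilpotent]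

theorem jordan_zero : jordanNilpotent 4 [1, 1, 1, 1] K = 0 := by
  ext i j; fin_cases i <;> fin_cases j <;> simp [jordanNilpotent]

theorem tyZero_iff {M : Mat4 K} :
    TyZero M ↔ ∃ P : (Mat4 K)ˣ, M = conjHom K P (jordanNilpotent 4 [1, 1, 1, 1] K) := by
  rw [jordan_zero, TyZero]
  exact ⟨fun h => ⟨1, by rw [h, map_zero]⟩, fun ⟨P, h⟩ => by rw [h, map_zero]⟩

theorem tySquare_iff {M : Mat4 K} :
    TySquare M ↔ ∃ P : (Mat4 K)ˣ, M = conjHom K P (jordanNilpotent 4 [2, 2] K) := by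
  constructor
  · rintro ⟨hM, i, j, k, l, h⟩
    let w : Fin 4 → Fin 4 → K := ![fun a => M a k, Pi.single k 1, fun a => M a l, Pi.single l 1]
    have hMM : ∀ a b, M a 0 * M 0 b + M a 1 * M 1 b + M a 2 * M 2 b + M a 3 * M 3 b = 0 := by
      intro a b
      have := congrFun (congrFun hM a) b
      simpa [Matrix.mul_apply, Fin.sum_univ_four] using this
    have hmul : ∀ (b : Fin 4) (t : Fin 4), M b 0 * (Pi.single t 1 : Fin 4 → K) 0 +
        M b 1 * (Pi.single t 1 : Fin 4 → K) 1 + M b 2 * (Pi.single t 1 : Fin 4 → K) 2 +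
        M b 3 * (Pi.single t 1 : Fin 4 → K) 3 = M b t := by
      intro b t; fin_cases t <;> simp
    refine exists_conj_of_cols w ?_ ?_
    · rw [Fintype.linearIndependent_iff]
      intro g hg
      simp only [Fin.sum_univ_four] at hg
      have h0 : ∀ a, g 0 * M a k + g 1 * (Pi.single k 1 : Fin 4 → K) a + g 2 * M a l +
          g 3 * (Pi.single l 1 : Fin 4 → K) a = 0 := by
        intro a
        have := congrFun hg a
        simpa [w] using this
      have h1 : ∀ b, g 1 * M b k + g 3 * M b l = 0 := by
        intro b
        linear_combination M b 0 * h0 0 + M b 1 * h0 1 + M b 2 * h0 2 + M b 3 * h0 3 -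
          g 0 * hMM b k - g 2 * hMM b l - g 1 * hmul b k - g 3 * hmul b l
      have hg1 : g 1 = 0 := by
        have : g 1 * (M i k * M j l - M i l * M j k) = 0 := by
          linear_combination M j l * h1 i - M i l * h1 j
        exact (mul_eq_zero.mp this).resolve_right h
      have hg3 : g 3 = 0 := by
        have : g 3 * (M i k * M j l - M i l * M j k) = 0 := by
          linear_combination M i k * h1 j - M j k * h1 i
        exact (mul_eq_zero.mp this).resolve_right h
      have h2 : ∀ b, g 0 * M b k + g 2 * M b l = 0 := by
        intro b
        have := h0 b
        rw [hg1, hg3] at this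
        linear_combination this
      have hg0 : g 0 = 0 := by
        have : g 0 * (M i k * M j l - M i l * M j k) = 0 := by
          linear_combination M j l * h2 i - M i l * h2 j
        exact (mul_eq_zero.mp this).resolve_right h
      have hg2 : g 2 = 0 := by
        have : g 2 * (M i k * M j l - M i l * M j k) = 0 := by
          linear_combination M i k * h2 j - M j k * h2 i
        exact (mul_eq_zero.mp this).resolve_right h
      intro t
      fin_cases t
      exacts [hg0, hg1, hg2, hg3]
    · rw [jordan_square]
      ext a b
      have e1 := hMM a k
      have e2 := hMM a l
      fin_cases b
      · simpa [Matrix.mul_apply, Fin.sum_univ_four, ofCols, w] using e1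
      · have := hmul a k
        simp only [Matrix.mul_apply, Fin.sum_univ_four, ofCols, w]
        simpa using this
      · simpa [Matrix.mul_apply, Fin.sum_univ_four, ofCols, w] using e2
      · have := hmul a l
        simp only [Matrix.mul_apply, Fin.sum_univ_four, ofCols, w]
        simpa using this
  · rintro ⟨P, rfl⟩
    refine tySquare_conjInvariant P _ ?_
    rw [jordan_square]
    refine ⟨?_, 0, 2, 1, 3, by simp⟩
    ext i j; fin_cases i <;> fin_cases j <;> simp

theorem tyRegular_iff {M : Mat4 K} :
    TyRegular M ↔ ∃ P : (Mat4 K)ˣ, M = conjHom K P (jordanNilpotent 4 [4] K) := by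
  constructor
  · rintro ⟨hM, h⟩
    obtain ⟨i, k, hik⟩ : ∃ i k, (M ^ 3) i k ≠ 0 := by
      by_contra! h'
      exact h (by ext a b; exact h' a b)
    let w : Fin 4 → Fin 4 → K := fun t a => (M ^ (3 - t.val)) a k
    have hcol : ∀ (m : ℕ) (a : Fin 4), (M ^ (m + 1)) a k = M a 0 * (M ^ m) 0 k +
        M a 1 * (M ^ m) 1 k + M a 2 * (M ^ m) 2 k + M a 3 * (M ^ m) 3 k := by
      intro m a
      rw [pow_succ', Matrix.mul_apply, Fin.sum_univ_four]
    refine exists_conj_of_cols w ?_ ?_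
    · rw [Fintype.linearIndependent_iff]
      intro g hg
      simp only [Fin.sum_univ_four] at hg
      have h0 : ∀ a, g 0 * (M ^ 3) a k + g 1 * (M ^ 2) a k + g 2 * (M ^ 1) a k +
          g 3 * (M ^ 0) a k = 0 := by
        intro a
        have := congrFun hg a
        simpa [w] using this
      have hz : ∀ m a, 4 ≤ m → (M ^ m) a k = 0 := by
        intro m a hm
        rw [pow_eq_zero_of_le hm hM]; rfl
      have hstep : ∀ m0 m1 m2 m3 : ℕ, (∀ a, g 0 * (M ^ m0) a k + g 1 * (M ^ m1) a k +
          g 2 * (M ^ m2) a k + g 3 * (M ^ m3) a k = 0) →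
          ∀ a, g 0 * (M ^ (m0 + 1)) a k + g 1 * (M ^ (m1 + 1)) a k +
          g 2 * (M ^ (m2 + 1)) a k + g 3 * (M ^ (m3 + 1)) a k = 0 := by
        intro m0 m1 m2 m3 h a
        rw [hcol, hcol, hcol, hcol]
        linear_combination M a 0 * h 0 + M a 1 * h 1 + M a 2 * h 2 + M a 3 * h 3
      have h1 := hstep _ _ _ _ h0
      have h2 := hstep _ _ _ _ h1
      have h3 := hstep _ _ _ _ h2
      have hg3 : g 3 = 0 := by
        have := h3 i
        rw [hz (3 + 1 + 1 + 1) i (by norm_num), hz (2 + 1 + 1 + 1) i (by norm_num),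
          hz (1 + 1 + 1 + 1) i (by norm_num)] at this
        simpa [hik] using this
      have hg2 : g 2 = 0 := by
        have := h2 i
        rw [hz (3 + 1 + 1) i (by norm_num), hz (2 + 1 + 1) i (by norm_num), hg3] at this
        simpa [hik] using this
      have hg1 : g 1 = 0 := by
        have := h1 i
        rw [hz (3 + 1) i (by norm_num), hg3, hg2] at this
        simpa [hik] using this
      have hg0 : g 0 = 0 := by
        have := h0 i
        rw [hg3, hg2, hg1] at this
        simpa [hik] using this
      intro t
      fin_cases t
      exacts [hg0, hg1, hg2, hg3]
    · rw [jordan_regular]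
      ext a b
      have e0 := (hcol 3 a).symm
      rw [hM] at e0
      have e1 := (hcol 2 a).symm
      have e2 := (hcol 1 a).symm
      have e3 := (hcol 0 a).symm
      fin_cases b
      · simpa [Matrix.mul_apply, Fin.sum_univ_four, ofCols, w] using e0
      · simpa [Matrix.mul_apply, Fin.sum_univ_four, ofCols, w] using e1
      · simpa [Matrix.mul_apply, Fin.sum_univ_four, ofCols, w] using e2
      · simpa [Matrix.mul_apply, Fin.sum_univ_four, ofCols, w] using e3
  · rintro ⟨P, rfl⟩
    refine tyRegular_conjInvariant P _ ?_
    rw [jordan_regular]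
    refine ⟨?_, fun h => ?_⟩
    · ext i j; fin_cases i <;> fin_cases j <;>
        simp [pow_succ, Matrix.mul_apply, Fin.sum_univ_four]
    · have := congrFun (congrFun h 0) 3
      simp [pow_succ, Matrix.mul_apply, Fin.sum_univ_four] at this

theorem TyZero.smul {M : Mat4 K} (h : TyZero M) (a : K) : TyZero (a • M) := by
  rw [TyZero] at *; rw [h, smul_zero]

theorem TySquare.smul {M : Mat4 K} (h : TySquare M) {a : K} (ha : a ≠ 0) : TySquare (a • M) := by
  obtain ⟨h1, i, j, k, l, h2⟩ := h
  refine ⟨by rw [smul_mul_smul_comm, h1, smul_zero], i, j, k, l, ?_⟩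
  have : (a • M) i k * (a • M) j l - (a • M) i l * (a • M) j k =
      a ^ 2 * (M i k * M j l - M i l * M j k) := by
    simp only [Matrix.smul_apply, smul_eq_mul]; ring
  rw [this]
  exact mul_ne_zero (pow_ne_zero _ ha) h2

theorem TyRegular.smul {M : Mat4 K} (h : TyRegular M) {a : K} (ha : a ≠ 0) : TyRegular (a • M) := by
  refine ⟨by rw [smul_pow, h.1, smul_zero], ?_⟩
  rw [smul_pow]
  exact smul_ne_zero (pow_ne_zero _ ha) h.2

end Types

/-! ### The families of pairs -/

section Labels

variable {k : Type*} [Field k]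

/-- The powers `q, …, q ^ 4` are different from `0` and `1`. -/
def IsBanalIn (k : Type*) [Field k] (q : ℕ) : Prop :=
  (q : k) ≠ 0 ∧ ∀ i, 1 ≤ i → i ≤ 4 → (q : k) ^ i ≠ 1

theorem IsBanalIn.pow_inj {q : ℕ} (h : IsBanalIn k q) {a b : ℕ} (ha : a ≤ 4) (hb : b ≤ 4)
    (hab : (q : k) ^ a = (q : k) ^ b) : a = b := by
  rcases lt_trichotomy a b with hlt | rfl | hlt
  · exfalso
    refine h.2 (b - a) (by omega) (by omega) ?_
    have : (q : k) ^ a * (q : k) ^ (b - a) = (q : k) ^ a * 1 := by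
      rw [← pow_add, mul_one, hab]; congr 1; omega
    exact mul_left_cancel₀ (pow_ne_zero _ h.1) this
  · rfl
  · exfalso
    refine h.2 (a - b) (by omega) (by omega) ?_
    have : (q : k) ^ b * (q : k) ^ (a - b) = (q : k) ^ b * 1 := by
      rw [← pow_add, mul_one, ← hab]; congr 1; omega
    exact mul_left_cancel₀ (pow_ne_zero _ h.1) this

/-- The labels `t q ^ (n i)`. -/
def powLabel (q : ℕ) (t : k) (n : Fin 4 → ℕ) : Fin 4 → k := fun i => t * (q : k) ^ n i

theorem isSupported_powLabel_one {q : ℕ} (h : IsBanalIn k q) {t : k} (ht : t ≠ 0) {n : Fin 4 → ℕ}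
    (hn : ∀ i, n i ≤ 3) {A : Type*} [Zero A] {M : Mat4 A} :
    IsSupported (powLabel q t n) 1 M ↔ ∀ i j, n i ≠ n j → M i j = 0 := by
  refine forall_congr' fun i => forall_congr' fun j => ?_
  have : powLabel q t n i = 1 * powLabel q t n j ↔ n i = n j := by
    rw [one_mul, powLabel, powLabel, mul_right_inj' ht]
    exact ⟨fun e => h.pow_inj ((hn i).trans (by norm_num)) ((hn j).trans (by norm_num)) e,
      fun e => by rw [e]⟩
  rw [ne_eq, this]

theorem isSupported_powLabel {q : ℕ} (h : IsBanalIn k q) {t : k} (ht : t ≠ 0) {n : Fin 4 → ℕ}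
    (hn : ∀ i, n i ≤ 3) {A : Type*} [Zero A] {M : Mat4 A} :
    IsSupported (powLabel q t n) (q : k) M ↔ ∀ i j, n i ≠ n j + 1 → M i j = 0 := by
  refine forall_congr' fun i => forall_congr' fun j => ?_
  have : powLabel q t n i = q * powLabel q t n j ↔ n i = n j + 1 := by
    rw [powLabel, powLabel, mul_left_comm, ← pow_succ', mul_right_inj' ht]
    exact ⟨fun e => h.pow_inj ((hn i).trans (by norm_num)) (Nat.succ_le_succ (hn j)) e,
      fun e => by rw [e]⟩
  rw [ne_eq, this]

end Labels

section Families

variable (O : Type u) [CommRing O] [IsLocalRing O] (K : Type u) [Field K] [Algebra O K]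

theorem natCast_smul_eq {A : Type*} [CommRing A] [Algebra O A] (q : ℕ) (x : A) :
    (q : O) • x = (q : A) * x := by
  rw [Algebra.smul_def, map_natCast]

theorem satisfies_bot {κ : Type} {A : Type u} [CommRing A] [Algebra O A] (p : κ → A) :
    Satisfies (⊥ : Ideal (MvPolynomial κ O)) p := fun g hg => by
  rw [(Submodule.mem_bot _).mp hg, map_zero]

open Classical in
/-- The pairs `(D, 0)`. -/
def familyZero (q : ℕ) (e : Fin 4 → ResidueField O) :
    Family O K q TyZero e where
  α := {p : Fin 4 × Fin 4 // e p.1 = 1 * e p.2}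
  κ := Empty
  J := Unit
  finite_α := inferInstance
  I := ⊥
  D := Matrix.of fun i j => if h : e i = 1 * e j then MvPolynomial.X (Sum.inl ⟨(i, j), h⟩) else 0
  N := 0
  co := Sum.elim (fun p => MvPolynomial.X (Sum.inl p.1)) fun k => k.elim
  nd _ := 1
  supp i j h := by simp only [Matrix.of_apply]; rw [dif_neg h]
  comm v _ := by
    have : evalMat v (0 : Mat4 (MvPolynomial _ O)) = 0 := map_zero _
    rw [this]; simp
  co_eval v j := by
    rcases j with ⟨⟨i, j⟩, h⟩ | k
    · simp only [Sum.elim_inl, MvPolynomial.aeval_X, entries, evalMat_apply, Matrix.of_apply]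
      rw [dif_pos h, MvPolynomial.aeval_X]
    · exact k.elim
  typed D' N' hD _ _ hT := by
    refine ⟨satisfies_bot O _, ?_, ?_⟩
    · ext i j
      rw [evalMat_apply, Matrix.of_apply]
      by_cases h : e i = 1 * e j
      · rw [dif_pos h]; simp [entries]
      · rw [dif_neg h, hD i j h, map_zero]
    · rw [TyZero] at hT
      rw [hT]; exact map_zero _
  ty_iff v _ := by
    have : evalMat v (0 : Mat4 (MvPolynomial _ O)) = 0 := map_zero _
    rw [this]; simp [TyZero]

variable {K} in
theorem minor_eq_zero_of_row {M : Mat4 K} (r : Fin 4) (h : ∀ i k, i ≠ r → M i k = 0)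
    (i j k l : Fin 4) : M i k * M j l - M i l * M j k = 0 := by
  by_cases hi : i = r
  · by_cases hj : j = r
    · rw [hi, hj]; ring
    · rw [h j l hj, h j k hj]; ring
  · rw [h i l hi, h i k hi]; ring

variable {K} in
theorem minor_eq_zero_of_col {M : Mat4 K} (r : Fin 4) (h : ∀ i k, k ≠ r → M i k = 0)
    (i j k l : Fin 4) : M i k * M j l - M i l * M j k = 0 := by
  have := minor_eq_zero_of_row (M := M.transpose) r (fun a b hab => h b a hab) k l i j
  simp only [Matrix.transpose_apply] at this
  linear_combination this

variable {O K} in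
theorem mul_entry {q : ℕ} {D N : Mat4 K} (h : D * N = (q : O) • (N * D)) (i j : Fin 4) :
    D i 0 * N 0 j + D i 1 * N 1 j + D i 2 * N 2 j + D i 3 * N 3 j =
      q * (N i 0 * D 0 j + N i 1 * D 1 j + N i 2 * D 2 j + N i 3 * D 3 j) := by
  have := congrFun (congrFun h i) j
  rwa [Matrix.smul_apply, natCast_smul_eq, Matrix.mul_apply, Matrix.mul_apply, Fin.sum_univ_four,
    Fin.sum_univ_four] at this

theorem evalMat_of {κ : Type} {A : Type u} [CommRing A] [Algebra O A] (v : κ → A)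
    (a b c d e f g h i j k l m n o p : MvPolynomial κ O) :
    evalMat v !![a, b, c, d; e, f, g, h; i, j, k, l; m, n, o, p] =
      !![MvPolynomial.aeval v a, MvPolynomial.aeval v b, MvPolynomial.aeval v c,
        MvPolynomial.aeval v d; MvPolynomial.aeval v e, MvPolynomial.aeval v f,
        MvPolynomial.aeval v g, MvPolynomial.aeval v h; MvPolynomial.aeval v i,
        MvPolynomial.aeval v j, MvPolynomial.aeval v k, MvPolynomial.aeval v l;
        MvPolynomial.aeval v m, MvPolynomial.aeval v n, MvPolynomial.aeval v o,
        MvPolynomial.aeval v p] := by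
  ext i j; fin_cases i <;> fin_cases j <;> rfl

theorem of_mul_of {A : Type u} [CommRing A] (a b c d e f g h i j k l m n o p
    a' b' c' d' e' f' g' h' i' j' k' l' m' n' o' p' : A) :
    (!![a, b, c, d; e, f, g, h; i, j, k, l; m, n, o, p] *
      !![a', b', c', d'; e', f', g', h'; i', j', k', l'; m', n', o', p'] : Mat4 A) =
    !![a * a' + b * e' + c * i' + d * m', a * b' + b * f' + c * j' + d * n',
      a * c' + b * g' + c * k' + d * o', a * d' + b * h' + c * l' + d * p';
      e * a' + f * e' + g * i' + h * m', e * b' + f * f' + g * j' + h * n',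
      e * c' + f * g' + g * k' + h * o', e * d' + f * h' + g * l' + h * p';
      i * a' + j * e' + k * i' + l * m', i * b' + j * f' + k * j' + l * n',
      i * c' + j * g' + k * k' + l * o', i * d' + j * h' + k * l' + l * p';
      m * a' + n * e' + o * i' + p * m', m * b' + n * f' + o * j' + p * n',
      m * c' + n * g' + o * k' + p * o', m * d' + n * h' + o * l' + p * p'] := by
  ext x y
  rw [Matrix.mul_apply, Fin.sum_univ_four]
  fin_cases x <;> fin_cases y <;> rfl

theorem zero_eq_of {A : Type u} [CommRing A] : (0 : Mat4 A) =
    !![0, 0, 0, 0; 0, 0, 0, 0; 0, 0, 0, 0; 0, 0, 0, 0] := by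
  ext i j; fin_cases i <;> fin_cases j <;> rfl

theorem natCast_smul_of {A : Type u} [CommRing A] [Algebra O A] (q : ℕ)
    (a b c d e f g h i j k l m n o p : A) :
    (q : O) • (!![a, b, c, d; e, f, g, h; i, j, k, l; m, n, o, p] : Mat4 A) =
      !![q * a, q * b, q * c, q * d; q * e, q * f, q * g, q * h; q * i, q * j, q * k, q * l;
        q * m, q * n, q * o, q * p] := by
  ext x y
  rw [Matrix.smul_apply, natCast_smul_eq]
  fin_cases x <;> fin_cases y <;> rfl

open MvPolynomial in
/-- The pairs with `N` regular nilpotent. -/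
def familyRegular (q : ℕ) {t : ResidueField O} (hq : IsBanalIn (ResidueField O) q) (ht : t ≠ 0) :
    Family O K q TyRegular (powLabel q t ![3, 2, 1, 0]) where
  α := Fin 4
  κ := Empty
  J := Unit
  finite_α := inferInstance
  I := ⊥
  D := Matrix.diagonal ![(q : MvPolynomial _ O) ^ 3 * X (Sum.inl 0),
    (q : MvPolynomial _ O) ^ 2 * X (Sum.inl 0), (q : MvPolynomial _ O) * X (Sum.inl 0),
    X (Sum.inl 0)]
  N := !![0, X (Sum.inl 1), 0, 0; 0, 0, X (Sum.inl 2), 0; 0, 0, 0, X (Sum.inl 3); 0, 0, 0, 0]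
  co := Sum.elim ![X (Sum.inl (3, 3)), X (Sum.inr (0, 1)), X (Sum.inr (1, 2)), X (Sum.inr (2, 3))]
    fun k => k.elim
  nd _ := X (Sum.inl 1) * X (Sum.inl 2) * X (Sum.inl 3)
  supp := by
    rw [isSupported_powLabel_one hq ht (by decide)]
    intro i j h
    refine Matrix.diagonal_apply_ne _ ?_
    rintro rfl
    exact h rfl
  comm v _ := by
    constructor
    · ext i j
      rw [Matrix.smul_apply, natCast_smul_eq, Matrix.mul_apply, Matrix.mul_apply,
        Fin.sum_univ_four, Fin.sum_univ_four]
      fin_cases i <;> fin_cases j <;> simp [evalMat_apply] <;> ring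
    · ext i j
      fin_cases i <;> fin_cases j <;>
        simp [evalMat_apply, pow_succ, Matrix.mul_apply, Fin.sum_univ_four]
  co_eval v j := by
    rcases j with j | k
    · fin_cases j <;> simp [entries, evalMat_apply]
    · exact k.elim
  typed D' N' hD hN hc hT := by
    rw [isSupported_powLabel_one hq ht (by decide)] at hD
    rw [isSupported_powLabel hq ht (by decide)] at hN
    obtain ⟨n1, n2, n3, rfl⟩ : ∃ n1 n2 n3, N' = !![0, n1, 0, 0; 0, 0, n2, 0; 0, 0, 0, n3; 0, 0, 0, 0] :=
      ⟨N' 0 1, N' 1 2, N' 2 3, by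
        ext i j; fin_cases i <;> fin_cases j <;> first | rfl | exact hN _ _ (by decide)⟩
    obtain ⟨d0, d1, d2, d3, rfl⟩ : ∃ d0 d1 d2 d3, D' =
        !![d0, 0, 0, 0; 0, d1, 0, 0; 0, 0, d2, 0; 0, 0, 0, d3] :=
      ⟨D' 0 0, D' 1 1, D' 2 2, D' 3 3, by
        ext i j; fin_cases i <;> fin_cases j <;> first | rfl | exact hD _ _ (by decide)⟩
    have hne : n1 * n2 * n3 ≠ 0 := by
      intro h0
      apply hT.2
      ext i j
      fin_cases i <;> fin_cases j <;> simp [pow_succ, Matrix.mul_apply, Fin.sum_univ_four]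
      simpa using h0
    have h01 := mul_entry hc 0 1
    have h12 := mul_entry hc 1 2
    have h23 := mul_entry hc 2 3
    simp at h01 h12 h23
    have m1 : n1 ≠ 0 := left_ne_zero_of_mul (left_ne_zero_of_mul hne)
    have m2 : n2 ≠ 0 := right_ne_zero_of_mul (left_ne_zero_of_mul hne)
    have m3 : n3 ≠ 0 := right_ne_zero_of_mul hne
    have e2 : d2 = q * d3 := mul_right_cancel₀ m3 (by linear_combination h23)
    have e1 : d1 = q * d2 := mul_right_cancel₀ m2 (by linear_combination h12)
    have e0 : d0 = q * d1 := mul_right_cancel₀ m1 (by linear_combination h01)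
    refine ⟨satisfies_bot O _, ?_, ?_⟩
    · ext i j
      fin_cases i <;> fin_cases j <;> simp [evalMat_apply, entries, e0, e1, e2] <;> ring
    · ext i j
      fin_cases i <;> fin_cases j <;> simp [evalMat_apply, entries]
  ty_iff v _ := by
    set M := evalMat v (!![0, X (Sum.inl 1), 0, 0; 0, 0, X (Sum.inl 2), 0; 0, 0, 0, X (Sum.inl 3);
      0, 0, 0, 0] : Mat4 (MvPolynomial (Fin 4 ⊕ Empty) O)) with hM
    have h4 : M ^ 4 = 0 := by
      ext i j
      fin_cases i <;> fin_cases j <;>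
        simp [hM, evalMat_apply, pow_succ, Matrix.mul_apply, Fin.sum_univ_four]
    have h3 : M ^ 3 = 0 ↔ v (Sum.inl 1) * v (Sum.inl 2) * v (Sum.inl 3) = 0 := by
      constructor
      · intro h
        have := congrFun (congrFun h 0) 3
        simpa [hM, evalMat_apply, pow_succ, Matrix.mul_apply, Fin.sum_univ_four] using this
      · intro h
        ext i j
        fin_cases i <;> fin_cases j <;>
          simp [hM, evalMat_apply, pow_succ, Matrix.mul_apply, Fin.sum_univ_four]
        simpa using h
    rw [TyRegular, and_iff_right h4, ne_eq, h3]
    simp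

variable {K} in
theorem tySquare_split_iff {x y z : K} (hxy : x * y = 0) (hyz : y * z = 0) :
    TySquare (!![0, x, 0, 0; 0, 0, y, 0; 0, 0, 0, z; 0, 0, 0, 0] : Mat4 K) ↔ x * z ≠ 0 := by
  constructor
  · rintro ⟨-, i, j, k, l, h⟩ h0
    apply h
    by_cases z1 : x = 0
    · rcases mul_eq_zero.mp hyz with z2 | z3
      · refine minor_eq_zero_of_row 2 (fun a b hab => ?_) i j k l
        fin_cases a <;> fin_cases b <;> first | rfl | exact z1 | exact z2 | exact absurd rfl hab
      · refine minor_eq_zero_of_row 1 (fun a b hab => ?_) i j k l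
        fin_cases a <;> fin_cases b <;> first | rfl | exact z1 | exact z3 | exact absurd rfl hab
    · have z2 := (mul_eq_zero.mp hxy).resolve_left z1
      have z3 := (mul_eq_zero.mp h0).resolve_left z1
      refine minor_eq_zero_of_row 0 (fun a b hab => ?_) i j k l
      fin_cases a <;> fin_cases b <;> first | rfl | exact z2 | exact z3 | exact absurd rfl hab
  · intro h
    refine ⟨?_, 0, 2, 1, 3, by simpa using h⟩
    rw [of_mul_of, zero_eq_of]
    simp [hxy, hyz]

open MvPolynomial in
/-- The pairs with `N` of rank two and square zero, and two unrelated eigenvalues. -/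
def familySplit (q : ℕ) {e : Fin 4 → ResidueField O}
    (he1 : ∀ i j, e i = 1 * e j → i = j)
    (he2 : ∀ i j, e i = q * e j → (i, j) = (0, 1) ∨ (i, j) = (2, 3) ∨ (i, j) = (1, 2)) :
    Family O K q TySquare e where
  α := Fin 4
  κ := Empty
  J := Unit
  finite_α := inferInstance
  I := ⊥
  D := !![(q : MvPolynomial (Fin 4 ⊕ Empty) O) * X (Sum.inl 0), 0, 0, 0; 0, X (Sum.inl 0), 0, 0;
    0, 0, (q : MvPolynomial (Fin 4 ⊕ Empty) O) * X (Sum.inl 1), 0; 0, 0, 0, X (Sum.inl 1)]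
  N := !![0, X (Sum.inl 2), 0, 0; 0, 0, 0, 0; 0, 0, 0, X (Sum.inl 3); 0, 0, 0, 0]
  co := Sum.elim ![X (Sum.inl (1, 1)), X (Sum.inl (3, 3)), X (Sum.inr (0, 1)), X (Sum.inr (2, 3))]
    fun k => k.elim
  nd _ := X (Sum.inl 2) * X (Sum.inl 3)
  supp i j h := by
    have h : i ≠ j := by rintro rfl; exact h (by simp)
    fin_cases i <;> fin_cases j <;> first | rfl | exact absurd rfl h
  comm v _ := by
    rw [evalMat_of, evalMat_of]
    constructor
    · rw [of_mul_of, of_mul_of, natCast_smul_of]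
      simp [mul_comm, mul_left_comm, mul_assoc]
    · rw [pow_succ, pow_succ, pow_two, of_mul_of, of_mul_of, of_mul_of, zero_eq_of]
      simp
  co_eval v j := by
    rw [evalMat_of, evalMat_of]
    rcases j with j | k
    · fin_cases j <;> simp [entries]
    · exact k.elim
  typed D' N' hD hN hc hT := by
    replace hD : ∀ i j, i ≠ j → D' i j = 0 := fun i j h => hD i j (fun h' => h (he1 i j h'))
    replace hN : ∀ i j, ¬ ((i, j) = (0, 1) ∨ (i, j) = (2, 3) ∨ (i, j) = (1, 2)) → N' i j = 0 :=
      fun i j h => hN i j (fun h' => h (he2 i j h'))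
    obtain ⟨n1, n2, n3, rfl⟩ : ∃ n1 n2 n3, N' = !![0, n1, 0, 0; 0, 0, n2, 0; 0, 0, 0, n3; 0, 0, 0, 0] :=
      ⟨N' 0 1, N' 1 2, N' 2 3, by
        ext i j; fin_cases i <;> fin_cases j <;> first | rfl | exact hN _ _ (by decide)⟩
    obtain ⟨d0, d1, d2, d3, rfl⟩ : ∃ d0 d1 d2 d3, D' =
        !![d0, 0, 0, 0; 0, d1, 0, 0; 0, 0, d2, 0; 0, 0, 0, d3] :=
      ⟨D' 0 0, D' 1 1, D' 2 2, D' 3 3, by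
        ext i j; fin_cases i <;> fin_cases j <;> first | rfl | exact hD _ _ (by decide)⟩
    have h02 : n1 * n2 = 0 := by
      have := congrFun (congrFun hT.1 0) 2
      rw [of_mul_of] at this
      simpa using this
    have h13 : n2 * n3 = 0 := by
      have := congrFun (congrFun hT.1 1) 3
      rw [of_mul_of] at this
      simpa using this
    have hne := (tySquare_split_iff h02 h13).mp hT
    have m1 : n1 ≠ 0 := left_ne_zero_of_mul hne
    have m3 : n3 ≠ 0 := right_ne_zero_of_mul hne
    obtain rfl : n2 = 0 := (mul_eq_zero.mp h02).resolve_left m1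
    have h01 := mul_entry hc 0 1
    have h23 := mul_entry hc 2 3
    simp at h01 h23
    have e2 : d2 = q * d3 := mul_right_cancel₀ m3 (by linear_combination h23)
    have e0 : d0 = q * d1 := mul_right_cancel₀ m1 (by linear_combination h01)
    refine ⟨satisfies_bot O _, ?_, ?_⟩
    · rw [evalMat_of]
      simp [entries, e0, e2]
    · rw [evalMat_of]
      simp [entries]
  ty_iff v _ := by
    rw [evalMat_of]
    simp only [map_zero, aeval_X, map_mul]
    rw [tySquare_split_iff (mul_zero _) (zero_mul _)]
    simp

variable {O} in
theorem satisfies_ideal22_iff {A : Type u} [CommRing A] [Algebra O A] {p : Fin 10 → A} :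
    Satisfies (ideal22 O) p ↔
      (p 4 * p 0 + p 5 * p 2 = p 0 * p 7 + p 1 * p 9 ∧
      p 4 * p 1 + p 5 * p 3 = p 0 * p 8 - p 1 * p 7) ∧
      (p 6 * p 0 - p 4 * p 2 = p 2 * p 7 + p 3 * p 9 ∧
      p 6 * p 1 - p 4 * p 3 = p 2 * p 8 - p 3 * p 7) ∧
      p 4 ^ 2 + p 5 * p 6 = p 7 ^ 2 + p 8 * p 9 := by
  have h1 : Satisfies (ideal22 O) p ↔ ideal22 O ≤ RingHom.ker (MvPolynomial.aeval (R := O) p) :=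
    Iff.rfl
  rw [h1, ideal22, Ideal.span_le, Set.union_subset_iff, Set.singleton_subset_iff]
  have h2 : ∀ G : Matrix (Fin 2) (Fin 2) (MvPolynomial (Fin 10) O), ({f | ∃ i j, f = G i j} ⊆
      (RingHom.ker (MvPolynomial.aeval (R := O) p) : Set (MvPolynomial (Fin 10) O))) ↔
      (MvPolynomial.aeval p (G 0 0) = 0 ∧ MvPolynomial.aeval p (G 0 1) = 0) ∧
      MvPolynomial.aeval p (G 1 0) = 0 ∧ MvPolynomial.aeval p (G 1 1) = 0 := by
    intro G
    constructor
    · intro h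
      exact ⟨⟨h ⟨0, 0, rfl⟩, h ⟨0, 1, rfl⟩⟩, h ⟨1, 0, rfl⟩, h ⟨1, 1, rfl⟩⟩
    · rintro ⟨⟨a, b⟩, c, d⟩ f ⟨i, j, rfl⟩
      fin_cases i <;> fin_cases j
      exacts [a, b, c, d]
  rw [h2, SetLike.mem_coe, RingHom.mem_ker, and_assoc (b := _ ∧ _)]
  simp only [Matrix.sub_apply, Matrix.mul_apply, Fin.sum_univ_two]
  simp only [Matrix.of_apply, Matrix.cons_val', Matrix.cons_val_zero, Matrix.cons_val_one,
    Matrix.cons_val_fin_one, map_sub, map_add, map_mul, map_neg, map_pow, MvPolynomial.aeval_X,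
    sub_eq_zero]
  refine and_congr (and_congr (by ring_nf) (by ring_nf)) (and_congr (and_congr ?_ ?_) (by ring_nf))
  · constructor <;> intro h <;> linear_combination h
  · constructor <;> intro h <;> linear_combination h

variable {O} in
theorem satisfies_ideal121_iff {A : Type u} [CommRing A] [Algebra O A] {p : Fin 8 → A} :
    Satisfies (ideal121 O) p ↔
      ((p 0 * p 5 + p 1 * p 7 = p 4 * p 0 ∧ p 0 * p 6 - p 1 * p 5 = p 4 * p 1) ∧
      p 5 * p 2 + p 6 * p 3 = - (p 4 * p 2) ∧ p 7 * p 2 - p 5 * p 3 = - (p 4 * p 3)) ∧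
      p 0 * p 2 + p 1 * p 3 = 0 ∧ p 4 ^ 2 = p 5 ^ 2 + p 6 * p 7 := by
  have h1 : Satisfies (ideal121 O) p ↔ ideal121 O ≤ RingHom.ker (MvPolynomial.aeval (R := O) p) :=
    Iff.rfl
  rw [h1, ideal121, Ideal.span_le, Set.union_subset_iff, Set.union_subset_iff,
    Set.insert_subset_iff, Set.singleton_subset_iff]
  have h2 : ∀ G : Matrix (Fin 1) (Fin 2) (MvPolynomial (Fin 8) O), ({f | ∃ i j, f = G i j} ⊆
      (RingHom.ker (MvPolynomial.aeval (R := O) p) : Set (MvPolynomial (Fin 8) O))) ↔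
      (MvPolynomial.aeval p (G 0 0) = 0 ∧ MvPolynomial.aeval p (G 0 1) = 0) := by
    intro G
    constructor
    · intro h
      exact ⟨h ⟨0, 0, rfl⟩, h ⟨0, 1, rfl⟩⟩
    · rintro ⟨a, b⟩ f ⟨i, j, rfl⟩
      fin_cases i; fin_cases j
      exacts [a, b]
  have h3 : ∀ G : Matrix (Fin 2) (Fin 1) (MvPolynomial (Fin 8) O), ({f | ∃ i j, f = G i j} ⊆
      (RingHom.ker (MvPolynomial.aeval (R := O) p) : Set (MvPolynomial (Fin 8) O))) ↔
      (MvPolynomial.aeval p (G 0 0) = 0 ∧ MvPolynomial.aeval p (G 1 0) = 0) := by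
    intro G
    constructor
    · intro h
      exact ⟨h ⟨0, 0, rfl⟩, h ⟨1, 0, rfl⟩⟩
    · rintro ⟨a, b⟩ f ⟨i, j, rfl⟩
      fin_cases j; fin_cases i
      exacts [a, b]
  rw [h2, h3, SetLike.mem_coe, RingHom.mem_ker, SetLike.mem_coe, RingHom.mem_ker]
  simp only [Matrix.sub_apply, Matrix.add_apply, Matrix.smul_apply, Matrix.mul_apply,
    Fin.sum_univ_two, smul_eq_mul]
  simp only [Matrix.of_apply, Matrix.cons_val', Matrix.cons_val_zero, Matrix.cons_val_one,
    Matrix.cons_val_fin_one, map_sub, map_add, map_mul, map_neg, map_pow, MvPolynomial.aeval_X,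
    sub_eq_zero]
  refine and_congr (and_congr (and_congr Iff.rfl ?_) (and_congr ?_ ?_)) Iff.rfl <;>
    constructor <;> intro h <;> linear_combination h

end Families

section ConeFamilies

variable (O : Type u) [CommRing O] [IsLocalRing O] (K : Type u) [Field K] [Algebra O K]

variable {K} in
theorem tySquare_22_iff {a b c d : K} :
    TySquare (!![0, 0, a, b; 0, 0, c, d; 0, 0, 0, 0; 0, 0, 0, 0] : Mat4 K) ↔ a * d - b * c ≠ 0 := by
  constructor
  · rintro ⟨-, i, j, k, l, h⟩ h0
    apply h
    by_cases ha : a = 0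
    · rw [ha, zero_mul, zero_sub, neg_eq_zero, mul_eq_zero] at h0
      rcases h0 with hb | hc
      · refine minor_eq_zero_of_row 1 (fun x y hab => ?_) i j k l
        fin_cases x <;> fin_cases y <;> first | rfl | exact ha | exact hb | exact absurd rfl hab
      · refine minor_eq_zero_of_col 3 (fun x y hab => ?_) i j k l
        fin_cases x <;> fin_cases y <;> first | rfl | exact ha | exact hc | exact absurd rfl hab
    · have hd : d = c / a * b := by
        field_simp
        linear_combination h0
      have key : ∀ x y, (!![0, 0, a, b; 0, 0, c, d; 0, 0, 0, 0; 0, 0, 0, 0] : Mat4 K) x y =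
          (![1, c / a, 0, 0] : Fin 4 → K) x * (![0, 0, a, b] : Fin 4 → K) y := by
        intro x y
        fin_cases x <;> fin_cases y <;> simp [ha, hd]
      rw [key, key, key, key]
      ring
  · intro h
    refine ⟨?_, 0, 1, 2, 3, by simpa using h⟩
    rw [of_mul_of, zero_eq_of]
    simp

variable {K} in
theorem tySquare_121_iff {a b c d : K} (h0 : a * c + b * d = 0) :
    TySquare (!![0, a, b, 0; 0, 0, 0, c; 0, 0, 0, d; 0, 0, 0, 0] : Mat4 K) ↔
      a * c ≠ 0 ∨ a * d ≠ 0 ∨ b * c ≠ 0 ∨ b * d ≠ 0 := by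
  constructor
  · rintro ⟨-, i, j, k, l, h⟩
    by_contra! hz
    obtain ⟨h1, h2, h3, h4⟩ := hz
    apply h
    by_cases ha : a = 0
    · by_cases hb : b = 0
      · refine minor_eq_zero_of_col 3 (fun x y hab => ?_) i j k l
        fin_cases x <;> fin_cases y <;> first | rfl | exact ha | exact hb | exact absurd rfl hab
      · have hc := (mul_eq_zero.mp h3).resolve_left hb
        have hd := (mul_eq_zero.mp h4).resolve_left hb
        refine minor_eq_zero_of_row 0 (fun x y hab => ?_) i j k l
        fin_cases x <;> fin_cases y <;> first | rfl | exact hc | exact hd | exact absurd rfl hab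
    · have hc := (mul_eq_zero.mp h1).resolve_left ha
      have hd := (mul_eq_zero.mp h2).resolve_left ha
      refine minor_eq_zero_of_row 0 (fun x y hab => ?_) i j k l
      fin_cases x <;> fin_cases y <;> first | rfl | exact hc | exact hd | exact absurd rfl hab
  · intro h
    refine ⟨?_, ?_⟩
    · rw [of_mul_of, zero_eq_of]
      simp [h0]
    · rcases h with h | h | h | h
      · exact ⟨0, 1, 1, 3, by simpa using h⟩
      · exact ⟨0, 2, 1, 3, by simpa using h⟩
      · exact ⟨0, 1, 2, 3, by simpa using h⟩
      · exact ⟨0, 2, 2, 3, by simpa using h⟩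

open MvPolynomial in
/-- The pairs near the eigenvalues `t q, t q, t, t`, with `N` in the closure of rank two and square
zero. -/
def family22 (q : ℕ) {t : ResidueField O} (hq : IsBanalIn (ResidueField O) q) (ht : t ≠ 0)
    {r c : O} (hr : q * r = 1) (hc : 6 * c = 1) :
    Family O K q TySquare (powLabel q t ![1, 1, 0, 0]) where
  α := Fin 1
  κ := Fin 10
  J := Unit
  finite_α := inferInstance
  I := ideal22 O
  D := !![(q : MvPolynomial (Fin 1 ⊕ Fin 10) O) * (X (Sum.inl 0) + X (Sum.inr 4)),
      (q : MvPolynomial (Fin 1 ⊕ Fin 10) O) * X (Sum.inr 5), 0, 0;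
    (q : MvPolynomial (Fin 1 ⊕ Fin 10) O) * X (Sum.inr 6),
      (q : MvPolynomial (Fin 1 ⊕ Fin 10) O) * (X (Sum.inl 0) - X (Sum.inr 4)), 0, 0;
    0, 0, X (Sum.inl 0) + X (Sum.inr 7), X (Sum.inr 8);
    0, 0, X (Sum.inr 9), X (Sum.inl 0) - X (Sum.inr 7)]
  N := !![0, 0, X (Sum.inr 0), X (Sum.inr 1); 0, 0, X (Sum.inr 2), X (Sum.inr 3); 0, 0, 0, 0;
    0, 0, 0, 0]
  co := Sum.elim ![3 * C c * (X (Sum.inl (2, 2)) + X (Sum.inl (3, 3)))]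
    ![X (Sum.inr (0, 2)), X (Sum.inr (0, 3)), X (Sum.inr (1, 2)), X (Sum.inr (1, 3)),
      C r * X (Sum.inl (0, 0)) - 3 * C c * (X (Sum.inl (2, 2)) + X (Sum.inl (3, 3))),
      C r * X (Sum.inl (0, 1)), C r * X (Sum.inl (1, 0)),
      X (Sum.inl (2, 2)) - 3 * C c * (X (Sum.inl (2, 2)) + X (Sum.inl (3, 3))),
      X (Sum.inl (2, 3)), X (Sum.inl (3, 2))]
  nd _ := X (Sum.inr 0) * X (Sum.inr 3) - X (Sum.inr 1) * X (Sum.inr 2)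
  supp := by
    rw [isSupported_powLabel_one hq ht (by decide)]
    intro i j h
    fin_cases i <;> fin_cases j <;> first | rfl | exact absurd rfl h
  comm {A} _ _ v hv := by
    rw [satisfies_ideal22_iff] at hv
    obtain ⟨⟨h1, h2⟩, ⟨h3, h4⟩, -⟩ := hv
    rw [evalMat_of, evalMat_of]
    simp only [map_zero, map_mul, map_add, map_sub, map_natCast, aeval_X]
    constructor
    · rw [of_mul_of, of_mul_of, natCast_smul_of]
      simp
      refine ⟨⟨?_, ?_⟩, ?_, ?_⟩
      · linear_combination (q : A) * h1
      · linear_combination (q : A) * h2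
      · linear_combination (q : A) * h3
      · linear_combination (q : A) * h4
    · rw [pow_succ, pow_succ, pow_two, of_mul_of, of_mul_of, of_mul_of, zero_eq_of]
      simp
  co_eval {A} _ _ v j := by
    have hrA : (q : A) * algebraMap O A r = 1 := by
      rw [← map_natCast (algebraMap O A), ← map_mul, hr, map_one]
    have hcA : 6 * algebraMap O A c = 1 := by
      rw [← map_ofNat (algebraMap O A) 6, ← map_mul, hc, map_one]
    rw [evalMat_of, evalMat_of]
    rcases j with j | j
    · fin_cases j
      simp [entries]
      linear_combination v (Sum.inl 0) * hcA
    · fin_cases j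
      · simp [entries]
      · simp [entries]
      · simp [entries]
      · simp [entries]
      · simp [entries]
        linear_combination (v (Sum.inl 0) + v (Sum.inr 4)) * hrA - v (Sum.inl 0) * hcA
      · simp [entries]
        linear_combination v (Sum.inr 5) * hrA
      · simp [entries]
        linear_combination v (Sum.inr 6) * hrA
      · simp [entries]
        linear_combination - v (Sum.inl 0) * hcA
      · simp [entries]
      · simp [entries]
  typed D' N' hD hN hcm hT := by
    rw [isSupported_powLabel_one hq ht (by decide)] at hD
    rw [isSupported_powLabel hq ht (by decide)] at hN
    obtain ⟨n1, n2, n3, n4, rfl⟩ : ∃ n1 n2 n3 n4, N' =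
        !![0, 0, n1, n2; 0, 0, n3, n4; 0, 0, 0, 0; 0, 0, 0, 0] :=
      ⟨N' 0 2, N' 0 3, N' 1 2, N' 1 3, by
        ext i j; fin_cases i <;> fin_cases j <;> first | rfl | exact hN _ _ (by decide)⟩
    obtain ⟨a, b, a', b', x, y, z, w, rfl⟩ : ∃ a b a' b' x y z w, D' =
        !![a, b, 0, 0; a', b', 0, 0; 0, 0, x, y; 0, 0, z, w] :=
      ⟨D' 0 0, D' 0 1, D' 1 0, D' 1 1, D' 2 2, D' 2 3, D' 3 2, D' 3 3, by
        ext i j; fin_cases i <;> fin_cases j <;> first | rfl | exact hD _ _ (by decide)⟩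
    clear hD hN
    have hδ := tySquare_22_iff.mp hT
    have h02 := mul_entry hcm 0 2
    have h03 := mul_entry hcm 0 3
    have h12 := mul_entry hcm 1 2
    have h13 := mul_entry hcm 1 3
    simp at h02 h03 h12 h13
    clear hcm hT
    have hrA : (q : K) * algebraMap O K r = 1 := by
      rw [← map_natCast (algebraMap O K), ← map_mul, hr, map_one]
    have hcA : 6 * algebraMap O K c = 1 := by
      rw [← map_ofNat (algebraMap O K) 6, ← map_mul, hc, map_one]
    have hv : (fun j => aeval (entries (!![a, b, 0, 0; a', b', 0, 0; 0, 0, x, y; 0, 0, z, w] : Mat4 K)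
        !![0, 0, n1, n2; 0, 0, n3, n4; 0, 0, 0, 0; 0, 0, 0, 0]) ((Sum.elim
        ![3 * C c * (X (Sum.inl (2, 2)) + X (Sum.inl (3, 3)))]
        ![X (Sum.inr (0, 2)), X (Sum.inr (0, 3)), X (Sum.inr (1, 2)), X (Sum.inr (1, 3)),
        C r * X (Sum.inl (0, 0)) - 3 * C c * (X (Sum.inl (2, 2)) + X (Sum.inl (3, 3))),
        C r * X (Sum.inl (0, 1)), C r * X (Sum.inl (1, 0)),
        X (Sum.inl (2, 2)) - 3 * C c * (X (Sum.inl (2, 2)) + X (Sum.inl (3, 3))),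
        X (Sum.inl (2, 3)), X (Sum.inl (3, 2))] : Fin 1 ⊕ Fin 10 → MvPolynomial _ O) j)) =
        Sum.elim ![3 * algebraMap O K c * (x + w)] ![n1, n2, n3, n4,
          algebraMap O K r * a - 3 * algebraMap O K c * (x + w), algebraMap O K r * b,
          algebraMap O K r * a', x - 3 * algebraMap O K c * (x + w), y, z] := by
      funext j
      rcases j with j | j
      · fin_cases j
        simp [entries]
      · fin_cases j <;> simp [entries]
    rw [hv]
    have hv' : (fun k => aeval (entries (!![a, b, 0, 0; a', b', 0, 0; 0, 0, x, y; 0, 0, z, w] : Mat4 K)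
        !![0, 0, n1, n2; 0, 0, n3, n4; 0, 0, 0, 0; 0, 0, 0, 0]) ((Sum.elim
        ![3 * C c * (X (Sum.inl (2, 2)) + X (Sum.inl (3, 3)))]
        ![X (Sum.inr (0, 2)), X (Sum.inr (0, 3)), X (Sum.inr (1, 2)), X (Sum.inr (1, 3)),
        C r * X (Sum.inl (0, 0)) - 3 * C c * (X (Sum.inl (2, 2)) + X (Sum.inl (3, 3))),
        C r * X (Sum.inl (0, 1)), C r * X (Sum.inl (1, 0)),
        X (Sum.inl (2, 2)) - 3 * C c * (X (Sum.inl (2, 2)) + X (Sum.inl (3, 3))),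
        X (Sum.inl (2, 3)), X (Sum.inl (3, 2))] : Fin 1 ⊕ Fin 10 → MvPolynomial _ O) (Sum.inr k))) =
        _ := congrArg (fun f => f ∘ Sum.inr) hv
    rw [hv', satisfies_ideal22_iff, evalMat_of, evalMat_of]
    clear hv hv'
    generalize algebraMap O K r = r at *
    generalize algebraMap O K c = c at *
    have htr : a + b' = q * (x + w) := by
      refine mul_right_cancel₀ hδ ?_
      linear_combination n4 * h02 - n3 * h03 + n1 * h13 - n2 * h12
    have hdet : a * b' - b * a' = q ^ 2 * (x * w - y * z) := by
      refine mul_right_cancel₀ hδ ?_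
      linear_combination (a' * n2 + b' * n4) * h02 + (q * (n1 * x + n2 * z)) * h13 -
        (a' * n1 + b' * n3) * h03 - q * (n1 * y + n2 * w) * h12
    refine ⟨?_, ?_, ?_⟩
    · simp only [Function.comp_apply, Sum.elim_inr]
      simp
      refine ⟨⟨?_, ?_⟩, ⟨?_, ?_⟩, ?_⟩
      · linear_combination r * h02 + (n1 * x + n2 * z) * hrA
      · linear_combination r * h03 + (n1 * y + n2 * w) * hrA - n2 * (x + w) * hcA
      · linear_combination r * h12 + (n3 * x + n4 * z) * hrA - r * n3 * htr -
          n3 * (x + w) * hrA + n3 * (x + w) * hcA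
      · linear_combination r * h13 + (n3 * y + n4 * w) * hrA - r * n4 * htr - n4 * (x + w) * hrA
      · have hs1 : r * a - 3 * c * (x + w) = -(r * b' - 3 * c * (x + w)) := by
          linear_combination r * htr + (x + w) * hrA - (x + w) * hcA
        have hs2 : x - 3 * c * (x + w) = -(w - 3 * c * (x + w)) := by
          linear_combination -(x + w) * hcA
        have hd : r ^ 2 * (a * b' - b * a') = x * w - y * z := by
          linear_combination r ^ 2 * hdet + (q * r + 1) * (x * w - y * z) * hrA
        have ht : r * (a + b') = x + w := by linear_combination r * htr + (x + w) * hrA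
        linear_combination (r * a - 3 * c * (x + w)) * hs1 - (x - 3 * c * (x + w)) * hs2 - hd +
          3 * c * (x + w) * ht
    · simp
      refine ⟨⟨?_, ?_⟩, ⟨?_, ?_⟩, ?_⟩
      · linear_combination a * hrA
      · linear_combination b * hrA
      · linear_combination a' * hrA
      · linear_combination q * (x + w) * hcA - a * hrA - htr
      · linear_combination (x + w) * hcA
    · simp
  ty_iff v _ := by
    rw [evalMat_of]
    simp only [map_zero, aeval_X, map_mul, map_sub]
    rw [tySquare_22_iff]
    simp

open MvPolynomial in
/-- The pairs near the eigenvalues `t q ^ 2, t q, t q, t`, with `N` in the closure of rank two and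
square zero. -/
def family121 (q : ℕ) {t : ResidueField O} (hq : IsBanalIn (ResidueField O) q) (ht : t ≠ 0)
    {r c : O} (hr : q * r = 1) (hc : 6 * c = 1) :
    Family O K q TySquare (powLabel q t ![2, 1, 1, 0]) where
  α := Fin 1
  κ := Fin 8
  J := Fin 4
  finite_α := inferInstance
  I := ideal121 O
  D := !![(q : MvPolynomial (Fin 1 ⊕ Fin 8) O) ^ 2 * (X (Sum.inl 0) + X (Sum.inr 4)), 0, 0, 0;
    0, (q : MvPolynomial (Fin 1 ⊕ Fin 8) O) * (X (Sum.inl 0) + X (Sum.inr 5)),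
      (q : MvPolynomial (Fin 1 ⊕ Fin 8) O) * X (Sum.inr 6), 0;
    0, (q : MvPolynomial (Fin 1 ⊕ Fin 8) O) * X (Sum.inr 7),
      (q : MvPolynomial (Fin 1 ⊕ Fin 8) O) * (X (Sum.inl 0) - X (Sum.inr 5)), 0;
    0, 0, 0, X (Sum.inl 0) - X (Sum.inr 4)]
  N := !![0, X (Sum.inr 0), X (Sum.inr 1), 0; 0, 0, 0, X (Sum.inr 2); 0, 0, 0, X (Sum.inr 3);
    0, 0, 0, 0]
  co := (Sum.elim
        ![3 * C c * C r * (X (Sum.inl (1, 1)) + X (Sum.inl (2, 2)))]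
        ![X (Sum.inr (0, 1)), X (Sum.inr (0, 2)), X (Sum.inr (1, 3)), X (Sum.inr (2, 3)),
        C r ^ 2 * X (Sum.inl (0, 0)) - 3 * C c * C r * (X (Sum.inl (1, 1)) + X (Sum.inl (2, 2))),
        C r * X (Sum.inl (1, 1)) - 3 * C c * C r * (X (Sum.inl (1, 1)) + X (Sum.inl (2, 2))),
        C r * X (Sum.inl (1, 2)), C r * X (Sum.inl (2, 1))] : Fin 1 ⊕ Fin 8 → MvPolynomial _ O)
  nd := ![X (Sum.inr 0) * X (Sum.inr 2), X (Sum.inr 0) * X (Sum.inr 3),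
    X (Sum.inr 1) * X (Sum.inr 2), X (Sum.inr 1) * X (Sum.inr 3)]
  supp := by
    rw [isSupported_powLabel_one hq ht (by decide)]
    intro i j h
    fin_cases i <;> fin_cases j <;> first | rfl | exact absurd rfl h
  comm {A} _ _ v hv := by
    rw [satisfies_ideal121_iff] at hv
    obtain ⟨⟨⟨h1, h2⟩, h3, h4⟩, h5, -⟩ := hv
    rw [evalMat_of, evalMat_of]
    simp only [map_zero, map_mul, map_add, map_sub, map_pow, map_natCast, aeval_X]
    constructor
    · rw [of_mul_of, of_mul_of, natCast_smul_of]
      simp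
      refine ⟨⟨?_, ?_⟩, ?_, ?_⟩
      · linear_combination -(q : A) ^ 2 * h1
      · linear_combination -(q : A) ^ 2 * h2
      · linear_combination (q : A) * h3
      · linear_combination (q : A) * h4
    · rw [pow_succ, pow_succ, pow_two, of_mul_of, of_mul_of, of_mul_of, zero_eq_of]
      simp
  co_eval {A} _ _ v j := by
    have hrA : (q : A) * algebraMap O A r = 1 := by
      rw [← map_natCast (algebraMap O A), ← map_mul, hr, map_one]
    have hcA : 6 * algebraMap O A c = 1 := by
      rw [← map_ofNat (algebraMap O A) 6, ← map_mul, hc, map_one]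
    rw [evalMat_of, evalMat_of]
    rcases j with j | j
    · fin_cases j
      simp [entries]
      linear_combination (v (Sum.inl 0)) * hcA +
        6 * algebraMap O A c * v (Sum.inl 0) * hrA
    · fin_cases j
      · simp [entries]
      · simp [entries]
      · simp [entries]
      · simp [entries]
      · simp [entries]
        linear_combination (q * algebraMap O A r + 1) * (v (Sum.inl 0) + v (Sum.inr 4)) * hrA -
          (v (Sum.inl 0)) * hcA - 6 * algebraMap O A c * v (Sum.inl 0) * hrA
      · simp [entries]
        linear_combination (v (Sum.inl 0) + v (Sum.inr 5)) * hrA -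
          (v (Sum.inl 0)) * hcA - 6 * algebraMap O A c * v (Sum.inl 0) * hrA
      · simp [entries]
        linear_combination v (Sum.inr 6) * hrA
      · simp [entries]
        linear_combination v (Sum.inr 7) * hrA
  typed D' N' hD hN hcm hT := by
    rw [isSupported_powLabel_one hq ht (by decide)] at hD
    rw [isSupported_powLabel hq ht (by decide)] at hN
    obtain ⟨n1, n2, n3, n4, rfl⟩ : ∃ n1 n2 n3 n4, N' =
        !![0, n1, n2, 0; 0, 0, 0, n3; 0, 0, 0, n4; 0, 0, 0, 0] :=
      ⟨N' 0 1, N' 0 2, N' 1 3, N' 2 3, by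
        ext i j; fin_cases i <;> fin_cases j <;> first | rfl | exact hN _ _ (by decide)⟩
    obtain ⟨d0, x, y, z, w, d3, rfl⟩ : ∃ d0 x y z w d3, D' =
        !![d0, 0, 0, 0; 0, x, y, 0; 0, z, w, 0; 0, 0, 0, d3] :=
      ⟨D' 0 0, D' 1 1, D' 1 2, D' 2 1, D' 2 2, D' 3 3, by
        ext i j; fin_cases i <;> fin_cases j <;> first | rfl | exact hD _ _ (by decide)⟩
    clear hD hN
    have hn : n1 * n3 + n2 * n4 = 0 := by
      have := congrFun (congrFun hT.1 0) 3
      rw [of_mul_of] at this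
      simpa using this
    have hδ := (tySquare_121_iff hn).mp hT
    have h01 := mul_entry hcm 0 1
    have h02 := mul_entry hcm 0 2
    have h13 := mul_entry hcm 1 3
    have h23 := mul_entry hcm 2 3
    simp at h01 h02 h13 h23
    clear hcm hT
    have hrA : (q : K) * algebraMap O K r = 1 := by
      rw [← map_natCast (algebraMap O K), ← map_mul, hr, map_one]
    have hcA : 6 * algebraMap O K c = 1 := by
      rw [← map_ofNat (algebraMap O K) 6, ← map_mul, hc, map_one]
    have hv : (fun j => aeval (entries (!![d0, 0, 0, 0; 0, x, y, 0; 0, z, w, 0; 0, 0, 0, d3] : Mat4 K)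
        !![0, n1, n2, 0; 0, 0, 0, n3; 0, 0, 0, n4; 0, 0, 0, 0]) ((Sum.elim
        ![3 * C c * C r * (X (Sum.inl (1, 1)) + X (Sum.inl (2, 2)))]
        ![X (Sum.inr (0, 1)), X (Sum.inr (0, 2)), X (Sum.inr (1, 3)), X (Sum.inr (2, 3)),
        C r ^ 2 * X (Sum.inl (0, 0)) - 3 * C c * C r * (X (Sum.inl (1, 1)) + X (Sum.inl (2, 2))),
        C r * X (Sum.inl (1, 1)) - 3 * C c * C r * (X (Sum.inl (1, 1)) + X (Sum.inl (2, 2))),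
        C r * X (Sum.inl (1, 2)), C r * X (Sum.inl (2, 1))] : Fin 1 ⊕ Fin 8 → MvPolynomial _ O) j)) =
        Sum.elim ![3 * algebraMap O K c * algebraMap O K r * (x + w)] ![n1, n2, n3, n4,
          algebraMap O K r ^ 2 * d0 - 3 * algebraMap O K c * algebraMap O K r * (x + w),
          algebraMap O K r * x - 3 * algebraMap O K c * algebraMap O K r * (x + w),
          algebraMap O K r * y, algebraMap O K r * z] := by
      funext j
      rcases j with j | j
      · fin_cases j
        simp [entries]
      · fin_cases j <;> simp [entries]
    rw [hv]
    have hv' : (fun k => aeval (entries (!![d0, 0, 0, 0; 0, x, y, 0; 0, z, w, 0; 0, 0, 0, d3] : Mat4 K)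
        !![0, n1, n2, 0; 0, 0, 0, n3; 0, 0, 0, n4; 0, 0, 0, 0]) ((Sum.elim
        ![3 * C c * C r * (X (Sum.inl (1, 1)) + X (Sum.inl (2, 2)))]
        ![X (Sum.inr (0, 1)), X (Sum.inr (0, 2)), X (Sum.inr (1, 3)), X (Sum.inr (2, 3)),
        C r ^ 2 * X (Sum.inl (0, 0)) - 3 * C c * C r * (X (Sum.inl (1, 1)) + X (Sum.inl (2, 2))),
        C r * X (Sum.inl (1, 1)) - 3 * C c * C r * (X (Sum.inl (1, 1)) + X (Sum.inl (2, 2))),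
        C r * X (Sum.inl (1, 2)), C r * X (Sum.inl (2, 1))] : Fin 1 ⊕ Fin 8 → MvPolynomial _ O) (Sum.inr k))) =
        _ := congrArg (fun f => f ∘ Sum.inr) hv
    rw [hv', satisfies_ideal121_iff, evalMat_of, evalMat_of]
    clear hv hv'
    generalize algebraMap O K r = r at *
    generalize algebraMap O K c = c at *
    obtain ⟨m, hm, hm3, hm4⟩ : ∃ m : K, m ≠ 0 ∧ n3 = -m * n2 ∧ n4 = m * n1 := by
      by_cases h1 : n1 = 0
      · have h2 : n2 ≠ 0 := by rintro rfl; simp [h1] at hδ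
        have h4 : n4 = 0 := by
          rw [h1, zero_mul, zero_add] at hn
          exact (mul_eq_zero.mp hn).resolve_left h2
        refine ⟨-n3 / n2, ?_, by field_simp, by rw [h1, h4, mul_zero]⟩
        rintro h0
        have h3 : n3 = 0 := by
          rcases div_eq_zero_iff.mp h0 with h | h
          · exact neg_eq_zero.mp h
          · exact absurd h h2
        simp [h1, h3, h4] at hδ
      · refine ⟨n4 / n1, ?_, ?_, by field_simp⟩
        · rintro h0
          have h4 : n4 = 0 := (div_eq_zero_iff.mp h0).resolve_right h1
          rw [h4, mul_zero, add_zero] at hn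
          have h3 := (mul_eq_zero.mp hn).resolve_left h1
          simp [h3, h4] at hδ
        · field_simp
          linear_combination hn
    have h13' : -x * n2 + y * n1 = -(q * n2 * d3) := by
      refine mul_left_cancel₀ hm ?_
      rw [hm3, hm4] at h13
      linear_combination h13
    have h23' : -z * n2 + w * n1 = q * n1 * d3 := by
      refine mul_left_cancel₀ hm ?_
      rw [hm3, hm4] at h23
      linear_combination h23
    have hor : n1 ≠ 0 ∨ n2 ≠ 0 := by
      by_contra! h
      simp [h.1, h.2] at hδ
    have htr : q * (x + w) = d0 + q ^ 2 * d3 := by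
      rcases hor with h | h
      · refine mul_left_cancel₀ h ?_
        linear_combination -h01 + q * h23'
      · refine mul_left_cancel₀ h ?_
        linear_combination -h02 - q * h13'
    have hdet : x * w - y * z = d0 * d3 := by
      rcases hor with h | h
      · refine mul_left_cancel₀ h ?_
        linear_combination x * h23' - z * h13' - d3 * h01
      · refine mul_left_cancel₀ h ?_
        linear_combination -w * h13' + y * h23' - d3 * h02
    set s := 3 * c * r * (x + w) with hs
    have hs2 : 2 * s = r * (x + w) := by rw [hs]; linear_combination r * (x + w) * hcA
    have hd3 : d3 = 2 * s - r ^ 2 * d0 := by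
      linear_combination -hs2 - r ^ 2 * htr + (r * (x + w) - d3 - q * r * d3) * hrA
    clear_value s
    clear hs
    refine ⟨?_, ?_, ?_⟩
    · simp only [Function.comp_apply, Sum.elim_inr]
      simp
      refine ⟨⟨⟨?_, ?_⟩, ?_, ?_⟩, ?_, ?_⟩
      · linear_combination -r ^ 2 * h01 - r * (n1 * x + n2 * z) * hrA
      · linear_combination -r ^ 2 * h02 - r * (n1 * y + n2 * w) * hrA + n2 * hs2
      · linear_combination r * h13 + n3 * d3 * hrA + n3 * hd3
      · linear_combination r * h23 + n4 * d3 * hrA + n4 * hd3 + n4 * hs2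
      · exact hn
      · have hP : r ^ 2 * d0 - s = -(d3 - s) := by linear_combination hd3
        have hQ : r * x - s = -(r * w - s) := by linear_combination -hs2
        linear_combination (r ^ 2 * d0 - s) * hP - (r * x - s) * hQ + r ^ 2 * hdet +
          s * (hd3 + hs2)
    · simp
      refine ⟨?_, ⟨?_, ?_⟩, ⟨?_, ?_⟩, ?_⟩
      · linear_combination (q * r + 1) * d0 * hrA
      · linear_combination x * hrA
      · linear_combination y * hrA
      · linear_combination z * hrA
      · linear_combination q * hs2 + w * hrA
      · linear_combination -hd3
    · simp
  ty_iff v hv := by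
    rw [satisfies_ideal121_iff] at hv
    rw [evalMat_of]
    simp only [map_zero, aeval_X]
    rw [tySquare_121_iff hv.2.1]
    constructor
    · rintro (h | h | h | h)
      · exact ⟨0, by simpa using h⟩
      · exact ⟨1, by simpa using h⟩
      · exact ⟨2, by simpa using h⟩
      · exact ⟨3, by simpa using h⟩
    · rintro ⟨j, h⟩
      fin_cases j
      · exact Or.inl (by simpa using h)
      · exact Or.inr (Or.inl (by simpa using h))
      · exact Or.inr (Or.inr (Or.inl (by simpa using h)))
      · exact Or.inr (Or.inr (Or.inr (by simpa using h)))

end ConeFamilies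

/-! ### Local models at smooth points -/

section Smooth

variable {O : Type u} [CommRing O] [IsLocalRing O]

theorem isUnit_of_sub_mem {A : Type*} [CommRing A] [IsLocalRing A] {x y : A} (hy : IsUnit y)
    (h : x - y ∈ maximalIdeal A) : IsUnit x := by
  by_contra hx
  have h1 : x ∈ maximalIdeal A := hx
  have h2 := sub_mem h1 h
  rw [sub_sub_cancel] at h2
  exact h2 hy

/-- There is a trivial local model if there are no variables. -/
theorem isLocalModel_of_isEmpty {κ : Type} [IsEmpty κ] [IsCNL O O] (p₀ : κ → O)
    (p : κ → MvPowerSeries (Fin 0) O) : IsLocalModel (⊥ : Ideal (MvPolynomial κ O)) p₀ p where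
  rel g hg := by rw [(Ideal.mem_bot).mp hg, map_zero]
  sub_mem k := isEmptyElim k
  gen := by
    refine generates_X.trans (sup_le_sup_left (Ideal.span_mono ?_) _)
    rintro _ ⟨i, rfl⟩
    exact i.elim0
  lift A _ _ _ _ _ _ _ := by
    obtain ⟨h, -⟩ := exists_powerSeries_lift_local (O := O) (A := A) (fun i : Fin 0 => i.elim0)
      fun i => i.elim0
    exact ⟨h, fun k => isEmptyElim k⟩

/-- Where the coordinate `f u` is invertible, the scheme defined by `I` is the graph of a function
of the coordinates `f i`. -/
structure IsChart {κ : Type} (I : Ideal (MvPolynomial κ O)) {m : ℕ} (f : Fin m → κ) (u : Fin m)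
    (num : κ → MvPolynomial (Fin m) O) : Prop where
  solve : ∀ {A : Type u} [CommRing A] [Algebra O A] (p : κ → A), Satisfies I p →
    ∀ k, p (f u) ^ 2 * p k = MvPolynomial.aeval (fun i => p (f i)) (num k)
  rel : ∀ {A : Type u} [CommRing A] [Algebra O A] (p : κ → A), IsUnit (p (f u)) →
    (∀ k, p (f u) ^ 2 * p k = MvPolynomial.aeval (fun i => p (f i)) (num k)) → Satisfies I p
  free : ∀ i, num (f i) = MvPolynomial.X u ^ 2 * MvPolynomial.X i

theorem IsChart.exists_isLocalModel [IsCNL O O] {κ : Type} {I : Ideal (MvPolynomial κ O)} {m : ℕ}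
    {f : Fin m → κ} {u : Fin m} {num : κ → MvPolynomial (Fin m) O} (h : IsChart I f u num)
    {p₀ : κ → O} (hp₀ : ∀ g ∈ I, MvPolynomial.aeval p₀ g ∈ maximalIdeal O)
    (hu : IsUnit (p₀ (f u))) :
    ∃ p : κ → MvPowerSeries (Fin m) O, IsLocalModel I p₀ p := by
  have hB : IsCNL O (MvPowerSeries (Fin m) O) := inferInstance
  let pf : Fin m → MvPowerSeries (Fin m) O := fun i =>
    algebraMap O _ (p₀ (f i)) + MvPowerSeries.X i
  have hpf : ∀ i, pf i - algebraMap O _ (p₀ (f i)) ∈ maximalIdeal (MvPowerSeries (Fin m) O) :=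
    fun i => by simpa [pf] using X_mem_maximalIdeal i
  have hw : IsUnit (pf u) := isUnit_of_sub_mem (hu.map (algebraMap O _)) (hpf u)
  obtain ⟨w, hw⟩ := hw
  let p : κ → MvPowerSeries (Fin m) O := fun k =>
    (w⁻¹).val ^ 2 * MvPolynomial.aeval pf (num k)
  have hpk : ∀ k, pf u ^ 2 * p k = MvPolynomial.aeval pf (num k) := fun k => by
    rw [← hw, ← mul_assoc, ← mul_pow, Units.mul_inv, one_pow, one_mul]
  have hpu : ∀ i, p (f i) = pf i := fun i => by
    have h1 := hpk (f i)
    rw [h.free, map_mul, map_pow, MvPolynomial.aeval_X, MvPolynomial.aeval_X, ← hw] at h1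
    exact (w.isUnit.pow 2).mul_left_cancel h1
  have hpfun : (fun i => p (f i)) = pf := funext hpu
  have hpk' : ∀ k, p (f u) ^ 2 * p k = MvPolynomial.aeval (fun i => p (f i)) (num k) := fun k => by
    rw [hpfun, hpu]; exact hpk k
  have hres : ∀ k, p₀ (f u) ^ 2 * p₀ k - MvPolynomial.aeval (fun i => p₀ (f i)) (num k) ∈
      maximalIdeal O := fun k => by
    have h1 : Satisfies I (fun k => residue O (p₀ k)) := fun g hg => by
      have h2 := (residue_eq_zero_iff _).mpr (hp₀ g hg)
      rw [← h2]
      exact (MvPolynomial.comp_aeval_apply _ (IsScalarTower.toAlgHom O O (ResidueField O)) g).symm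
    have h3 := h.solve _ h1 k
    have h4 : MvPolynomial.aeval (fun i => residue O (p₀ (f i))) (num k) =
        residue O (MvPolynomial.aeval (fun i => p₀ (f i)) (num k)) :=
      (MvPolynomial.comp_aeval_apply _ (IsScalarTower.toAlgHom O O (ResidueField O)) (num k)).symm
    rw [← residue_eq_zero_iff, map_sub, map_mul, map_pow, h3, h4, sub_self]
  refine ⟨p, ⟨h.rel p (by rw [hpu, ← hw]; exact w.isUnit) hpk', fun k => ?_, ?_, ?_⟩⟩
  · have h1 := algebraMap_mem_maximalIdeal (MvPowerSeries (Fin m) O) (hres k)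
    have h2 := aeval_sub_mem hpf (num k)
    have h3 := Ideal.mul_mem_right (algebraMap O _ (p₀ k) * (pf u + algebraMap O _ (p₀ (f u)))) _
      (hpf u)
    have h4 : pf u ^ 2 * (p k - algebraMap O _ (p₀ k)) ∈
        maximalIdeal (MvPowerSeries (Fin m) O) := by
      have h5 := sub_mem (sub_mem h2 h1) h3
      rw [← hpk k] at h5
      convert h5 using 1
      rw [map_sub, map_mul, map_pow]
      ring
    rw [← hw] at h4
    have h5 := Ideal.mul_mem_left _ ((w⁻¹).val ^ 2) h4
    rwa [← mul_assoc, ← mul_pow, Units.inv_mul, one_pow, one_mul] at h5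
  · refine generates_X.trans (sup_le_sup_left (Ideal.span_mono ?_) _)
    rintro _ ⟨i, rfl⟩
    exact ⟨f i, by simp [hpu, pf]⟩
  · intro A _ _ _ _ p' hp' hp'm
    obtain ⟨g, hg⟩ := exists_powerSeries_lift_local (O := O)
      (fun i => p' (f i) - algebraMap O A (p₀ (f i))) (fun i => hp'm _)
    have hgpf : (fun i => g (pf i)) = fun i => p' (f i) := by
      funext i
      simp only [pf]
      rw [map_add, AlgHom.commutes, hg, add_sub_cancel]
    refine ⟨g, fun k => ?_⟩
    have h1 := congrArg g (hpk k)
    have h2 := h.solve p' hp' k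
    have h3 : g (MvPolynomial.aeval pf (num k)) =
        MvPolynomial.aeval (fun i => p' (f i)) (num k) := by
      rw [← hgpf]
      exact MvPolynomial.comp_aeval_apply _ g (num k)
    rw [h3, ← h2, map_mul, map_pow, congrFun hgpf u] at h1
    have hu' : IsUnit (p' (f u)) := isUnit_of_sub_mem (hu.map (algebraMap O A)) (hp'm (f u))
    exact (hu'.pow 2).mul_left_cancel h1

/-- Signed permutation of the coordinates. -/
def signedPerm {κ : Type} (ε : κ → ℤ) (π : κ → κ) {A : Type*} [CommRing A] (p : κ → A) : κ → A :=
  fun k => (ε k : A) * p (π k)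

/-- A signed permutation that is an involution preserving the equations `I`. -/
structure IsSymmetry {κ : Type} (I : Ideal (MvPolynomial κ O)) (ε : κ → ℤ) (π : κ → κ) : Prop where
  invol : ∀ k, π (π k) = k
  sign : ∀ k, ε (π k) * ε k = 1
  rel : ∀ {A : Type u} [CommRing A] [Algebra O A] (p : κ → A), Satisfies I p →
    Satisfies I (signedPerm ε π p)

theorem IsSymmetry.apply_apply {κ : Type} {I : Ideal (MvPolynomial κ O)} {ε : κ → ℤ} {π : κ → κ}
    (h : IsSymmetry I ε π) {A : Type*} [CommRing A] (p : κ → A) :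
    signedPerm ε π (signedPerm ε π p) = p := by
  funext k
  simp only [signedPerm]
  rw [h.invol, ← mul_assoc, ← Int.cast_mul, mul_comm (ε k), h.sign, Int.cast_one, one_mul]

theorem IsSymmetry.aeval_mem {κ : Type} {I : Ideal (MvPolynomial κ O)} {ε : κ → ℤ} {π : κ → κ}
    (h : IsSymmetry I ε π) {p₀ : κ → O}
    (hp₀ : ∀ g ∈ I, MvPolynomial.aeval p₀ g ∈ maximalIdeal O) :
    ∀ g ∈ I, MvPolynomial.aeval (signedPerm ε π p₀) g ∈ maximalIdeal O := by
  have hc : ∀ (p : κ → O) g, residue O (MvPolynomial.aeval p g) =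
      MvPolynomial.aeval (fun k => residue O (p k)) g := fun p g =>
    MvPolynomial.comp_aeval_apply _ (IsScalarTower.toAlgHom O O (ResidueField O)) g
  intro g hg
  have h1 := h.rel (fun k => residue O (p₀ k)) (fun g hg => by
    rw [← hc, (residue_eq_zero_iff _).mpr (hp₀ g hg)]) g hg
  rw [← residue_eq_zero_iff, hc, ← h1]
  congr 2

theorem IsSymmetry.isLocalModel {κ : Type} {I : Ideal (MvPolynomial κ O)} {ε : κ → ℤ} {π : κ → κ}
    (h : IsSymmetry I ε π) {p₀ : κ → O} {C : Type u} [CommRing C] [IsLocalRing C] [Algebra O C]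
    {p : κ → C} (hp : IsLocalModel I (signedPerm ε π p₀) p) :
    IsLocalModel I p₀ (signedPerm ε π p) := by
  have hsub : ∀ {A : Type u} [CommRing A] [Algebra O A] (p : κ → A) (p₀ : κ → O) k,
      signedPerm ε π p k - algebraMap O A (signedPerm ε π p₀ k) =
        (ε k : A) * (p (π k) - algebraMap O A (p₀ (π k))) := fun p p₀ k => by
    simp only [signedPerm, map_mul, map_intCast]
    ring
  have hback : ∀ k, signedPerm ε π p k - algebraMap O C (p₀ k) =
      (ε k : C) * (p (π k) - algebraMap O C (signedPerm ε π p₀ (π k))) := fun k => by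
    rw [← hsub, h.apply_apply]
  refine ⟨h.rel p hp.rel, fun k => ?_, ?_, fun A _ _ _ _ p' hp' hpm => ?_⟩
  · rw [hback]; exact Ideal.mul_mem_left _ _ (hp.sub_mem _)
  · refine hp.gen.trans (sup_le_sup_left ?_ _)
    rw [Ideal.span_le]
    rintro _ ⟨k, rfl⟩
    have h1 := hback (π k)
    rw [h.invol] at h1
    have h2 : (p k - algebraMap O C (signedPerm ε π p₀ k)) =
        (ε k : C) * (signedPerm ε π p (π k) - algebraMap O C (p₀ (π k))) := by
      rw [h1, ← mul_assoc, ← Int.cast_mul, mul_comm (ε k), h.sign, Int.cast_one, one_mul]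
    simp only [h2]
    exact Ideal.mul_mem_left _ _ (Ideal.subset_span ⟨π k, rfl⟩)
  · obtain ⟨g, hg⟩ := hp.lift A (signedPerm ε π p') (h.rel _ hp') (fun k => by
      rw [hsub]; exact Ideal.mul_mem_left _ _ (hpm _))
    refine ⟨g, fun k => ?_⟩
    have := congrFun (h.apply_apply p') k
    rw [← this]
    simp only [signedPerm, map_mul, map_intCast] at *
    rw [hg]

theorem IsSymmetry.exists_isLocalModel {κ : Type} {I : Ideal (MvPolynomial κ O)} {ε : κ → ℤ}
    {π : κ → κ} (h : IsSymmetry I ε π) {p₀ : κ → O} {C : Type u} [CommRing C] [IsLocalRing C]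
    [Algebra O C] (hp : ∃ p : κ → C, IsLocalModel I (signedPerm ε π p₀) p) :
    ∃ p : κ → C, IsLocalModel I p₀ p :=
  let ⟨_, hp⟩ := hp
  ⟨_, h.isLocalModel hp⟩

end Smooth

section Charts

variable {O : Type u} [CommRing O] [IsLocalRing O]

open MvPolynomial

theorem forall_fin_ten {P : Fin 10 → Prop} : (∀ k, P k) ↔ P 0 ∧ P 1 ∧ P 2 ∧ P 3 ∧ P 4 ∧ P 5 ∧
    P 6 ∧ P 7 ∧ P 8 ∧ P 9 := by
  refine ⟨fun h => ⟨h _, h _, h _, h _, h _, h _, h _, h _, h _, h _⟩, fun h k => ?_⟩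
  obtain ⟨h0, h1, h2, h3, h4, h5, h6, h7, h8, h9⟩ := h
  fin_cases k <;> assumption

theorem forall_fin_eight {P : Fin 8 → Prop} : (∀ k, P k) ↔ P 0 ∧ P 1 ∧ P 2 ∧ P 3 ∧ P 4 ∧ P 5 ∧
    P 6 ∧ P 7 := by
  refine ⟨fun h => ⟨h _, h _, h _, h _, h _, h _, h _, h _⟩, fun h k => ?_⟩
  obtain ⟨h0, h1, h2, h3, h4, h5, h6, h7⟩ := h
  fin_cases k <;> assumption

/-- The chart of the first model where `A` is invertible; the free coordinates are
`A, B, C, D, S, T, Z`. -/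
theorem isChart_22_A : IsChart (ideal22 O) ![0, 1, 2, 3, 4, 5, 9] 0
    ![X 0 ^ 2 * X 0, X 0 ^ 2 * X 1, X 0 ^ 2 * X 2, X 0 ^ 2 * X 3, X 0 ^ 2 * X 4, X 0 ^ 2 * X 5,
      X 0 * X 4 * X 2 + X 2 * (X 0 * X 4 + X 5 * X 2 - X 1 * X 6) + X 0 * X 3 * X 6,
      X 0 * (X 0 * X 4 + X 5 * X 2 - X 1 * X 6),
      X 0 * X 4 * X 1 + X 0 * X 5 * X 3 + X 1 * (X 0 * X 4 + X 5 * X 2 - X 1 * X 6),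
      X 0 ^ 2 * X 6] where
  solve p hp := by
    rw [satisfies_ideal22_iff] at hp
    obtain ⟨⟨h1, h2⟩, ⟨h3, h4⟩, h5⟩ := hp
    rw [forall_fin_ten]
    simp [-mul_eq_mul_left_iff]
    refine ⟨?_, ?_, ?_⟩
    · linear_combination p 0 * h3 - p 2 * h1
    · linear_combination -p 0 * h1
    · linear_combination -p 0 * h2 - p 1 * h1
  rel p hu hp := by
    rw [forall_fin_ten] at hp
    obtain ⟨-, -, -, -, -, -, h6, h7, h8, -⟩ := hp
    simp at h6 h7 h8 hu
    have h7' : p 0 * p 7 = p 0 * p 4 + p 5 * p 2 - p 1 * p 9 :=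
      hu.mul_left_cancel (by linear_combination h7)
    have key : ∀ {a b}, p 0 ^ 2 * a = p 0 ^ 2 * b → a = b := fun h => (hu.pow 2).mul_left_cancel h
    rw [satisfies_ideal22_iff]
    refine ⟨⟨?_, ?_⟩, ⟨?_, ?_⟩, ?_⟩
    · linear_combination -h7'
    · exact hu.mul_left_cancel (by linear_combination -h8 + p 1 * h7')
    · exact hu.mul_left_cancel (by linear_combination h6 - p 2 * h7')
    · exact key (by linear_combination p 1 * h6 - p 2 * h8 + p 0 * p 3 * h7')
    · exact key (by
        linear_combination p 5 * h6 - p 9 * h8 -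
          (p 0 * p 7 + p 0 * p 4 + p 5 * p 2 - p 1 * p 9) * h7')
  free i := by fin_cases i <;> rfl

/-- The chart of the first model where `T` is invertible; the free coordinates are
`T, A, B, S, X, Y, Z`. -/
theorem isChart_22_T : IsChart (ideal22 O) ![5, 0, 1, 4, 7, 8, 9] 0
    ![X 0 ^ 2 * X 1, X 0 ^ 2 * X 2, X 0 * (X 1 * X 4 + X 2 * X 6 - X 3 * X 1),
      X 0 * (X 1 * X 5 - X 2 * X 4 - X 3 * X 2), X 0 ^ 2 * X 3, X 0 ^ 2 * X 0,
      X 0 * (X 4 ^ 2 + X 5 * X 6 - X 3 ^ 2), X 0 ^ 2 * X 4, X 0 ^ 2 * X 5, X 0 ^ 2 * X 6] where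
  solve p hp := by
    rw [satisfies_ideal22_iff] at hp
    obtain ⟨⟨h1, h2⟩, ⟨h3, h4⟩, h5⟩ := hp
    rw [forall_fin_ten]
    simp [-mul_eq_mul_left_iff]
    refine ⟨?_, ?_, ?_⟩
    · linear_combination p 5 * h1
    · linear_combination p 5 * h2
    · linear_combination p 5 * h5
  rel p hu hp := by
    rw [forall_fin_ten] at hp
    obtain ⟨-, -, h2, h3, -, -, h6, -, -, -⟩ := hp
    simp at h2 h3 h6 hu
    have h2' : p 5 * p 2 = p 0 * p 7 + p 1 * p 9 - p 4 * p 0 :=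
      hu.mul_left_cancel (by linear_combination h2)
    have h3' : p 5 * p 3 = p 0 * p 8 - p 1 * p 7 - p 4 * p 1 :=
      hu.mul_left_cancel (by linear_combination h3)
    have h6' : p 5 * p 6 = p 7 ^ 2 + p 8 * p 9 - p 4 ^ 2 :=
      hu.mul_left_cancel (by linear_combination h6)
    rw [satisfies_ideal22_iff]
    refine ⟨⟨?_, ?_⟩, ⟨?_, ?_⟩, ?_⟩
    · linear_combination h2'
    · linear_combination h3'
    · exact hu.mul_left_cancel (by
        linear_combination p 0 * h6' - (p 4 + p 7) * h2' - p 9 * h3')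
    · exact hu.mul_left_cancel (by
        linear_combination p 1 * h6' - p 8 * h2' + (p 7 - p 4) * h3')
    · linear_combination h6'
  free i := by fin_cases i <;> rfl

theorem isSymmetry_22_transpose : IsSymmetry (ideal22 O) ![1, 1, 1, 1, 1, 1, 1, 1, 1, 1]
    ![0, 2, 1, 3, 7, 9, 8, 4, 6, 5] where
  invol := by decide
  sign := by decide
  rel p hp := by
    rw [satisfies_ideal22_iff] at hp ⊢
    obtain ⟨⟨h1, h2⟩, ⟨h3, h4⟩, h5⟩ := hp
    simp [signedPerm]
    refine ⟨⟨?_, ?_⟩, ⟨?_, ?_⟩, ?_⟩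
    · linear_combination -h1
    · linear_combination -h3
    · linear_combination -h2
    · linear_combination -h4
    · linear_combination -h5

theorem isSymmetry_22_left : IsSymmetry (ideal22 O) ![1, 1, 1, 1, -1, 1, 1, 1, 1, 1]
    ![2, 3, 0, 1, 4, 6, 5, 7, 8, 9] where
  invol := by decide
  sign := by decide
  rel p hp := by
    rw [satisfies_ideal22_iff] at hp ⊢
    obtain ⟨⟨h1, h2⟩, ⟨h3, h4⟩, h5⟩ := hp
    simp [signedPerm]
    refine ⟨⟨?_, ?_⟩, ⟨?_, ?_⟩, ?_⟩
    · linear_combination h3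
    · linear_combination h4
    · linear_combination h1
    · linear_combination h2
    · linear_combination h5

theorem isSymmetry_22_right : IsSymmetry (ideal22 O) ![1, 1, 1, 1, 1, 1, 1, -1, 1, 1]
    ![1, 0, 3, 2, 4, 5, 6, 7, 9, 8] where
  invol := by decide
  sign := by decide
  rel p hp := by
    rw [satisfies_ideal22_iff] at hp ⊢
    obtain ⟨⟨h1, h2⟩, ⟨h3, h4⟩, h5⟩ := hp
    simp [signedPerm]
    refine ⟨⟨?_, ?_⟩, ⟨?_, ?_⟩, ?_⟩
    · linear_combination h2
    · linear_combination h1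
    · linear_combination h4
    · linear_combination h3
    · linear_combination h5

theorem exists_isLocalModel_22 [IsCNL O O] {p₀ : Fin 10 → O}
    (hp₀ : ∀ g ∈ ideal22 O, MvPolynomial.aeval p₀ g ∈ maximalIdeal O)
    (hu : ∃ k, k ≠ 4 ∧ k ≠ 7 ∧ IsUnit (p₀ k)) :
    ∃ p : Fin 10 → MvPowerSeries (Fin 7) O, IsLocalModel (ideal22 O) p₀ p := by
  have hA : ∀ {p₀ : Fin 10 → O}, (∀ g ∈ ideal22 O, MvPolynomial.aeval p₀ g ∈ maximalIdeal O) →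
      IsUnit (p₀ 0) → ∃ p : Fin 10 → MvPowerSeries (Fin 7) O, IsLocalModel (ideal22 O) p₀ p :=
    fun h hu => isChart_22_A.exists_isLocalModel h hu
  have hT : ∀ {p₀ : Fin 10 → O}, (∀ g ∈ ideal22 O, MvPolynomial.aeval p₀ g ∈ maximalIdeal O) →
      IsUnit (p₀ 5) → ∃ p : Fin 10 → MvPowerSeries (Fin 7) O, IsLocalModel (ideal22 O) p₀ p :=
    fun h hu => isChart_22_T.exists_isLocalModel h hu
  have hB : ∀ {p₀ : Fin 10 → O}, (∀ g ∈ ideal22 O, MvPolynomial.aeval p₀ g ∈ maximalIdeal O) →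
      IsUnit (p₀ 1) → ∃ p : Fin 10 → MvPowerSeries (Fin 7) O, IsLocalModel (ideal22 O) p₀ p :=
    fun h hu => isSymmetry_22_right.exists_isLocalModel
      (hA (isSymmetry_22_right.aeval_mem h) (by simpa [signedPerm] using hu))
  have hZ : ∀ {p₀ : Fin 10 → O}, (∀ g ∈ ideal22 O, MvPolynomial.aeval p₀ g ∈ maximalIdeal O) →
      IsUnit (p₀ 9) → ∃ p : Fin 10 → MvPowerSeries (Fin 7) O, IsLocalModel (ideal22 O) p₀ p :=
    fun h hu => isSymmetry_22_transpose.exists_isLocalModel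
      (hT (isSymmetry_22_transpose.aeval_mem h) (by simpa [signedPerm] using hu))
  obtain ⟨k, h4, h7, hu⟩ := hu
  fin_cases k
  · exact hA hp₀ hu
  · exact hB hp₀ hu
  · exact isSymmetry_22_left.exists_isLocalModel
      (hA (isSymmetry_22_left.aeval_mem hp₀) (by simpa [signedPerm] using hu))
  · exact isSymmetry_22_left.exists_isLocalModel
      (hB (isSymmetry_22_left.aeval_mem hp₀) (by simpa [signedPerm] using hu))
  · exact absurd rfl h4
  · exact hT hp₀ hu
  · exact isSymmetry_22_left.exists_isLocalModel
      (hT (isSymmetry_22_left.aeval_mem hp₀) (by simpa [signedPerm] using hu))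
  · exact absurd rfl h7
  · exact isSymmetry_22_right.exists_isLocalModel
      (hZ (isSymmetry_22_right.aeval_mem hp₀) (by simpa [signedPerm] using hu))
  · exact hZ hp₀ hu

/-- The chart of the second model where `A` is invertible; the free coordinates are
`A, B, D, R, Z`. -/
theorem isChart_121_A : IsChart (ideal121 O) ![0, 1, 3, 4, 7] 0
    ![X 0 ^ 2 * X 0, X 0 ^ 2 * X 1, -(X 0 * X 1 * X 2), X 0 ^ 2 * X 2, X 0 ^ 2 * X 3,
      X 0 * (X 3 * X 0 - X 1 * X 4), X 0 * X 3 * X 1 + X 1 * (X 3 * X 0 - X 1 * X 4),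
      X 0 ^ 2 * X 4] where
  solve p hp := by
    rw [satisfies_ideal121_iff] at hp
    obtain ⟨⟨⟨h1, h2⟩, h3, h4⟩, h5, h6⟩ := hp
    rw [forall_fin_eight]
    simp [-mul_eq_mul_left_iff]
    refine ⟨?_, ?_, ?_⟩
    · linear_combination p 0 * h5
    · linear_combination p 0 * h1
    · linear_combination p 0 * h2 + p 1 * h1
  rel p hu hp := by
    rw [forall_fin_eight] at hp
    obtain ⟨-, -, h2, -, -, h5, h6, -⟩ := hp
    simp at h2 h5 h6 hu
    have h2' : p 0 * p 2 = - (p 1 * p 3) := hu.mul_left_cancel (by linear_combination h2)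
    have h5' : p 0 * p 5 = p 4 * p 0 - p 1 * p 7 := hu.mul_left_cancel (by linear_combination h5)
    have key : ∀ {a b}, p 0 ^ 2 * a = p 0 ^ 2 * b → a = b := fun h => (hu.pow 2).mul_left_cancel h
    rw [satisfies_ideal121_iff]
    refine ⟨⟨⟨?_, ?_⟩, ?_, ?_⟩, ?_, ?_⟩
    · linear_combination h5'
    · exact hu.mul_left_cancel (by linear_combination h6 - p 1 * h5')
    · exact key (by
        linear_combination p 0 * p 2 * h5' + (2 * p 4 * p 0 - p 1 * p 7) * h2' + p 3 * h6)
    · exact hu.mul_left_cancel (by linear_combination p 7 * h2' - p 3 * h5')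
    · linear_combination h2'
    · exact key (by
        linear_combination -(p 0 * p 5 + p 4 * p 0 - p 1 * p 7) * h5' - p 7 * h6)
  free i := by fin_cases i <;> rfl

/-- The chart of the second model where `Y` is invertible; the free coordinates are
`Y, R, X, B, C`. -/
theorem isChart_121_Y : IsChart (ideal121 O) ![6, 4, 5, 1, 2] 0
    ![X 0 * ((X 1 + X 2) * X 3), X 0 ^ 2 * X 3, X 0 ^ 2 * X 4, -(X 0 * ((X 1 + X 2) * X 4)),
      X 0 ^ 2 * X 1, X 0 ^ 2 * X 2, X 0 ^ 2 * X 0, X 0 * (X 1 ^ 2 - X 2 ^ 2)] where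
  solve p hp := by
    rw [satisfies_ideal121_iff] at hp
    obtain ⟨⟨⟨h1, h2⟩, h3, h4⟩, h5, h6⟩ := hp
    rw [forall_fin_eight]
    simp [-mul_eq_mul_left_iff]
    refine ⟨?_, ?_, ?_⟩
    · linear_combination p 6 * h2
    · linear_combination p 6 * h3
    · linear_combination -p 6 * h6
  rel p hu hp := by
    rw [forall_fin_eight] at hp
    obtain ⟨h0, -, -, h3, -, -, -, h7⟩ := hp
    simp at h0 h3 h7 hu
    have h0' : p 6 * p 0 = (p 4 + p 5) * p 1 := hu.mul_left_cancel (by linear_combination h0)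
    have h3' : p 6 * p 3 = - ((p 4 + p 5) * p 2) := hu.mul_left_cancel (by linear_combination h3)
    have h7' : p 6 * p 7 = p 4 ^ 2 - p 5 ^ 2 := hu.mul_left_cancel (by linear_combination h7)
    rw [satisfies_ideal121_iff]
    refine ⟨⟨⟨?_, ?_⟩, ?_, ?_⟩, ?_, ?_⟩
    · exact hu.mul_left_cancel (by linear_combination (p 5 - p 4) * h0' + p 1 * h7')
    · linear_combination h0'
    · linear_combination h3'
    · exact hu.mul_left_cancel (by linear_combination p 2 * h7' + (p 4 - p 5) * h3')
    · exact hu.mul_left_cancel (by linear_combination p 2 * h0' + p 1 * h3')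
    · linear_combination -h7'
  free i := by fin_cases i <;> rfl

theorem isSymmetry_121_transpose : IsSymmetry (ideal121 O) ![1, 1, 1, 1, -1, 1, 1, 1]
    ![2, 3, 0, 1, 4, 5, 7, 6] where
  invol := by decide
  sign := by decide
  rel p hp := by
    rw [satisfies_ideal121_iff] at hp ⊢
    obtain ⟨⟨⟨h1, h2⟩, h3, h4⟩, h5, h6⟩ := hp
    simp [signedPerm]
    refine ⟨⟨⟨?_, ?_⟩, ?_, ?_⟩, ?_, ?_⟩
    · linear_combination h3
    · linear_combination h4
    · linear_combination h1
    · linear_combination h2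
    · linear_combination h5
    · linear_combination h6

theorem isSymmetry_121_flip : IsSymmetry (ideal121 O) ![1, 1, 1, 1, 1, -1, 1, 1]
    ![1, 0, 3, 2, 4, 5, 7, 6] where
  invol := by decide
  sign := by decide
  rel p hp := by
    rw [satisfies_ideal121_iff] at hp ⊢
    obtain ⟨⟨⟨h1, h2⟩, h3, h4⟩, h5, h6⟩ := hp
    simp [signedPerm]
    refine ⟨⟨⟨?_, ?_⟩, ?_, ?_⟩, ?_, ?_⟩
    · linear_combination h2
    · linear_combination h1
    · linear_combination h4
    · linear_combination h3
    · linear_combination h5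
    · linear_combination h6

theorem exists_isLocalModel_121 [IsCNL O O] {p₀ : Fin 8 → O}
    (hp₀ : ∀ g ∈ ideal121 O, MvPolynomial.aeval p₀ g ∈ maximalIdeal O)
    (hu : ∃ k, k ≠ 4 ∧ k ≠ 5 ∧ IsUnit (p₀ k)) :
    ∃ p : Fin 8 → MvPowerSeries (Fin 5) O, IsLocalModel (ideal121 O) p₀ p := by
  have hA : ∀ {p₀ : Fin 8 → O}, (∀ g ∈ ideal121 O, MvPolynomial.aeval p₀ g ∈ maximalIdeal O) →
      IsUnit (p₀ 0) → ∃ p : Fin 8 → MvPowerSeries (Fin 5) O, IsLocalModel (ideal121 O) p₀ p :=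
    fun h hu => isChart_121_A.exists_isLocalModel h hu
  have hY : ∀ {p₀ : Fin 8 → O}, (∀ g ∈ ideal121 O, MvPolynomial.aeval p₀ g ∈ maximalIdeal O) →
      IsUnit (p₀ 6) → ∃ p : Fin 8 → MvPowerSeries (Fin 5) O, IsLocalModel (ideal121 O) p₀ p :=
    fun h hu => isChart_121_Y.exists_isLocalModel h hu
  have hB : ∀ {p₀ : Fin 8 → O}, (∀ g ∈ ideal121 O, MvPolynomial.aeval p₀ g ∈ maximalIdeal O) →
      IsUnit (p₀ 1) → ∃ p : Fin 8 → MvPowerSeries (Fin 5) O, IsLocalModel (ideal121 O) p₀ p :=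
    fun h hu => isSymmetry_121_flip.exists_isLocalModel
      (hA (isSymmetry_121_flip.aeval_mem h) (by simpa [signedPerm] using hu))
  obtain ⟨k, h4, h5, hu⟩ := hu
  fin_cases k
  · exact hA hp₀ hu
  · exact hB hp₀ hu
  · exact isSymmetry_121_transpose.exists_isLocalModel
      (hA (isSymmetry_121_transpose.aeval_mem hp₀) (by simpa [signedPerm] using hu))
  · exact isSymmetry_121_transpose.exists_isLocalModel
      (hB (isSymmetry_121_transpose.aeval_mem hp₀) (by simpa [signedPerm] using hu))
  · exact absurd rfl h4
  · exact absurd rfl h5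
  · exact hY hp₀ hu
  · exact isSymmetry_121_flip.exists_isLocalModel
      (hY (isSymmetry_121_flip.aeval_mem hp₀) (by simpa [signedPerm] using hu))

end Charts

/-! ### Standard monomials -/

section StandardMonomials

variable {O S κ τ : Type*} [CommRing O] [CommRing S] [Algebra O S] [Fintype κ] [DecidableEq κ]

theorem prod_pow_mem_span_standard (y : κ → S) (w : κ → ℕ) (F : κ → κ → Prop)
    (hFne : ∀ a b, F a b → a ≠ b)
    (hF : ∀ a b, F a b → y a * y b ∈
      Submodule.span O {z | ∃ c d, w c + w d < w a + w b ∧ z = y c * y d}) (m : κ → ℕ) :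
    ∏ k, y k ^ m k ∈ Submodule.span O ((fun m : κ → ℕ => ∏ k, y k ^ m k) ''
      {m | ∀ a b, F a b → m a = 0 ∨ m b = 0}) := by
  induction hW : ∑ k, m k * w k using Nat.strong_induction_on generalizing m with
  | _ W ih =>
    by_cases hstd : ∀ a b, F a b → m a = 0 ∨ m b = 0
    · exact Submodule.subset_span ⟨m, hstd, rfl⟩
    · push Not at hstd
      obtain ⟨a, b, hab, hma, hmb⟩ := hstd
      have hne := hFne a b hab
      set m' : κ → ℕ := fun k => m k - ((if k = a then 1 else 0) + if k = b then 1 else 0) with hm'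
      have hm : ∀ k, m k = m' k + ((if k = a then 1 else 0) + if k = b then 1 else 0) := by
        intro k
        simp only [hm']
        by_cases h1 : k = a
        · have : k ≠ b := fun h2 => hne (h1.symm.trans h2)
          subst h1
          simp only [if_true, if_neg this]
          omega
        · by_cases h2 : k = b
          · subst h2
            simp only [if_true, if_neg h1]
            omega
          · simp [h1, h2]
      have hmul : ∀ c d, y c * y d * ∏ k, y k ^ m' k =
          ∏ k, y k ^ (m' k + ((if k = c then 1 else 0) + if k = d then 1 else 0)) := by
        intro c d
        simp only [pow_add, Finset.prod_mul_distrib]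
        simp [Finset.prod_ite_eq', pow_ite, mul_comm]
      have hwt : ∀ c d, ∑ k, (m' k + ((if k = c then 1 else 0) + if k = d then 1 else 0)) * w k =
          ∑ k, m' k * w k + (w c + w d) := by
        intro c d
        simp [add_mul, Finset.sum_add_distrib]
      have h1 : ∏ k, y k ^ m k = y a * y b * ∏ k, y k ^ m' k := by
        rw [hmul]; exact Finset.prod_congr rfl fun k _ => by rw [← hm]
      have h2 : W = ∑ k, m' k * w k + (w a + w b) := by
        rw [← hW, ← hwt]; exact Finset.sum_congr rfl fun k _ => by rw [← hm]
      rw [h1]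
      refine Submodule.span_induction (p := fun z _ => z * ∏ k, y k ^ m' k ∈ _) ?_ ?_ ?_ ?_
        (hF a b hab)
      · rintro _ ⟨c, d, hcd, rfl⟩
        rw [hmul]
        exact ih _ (by rw [hwt]; omega) _ rfl
      · rw [zero_mul]; exact zero_mem _
      · intro z z' _ _ hz hz'
        rw [add_mul]; exact add_mem hz hz'
      · intro o z _ hz
        rw [smul_mul_assoc]; exact Submodule.smul_mem _ _ hz

theorem injective_of_standard_monomials [IsDomain O] (y : κ → S)
    (hy : Algebra.adjoin O (Set.range y) = ⊤) (w : κ → ℕ) (F : κ → κ → Prop)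
    (hFne : ∀ a b, F a b → a ≠ b)
    (hF : ∀ a b, F a b → y a * y b ∈
      Submodule.span O {z | ∃ c d, w c + w d < w a + w b ∧ z = y c * y d})
    (ord : MonomialOrder τ) (θ : S →ₐ[O] MvPolynomial τ O) (δ : κ → τ →₀ ℕ)
    (hne : ∀ k, θ (y k) ≠ 0) (hδ : ∀ k, ord.degree (θ (y k)) = δ k)
    (hinj : ∀ m m' : κ → ℕ, (∀ a b, F a b → m a = 0 ∨ m b = 0) →
      (∀ a b, F a b → m' a = 0 ∨ m' b = 0) → ∑ k, m k • δ k = ∑ k, m' k • δ k → m = m') :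
    Function.Injective θ := by
  rw [injective_iff_map_eq_zero]
  intro s hs
  have hspan : s ∈ Submodule.span O ((fun m : κ → ℕ => ∏ k, y k ^ m k) ''
      {m | ∀ a b, F a b → m a = 0 ∨ m b = 0}) := by
    have : s ∈ Algebra.adjoin O (Set.range y) := hy ▸ Algebra.mem_top
    rw [Algebra.adjoin_range_eq_range_aeval] at this
    obtain ⟨f, rfl⟩ := this
    change MvPolynomial.aeval y f ∈ _
    rw [MvPolynomial.aeval_def, MvPolynomial.eval₂_eq']
    refine Submodule.sum_mem _ fun m _ => ?_
    rw [← Algebra.smul_def]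
    exact Submodule.smul_mem _ _ (prod_pow_mem_span_standard y w F hFne hF m)
  obtain ⟨c, hc, rfl⟩ := (Finsupp.mem_span_image_iff_linearCombination O).mp hspan
  by_cases hc0 : c.support.Nonempty
  · exfalso
    obtain ⟨m₀, hm₀, hmax⟩ := Finset.exists_max_image c.support
      (fun m => ord.toSyn (∑ k, m k • δ k)) hc0
    have hstd : ∀ m ∈ c.support, ∀ a b, F a b → m a = 0 ∨ m b = 0 := fun m hm =>
      (Finsupp.mem_supported _ _).mp hc hm
    have hdeg : ∀ m : κ → ℕ, ord.degree (θ (∏ k, y k ^ m k)) = ∑ k, m k • δ k := by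
      intro m
      rw [map_prod, ord.degree_prod]
      · exact Finset.sum_congr rfl fun k _ => by rw [map_pow, ord.degree_pow, hδ]
      · intro k _
        rw [map_pow]
        exact pow_ne_zero _ (hne k)
    have hzero : ∀ m : κ → ℕ, θ (∏ k, y k ^ m k) ≠ 0 := fun m => by
      rw [map_prod]
      exact Finset.prod_ne_zero_iff.mpr fun k _ => by rw [map_pow]; exact pow_ne_zero _ (hne k)
    have h1 : MvPolynomial.coeff (∑ k, m₀ k • δ k)
        (θ (Finsupp.linearCombination O (fun m : κ → ℕ => ∏ k, y k ^ m k) c)) =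
        c m₀ * MvPolynomial.coeff (∑ k, m₀ k • δ k) (θ (∏ k, y k ^ m₀ k)) := by
      rw [Finsupp.linearCombination_apply, Finsupp.sum, map_sum, MvPolynomial.coeff_sum,
        Finset.sum_eq_single_of_mem m₀ hm₀]
      · rw [map_smul, MvPolynomial.coeff_smul, smul_eq_mul]
      · intro m hm hmm
        rw [map_smul, MvPolynomial.coeff_smul, smul_eq_mul]
        rw [ord.coeff_eq_zero_of_lt, mul_zero]
        rw [hdeg]
        refine lt_of_le_of_ne (hmax m hm) fun h => hmm ?_
        exact hinj _ _ (hstd m hm) (hstd m₀ hm₀) (ord.toSyn.injective h)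
    rw [hs, MvPolynomial.coeff_zero, eq_comm, mul_eq_zero] at h1
    rcases h1 with h1 | h1
    · exact (Finsupp.mem_support_iff.mp hm₀) h1
    · rw [← hdeg, ord.coeff_degree_eq_zero_iff] at h1
      exact hzero m₀ h1
  · rw [Finset.not_nonempty_iff_eq_empty, Finsupp.support_eq_empty] at hc0
    rw [hc0, map_zero]

end StandardMonomials

/-! ### Completed graded rings -/

section GradedCompletion

variable {O : Type u} [CommRing O] {d : ℕ} (J : Ideal (MvPolynomial (Fin d) O))

/-- The irrelevant ideal. -/
abbrev irrelevant : Ideal (MvPolynomial (Fin d) O ⧸ J) :=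
  Ideal.span (Set.range fun i : Fin d => Ideal.Quotient.mk J (MvPolynomial.X i))

theorem irrelevant_fg : (irrelevant J).FG := by
  refine ⟨(Set.finite_range (fun i : Fin d => Ideal.Quotient.mk J (MvPolynomial.X i))).toFinset, ?_⟩
  rw [Set.Finite.coe_toFinset]

/-- The coordinates of the completed graded ring. -/
def gradedPoint (k : Fin d) : GradedCompletion O J :=
  AdicCompletion.of (irrelevant J) _ (Ideal.Quotient.mk J (MvPolynomial.X k))

theorem map_irrelevant : (irrelevant J).map (algebraMap _ (GradedCompletion O J)) =
    Ideal.span (Set.range (gradedPoint J)) := by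
  rw [Ideal.map_span, ← Set.range_comp]
  rfl

theorem mk_eq_aeval (f : MvPolynomial (Fin d) O) :
    Ideal.Quotient.mk J f =
      MvPolynomial.aeval (fun k => Ideal.Quotient.mk J (MvPolynomial.X k)) f := by
  have := MvPolynomial.comp_aeval_apply MvPolynomial.X (Ideal.Quotient.mkₐ O J) f
  rw [MvPolynomial.aeval_X_left, AlgHom.id_apply] at this
  exact this

theorem of_mk_eq_aeval (f : MvPolynomial (Fin d) O) :
    AdicCompletion.of (irrelevant J) _ (Ideal.Quotient.mk J f) =
      MvPolynomial.aeval (gradedPoint J) f := by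
  rw [mk_eq_aeval]
  exact MvPolynomial.comp_aeval_apply _ (IsScalarTower.toAlgHom O (MvPolynomial (Fin d) O ⧸ J)
    (GradedCompletion O J)) f

theorem satisfies_gradedPoint : Satisfies J (gradedPoint J) := fun g hg => by
  rw [← of_mk_eq_aeval, Ideal.Quotient.eq_zero_iff_mem.mpr hg, map_zero]

theorem coe_eq_aeval {τ : Type*} (f : MvPolynomial τ O) :
    (f : MvPowerSeries τ O) = MvPolynomial.aeval MvPowerSeries.X f := by
  have h : (MvPolynomial.coeToMvPowerSeries.algHom O : MvPolynomial τ O →ₐ[O] MvPowerSeries τ O) =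
      MvPolynomial.aeval MvPowerSeries.X := by
    ext i
    simp [MvPolynomial.coeToMvPowerSeries.algHom_apply]
  rw [← h, MvPolynomial.coeToMvPowerSeries.algHom_apply]
  simp

theorem exists_gradedCompletion_surjective :
    ∃ ψ : MvPowerSeries (Fin d) O →ₐ[O] GradedCompletion O J,
      (∀ k, ψ (MvPowerSeries.X k) = gradedPoint J k) ∧ Function.Surjective ψ := by
  have hc := AdicCompletion.isAdicComplete_self (irrelevant J) (irrelevant_fg J)
  rw [map_irrelevant] at hc
  obtain ⟨ψ, hψ⟩ := exists_powerSeries_lift (O := O) (Ideal.span (Set.range (gradedPoint J)))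
    (gradedPoint J) (fun k => Ideal.subset_span ⟨k, rfl⟩)
  refine ⟨ψ, hψ, ?_⟩
  have hmap : (Ideal.span (Set.range (MvPowerSeries.X : Fin d → MvPowerSeries (Fin d) O))).map
      (ψ : MvPowerSeries (Fin d) O →+* GradedCompletion O J) =
      Ideal.span (Set.range (gradedPoint J)) := by
    rw [Ideal.map_span, ← Set.range_comp]
    congr 2
    exact funext hψ
  have hH : IsHausdorff ((Ideal.span (Set.range
      (MvPowerSeries.X : Fin d → MvPowerSeries (Fin d) O))).map
      (ψ : MvPowerSeries (Fin d) O →+* GradedCompletion O J)) (GradedCompletion O J) := by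
    rw [hmap]; exact hc.toIsHausdorff
  apply surjective_of_mk_map_comp_surjective (I := Ideal.span (Set.range
      (MvPowerSeries.X : Fin d → MvPowerSeries (Fin d) O)))
      (ψ : MvPowerSeries (Fin d) O →+* GradedCompletion O J)
  intro z
  obtain ⟨z, rfl⟩ := Ideal.Quotient.mk_surjective z
  obtain ⟨s, hs⟩ := Ideal.Quotient.mk_surjective (AdicCompletion.evalOneₐ (irrelevant J) z)
  obtain ⟨f, rfl⟩ := Ideal.Quotient.mk_surjective s
  have hz : z - AdicCompletion.of (irrelevant J) _ (Ideal.Quotient.mk J f) ∈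
      Ideal.span (Set.range (gradedPoint J)) := by
    rw [← map_irrelevant, ← AdicCompletion.ker_evalOneₐ_eq_map _ (irrelevant_fg J)]
    change AdicCompletion.evalOneₐ (irrelevant J) _ = 0
    rw [map_sub, ← hs, sub_eq_zero]
    rfl
  refine ⟨(f : MvPowerSeries (Fin d) O), ?_⟩
  change Ideal.Quotient.mk _ (ψ f) = _
  have h1 : ψ f = MvPolynomial.aeval (gradedPoint J) f := by
    rw [coe_eq_aeval, MvPolynomial.comp_aeval_apply]
    congr 2
    exact funext hψ
  rw [h1, ← of_mk_eq_aeval, eq_comm, Ideal.Quotient.eq, hmap]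
  exact hz

/-- An algebra homomorphism from the graded ring to a complete ring extends to the completion. -/
theorem exists_gradedCompletion_lift {A : Type u} [CommRing A] [Algebra O A] (I : Ideal A)
    [IsAdicComplete I A] {p : Fin d → A} (hp : Satisfies J p) (hpI : ∀ k, p k ∈ I) :
    ∃ h : GradedCompletion O J →ₐ[O] A,
      (∀ s, h (AdicCompletion.of (irrelevant J) _ s) =
        Ideal.Quotient.liftₐ J (MvPolynomial.aeval p) hp s) ∧ ∀ k, h (gradedPoint J k) = p k := by
  obtain ⟨h, hh⟩ := exists_adicCompletion_lift (irrelevant J) I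
    (Ideal.Quotient.liftₐ J (MvPolynomial.aeval p) hp) (fun x hx => by
      have : irrelevant J ≤ I.comap (Ideal.Quotient.liftₐ J (MvPolynomial.aeval p) hp) := by
        rw [irrelevant, Ideal.span_le]
        rintro _ ⟨k, rfl⟩
        have h1 : Ideal.Quotient.liftₐ J (MvPolynomial.aeval p) hp
          (Ideal.Quotient.mk J (MvPolynomial.X k)) = p k :=
          (MvPolynomial.aeval_X _ _)
        rw [SetLike.mem_coe, Ideal.mem_comap, h1]
        exact hpI k
      exact this hx)
  exact ⟨h, hh, fun k => (hh _).trans (MvPolynomial.aeval_X _ _)⟩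

section Local

variable [IsLocalRing O] [IsCNL O O]

/-- All equations vanish at the origin. -/
theorem nontrivial_gradedCompletion (hJ : Satisfies J (0 : Fin d → O)) :
    Nontrivial (GradedCompletion O J) := by
  have : IsAdicComplete (maximalIdeal O) O := IsCNL.complete (O := O)
  obtain ⟨h, -⟩ := exists_gradedCompletion_lift J (maximalIdeal O) hJ fun _ => zero_mem _
  exact (h : GradedCompletion O J →+* O).domain_nontrivial

theorem isLocalRing_gradedCompletion (hJ : Satisfies J (0 : Fin d → O)) :
    IsLocalRing (GradedCompletion O J) := by
  have := nontrivial_gradedCompletion J hJ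
  obtain ⟨ψ, -, hψ⟩ := exists_gradedCompletion_surjective J
  exact IsLocalRing.of_surjective' (ψ : MvPowerSeries (Fin d) O →+* GradedCompletion O J) hψ

theorem isCNL_gradedCompletion [IsLocalRing (GradedCompletion O J)] :
    IsCNL O (GradedCompletion O J) := by
  obtain ⟨ψ, -, hψ⟩ := exists_gradedCompletion_surjective J
  exact IsCNL.of_surjective ψ hψ

theorem isLocalModel_gradedPoint [IsLocalRing (GradedCompletion O J)] :
    IsLocalModel J (0 : Fin d → O) (gradedPoint J) := by
  obtain ⟨ψ, hψX, hψ⟩ := exists_gradedCompletion_surjective J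
  have hC := isCNL_gradedCompletion J
  have hloc : ∀ x ∈ maximalIdeal (MvPowerSeries (Fin d) O), ψ x ∈ maximalIdeal _ := fun x hx =>
    map_mem_maximalIdeal (IsCNL.residue_surjective (O := O)) ψ hx
  refine ⟨satisfies_gradedPoint J, fun k => ?_, ?_, fun A _ _ _ _ p hp hpm => ?_⟩
  · rw [Pi.zero_apply, map_zero, sub_zero, ← hψX]
    exact hloc _ (X_mem_maximalIdeal k)
  · intro z hz
    obtain ⟨f, rfl⟩ := hψ z
    have hf : f ∈ maximalIdeal (MvPowerSeries (Fin d) O) := fun hu => hz (hu.map ψ)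
    have h1 := Ideal.mem_map_of_mem (ψ : MvPowerSeries (Fin d) O →+* GradedCompletion O J)
      (generates_X hf)
    rw [Ideal.map_sup, Ideal.map_map, Ideal.map_span, ← Set.range_comp] at h1
    have h2 : (ψ : MvPowerSeries (Fin d) O →+* GradedCompletion O J).comp (algebraMap O _) =
      algebraMap O _ := RingHom.ext fun o => ψ.commutes o
    rw [h2] at h1
    have h3 : (fun k => gradedPoint J k - algebraMap O (GradedCompletion O J) ((0 : Fin d → O) k)) =
        ψ ∘ MvPowerSeries.X := by
      funext k
      rw [Pi.zero_apply, map_zero, sub_zero]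
      exact (hψX k).symm
    rw [h3]
    exact h1
  · have : IsAdicComplete (maximalIdeal A) A := IsCNL.complete (O := O)
    obtain ⟨h, -, hh⟩ := exists_gradedCompletion_lift J (maximalIdeal A) hp
      (fun k => by simpa using hpm k)
    exact ⟨h, hh⟩

end Local

theorem coeff_eq_zero_of_mem_span_X_pow {τ : Type*} {n : ℕ} {f : MvPowerSeries τ O}
    (hf : f ∈ Ideal.span (Set.range (MvPowerSeries.X : τ → MvPowerSeries τ O)) ^ n) {x : τ →₀ ℕ}
    (hx : x.degree < n) : MvPowerSeries.coeff x f = 0 := by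
  suffices h : (n : ℕ∞) ≤ f.order from MvPowerSeries.coeff_of_lt_order
    (lt_of_lt_of_le (by exact_mod_cast hx) h)
  clear hx
  refine Submodule.pow_induction_on_left' _
    (C := fun n f _ => (n : ℕ∞) ≤ MvPowerSeries.order f) ?_ ?_ ?_ hf
  · intro r; simp
  · intro f g n _ _ h1 h2
    exact (le_min h1 h2).trans MvPowerSeries.min_order_le_add
  · intro m hm n f _ hn
    refine le_trans ?_ MvPowerSeries.le_order_mul
    rw [Nat.succ_eq_add_one, Nat.cast_add, Nat.cast_one, add_comm]
    refine add_le_add ?_ hn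
    rw [MvPowerSeries.one_le_order_iff_constCoeff_eq_zero]
    have : Ideal.span (Set.range (MvPowerSeries.X : τ → MvPowerSeries τ O)) ≤
        RingHom.ker (MvPowerSeries.constantCoeff (σ := τ) (R := O)) := by
      rw [Ideal.span_le]
      rintro _ ⟨i, rfl⟩
      exact MvPowerSeries.constantCoeff_X i
    exact this hm

theorem mem_map_pow_of_evalₐ_eq_zero {S : Type*} [CommRing S] {I : Ideal S} (hI : I.FG) {n : ℕ}
    {a : AdicCompletion I S} (ha : AdicCompletion.evalₐ I n a = 0) :
    a ∈ (I.map (algebraMap S (AdicCompletion I S))) ^ n := by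
  have h : a ∈ (AdicCompletion.eval I S n).ker := by
    rw [LinearMap.mem_ker]
    have := AdicCompletion.factor_evalₐ_eq_eval (I := I) a (n := n) (by simp)
    rw [ha, map_zero] at this
    exact this.symm
  rw [← AdicCompletion.pow_smul_top_eq_ker_eval hI] at h
  have h2 := Ideal.smul_top_eq_map (S := AdicCompletion I S) (I ^ n)
  rw [Ideal.map_pow] at h2
  exact (h2 ▸ h : a ∈ Submodule.restrictScalars S _)

theorem mk_mem_irrelevant_pow {τ : Type} {p : Fin d → MvPolynomial τ O}
    (hhom : ∀ k, (p k).IsHomogeneous 2) (hinj : ∀ f, MvPolynomial.aeval p f = 0 → f ∈ J) {n : ℕ}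
    {f : MvPolynomial (Fin d) O}
    (hf : ∀ x : τ →₀ ℕ, x.degree < 2 * n → (MvPolynomial.aeval p f).coeff x = 0) :
    Ideal.Quotient.mk J f ∈ irrelevant J ^ n := by
  have h4 : ∀ i < n, MvPolynomial.homogeneousComponent i f ∈ J := by
    intro i hi
    apply hinj
    have hh : ∀ j, (MvPolynomial.aeval p (MvPolynomial.homogeneousComponent j f)).IsHomogeneous
        (2 * j) := fun j =>
      (MvPolynomial.homogeneousComponent_isHomogeneous j f).aeval p hhom
    have h5 : MvPolynomial.homogeneousComponent (2 * i) (MvPolynomial.aeval p f) =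
        MvPolynomial.aeval p (MvPolynomial.homogeneousComponent i f) := by
      conv_lhs => rw [← MvPolynomial.sum_homogeneousComponent f, map_sum, map_sum]
      rw [Finset.sum_congr rfl fun j _ => MvPolynomial.homogeneousComponent_of_mem (hh j)]
      by_cases hif : i ∈ Finset.range (f.totalDegree + 1)
      · rw [Finset.sum_eq_single_of_mem i hif (fun j _ hj => if_neg (by omega)), if_pos rfl]
      · rw [MvPolynomial.homogeneousComponent_eq_zero i f (by simpa using hif), map_zero]
        refine Finset.sum_eq_zero fun j hj => if_neg fun h => hif ?_
        have : j = i := by omega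
        exact this ▸ hj
    rw [← h5]
    ext x
    rw [MvPolynomial.coeff_homogeneousComponent, MvPolynomial.coeff_zero]
    split_ifs with hx
    · exact hf x (by omega)
    · rfl
  rw [← MvPolynomial.sum_homogeneousComponent f, map_sum]
  refine sum_mem fun i _ => ?_
  by_cases hi : i < n
  · rw [Ideal.Quotient.eq_zero_iff_mem.mpr (h4 i hi)]
    exact zero_mem _
  · have h6 : MvPolynomial.homogeneousComponent i f ∈ MvPolynomial.idealOfVars (Fin d) O ^ n := by
      rw [MvPolynomial.mem_pow_idealOfVars_iff']
      intro x hx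
      rw [MvPolynomial.coeff_homogeneousComponent, if_neg (by omega)]
    have h7 := Ideal.mem_map_of_mem (Ideal.Quotient.mk J) h6
    rw [Ideal.map_pow, MvPolynomial.idealOfVars, Ideal.map_span, ← Set.range_comp] at h7
    exact h7

theorem mem_span_X_pow_of_isHomogeneous {τ : Type} [Finite τ] {g : MvPolynomial τ O} {n : ℕ}
    (hg : g.IsHomogeneous n) : (g : MvPowerSeries τ O) ∈
      Ideal.span (Set.range (MvPowerSeries.X : τ → MvPowerSeries τ O)) ^ n :=
  mem_span_X_pow_of_coeff_eq_zero fun x hx => by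
    rw [MvPolynomial.coeff_coe]
    exact hg.coeff_eq_zero hx.ne

/-- A homogeneous parametrisation of degree two that is injective on the graded ring stays injective
on the completion. -/
theorem exists_gradedCompletion_embedding {τ : Type} [Finite τ] {p : Fin d → MvPolynomial τ O}
    (hp : Satisfies J p) (hhom : ∀ k, (p k).IsHomogeneous 2)
    (hinj : ∀ f, MvPolynomial.aeval p f = 0 → f ∈ J) :
    ∃ θ : GradedCompletion O J →ₐ[O] MvPowerSeries τ O, Function.Injective θ := by
  have hmem := fun k => mem_span_X_pow_of_isHomogeneous (hhom k)
  have hp' : Satisfies J (fun k => (p k : MvPowerSeries τ O)) := by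
    have h := hp.map (MvPolynomial.aeval (R := O) (MvPowerSeries.X : τ → MvPowerSeries τ O))
    simpa only [← coe_eq_aeval] using h
  obtain ⟨θ, hθ, hθX⟩ := exists_gradedCompletion_lift J
    (Ideal.span (Set.range (MvPowerSeries.X : τ → MvPowerSeries τ O))) hp'
    (fun k => Ideal.pow_le_self two_ne_zero (hmem k))
  refine ⟨θ, (injective_iff_map_eq_zero θ).mpr fun a ha => ?_⟩
  refine AdicCompletion.ext_evalₐ fun n => ?_
  obtain ⟨s, hs⟩ := Ideal.Quotient.mk_surjective (AdicCompletion.evalₐ (irrelevant J) n a)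
  obtain ⟨f, rfl⟩ := Ideal.Quotient.mk_surjective s
  rw [map_zero, ← hs, Ideal.Quotient.eq_zero_iff_mem]
  have h1 : a - AdicCompletion.of (irrelevant J) _ (Ideal.Quotient.mk J f) ∈
      Ideal.span (Set.range (gradedPoint J)) ^ n := by
    rw [← map_irrelevant]
    refine mem_map_pow_of_evalₐ_eq_zero (irrelevant_fg J) ?_
    rw [map_sub, ← hs, AdicCompletion.evalₐ_of, sub_self]
  have h2 : θ (AdicCompletion.of (irrelevant J) _ (Ideal.Quotient.mk J f)) =
      (MvPolynomial.aeval p f : MvPolynomial τ O) := by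
    rw [hθ]
    change MvPolynomial.aeval _ f = _
    rw [coe_eq_aeval, MvPolynomial.comp_aeval_apply]
    simp only [← coe_eq_aeval]
  have h4 : (Ideal.span (Set.range (gradedPoint J)) ^ n).map
      (θ : GradedCompletion O J →+* MvPowerSeries τ O) ≤
      Ideal.span (Set.range (MvPowerSeries.X : τ → MvPowerSeries τ O)) ^ (2 * n) := by
    rw [Ideal.map_pow, pow_mul]
    refine Ideal.pow_right_mono ?_ n
    rw [Ideal.map_span, Ideal.span_le]
    rintro _ ⟨_, ⟨k, rfl⟩, rfl⟩
    exact (hθX k).symm ▸ hmem k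
  have h5 := h4 (Ideal.mem_map_of_mem (θ : GradedCompletion O J →+* MvPowerSeries τ O) h1)
  rw [RingHom.coe_coe, map_sub, ha, zero_sub, h2] at h5
  refine mk_mem_irrelevant_pow J hhom hinj fun x hx => ?_
  rw [← MvPolynomial.coeff_coe]
  exact coeff_eq_zero_of_mem_span_X_pow (neg_mem_iff.mp h5) hx

end GradedCompletion

/-! ### The two vertex models -/

section Combinatorics

theorem plucker_pattern {P Y A Z Q C : ℕ} (f1 : P = 0 ∨ A = 0) (f2 : Y = 0 ∨ A = 0)
    (f3 : Y = 0 ∨ Z = 0) (f4 : Y = 0 ∨ C = 0) (f5 : Q = 0 ∨ C = 0) :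
    (A = 0 ∧ Z = 0 ∧ C = 0) ∨ (Y = 0 ∧ (P = 0 ∨ A = 0) ∧ (Q = 0 ∨ C = 0)) := by tauto

theorem segre_pattern {a2 a3 a4 b1 b2 b3 : ℕ} (f1 : a2 = 0 ∨ b1 = 0) (f2 : a3 = 0 ∨ b1 = 0)
    (f3 : a4 = 0 ∨ b1 = 0) (f4 : a3 = 0 ∨ b2 = 0) (f5 : a4 = 0 ∨ b2 = 0) (f6 : a4 = 0 ∨ b3 = 0) :
    (b1 = 0 ∧ b2 = 0 ∧ b3 = 0) ∨ (a4 = 0 ∧ b1 = 0 ∧ b2 = 0) ∨ (a4 = 0 ∧ a3 = 0 ∧ b1 = 0) ∨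
      (a2 = 0 ∧ a3 = 0 ∧ a4 = 0) := by tauto

set_option maxHeartbeats 1000000 in
/-- A semistandard tableau with two rows is determined by the contents of its rows. -/
theorem plucker_unique (T B P Y A Z Q C D U T' B' P' Y' A' Z' Q' C' D' U' : ℕ)
    (f1 : P = 0 ∨ A = 0) (f2 : Y = 0 ∨ A = 0) (f3 : Y = 0 ∨ Z = 0) (f4 : Y = 0 ∨ C = 0)
    (f5 : Q = 0 ∨ C = 0) (g1 : P' = 0 ∨ A' = 0) (g2 : Y' = 0 ∨ A' = 0) (g3 : Y' = 0 ∨ Z' = 0)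
    (g4 : Y' = 0 ∨ C' = 0) (g5 : Q' = 0 ∨ C' = 0) (u1 : T + B + P + Y = T' + B' + P' + Y')
    (u2 : A + Z + Q = A' + Z' + Q') (u3 : C + D = C' + D') (u4 : U = U') (v2 : T = T')
    (v3 : B + A = B' + A') (v4 : P + Z + C = P' + Z' + C')
    (v5 : Y + Q + D + U = Y' + Q' + D' + U') :
    B = B' ∧ P = P' ∧ Y = Y' ∧ A = A' ∧ Z = Z' ∧ Q = Q' ∧ C = C' ∧ D = D' := by
  have h1 := plucker_pattern f1 f2 f3 f4 f5
  have h2 := plucker_pattern g1 g2 g3 g4 g5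
  clear f1 f2 f3 f4 f5 g1 g2 g3 g4 g5
  subst u4 v2
  rcases h1 with ⟨rfl, rfl, rfl⟩ | ⟨rfl, rfl | rfl, rfl | rfl⟩ <;>
  rcases h2 with ⟨rfl, rfl, rfl⟩ | ⟨rfl, rfl | rfl, rfl | rfl⟩ <;>
  (refine ⟨?_, ?_, ?_, ?_, ?_, ?_, ?_, ?_⟩ <;> omega)

set_option maxHeartbeats 1000000 in
/-- A standard two-rowed array is determined by its row and column sums. -/
theorem segre_unique (a1 a2 a3 a4 b1 b2 b3 b4 c1 c2 c3 c4 d1 d2 d3 d4 : ℕ)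
    (f1 : a2 = 0 ∨ b1 = 0) (f2 : a3 = 0 ∨ b1 = 0) (f3 : a4 = 0 ∨ b1 = 0) (f4 : a3 = 0 ∨ b2 = 0)
    (f5 : a4 = 0 ∨ b2 = 0) (f6 : a4 = 0 ∨ b3 = 0) (g1 : c2 = 0 ∨ d1 = 0) (g2 : c3 = 0 ∨ d1 = 0)
    (g3 : c4 = 0 ∨ d1 = 0) (g4 : c3 = 0 ∨ d2 = 0) (g5 : c4 = 0 ∨ d2 = 0) (g6 : c4 = 0 ∨ d3 = 0)
    (h1 : a1 + b1 = c1 + d1) (h2 : a2 + b2 = c2 + d2) (h3 : a3 + b3 = c3 + d3)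
    (h4 : a4 + b4 = c4 + d4) (h5 : a1 + a2 + a3 + a4 = c1 + c2 + c3 + c4) :
    a1 = c1 ∧ a2 = c2 ∧ a3 = c3 ∧ a4 = c4 := by
  have k1 := segre_pattern f1 f2 f3 f4 f5 f6
  have k2 := segre_pattern g1 g2 g3 g4 g5 g6
  clear f1 f2 f3 f4 f5 f6 g1 g2 g3 g4 g5 g6
  rcases k1 with ⟨rfl, rfl, rfl⟩ | ⟨rfl, rfl, rfl⟩ | ⟨rfl, rfl, rfl⟩ | ⟨rfl, rfl, rfl⟩ <;>
  rcases k2 with ⟨rfl, rfl, rfl⟩ | ⟨rfl, rfl, rfl⟩ | ⟨rfl, rfl, rfl⟩ | ⟨rfl, rfl, rfl⟩ <;>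
  (refine ⟨?_, ?_, ?_, ?_⟩ <;> omega)

end Combinatorics

section Vertex

variable {O : Type u} [CommRing O] [IsLocalRing O]

open MvPolynomial

/-- The variables in the first row. -/
def row₁ (i : Fin 5) : Fin 10 := ⟨i.val, by omega⟩

/-- The variables in the second row. -/
def row₂ (i : Fin 5) : Fin 10 := ⟨5 + i.val, by omega⟩

theorem row₁_lt_row₂ (i j : Fin 5) : row₁ i < row₂ j := by
  rw [Fin.lt_def]
  simp only [row₁, row₂]
  omega

/-- The minors of a generic matrix with two rows and five columns. -/
def minor (O : Type u) [CommRing O] (i j : Fin 5) : MvPolynomial (Fin 10) O :=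
  X (row₁ i) * X (row₂ j) - X (row₁ j) * X (row₂ i)

theorem minor_isHomogeneous (i j : Fin 5) : (minor O i j).IsHomogeneous 2 :=
  ((isHomogeneous_X _ _).mul (isHomogeneous_X _ _)).sub
    ((isHomogeneous_X _ _).mul (isHomogeneous_X _ _))

theorem degree_X_mul_X [Nontrivial O] [NoZeroDivisors O] {τ : Type*} (ord : MonomialOrder τ)
    (a b : τ) : ord.degree (X a * X b : MvPolynomial τ O) =
      Finsupp.single a 1 + Finsupp.single b 1 := by
  rw [ord.degree_mul (X_ne_zero _) (X_ne_zero _), ord.degree_X, ord.degree_X]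

theorem degree_minor [IsDomain O] {i j : Fin 5} (h : i < j) :
    MonomialOrder.lex.degree (minor O i j) =
      Finsupp.single (row₁ i) 1 + Finsupp.single (row₂ j) 1 := by
  rw [minor, sub_eq_add_neg, MonomialOrder.degree_add_of_lt, degree_X_mul_X]
  rw [MonomialOrder.degree_neg, degree_X_mul_X, degree_X_mul_X, MonomialOrder.lex_lt_iff,
    Finsupp.Lex.lt_iff]
  have hij : row₁ j ≠ row₁ i := fun h' => h.ne' (Fin.ext (congrArg Fin.val h' :))
  refine ⟨row₁ i, fun k hk => ?_, ?_⟩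
  · have h1 : row₁ i ≠ k := hk.ne'
    have h2 : row₁ j ≠ k := (hk.trans h).ne'
    have h3 : ∀ l, row₂ l ≠ k := fun l => (hk.trans (row₁_lt_row₂ i l)).ne'
    simp [h1, h2, h3]
  · simp [hij, fun l => (row₁_lt_row₂ i l).ne']

theorem minor_ne_zero [IsDomain O] {i j : Fin 5} (h : i < j) : minor O i j ≠ 0 := by
  intro h0
  have := degree_minor (O := O) h
  rw [h0, MonomialOrder.degree_zero] at this
  have := DFunLike.congr_fun this (row₁ i)
  simp [(row₁_lt_row₂ i j).ne'] at this

/-- The Plücker parametrisation of the first model. -/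
def pluckerPoint (c : O) : Fin 10 → MvPolynomial (Fin 10) O :=
  ![minor O 1 2, minor O 0 2, minor O 2 3, minor O 2 4,
    3 * C c * (minor O 0 3 - minor O 1 4), minor O 0 1, minor O 3 4,
    3 * C c * (-minor O 1 4 - minor O 0 3), -minor O 0 4, minor O 1 3]

theorem sum_fin_ten {M : Type*} [AddCommMonoid M] (f : Fin 10 → M) : ∑ k, f k =
    f 0 + f 1 + f 2 + f 3 + f 4 + f 5 + f 6 + f 7 + f 8 + f 9 := by
  rw [Fin.sum_univ_castSucc, Fin.sum_univ_castSucc, Fin.sum_univ_eight]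
  rfl

theorem plucker_relation (i j k l : Fin 5) :
    minor O i j * minor O k l - minor O i k * minor O j l + minor O i l * minor O j k = 0 := by
  simp only [minor]; ring

theorem satisfies_pluckerPoint {c : O} (hc : 6 * c = 1) : Satisfies (ideal22 O) (pluckerPoint c) := by
  have hc' : (6 : MvPolynomial (Fin 10) O) * C c = 1 := by
    rw [← C_1, ← hc, C_mul, map_ofNat]
  have h1 := plucker_relation (O := O) 0 1 2 3
  have h2 := plucker_relation (O := O) 0 1 2 4
  have h3 := plucker_relation (O := O) 0 1 3 4
  have h4 := plucker_relation (O := O) 0 2 3 4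
  have h5 := plucker_relation (O := O) 1 2 3 4
  rw [satisfies_ideal22_iff]
  simp only [pluckerPoint, Matrix.cons_val]
  refine ⟨⟨?_, ?_⟩, ⟨?_, ?_⟩, ?_⟩
  · linear_combination h1 + minor O 0 3 * minor O 1 2 * hc'
  · linear_combination h2 - minor O 1 4 * minor O 0 2 * hc'
  · linear_combination h5 + minor O 1 4 * minor O 2 3 * hc'
  · linear_combination h4 - minor O 0 3 * minor O 2 4 * hc'
  · linear_combination h3 - minor O 0 3 * minor O 1 4 * (6 * C c + 1) * hc'

theorem pluckerPoint_isHomogeneous (c : O) (k : Fin 10) : (pluckerPoint c k).IsHomogeneous 2 := by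
  have hs : ∀ f : MvPolynomial (Fin 10) O, f.IsHomogeneous 2 →
      (3 * C c * f).IsHomogeneous 2 := fun f hf => by
    have : (3 * C c : MvPolynomial (Fin 10) O) = C (3 * c) := by rw [C_mul, map_ofNat]
    rw [this]
    simpa using (isHomogeneous_C (Fin 10) (3 * c)).mul hf
  have hm := fun i j => minor_isHomogeneous (O := O) i j
  fin_cases k
  · exact hm 1 2
  · exact hm 0 2
  · exact hm 2 3
  · exact hm 2 4
  · exact hs _ ((hm 0 3).sub (hm 1 4))
  · exact hm 0 1
  · exact hm 3 4
  · exact hs _ ((hm 1 4).neg.sub (hm 0 3))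
  · exact (hm 0 4).neg
  · exact hm 1 3

theorem adjoin_eq_top_of_mk_X_mem {κ : Type*} (J : Ideal (MvPolynomial κ O))
    {A : Subalgebra O (MvPolynomial κ O ⧸ J)} (hA : ∀ k, Ideal.Quotient.mk J (X k) ∈ A) : A = ⊤ := by
  rw [eq_top_iff]
  rintro s -
  obtain ⟨f, rfl⟩ := Ideal.Quotient.mk_surjective s
  have h1 : Ideal.Quotient.mk J f = aeval (fun k => Ideal.Quotient.mk J (X k)) f := by
    have := comp_aeval_apply X (Ideal.Quotient.mkₐ O J) f
    rw [aeval_X_left, AlgHom.id_apply] at this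
    exact this
  rw [h1]
  exact Algebra.adjoin_le (Set.range_subset_iff.mpr hA)
    (by rw [Algebra.adjoin_range_eq_range_aeval]; exact ⟨f, rfl⟩)

theorem forall_list_mem {κ : Type*} {l : List (κ × κ)} {P : κ → κ → Prop} :
    (∀ a b, (a, b) ∈ l → P a b) ↔ ∀ x ∈ l, P x.1 x.2 :=
  ⟨fun h _ hx => h _ _ hx, fun h a b hab => h (a, b) hab⟩

theorem mem_ideal22_of_aeval_eq_zero [IsDomain O] {c : O} (hc : 6 * c = 1)
    (f : MvPolynomial (Fin 10) O) (hf : aeval (pluckerPoint c) f = 0) : f ∈ ideal22 O := by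
  let θ : (MvPolynomial (Fin 10) O ⧸ ideal22 O) →ₐ[O] MvPolynomial (Fin 10) O :=
    Ideal.Quotient.liftₐ (ideal22 O) (aeval (pluckerPoint c)) (satisfies_pluckerPoint hc)
  let x : Fin 10 → MvPolynomial (Fin 10) O ⧸ ideal22 O := fun k => Ideal.Quotient.mk _ (X k)
  have hθx : ∀ k, θ (x k) = pluckerPoint c k := fun k => aeval_X _ _
  have hc' : (6 : MvPolynomial (Fin 10) O) * C c = 1 := by
    rw [← C_1, ← hc, C_mul, map_ofNat]
  let y : Fin 10 → MvPolynomial (Fin 10) O ⧸ ideal22 O :=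
    ![x 5, x 1, x 4 - x 7, -x 8, x 0, x 9, -(x 4 + x 7), x 2, x 3, x 6]
  let α : Fin 10 → Fin 5 × Fin 5 :=
    ![(0, 1), (0, 2), (0, 3), (0, 4), (1, 2), (1, 3), (1, 4), (2, 3), (2, 4), (3, 4)]
  have hα : ∀ k, (α k).1 < (α k).2 := by decide
  have hθy : ∀ k, θ (y k) = minor O (α k).1 (α k).2 := by
    rw [forall_fin_ten]
    simp only [y, α, Matrix.cons_val, map_neg, map_sub, map_add, hθx, pluckerPoint]
    refine ⟨trivial, trivial, ?_, neg_neg _, trivial, trivial, ?_, trivial, trivial, trivial⟩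
    · linear_combination minor O 0 3 * hc'
    · linear_combination minor O 1 4 * hc'
  suffices h : Function.Injective θ by
    rw [← Ideal.Quotient.eq_zero_iff_mem]
    exact (injective_iff_map_eq_zero θ).mp h _ hf
  have hrel : Satisfies (ideal22 O) x := fun g hg => by
    rw [← mk_eq_aeval, Ideal.Quotient.eq_zero_iff_mem.mpr hg]
  rw [satisfies_ideal22_iff] at hrel
  obtain ⟨⟨h1, h2⟩, ⟨h3, h4⟩, h5⟩ := hrel
  refine injective_of_standard_monomials y ?_ ![1, 4, 9, 16, 1, 4, 9, 1, 4, 1]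
    (fun a b => (a, b) ∈ [((2 : Fin 10), (4 : Fin 10)), (3, 4), (3, 5), (3, 7), (6, 7)]) ?_ ?_
    MonomialOrder.lex θ (fun k => Finsupp.single (row₁ (α k).1) 1 + Finsupp.single (row₂ (α k).2) 1)
    (fun k => by rw [hθy]; exact minor_ne_zero (hα k))
    (fun k => by rw [hθy]; exact degree_minor (hα k)) ?_
  · have hS : ∀ k, x k ∈ Algebra.adjoin O (Set.range y) := by
      have hy : ∀ k, y k ∈ Algebra.adjoin O (Set.range y) := fun k =>
        Algebra.subset_adjoin ⟨k, rfl⟩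
      have hcS : (6 : MvPolynomial (Fin 10) O ⧸ ideal22 O) * algebraMap O _ c = 1 := by
        rw [← map_one (algebraMap O _), ← hc, map_mul, map_ofNat]
      rw [forall_fin_ten]
      refine ⟨hy 4, hy 1, hy 7, hy 8, ?_, hy 0, hy 9, ?_, ?_, hy 5⟩
      · have : x 4 = algebraMap O _ (3 * c) * (y 2 - y 6) := by
          simp only [y, Matrix.cons_val, map_mul, map_ofNat]
          linear_combination -x 4 * hcS
        rw [this]
        exact mul_mem (Subalgebra.algebraMap_mem _ _) (sub_mem (hy 2) (hy 6))
      · have : x 7 = algebraMap O _ (3 * c) * (-y 6 - y 2) := by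
          simp only [y, Matrix.cons_val, map_mul, map_ofNat]
          linear_combination -x 7 * hcS
        rw [this]
        exact mul_mem (Subalgebra.algebraMap_mem _ _) (sub_mem (neg_mem (hy 6)) (hy 2))
      · have : x 8 = -y 3 := (neg_neg _).symm
        rw [this]
        exact neg_mem (hy 3)
    exact adjoin_eq_top_of_mk_X_mem (ideal22 O) hS
  · decide
  · rw [forall_list_mem]
    have key : ∀ (a b c d e f : Fin 10), y a * y b = y c * y d - y e * y f →
        ![1, 4, 9, 16, 1, 4, 9, 1, 4, 1] c + ![1, 4, 9, 16, 1, 4, 9, 1, 4, 1] d <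
          ![1, 4, 9, 16, 1, 4, 9, 1, 4, 1] a + ![1, 4, 9, 16, 1, 4, 9, 1, 4, 1] b →
        ![1, 4, 9, 16, 1, 4, 9, 1, 4, 1] e + ![1, 4, 9, 16, 1, 4, 9, 1, 4, 1] f <
          ![1, 4, 9, 16, 1, 4, 9, 1, 4, 1] a + ![1, 4, 9, 16, 1, 4, 9, 1, 4, 1] b →
        y a * y b ∈ Submodule.span O {z | ∃ c d, ![1, 4, 9, 16, 1, 4, 9, 1, 4, 1] c +
          ![1, 4, 9, 16, 1, 4, 9, 1, 4, 1] d < ![1, 4, 9, 16, 1, 4, 9, 1, 4, 1] a +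
          ![1, 4, 9, 16, 1, 4, 9, 1, 4, 1] b ∧ z = y c * y d} :=
      fun a b c d e f h hw hw' => by
        rw [h]
        exact sub_mem (Submodule.subset_span ⟨c, d, hw, rfl⟩)
          (Submodule.subset_span ⟨e, f, hw', rfl⟩)
    simp only [List.forall_mem_cons, List.not_mem_nil, IsEmpty.forall_iff, implies_true, and_true]
    refine ⟨key _ _ 1 5 0 7 ?_ (by decide) (by decide), key _ _ 1 6 0 8 ?_ (by decide) (by decide),
      key _ _ 2 6 0 9 ?_ (by decide) (by decide), key _ _ 2 8 1 9 ?_ (by decide) (by decide),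
      key _ _ 5 8 4 9 ?_ (by decide) (by decide)⟩ <;> simp only [y, Matrix.cons_val]
    · linear_combination h1
    · linear_combination h2
    · linear_combination h5
    · linear_combination h4
    · linear_combination h3
  · intro m m' hm hm' h
    rw [forall_list_mem] at hm hm'
    simp only [List.forall_mem_cons, List.not_mem_nil, IsEmpty.forall_iff, implies_true,
      and_true] at hm hm'
    obtain ⟨f1, f2, f3, f4, f5⟩ := hm
    obtain ⟨g1, g2, g3, g4, g5⟩ := hm'
    have hu : ∀ t, ∑ k, m k * ((if row₁ (α k).1 = t then 1 else 0) +
        if row₂ (α k).2 = t then 1 else 0) = ∑ k, m' k * ((if row₁ (α k).1 = t then 1 else 0) +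
        if row₂ (α k).2 = t then 1 else 0) := fun t => by
      simpa [Finsupp.single_apply, mul_add] using DFunLike.congr_fun h t
    simp only [sum_fin_ten] at hu
    have u1 : m 0 + m 1 + m 2 + m 3 = m' 0 + m' 1 + m' 2 + m' 3 := by simpa [α, row₁, row₂] using hu 0
    have u2 : m 4 + m 5 + m 6 = m' 4 + m' 5 + m' 6 := by simpa [α, row₁, row₂] using hu 1
    have u3 : m 7 + m 8 = m' 7 + m' 8 := by simpa [α, row₁, row₂] using hu 2
    have u4 : m 9 = m' 9 := by simpa [α, row₁, row₂] using hu 3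
    have v2 : m 0 = m' 0 := by simpa [α, row₁, row₂] using hu 6
    have v3 : m 1 + m 4 = m' 1 + m' 4 := by simpa [α, row₁, row₂] using hu 7
    have v4 : m 2 + m 5 + m 7 = m' 2 + m' 5 + m' 7 := by simpa [α, row₁, row₂] using hu 8
    have v5 : m 3 + m 6 + m 8 + m 9 = m' 3 + m' 6 + m' 8 + m' 9 := by
      simpa [α, row₁, row₂] using hu 9
    obtain ⟨e1, e2, e3, e4, e5, e6, e7, e8⟩ := plucker_unique _ _ _ _ _ _ _ _ _ _ _ _ _ _ _ _ _ _
      _ _ f1 f2 f3 f4 f5 g1 g2 g3 g4 g5 u1 u2 u3 u4 v2 v3 v4 v5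
    funext k
    revert k
    rw [forall_fin_ten]
    exact ⟨v2, e1, e2, e3, e4, e5, e6, e7, e8, u4⟩

theorem satisfies_zero_22 : Satisfies (ideal22 O) (0 : Fin 10 → O) := by
  rw [satisfies_ideal22_iff]; simp

theorem exists_embedding_22 [IsDomain O] {c : O} (hc : 6 * c = 1) :
    ∃ θ : Rhat22 O →ₐ[O] MvPowerSeries (Fin 10) O, Function.Injective θ :=
  exists_gradedCompletion_embedding _ (satisfies_pluckerPoint hc) (pluckerPoint_isHomogeneous c)
    (mem_ideal22_of_aeval_eq_zero hc)

/-- The Segre parametrisation of the second model. -/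
def segrePoint (c : O) : Fin 8 → MvPolynomial (Fin 10) O :=
  ![X 0 * X 2, X 1 * X 2, X 1 * X 5, -(X 0 * X 5), 3 * C c * (X 1 * X 3 + X 0 * X 4),
    3 * C c * (X 0 * X 4 - X 1 * X 3), X 1 * X 4, X 0 * X 3]

theorem satisfies_segrePoint {c : O} (hc : 6 * c = 1) : Satisfies (ideal121 O) (segrePoint c) := by
  have hc' : (6 : MvPolynomial (Fin 10) O) * C c = 1 := by
    rw [← C_1, ← hc, C_mul, map_ofNat]
  rw [satisfies_ideal121_iff]
  simp only [segrePoint, Matrix.cons_val]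
  refine ⟨⟨⟨?_, ?_⟩, ?_, ?_⟩, ?_, ?_⟩
  · linear_combination -(X 0 * X 2 * X 1 * X 3) * hc'
  · linear_combination -(X 0 * X 2 * X 1 * X 4) * hc'
  · linear_combination (X 1 * X 5 * X 0 * X 4) * hc'
  · linear_combination -(X 0 * X 5 * X 1 * X 3) * hc'
  · ring
  · linear_combination (X 1 * X 3 * X 0 * X 4) * (6 * C c + 1) * hc'

theorem segrePoint_isHomogeneous (c : O) (k : Fin 8) : (segrePoint c k).IsHomogeneous 2 := by
  have hs : ∀ f : MvPolynomial (Fin 10) O, f.IsHomogeneous 2 →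
      (3 * C c * f).IsHomogeneous 2 := fun f hf => by
    have : (3 * C c : MvPolynomial (Fin 10) O) = C (3 * c) := by rw [C_mul, map_ofNat]
    rw [this]
    simpa using (isHomogeneous_C (Fin 10) (3 * c)).mul hf
  have hm : ∀ i j, (X i * X j : MvPolynomial (Fin 10) O).IsHomogeneous 2 := fun i j =>
    (isHomogeneous_X _ _).mul (isHomogeneous_X _ _)
  fin_cases k
  · exact hm 0 2
  · exact hm 1 2
  · exact hm 1 5
  · exact (hm 0 5).neg
  · exact hs _ ((hm 1 3).add (hm 0 4))
  · exact hs _ ((hm 0 4).sub (hm 1 3))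
  · exact hm 1 4
  · exact hm 0 3

theorem mem_ideal121_of_aeval_eq_zero [IsDomain O] {c : O} (hc : 6 * c = 1)
    (f : MvPolynomial (Fin 8) O) (hf : aeval (segrePoint c) f = 0) : f ∈ ideal121 O := by
  let θ : (MvPolynomial (Fin 8) O ⧸ ideal121 O) →ₐ[O] MvPolynomial (Fin 10) O :=
    Ideal.Quotient.liftₐ (ideal121 O) (aeval (segrePoint c)) (satisfies_segrePoint hc)
  let x : Fin 8 → MvPolynomial (Fin 8) O ⧸ ideal121 O := fun k => Ideal.Quotient.mk _ (X k)
  have hθx : ∀ k, θ (x k) = segrePoint c k := fun k => aeval_X _ _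
  have hc' : (6 : MvPolynomial (Fin 10) O) * C c = 1 := by
    rw [← C_1, ← hc, C_mul, map_ofNat]
  let y : Fin 8 → MvPolynomial (Fin 8) O ⧸ ideal121 O :=
    ![x 0, x 7, x 4 + x 5, -x 3, x 1, x 4 - x 5, x 6, x 2]
  let α : Fin 8 → Fin 10 × Fin 10 :=
    ![(0, 2), (0, 3), (0, 4), (0, 5), (1, 2), (1, 3), (1, 4), (1, 5)]
  have hθy : ∀ k, θ (y k) = X (α k).1 * X (α k).2 := by
    rw [forall_fin_eight]
    simp only [y, α, Matrix.cons_val, map_neg, map_sub, map_add, hθx, segrePoint]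
    refine ⟨trivial, trivial, ?_, neg_neg _, trivial, ?_, trivial, trivial⟩
    · linear_combination X 0 * X 4 * hc'
    · linear_combination X 1 * X 3 * hc'
  suffices h : Function.Injective θ by
    rw [← Ideal.Quotient.eq_zero_iff_mem]
    exact (injective_iff_map_eq_zero θ).mp h _ hf
  have hrel : Satisfies (ideal121 O) x := fun g hg => by
    rw [← mk_eq_aeval, Ideal.Quotient.eq_zero_iff_mem.mpr hg]
  rw [satisfies_ideal121_iff] at hrel
  obtain ⟨⟨⟨h1, h2⟩, h3, h4⟩, h5, h6⟩ := hrel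
  refine injective_of_standard_monomials y ?_ ![0, 1, 2, 3, 0, 0, 0, 0]
    (fun a b => (a, b) ∈ [((1 : Fin 8), (4 : Fin 8)), (2, 4), (3, 4), (2, 5), (3, 5), (3, 6)]) ?_ ?_
    MonomialOrder.lex θ (fun k => Finsupp.single (α k).1 1 + Finsupp.single (α k).2 1)
    (fun k => by rw [hθy]; exact mul_ne_zero (X_ne_zero _) (X_ne_zero _))
    (fun k => by rw [hθy]; exact degree_X_mul_X _ _ _) ?_
  · have hS : ∀ k, x k ∈ Algebra.adjoin O (Set.range y) := by
      have hy : ∀ k, y k ∈ Algebra.adjoin O (Set.range y) := fun k =>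
        Algebra.subset_adjoin ⟨k, rfl⟩
      have hcS : (6 : MvPolynomial (Fin 8) O ⧸ ideal121 O) * algebraMap O _ c = 1 := by
        rw [← map_one (algebraMap O _), ← hc, map_mul, map_ofNat]
      rw [forall_fin_eight]
      refine ⟨hy 0, hy 4, hy 7, ?_, ?_, ?_, hy 6, hy 1⟩
      · have : x 3 = -y 3 := (neg_neg _).symm
        rw [this]
        exact neg_mem (hy 3)
      · have : x 4 = algebraMap O _ (3 * c) * (y 2 + y 5) := by
          simp only [y, Matrix.cons_val, map_mul, map_ofNat]
          linear_combination -x 4 * hcS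
        rw [this]
        exact mul_mem (Subalgebra.algebraMap_mem _ _) (add_mem (hy 2) (hy 5))
      · have : x 5 = algebraMap O _ (3 * c) * (y 2 - y 5) := by
          simp only [y, Matrix.cons_val, map_mul, map_ofNat]
          linear_combination -x 5 * hcS
        rw [this]
        exact mul_mem (Subalgebra.algebraMap_mem _ _) (sub_mem (hy 2) (hy 5))
    exact adjoin_eq_top_of_mk_X_mem (ideal121 O) hS
  · decide
  · rw [forall_list_mem]
    have key : ∀ (a b c d : Fin 8), y a * y b = y c * y d →
        ![0, 1, 2, 3, 0, 0, 0, 0] c + ![0, 1, 2, 3, 0, 0, 0, 0] d <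
          ![0, 1, 2, 3, 0, 0, 0, 0] a + ![0, 1, 2, 3, 0, 0, 0, 0] b →
        y a * y b ∈ Submodule.span O {z | ∃ c d, ![0, 1, 2, 3, 0, 0, 0, 0] c +
          ![0, 1, 2, 3, 0, 0, 0, 0] d < ![0, 1, 2, 3, 0, 0, 0, 0] a +
          ![0, 1, 2, 3, 0, 0, 0, 0] b ∧ z = y c * y d} :=
      fun a b c d h hw => by
        rw [h]
        exact Submodule.subset_span ⟨c, d, hw, rfl⟩
    simp only [List.forall_mem_cons, List.not_mem_nil, IsEmpty.forall_iff, implies_true, and_true]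
    refine ⟨key _ _ 0 5 ?_ (by decide), key _ _ 0 6 ?_ (by decide), key _ _ 0 7 ?_ (by decide),
      key _ _ 1 6 ?_ (by decide), key _ _ 1 7 ?_ (by decide), key _ _ 2 7 ?_ (by decide)⟩ <;>
      simp only [y, Matrix.cons_val]
    · linear_combination h1
    · linear_combination -h2
    · linear_combination -h5
    · linear_combination h6
    · linear_combination -h4
    · linear_combination -h3
  · intro m m' hm hm' h
    rw [forall_list_mem] at hm hm'
    simp only [List.forall_mem_cons, List.not_mem_nil, IsEmpty.forall_iff, implies_true,
      and_true] at hm hm'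
    obtain ⟨f1, f2, f3, f4, f5, f6⟩ := hm
    obtain ⟨g1, g2, g3, g4, g5, g6⟩ := hm'
    have hu : ∀ t, ∑ k, m k * ((if (α k).1 = t then 1 else 0) +
        if (α k).2 = t then 1 else 0) = ∑ k, m' k * ((if (α k).1 = t then 1 else 0) +
        if (α k).2 = t then 1 else 0) := fun t => by
      simpa [Finsupp.single_apply, mul_add] using DFunLike.congr_fun h t
    simp only [Fin.sum_univ_eight] at hu
    have u0 : m 0 + m 1 + m 2 + m 3 = m' 0 + m' 1 + m' 2 + m' 3 := by simpa [α] using hu 0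
    have u2 : m 0 + m 4 = m' 0 + m' 4 := by simpa [α] using hu 2
    have u3 : m 1 + m 5 = m' 1 + m' 5 := by simpa [α] using hu 3
    have u4 : m 2 + m 6 = m' 2 + m' 6 := by simpa [α] using hu 4
    have u5 : m 3 + m 7 = m' 3 + m' 7 := by simpa [α] using hu 5
    obtain ⟨e0, e1, e2, e3⟩ := segre_unique _ _ _ _ _ _ _ _ _ _ _ _ _ _ _ _
      f1 f2 f3 f4 f5 f6 g1 g2 g3 g4 g5 g6 u2 u3 u4 u5 u0
    funext k
    revert k
    rw [forall_fin_eight]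
    exact ⟨e0, e1, e2, e3, by omega, by omega, by omega, by omega⟩

theorem satisfies_zero_121 : Satisfies (ideal121 O) (0 : Fin 8 → O) := by
  rw [satisfies_ideal121_iff]; simp

theorem exists_embedding_121 [IsDomain O] {c : O} (hc : 6 * c = 1) :
    ∃ θ : Rhat121 O →ₐ[O] MvPowerSeries (Fin 10) O, Function.Injective θ :=
  exists_gradedCompletion_embedding _ (satisfies_segrePoint hc) (segrePoint_isHomogeneous c)
    (mem_ideal121_of_aeval_eq_zero hc)

end Vertex

/-! ### Fixed type rings in terms of the residual labels -/

section Cards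

theorem card_subtype_off {k : Type*} [Field k] {e : Fin 4 → k} (r : Fin 4 → Fin 4 → Prop)
    [∀ i j, Decidable (r i j)] (h : ∀ i j, e i = 1 * e j ↔ r i j) :
    Nat.card {p : Fin 4 × Fin 4 // e p.1 ≠ 1 * e p.2} =
      (Finset.univ.filter fun p : Fin 4 × Fin 4 => ¬ r p.1 p.2).card := by
  rw [← Fintype.card_subtype, ← Nat.card_eq_fintype_card]
  exact Nat.card_congr (Equiv.subtypeEquivRight fun p => not_congr (h _ _))

theorem powLabel_eq_iff {k : Type*} [Field k] {q : ℕ} (h : IsBanalIn k q) {t : k} (ht : t ≠ 0)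
    {n : Fin 4 → ℕ} (hn : ∀ i, n i ≤ 4) (i j : Fin 4) :
    powLabel q t n i = 1 * powLabel q t n j ↔ n i = n j := by
  rw [one_mul, powLabel, powLabel, mul_right_inj' ht]
  exact ⟨h.pow_inj (hn i) (hn j), fun h => by rw [h]⟩

end Cards

theorem IsBlock.eq_diagonal {k : Type*} [Field k] {e : Fin 4 → k} {M : Mat4 k} (h : IsBlock e M)
    (hM : ∀ i j, i ≠ j → M i j = 0) : M = Matrix.diagonal e := by
  have hd : M = Matrix.diagonal fun i => M i i := by
    ext i j
    by_cases hij : i = j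
    · rw [hij, Matrix.diagonal_apply_eq]
    · rw [hM i j hij, Matrix.diagonal_apply_ne _ hij]
  obtain ⟨m, hm⟩ := h.nil
  have he : ∀ i, M i i = e i := fun i => by
    have h1 := hm i i
    have h2 : M - e i • (1 : Mat4 k) = Matrix.diagonal fun j => M j j - e i := by
      conv_lhs => rw [hd]
      rw [Matrix.smul_one_eq_diagonal, Matrix.diagonal_sub]
    rw [h2, Matrix.diagonal_pow, Matrix.diagonal_apply_eq, Pi.pow_apply] at h1
    exact sub_eq_zero.mp (IsReduced.eq_zero _ ⟨m, h1⟩)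
  rw [hd]
  exact congrArg _ (funext he)

section EvalMat

variable {O : Type u} [CommRing O] [IsLocalRing O] {K : Type u} [Field K] [Algebra O K] {q : ℕ}
  {t : ResidueField O} (hq : IsBanalIn (ResidueField O) q) (ht : t ≠ 0) {r c : O}
  (hr : q * r = 1) (hc : 6 * c = 1) {A : Type u} [CommRing A] [Algebra O A]

theorem family22_evalMat_D (v : Fin 1 ⊕ Fin 10 → A) :
    evalMat (κ := Fin 1 ⊕ Fin 10) v (family22 O K q hq ht hr hc).D =
      !![(q : A) * (v (Sum.inl 0) + v (Sum.inr 4)), (q : A) * v (Sum.inr 5), 0, 0;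
        (q : A) * v (Sum.inr 6), (q : A) * (v (Sum.inl 0) - v (Sum.inr 4)), 0, 0;
        0, 0, v (Sum.inl 0) + v (Sum.inr 7), v (Sum.inr 8);
        0, 0, v (Sum.inr 9), v (Sum.inl 0) - v (Sum.inr 7)] := by
  refine (evalMat_of ..).trans ?_
  simp only [map_zero, map_mul, map_add, map_sub, map_natCast, MvPolynomial.aeval_X]

theorem family22_evalMat_N (v : Fin 1 ⊕ Fin 10 → A) :
    evalMat (κ := Fin 1 ⊕ Fin 10) v (family22 O K q hq ht hr hc).N =
      !![0, 0, v (Sum.inr 0), v (Sum.inr 1); 0, 0, v (Sum.inr 2), v (Sum.inr 3); 0, 0, 0, 0;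
        0, 0, 0, 0] := by
  refine (evalMat_of ..).trans ?_
  simp only [map_zero, MvPolynomial.aeval_X]

theorem family121_evalMat_D (v : Fin 1 ⊕ Fin 8 → A) :
    evalMat (κ := Fin 1 ⊕ Fin 8) v (family121 O K q hq ht hr hc).D =
      !![(q : A) ^ 2 * (v (Sum.inl 0) + v (Sum.inr 4)), 0, 0, 0;
        0, (q : A) * (v (Sum.inl 0) + v (Sum.inr 5)), (q : A) * v (Sum.inr 6), 0;
        0, (q : A) * v (Sum.inr 7), (q : A) * (v (Sum.inl 0) - v (Sum.inr 5)), 0;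
        0, 0, 0, v (Sum.inl 0) - v (Sum.inr 4)] := by
  refine (evalMat_of ..).trans ?_
  simp only [map_zero, map_mul, map_add, map_sub, map_pow, map_natCast, MvPolynomial.aeval_X]

theorem family121_evalMat_N (v : Fin 1 ⊕ Fin 8 → A) :
    evalMat (κ := Fin 1 ⊕ Fin 8) v (family121 O K q hq ht hr hc).N =
      !![0, v (Sum.inr 0), v (Sum.inr 1), 0; 0, 0, 0, v (Sum.inr 2); 0, 0, 0, v (Sum.inr 3);
        0, 0, 0, 0] := by
  refine (evalMat_of ..).trans ?_
  simp only [map_zero, MvPolynomial.aeval_X]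

theorem family22_mem (s₀ : Fin 1 → O) {p₀ : Fin 10 → O}
    (hu : ∀ k : Fin 10, k ≠ 4 → k ≠ 7 → p₀ k ∈ maximalIdeal O) :
    (∀ i j, i ≠ j → evalMat (κ := Fin 1 ⊕ Fin 10) (Sum.elim s₀ p₀)
      (family22 O K q hq ht hr hc).D i j ∈ maximalIdeal O) ∧
    ∀ i j, evalMat (κ := Fin 1 ⊕ Fin 10) (Sum.elim s₀ p₀)
      (family22 O K q hq ht hr hc).N i j ∈ maximalIdeal O := by
  rw [family22_evalMat_D, family22_evalMat_N]
  refine ⟨fun i j hij => ?_, fun i j => ?_⟩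
  · fin_cases i <;> fin_cases j <;> first
      | exact absurd rfl hij
      | exact zero_mem (maximalIdeal O)
      | exact Ideal.mul_mem_left _ _ (hu 5 (by decide) (by decide))
      | exact Ideal.mul_mem_left _ _ (hu 6 (by decide) (by decide))
      | exact hu 8 (by decide) (by decide)
      | exact hu 9 (by decide) (by decide)
  · fin_cases i <;> fin_cases j <;> first
      | exact zero_mem (maximalIdeal O)
      | exact hu 0 (by decide) (by decide)
      | exact hu 1 (by decide) (by decide)
      | exact hu 2 (by decide) (by decide)
      | exact hu 3 (by decide) (by decide)

theorem family121_mem (s₀ : Fin 1 → O) {p₀ : Fin 8 → O}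
    (hu : ∀ k : Fin 8, k ≠ 4 → k ≠ 5 → p₀ k ∈ maximalIdeal O) :
    (∀ i j, i ≠ j → evalMat (κ := Fin 1 ⊕ Fin 8) (Sum.elim s₀ p₀)
      (family121 O K q hq ht hr hc).D i j ∈ maximalIdeal O) ∧
    ∀ i j, evalMat (κ := Fin 1 ⊕ Fin 8) (Sum.elim s₀ p₀)
      (family121 O K q hq ht hr hc).N i j ∈ maximalIdeal O := by
  rw [family121_evalMat_D, family121_evalMat_N]
  refine ⟨fun i j hij => ?_, fun i j => ?_⟩
  · fin_cases i <;> fin_cases j <;> first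
      | exact absurd rfl hij
      | exact zero_mem (maximalIdeal O)
      | exact Ideal.mul_mem_left _ _ (hu 6 (by decide) (by decide))
      | exact Ideal.mul_mem_left _ _ (hu 7 (by decide) (by decide))
  · fin_cases i <;> fin_cases j <;> first
      | exact zero_mem (maximalIdeal O)
      | exact hu 0 (by decide) (by decide)
      | exact hu 1 (by decide) (by decide)
      | exact hu 2 (by decide) (by decide)
      | exact hu 3 (by decide) (by decide)

end EvalMat

section Rings

attribute [local instance] self_isCNL

variable {O : Type u} [CommRing O] [IsDomain O] [IsDiscreteValuationRing O] [Infinite O]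
  [IsAdicComplete (maximalIdeal O) O] {K : Type u} [Field K] [Algebra O K] {q : ℕ}
  {Ty : Mat4 K → Prop} {e : Fin 4 → ResidueField O}

theorem subsingleton_quotient_of_forall_not {R : Type u} [CommRing R] [Algebra O R] {S : Mat4 R}
    {c : O} (h : ¬ ∃ x : R →ₐ[O] K, IsTypePoint c Ty S x) :
    Subsingleton (R ⧸ pointIdeal c Ty S) := by
  rw [Ideal.Quotient.subsingleton_iff, pointIdeal, eq_top_iff]
  refine le_iInf fun x => le_iInf fun hx => absurd ⟨x, hx⟩ h

theorem Family.subsingleton_or_equiv (hOK : Function.Injective (algebraMap O K)) {c : O}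
    (hc : 6 * c = 1) {φ₀ σ₀ : Mat4 O}
    {R : Type u} [CommRing R] [IsLocalRing R] [Algebra O R] {F S : Mat4 R}
    (U : IsUniversalPair q φ₀ σ₀ F S) (he : IsBlock e (φ₀.map (residue O)))
    (fam : Family O K q Ty e) (hTy : ConjInvariant Ty) {m : ℕ}
    (hm : Nat.card (Off e) + Nat.card fam.α + m = 16)
    (hmodel : ∀ (s₀ : fam.α → O) (p₀ : fam.κ → O), IsCongr (evalMat (Sum.elim s₀ p₀) fam.D) φ₀ →
      IsCongr (evalMat (Sum.elim s₀ p₀) fam.N) (lg c σ₀) → IsCongr (ex c (lg c σ₀)) σ₀ →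
      (∀ g ∈ fam.I, MvPolynomial.aeval p₀ g ∈ maximalIdeal O) →
      ∃ p : fam.κ → MvPowerSeries (Fin m) O, IsLocalModel fam.I p₀ p) :
    Subsingleton (R ⧸ pointIdeal c Ty S) ∨
      Nonempty ((R ⧸ pointIdeal c Ty S) ≃ₐ[O] MvPowerSeries (Fin 16) O) := by
  by_cases hx : ∃ x : R →ₐ[O] K, IsTypePoint c Ty S x
  swap
  · exact Or.inl (subsingleton_quotient_of_forall_not hx)
  right
  obtain ⟨x, hx'⟩ := hx
  obtain ⟨s₀, p₀, h1, h2, h3, h4⟩ := fam.exists_base hc U he hTy hx'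
  obtain ⟨p, hp⟩ := hmodel s₀ p₀ h1 h2 h3 h4
  obtain ⟨E⟩ := fam.equiv_of_ne_zero hOK hc U he hTy s₀ p₀ h1 h2 h3 hp (AlgHom.id O _)
    (fun _ _ h => h) (Or.inl ⟨x, hx'⟩)
  obtain ⟨E'⟩ := exists_powerSeries_sum_equiv (O := O) (Off e ⊕ fam.α) (Fin m)
  have hcard : Nat.card ((Off e ⊕ fam.α) ⊕ Fin m) = 16 := by
    rw [Nat.card_sum, Nat.card_sum, Nat.card_fin, hm]
  exact ⟨(E.trans E').trans (MvPowerSeries.renameEquiv O (Finite.equivFinOfCardEq hcard))⟩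

variable (hOK : Function.Injective (algebraMap O K)) {c : O} (hc : 6 * c = 1) {φ₀ σ₀ : Mat4 O}
    {R : Type u} [CommRing R] [IsLocalRing R] [Algebra O R] {F S : Mat4 R}
    (U : IsUniversalPair q φ₀ σ₀ F S)

theorem zero_subsingleton_or_equiv (hOK : Function.Injective (algebraMap O K)) (hc : 6 * c = 1)
    (U : IsUniversalPair q φ₀ σ₀ F S) (he : IsBlock e (φ₀.map (residue O))) :
    Subsingleton (R ⧸ pointIdeal c (TyZero (K := K)) S) ∨
      Nonempty ((R ⧸ pointIdeal c (TyZero (K := K)) S) ≃ₐ[O] MvPowerSeries (Fin 16) O) := by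
  refine (familyZero O K q e).subsingleton_or_equiv hOK hc U he tyZero_conjInvariant (m := 0) ?_
    fun _ p₀ _ _ _ _ => ⟨fun k => k.elim, isLocalModel_of_isEmpty (κ := Empty) p₀ _⟩
  classical
  change Nat.card {p : Fin 4 × Fin 4 // ¬ (e p.1 = 1 * e p.2)} +
    Nat.card {p : Fin 4 × Fin 4 // e p.1 = 1 * e p.2} + 0 = 16
  rw [add_zero, add_comm, ← Nat.card_sum, Nat.card_congr (Equiv.sumCompl _)]
  simp

theorem regular_subsingleton_or_equiv (hOK : Function.Injective (algebraMap O K)) (hc : 6 * c = 1)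
    (U : IsUniversalPair q φ₀ σ₀ F S) {t : ResidueField O} (hq : IsBanalIn (ResidueField O) q)
    (ht : t ≠ 0) (he : IsBlock (powLabel q t ![3, 2, 1, 0]) (φ₀.map (residue O))) :
    Subsingleton (R ⧸ pointIdeal c (TyRegular (K := K)) S) ∨
      Nonempty ((R ⧸ pointIdeal c (TyRegular (K := K)) S) ≃ₐ[O] MvPowerSeries (Fin 16) O) := by
  refine (familyRegular O K q hq ht).subsingleton_or_equiv hOK hc U he tyRegular_conjInvariant
    (m := 0) ?_ fun _ p₀ _ _ _ _ => ⟨fun k => k.elim, isLocalModel_of_isEmpty (κ := Empty) p₀ _⟩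
  rw [Off, card_subtype_off _ (powLabel_eq_iff hq ht (by decide))]
  change _ + Nat.card (Fin 4) + 0 = 16
  rw [Nat.card_fin]
  decide

theorem split_subsingleton_or_equiv (hOK : Function.Injective (algebraMap O K)) (hc : 6 * c = 1)
    (U : IsUniversalPair q φ₀ σ₀ F S) (he1 : ∀ i j, e i = 1 * e j → i = j)
    (he2 : ∀ i j, e i = q * e j → (i, j) = (0, 1) ∨ (i, j) = (2, 3) ∨ (i, j) = (1, 2))
    (he : IsBlock e (φ₀.map (residue O))) :
    Subsingleton (R ⧸ pointIdeal c (TySquare (K := K)) S) ∨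
      Nonempty ((R ⧸ pointIdeal c (TySquare (K := K)) S) ≃ₐ[O] MvPowerSeries (Fin 16) O) := by
  refine (familySplit O K q he1 he2).subsingleton_or_equiv hOK hc U he tySquare_conjInvariant
    (m := 0) ?_ fun _ p₀ _ _ _ _ => ⟨fun k => k.elim, isLocalModel_of_isEmpty (κ := Empty) p₀ _⟩
  rw [Off, card_subtype_off (fun i j => i = j) (fun i j => ⟨he1 i j, fun h => by rw [h, one_mul]⟩)]
  change _ + Nat.card (Fin 4) + 0 = 16
  rw [Nat.card_fin]
  decide

theorem isCongr_one_of_lg (hN : ∀ i j, lg c σ₀ i j ∈ maximalIdeal O)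
    (hσ₀ : IsCongr (ex c (lg c σ₀)) σ₀) : IsCongr σ₀ (1 : Mat4 O) := by
  have h1 : IsCongr (lg c σ₀) (0 : Mat4 O) := fun i j => by simpa using hN i j
  have h2 := h1.ex c
  rw [ex_zero] at h2
  exact hσ₀.symm.trans h2

theorem map_residue_eq_diagonal (he : IsBlock e (φ₀.map (residue O))) {D : Mat4 O}
    (hD : IsCongr D φ₀) (hoff : ∀ i j, i ≠ j → D i j ∈ maximalIdeal O) :
    φ₀.map (residue O) = Matrix.diagonal e :=
  he.eq_diagonal fun i j hij => by
    rw [Matrix.map_apply, residue_eq_zero_iff]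
    have := sub_mem (hoff i j hij) (hD i j)
    rwa [sub_sub_cancel] at this

theorem isCongr_one_of_mem {N : Mat4 O} (hN : IsCongr N (lg c σ₀))
    (hm : ∀ i j, N i j ∈ maximalIdeal O) (hσ₀ : IsCongr (ex c (lg c σ₀)) σ₀) :
    IsCongr σ₀ (1 : Mat4 O) :=
  isCongr_one_of_lg (fun i j => by
    have := sub_mem (hm i j) (hN i j)
    rwa [sub_sub_cancel] at this) hσ₀

theorem square22_subsingleton_or_equiv (hOK : Function.Injective (algebraMap O K)) (hc : 6 * c = 1)
    (U : IsUniversalPair q φ₀ σ₀ F S) {t : ResidueField O} (hq : IsBanalIn (ResidueField O) q)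
    (ht : t ≠ 0) {r : O} (hr : q * r = 1)
    (he : IsBlock (powLabel q t ![1, 1, 0, 0]) (φ₀.map (residue O)))
    (hns : ¬ (φ₀.map (residue O) = Matrix.diagonal (powLabel q t ![1, 1, 0, 0]) ∧
      IsCongr σ₀ (1 : Mat4 O))) :
    Subsingleton (R ⧸ pointIdeal c (TySquare (K := K)) S) ∨
      Nonempty ((R ⧸ pointIdeal c (TySquare (K := K)) S) ≃ₐ[O] MvPowerSeries (Fin 16) O) := by
  refine (family22 O K q hq ht hr hc).subsingleton_or_equiv hOK hc U he tySquare_conjInvariant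
    (m := 7) ?_ fun s₀ p₀ hD hN hσ₀ hp₀ => ?_
  · rw [Off, card_subtype_off _ (powLabel_eq_iff hq ht (by decide))]
    change _ + Nat.card (Fin 1) + 7 = 16
    rw [Nat.card_fin]
    decide
  · refine exists_isLocalModel_22 (p₀ := p₀) hp₀ ?_
    by_contra! hu
    replace hu : ∀ k : Fin 10, k ≠ 4 → k ≠ 7 → p₀ k ∈ maximalIdeal O := hu
    have hm := family22_mem (K := K) hq ht hr hc s₀ hu
    exact hns ⟨map_residue_eq_diagonal he hD hm.1, isCongr_one_of_mem hN hm.2 hσ₀⟩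

theorem square121_subsingleton_or_equiv (hOK : Function.Injective (algebraMap O K)) (hc : 6 * c = 1)
    (U : IsUniversalPair q φ₀ σ₀ F S) {t : ResidueField O} (hq : IsBanalIn (ResidueField O) q)
    (ht : t ≠ 0) {r : O} (hr : q * r = 1)
    (he : IsBlock (powLabel q t ![2, 1, 1, 0]) (φ₀.map (residue O)))
    (hns : ¬ (φ₀.map (residue O) = Matrix.diagonal (powLabel q t ![2, 1, 1, 0]) ∧
      IsCongr σ₀ (1 : Mat4 O))) :
    Subsingleton (R ⧸ pointIdeal c (TySquare (K := K)) S) ∨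
      Nonempty ((R ⧸ pointIdeal c (TySquare (K := K)) S) ≃ₐ[O] MvPowerSeries (Fin 16) O) := by
  refine (family121 O K q hq ht hr hc).subsingleton_or_equiv hOK hc U he tySquare_conjInvariant
    (m := 5) ?_ fun s₀ p₀ hD hN hσ₀ hp₀ => ?_
  · rw [Off, card_subtype_off _ (powLabel_eq_iff hq ht (by decide))]
    change _ + Nat.card (Fin 1) + 5 = 16
    rw [Nat.card_fin]
    decide
  · refine exists_isLocalModel_121 (p₀ := p₀) hp₀ ?_
    by_contra! hu
    replace hu : ∀ k : Fin 8, k ≠ 4 → k ≠ 5 → p₀ k ∈ maximalIdeal O := hu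
    have hm := family121_mem (K := K) hq ht hr hc s₀ hu
    exact hns ⟨map_residue_eq_diagonal he hD hm.1, isCongr_one_of_mem hN hm.2 hσ₀⟩

theorem isCongr_lg_of_one (hσ₀ : IsCongr σ₀ (1 : Mat4 O)) : IsCongr (0 : Mat4 O) (lg c σ₀) := by
  have := (hσ₀.lg c).symm
  rwa [lg_one] at this

theorem isCongr_ex_lg_of_one (hσ₀ : IsCongr σ₀ (1 : Mat4 O)) : IsCongr (ex c (lg c σ₀)) σ₀ := by
  have := ((isCongr_lg_of_one (c := c) hσ₀).symm.ex c)
  rw [ex_zero] at this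
  exact this.trans hσ₀.symm

theorem isCongr_iff_residue {M M₀ : Mat4 O} :
    IsCongr M M₀ ↔ M.map (residue O) = M₀.map (residue O) := isCongr_iff

theorem isBlock_diagonal {k : Type*} [Field k] (e : Fin 4 → k) : IsBlock e (Matrix.diagonal e) where
  supp i j h := Matrix.diagonal_apply_ne _ fun hij => h (by rw [hij, one_mul])
  nil := ⟨1, fun i j => by
    rw [pow_one, Matrix.sub_apply, Matrix.smul_apply, Matrix.diagonal_apply, Matrix.one_apply]
    split_ifs with h
    · rw [h]; simp
    · simp⟩

theorem square22_equiv_vertex (hOK : Function.Injective (algebraMap O K)) (hc : 6 * c = 1)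
    (U : IsUniversalPair q φ₀ σ₀ F S) {t : ResidueField O} (hq : IsBanalIn (ResidueField O) q)
    (ht : t ≠ 0) {r : O} (hr : q * r = 1)
    (hs : φ₀.map (residue O) = Matrix.diagonal (powLabel q t ![1, 1, 0, 0]))
    (hσ₀ : IsCongr σ₀ (1 : Mat4 O)) :
    Nonempty ((R ⧸ pointIdeal c (TySquare (K := K)) S) ≃ₐ[O]
      MvPowerSeries (Fin 9) (Rhat22 O)) := by
  have he : IsBlock (powLabel q t ![1, 1, 0, 0]) (φ₀.map (residue O)) := hs ▸ isBlock_diagonal _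
  obtain ⟨t₀, rfl⟩ := residue_surjective t
  have hloc := isLocalRing_gradedCompletion (ideal22 O) satisfies_zero_22
  have hcnl := isCNL_gradedCompletion (ideal22 O)
  obtain ⟨θ, hθ⟩ := exists_embedding_22 (O := O) hc
  have hD : IsCongr (evalMat (κ := Fin 1 ⊕ Fin 10) (Sum.elim (fun _ => t₀) 0)
      (family22 O K q hq ht hr hc).D) φ₀ := by
    rw [family22_evalMat_D, isCongr_iff_residue, hs]
    ext i j
    fin_cases i <;> fin_cases j <;> simp [powLabel, mul_comm]
  have hN : IsCongr (evalMat (κ := Fin 1 ⊕ Fin 10) (Sum.elim (fun _ => t₀) 0)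
      (family22 O K q hq ht hr hc).N) (lg c σ₀) := by
    rw [family22_evalMat_N]
    convert isCongr_lg_of_one (c := c) hσ₀ using 1
    ext i j
    fin_cases i <;> fin_cases j <;> rfl
  have hnd : MvPolynomial.aeval (genPoint (powLabel q (residue O t₀) ![1, 1, 0, 0])
      (fun _ : Fin 1 => t₀) (gradedPoint (ideal22 O)))
      ((family22 O K q hq ht hr hc).nd ()) ≠ 0 := by
    obtain ⟨ϖ, hϖ⟩ := IsDiscreteValuationRing.exists_irreducible O
    have hϖm : ϖ ∈ maximalIdeal O := hϖ.not_isUnit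
    obtain ⟨h, -, hh⟩ := exists_gradedCompletion_lift (A := O) (ideal22 O) (maximalIdeal O)
      (p := ![ϖ, 0, 0, ϖ, 0, 0, 0, 0, 0, 0])
      (by rw [satisfies_ideal22_iff]; simp)
      (fun k => by fin_cases k <;> first | exact hϖm | exact zero_mem (maximalIdeal O))
    change MvPolynomial.aeval _ (MvPolynomial.X (Sum.inr 0) * MvPolynomial.X (Sum.inr 3) -
      MvPolynomial.X (Sum.inr 1) * MvPolynomial.X (Sum.inr 2) : MvPolynomial (Fin 1 ⊕ Fin 10) O) ≠ 0
    simp only [map_sub, map_mul, MvPolynomial.aeval_X, genPoint, Sum.elim_inr]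
    intro h0
    have h1 := congrArg (fun z => h (MvPowerSeries.constantCoeff z)) h0
    simp only [map_sub, map_mul, MvPowerSeries.constantCoeff_C, hh, map_zero] at h1
    exact hϖ.ne_zero (by simpa using h1)
  obtain ⟨E⟩ := (family22 O K q hq ht hr hc).equiv_of_ne_zero hOK hc U he tySquare_conjInvariant
    (fun _ : Fin 1 => t₀) (0 : Fin 10 → O) hD hN (isCongr_ex_lg_of_one hσ₀)
    (isLocalModel_gradedPoint (ideal22 O)) θ hθ (Or.inr ⟨(), hnd⟩)
  have hcard : Nat.card (Off (powLabel q (residue O t₀) ![1, 1, 0, 0]) ⊕ Fin 1) = 9 := by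
    rw [Nat.card_sum, Off, card_subtype_off _ (powLabel_eq_iff hq ht (by decide)), Nat.card_fin]
    decide
  exact ⟨E.trans ((MvPowerSeries.renameEquiv (Rhat22 O)
    (Finite.equivFinOfCardEq hcard)).restrictScalars O)⟩

theorem square121_equiv_vertex (hOK : Function.Injective (algebraMap O K)) (hc : 6 * c = 1)
    (U : IsUniversalPair q φ₀ σ₀ F S) {t : ResidueField O} (hq : IsBanalIn (ResidueField O) q)
    (ht : t ≠ 0) {r : O} (hr : q * r = 1)
    (hs : φ₀.map (residue O) = Matrix.diagonal (powLabel q t ![2, 1, 1, 0]))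
    (hσ₀ : IsCongr σ₀ (1 : Mat4 O)) :
    Nonempty ((R ⧸ pointIdeal c (TySquare (K := K)) S) ≃ₐ[O]
      MvPowerSeries (Fin 11) (Rhat121 O)) := by
  have he : IsBlock (powLabel q t ![2, 1, 1, 0]) (φ₀.map (residue O)) := hs ▸ isBlock_diagonal _
  obtain ⟨t₀, rfl⟩ := residue_surjective t
  have hloc := isLocalRing_gradedCompletion (ideal121 O) satisfies_zero_121
  have hcnl := isCNL_gradedCompletion (ideal121 O)
  obtain ⟨θ, hθ⟩ := exists_embedding_121 (O := O) hc
  have hD : IsCongr (evalMat (κ := Fin 1 ⊕ Fin 8) (Sum.elim (fun _ => t₀) 0)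
      (family121 O K q hq ht hr hc).D) φ₀ := by
    rw [family121_evalMat_D, isCongr_iff_residue, hs]
    ext i j
    fin_cases i <;> fin_cases j <;> simp [powLabel, mul_comm]
  have hN : IsCongr (evalMat (κ := Fin 1 ⊕ Fin 8) (Sum.elim (fun _ => t₀) 0)
      (family121 O K q hq ht hr hc).N) (lg c σ₀) := by
    rw [family121_evalMat_N]
    convert isCongr_lg_of_one (c := c) hσ₀ using 1
    ext i j
    fin_cases i <;> fin_cases j <;> rfl
  have hnd : MvPolynomial.aeval (genPoint (powLabel q (residue O t₀) ![2, 1, 1, 0])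
      (fun _ : Fin 1 => t₀) (gradedPoint (ideal121 O)))
      ((family121 O K q hq ht hr hc).nd (1 : Fin 4)) ≠ 0 := by
    obtain ⟨ϖ, hϖ⟩ := IsDiscreteValuationRing.exists_irreducible O
    have hϖm : ϖ ∈ maximalIdeal O := hϖ.not_isUnit
    obtain ⟨h, -, hh⟩ := exists_gradedCompletion_lift (A := O) (ideal121 O) (maximalIdeal O)
      (p := ![ϖ, 0, 0, ϖ, 0, 0, 0, 0])
      (by rw [satisfies_ideal121_iff]; simp)
      (fun k => by fin_cases k <;> first | exact hϖm | exact zero_mem (maximalIdeal O))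
    change MvPolynomial.aeval _ (MvPolynomial.X (Sum.inr 0) * MvPolynomial.X (Sum.inr 3) : MvPolynomial (Fin 1 ⊕ Fin 8) O) ≠ 0
    simp only [map_mul, MvPolynomial.aeval_X, genPoint, Sum.elim_inr]
    intro h0
    have h1 := congrArg (fun z => h (MvPowerSeries.constantCoeff z)) h0
    simp only [map_mul, MvPowerSeries.constantCoeff_C, hh, map_zero] at h1
    exact hϖ.ne_zero (by simpa using h1)
  obtain ⟨E⟩ := (family121 O K q hq ht hr hc).equiv_of_ne_zero hOK hc U he tySquare_conjInvariant
    (fun _ : Fin 1 => t₀) (0 : Fin 8 → O) hD hN (isCongr_ex_lg_of_one hσ₀)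
    (isLocalModel_gradedPoint (ideal121 O)) θ hθ (Or.inr ⟨(1 : Fin 4), hnd⟩)
  have hcard : Nat.card (Off (powLabel q (residue O t₀) ![2, 1, 1, 0]) ⊕ Fin 1) = 11 := by
    rw [Nat.card_sum, Off, card_subtype_off _ (powLabel_eq_iff hq ht (by decide)), Nat.card_fin]
    decide
  exact ⟨E.trans ((MvPowerSeries.renameEquiv (Rhat121 O)
    (Finite.equivFinOfCardEq hcard)).restrictScalars O)⟩

end Rings

/-! ### Block decompositions of matrices with split characteristic polynomial -/

section Block

variable {k : Type*} [Field k]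

theorem exists_basis_maxGenEigenspace {V : Type*} [AddCommGroup V] [Module k V]
    [FiniteDimensional k V] {e : Fin 4 → k} {f : Module.End k V}
    (hV : Module.finrank k V = 4)
    (h : f.charpoly = ∏ i, (Polynomial.X - Polynomial.C (e i))) :
    ∃ b : Module.Basis (Fin 4) k V, (∀ i, b i ∈ f.maxGenEigenspace (e i)) ∧
      ∀ i j, e i ≠ e j → b.repr (f (b j)) i = 0 := by
  classical
  have hdim : ∀ μ : k, Module.finrank k (f.maxGenEigenspace μ) = Fintype.card {i // e i = μ} := by
    intro μ
    have h1 : ∏ i, (Polynomial.X - Polynomial.C (e i)) =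
        ((Finset.univ.val.map e).map fun a => Polynomial.X - Polynomial.C a).prod := by
      rw [Multiset.map_map]; rfl
    rw [LinearMap.finrank_maxGenEigenspace_eq, h, h1, ← Polynomial.count_roots,
      Polynomial.roots_multiset_prod_X_sub_C, Multiset.count_map, Fintype.card_subtype,
      ← Finset.filter_val, Finset.card_val]
    simp only [eq_comm]
  let B : ∀ μ : k, Module.Basis {i // e i = μ} k (f.maxGenEigenspace μ) := fun μ =>
    (Module.finBasisOfFinrankEq k _ (hdim μ)).reindex (Fintype.equivFin _).symm
  let w : ∀ μ : k, {i // e i = μ} → V := fun μ i => (B μ i : V)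
  have hspan : ∀ μ, Submodule.span k (Set.range (w μ)) = f.maxGenEigenspace μ := by
    intro μ
    have : Set.range (w μ) = (f.maxGenEigenspace μ).subtype '' Set.range (B μ) := by
      rw [← Set.range_comp]; rfl
    rw [this, Submodule.span_image, (B μ).span_eq, Submodule.map_top, Submodule.range_subtype]
  have hli : LinearIndependent k fun x : Σ μ : k, {i // e i = μ} => w x.1 x.2 := by
    refine linearIndependent_iUnion_finite (f := w) (fun μ => ?_) fun μ t ht hμ => ?_
    · have h1 := (B μ).linearIndependent.map' (f.maxGenEigenspace μ).subtype
        (Submodule.ker_subtype _)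
      exact h1
    · simp only [hspan]
      exact (f.independent_maxGenEigenspace).disjoint_biSup hμ
  let v : Fin 4 → V := fun i => w (e i) ⟨i, rfl⟩
  have hv : LinearIndependent k v :=
    hli.comp (fun i => (⟨e i, i, rfl⟩ : Σ μ : k, {i // e i = μ})) fun i j hij => by
      have : ∀ x y : Σ μ : k, {i // e i = μ}, x = y → x.2.1 = y.2.1 := by rintro x _ rfl; rfl
      exact this _ _ hij
  let b := basisOfLinearIndependentOfCardEqFinrank hv (by rw [hV]; rfl)
  have hb : ∀ i, b i = v i := fun i => by
    rw [coe_basisOfLinearIndependentOfCardEqFinrank]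
  refine ⟨b, fun i => hb i ▸ (B _ _).2, fun i j hij => ?_⟩
  have hmem : f (b j) ∈ Submodule.span k (Set.range (w (e j))) := by
    rw [hspan, hb]
    exact f.mapsTo_maxGenEigenspace_of_comm (Commute.refl f) (e j) (B _ _).2
  have hrange : Set.range (w (e j)) ⊆ b '' {l | e l = e j} := by
    rintro _ ⟨⟨l, hl⟩, rfl⟩
    refine ⟨l, hl, ?_⟩
    rw [hb]
    have : ∀ μ (h : e l = μ), w (e l) ⟨l, rfl⟩ = w μ ⟨l, h⟩ := by rintro _ rfl; rfl
    exact this _ hl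
  have h3 := b.mem_span_image.mp (Submodule.span_mono hrange hmem)
  by_contra hne
  exact hij (h3 (Finsupp.mem_support_iff.mpr hne))

open Matrix in
theorem exists_isBlock_conj {e : Fin 4 → k} {M : Mat4 k}
    (h : M.charpoly = ∏ i, (Polynomial.X - Polynomial.C (e i))) :
    ∃ P : (Mat4 k)ˣ, IsBlock e (conjHom k P M) := by
  obtain ⟨b, hb, hsupp⟩ := exists_basis_maxGenEigenspace (f := (toLin' M : Module.End k (Fin 4 → k)))
    (by simp) ((Matrix.charpoly_toLin' M).trans h)
  let ψ : Mat4 k ≃ₐ[k] Mat4 k := (Matrix.toLinAlgEquiv' : Mat4 k ≃ₐ[k] _).trans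
    (LinearMap.toMatrixAlgEquiv b)
  let P : (Mat4 k)ˣ :=
    ⟨b.toMatrix (Pi.basisFun k (Fin 4)), (Pi.basisFun k (Fin 4)).toMatrix b,
      b.toMatrix_mul_toMatrix_flip _, (Pi.basisFun k (Fin 4)).toMatrix_mul_toMatrix_flip _⟩
  have hψ : ∀ N : Mat4 k, conjHom k P N = ψ N := fun N => by
    have := basis_toMatrix_mul_linearMap_toMatrix_mul_basis_toMatrix b
      (Pi.basisFun k (Fin 4)) b (Pi.basisFun k (Fin 4)) (toLin' N)
    change _ = LinearMap.toMatrix b b (toLin' N)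
    rw [← this, conjHom_apply]
    congr 2
    exact (LinearMap.toMatrix'_toLin' N).symm
  refine ⟨P, fun i j hij => ?_, 4, fun i j => ?_⟩
  · rw [hψ]
    change LinearMap.toMatrix b b (toLin' M) i j = 0
    rw [LinearMap.toMatrix_apply]
    exact hsupp i j (by rwa [one_mul] at hij)
  · have h1 : (conjHom k P M - e j • 1) ^ 4 = ψ ((M - e j • 1) ^ 4) := by
      rw [hψ, map_pow, map_sub, map_smul, map_one]
    rw [h1]
    change LinearMap.toMatrix b b (toLinAlgEquiv' ((M - e j • 1) ^ 4)) i j = 0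
    rw [LinearMap.toMatrix_apply, map_pow, map_sub, map_smul, map_one]
    have h2 := hb j
    rw [Module.End.maxGenEigenspace_eq_genEigenspace_finrank, Module.End.mem_genEigenspace_nat,
      Module.finrank_fin_fun, LinearMap.mem_ker] at h2
    have h3 := congrArg (fun z => b.repr z i) h2
    rwa [map_zero, Finsupp.zero_apply] at h3

open Matrix in
theorem IsBlock.eq_diagonal_of_squarefree {e : Fin 4 → k} {M : Mat4 k} (h : IsBlock e M)
    {p : Polynomial k} (hp : Squarefree p) (hM : Polynomial.aeval M p = 0) :
    M = Matrix.diagonal e := by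
  have hs : Module.End.IsSemisimple (toLin' M) := by
    refine Module.End.isSemisimple_of_squarefree_aeval_eq_zero hp ?_
    have := congrArg (toLinAlgEquiv' : Mat4 k ≃ₐ[k] _) hM
    rwa [map_zero, ← Polynomial.aeval_algHom_apply] at this
  obtain ⟨m, hm⟩ := h.nil
  have key : ∀ j, toLin' M (Pi.single j 1) = e j • Pi.single j (1 : k) := fun j => by
    have h1 : Pi.single j 1 ∈ Module.End.maxGenEigenspace (toLin' M) (e j) := by
      rw [Module.End.mem_maxGenEigenspace]
      refine ⟨m, ?_⟩
      have h2 : (toLin' M - e j • 1) ^ m = toLinAlgEquiv' ((M - e j • 1) ^ m) := by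
        rw [map_pow, map_sub, map_smul, map_one]; rfl
      rw [h2]
      change ((M - e j • 1) ^ m) *ᵥ Pi.single j 1 = 0
      rw [mulVec_single_one]
      funext i
      exact hm i j
    rw [hs.isFinitelySemisimple.maxGenEigenspace_eq_eigenspace] at h1
    exact Module.End.mem_eigenspace_iff.mp h1
  ext i j
  have h1 := congrFun (key j) i
  rw [toLin'_apply, mulVec_single_one] at h1
  change M i j = _ at h1
  rw [h1, Matrix.diagonal_apply]
  by_cases hij : i = j
  · subst hij; simp
  · simp [hij]

end Block

/-! ### Frobenius eigenvalues at points of a given type -/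

section Eigenvalues

variable {K : Type u} [Field K]

theorem charpoly_conjHom {P : (Mat4 K)ˣ} {M : Mat4 K} :
    (conjHom K P M).charpoly = M.charpoly := by
  rw [conjHom_apply, Matrix.charpoly_mul_comm, ← mul_assoc, Units.inv_mul, one_mul]

theorem charpoly_of_tyRegular {q : ℕ} {Φ N : Mat4 K} (hN : TyRegular N) (h : Φ * N = q • (N * Φ)) :
    ∃ α : K, Φ.charpoly = ∏ i, (Polynomial.X - Polynomial.C (powLabel q α ![3, 2, 1, 0] i)) := by
  obtain ⟨P, rfl⟩ := tyRegular_iff.mp hN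
  obtain ⟨M, rfl⟩ : ∃ M, Φ = conjHom K P M := ⟨_, (conjHom_conjHom_inv K P Φ).symm⟩
  rw [← map_mul, ← map_mul, ← map_nsmul] at h
  replace h := congrArg (conjHom K P⁻¹) h
  rw [conjHom_inv_conjHom, conjHom_inv_conjHom] at h
  have h' := fun i j => congrFun (congrFun h i) j
  simp [Fin.forall_fin_succ, jordanNilpotent, Matrix.mul_apply, Fin.sum_univ_succ] at h'
  obtain ⟨⟨-, h00, -, -⟩, ⟨-, h10, h11, -⟩, ⟨-, h20, h21, h22⟩, h30, h31, h32⟩ := h'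
  rw [h31, mul_zero] at h20
  rw [h32, mul_zero] at h21
  rw [h21, mul_zero] at h10
  rw [h22] at h11
  rw [h11] at h00
  refine ⟨M 3 3, ?_⟩
  rw [charpoly_conjHom, Matrix.charpoly_of_isUpperTriangular]
  · refine Finset.prod_congr rfl fun i _ => ?_
    congr 2
    fin_cases i <;> simp [powLabel, h00, h11, h22] <;> ring
  · intro i j hij
    fin_cases i <;> fin_cases j <;> first | assumption | exact absurd hij (by decide)

theorem charpoly_of_tySquare [IsAlgClosed K] {q : ℕ} {Φ N : Mat4 K} (hN : TySquare N)
    (h : Φ * N = q • (N * Φ)) :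
    ∃ α β : K, Φ.charpoly = ∏ i, (Polynomial.X - Polynomial.C (![q * α, α, q * β, β] i)) := by
  obtain ⟨P, rfl⟩ := tySquare_iff.mp hN
  obtain ⟨M, rfl⟩ : ∃ M, Φ = conjHom K P M := ⟨_, (conjHom_conjHom_inv K P Φ).symm⟩
  rw [← map_mul, ← map_mul, ← map_nsmul] at h
  replace h := congrArg (conjHom K P⁻¹) h
  rw [conjHom_inv_conjHom, conjHom_inv_conjHom] at h
  have h' := fun i j => congrFun (congrFun h i) j
  simp [Fin.forall_fin_succ, jordanNilpotent, Matrix.mul_apply, Fin.sum_univ_succ] at h'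
  obtain ⟨⟨-, h00, -, h02⟩, ⟨h10, h12⟩, ⟨-, h20, -, h22⟩, h30, h32⟩ := h'
  obtain ⟨α, hα⟩ := IsAlgClosed.exists_root
    (Polynomial.X ^ 2 - Polynomial.C (M 1 1 + M 3 3) * Polynomial.X +
      Polynomial.C (M 1 1 * M 3 3 - M 1 3 * M 3 1)) (by
      have : (Polynomial.X ^ 2 - Polynomial.C (M 1 1 + M 3 3) * Polynomial.X +
        Polynomial.C (M 1 1 * M 3 3 - M 1 3 * M 3 1)).degree = 2 := by compute_degree!
      rw [this]; decide)
  simp only [Polynomial.IsRoot.def, Polynomial.eval_add, Polynomial.eval_sub, Polynomial.eval_pow,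
    Polynomial.eval_X, Polynomial.eval_mul, Polynomial.eval_C] at hα
  refine ⟨α, M 1 1 + M 3 3 - α, ?_⟩
  have hα' := congrArg (Polynomial.C : K →+* Polynomial K) hα
  simp only [map_add, map_sub, map_mul, map_pow, map_zero] at hα'
  rw [charpoly_conjHom, Matrix.charpoly, Matrix.det_succ_row_zero]
  simp [Fin.sum_univ_succ, Matrix.det_fin_three, Matrix.charmatrix_apply, Fin.succAbove,
    Fin.prod_univ_succ, h00, h02, h10, h12, h20, h22, h30, h32, Matrix.diagonal_apply]
  generalize (Polynomial.X : Polynomial K) = X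
  generalize Polynomial.C (M 1 1) = a at hα' ⊢
  generalize Polynomial.C (M 3 3) = d at hα' ⊢
  generalize Polynomial.C (M 1 3) = b at hα' ⊢
  generalize Polynomial.C (M 3 1) = c at hα' ⊢
  generalize Polynomial.C α = y at hα' ⊢
  linear_combination ((q : Polynomial K) ^ 2 * ((X - a) * (X - d) - b * c) +
    ((X - q * a) * (X - q * d) - (q : Polynomial K) ^ 2 * b * c) -
    (q : Polynomial K) ^ 2 * (y ^ 2 - (a + d) * y + (a * d - b * c))) * hα'
end Eigenvalues
open Polynomial in
theorem exists_residual_roots {A : Type u} [CommRing A] [IsLocalRing A] {K : Type u} [Field K]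
    (i : A →+* K) (hi : Function.Injective i) {f : Polynomial A} (hf : f.Monic) {k : Type u} [Field k]
    (r : k →+* ResidueField A) {fbar : Polynomial k} (hfr : fbar.map r = f.map (residue A))
    (hsplit : fbar.Splits) {ι : Type} {q : ℕ} (n : Fin 4 → ℕ) (s : Fin 4 → ι)
    (hs : ∀ a, ∃ j, n j = 0 ∧ s j = a) {α : ι → K}
    (h : f.map i = ∏ j, (X - C (q ^ n j * α (s j)))) :
    ∃ β : ι → k, fbar = ∏ j, (X - C (q ^ n j * β (s j))) := by
  let _ : Algebra A K := i.toAlgebra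
  have : FaithfulSMul A K := (faithfulSMul_iff_algebraMap_injective A K).mpr hi
  have hInt : ∀ a, IsIntegral A (α a) := fun a => by
    refine ⟨f, hf, ?_⟩
    obtain ⟨j, hj, rfl⟩ := hs a
    have h1 := congrArg (eval (α (s j))) h
    rw [eval_map, eval_prod, Finset.prod_eq_zero (Finset.mem_univ j) (by simp [hj])] at h1
    exact h1
  let B := integralClosure A K
  let γ : ι → B := fun a => ⟨α a, hInt a⟩
  have : FaithfulSMul A B := (faithfulSMul_iff_algebraMap_injective A B).mpr fun a b hab =>
    hi (congrArg Subtype.val hab)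
  obtain ⟨𝔫, h𝔫, hover⟩ := Ideal.exists_maximal_ideal_liesOver_of_isIntegral (S := B)
    (maximalIdeal A)
  let _ : Field (B ⧸ 𝔫) := Ideal.Quotient.field 𝔫
  let ρ : ResidueField A →+* B ⧸ 𝔫 := Ideal.Quotient.lift (maximalIdeal A)
    ((Ideal.Quotient.mk 𝔫).comp (algebraMap A B)) fun a ha => by
      rw [hover.over] at ha
      exact Ideal.Quotient.eq_zero_iff_mem.mpr ha
  have hρ : ρ.comp (residue A) = (Ideal.Quotient.mk 𝔫).comp (algebraMap A B) :=
    RingHom.ext fun a => rfl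
  have hB : f.map (algebraMap A B) = ∏ j, (X - C (q ^ n j * γ (s j))) := by
    apply Polynomial.map_injective (algebraMap B K) Subtype.val_injective
    rw [Polynomial.map_map, ← IsScalarTower.algebraMap_eq]
    refine h.trans ?_
    rw [Polynomial.map_prod]
    refine Finset.prod_congr rfl fun j _ => ?_
    simp [γ]
  have hk : fbar.map (ρ.comp r) =
      ∏ j, (X - C (q ^ n j * Ideal.Quotient.mk 𝔫 (γ (s j)))) := by
    rw [← Polynomial.map_map, hfr, Polynomial.map_map, hρ, ← Polynomial.map_map, hB,
      Polynomial.map_prod]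
    refine Finset.prod_congr rfl fun j _ => ?_
    simp
  have hroot : ∀ a, ∃ b : k, (ρ.comp r) b = Ideal.Quotient.mk 𝔫 (γ a) := fun a => by
    obtain ⟨j, hj, rfl⟩ := hs a
    have h0 : fbar ≠ 0 := fun h0 => by
      rw [h0, Polynomial.map_zero] at hk
      exact (Finset.prod_ne_zero_iff.mpr fun j _ => X_sub_C_ne_zero _) hk.symm
    have h1 : Ideal.Quotient.mk 𝔫 (γ (s j)) ∈ (fbar.map (ρ.comp r)).roots := by
      rw [mem_roots ((Polynomial.map_ne_zero_iff (ρ.comp r).injective).mpr h0), hk, IsRoot.def,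
        eval_prod, Finset.prod_eq_zero (Finset.mem_univ j) (by simp [hj])]
    rw [hsplit.roots_map] at h1
    obtain ⟨b, -, hb⟩ := Multiset.mem_map.mp h1
    exact ⟨b, hb⟩
  choose β hβ using hroot
  refine ⟨β, Polynomial.map_injective _ (ρ.comp r).injective ?_⟩
  rw [hk, Polynomial.map_prod]
  refine Finset.prod_congr rfl fun j _ => ?_
  rw [Polynomial.map_sub, map_X, map_C, map_mul (ρ.comp r), hβ, map_pow (ρ.comp r), map_natCast]

/-! ### The fixed type rings in terms of the residual representation -/

section Rings

variable {O : Type u} [CommRing O] [IsDomain O] [IsDiscreteValuationRing O] [Infinite O]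
  [IsAdicComplete (maximalIdeal O) O] {K : Type u} [Field K] [Algebra O K] {q : ℕ} {c : O}
  {φ₀ σ₀ : Mat4 O} {R : Type u} [CommRing R] [IsLocalRing R] [Algebra O R] {F S : Mat4 R}

theorem exists_unit_lift (P : (Mat4 (ResidueField O))ˣ) :
    ∃ Q : (Mat4 O)ˣ, ∀ M : Mat4 O, (conjHom O Q M).map (residue O) =
      conjHom (ResidueField O) P (M.map (residue O)) := by
  choose Q₀ hQ₀ using fun i j => residue_surjective (P.val i j)
  have h1 : (residue O).mapMatrix (Matrix.of Q₀) = P.val := by ext i j; exact hQ₀ i j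
  have h2 : IsUnit (Matrix.of Q₀) := by
    rw [Matrix.isUnit_iff_isUnit_det, ← residue_ne_zero_iff_isUnit, RingHom.map_det, h1]
    exact ((Matrix.isUnit_iff_isUnit_det _).mp P.isUnit).ne_zero
  obtain ⟨Q, hQ⟩ := h2
  refine ⟨Q, fun M => ?_⟩
  rw [← hQ] at h1
  have hm : ∀ X Y : Mat4 O, (X * Y).map (residue O) = X.map (residue O) * Y.map (residue O) :=
    map_mul ((residue O).mapMatrix (m := Fin 4))
  rw [eq_comm, conjHom_eq_iff, ← h1]
  change _ = _ * Q.val.map (residue O)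
  rw [← hm, conjHom_apply, mul_assoc, Units.inv_mul, mul_one, hm]
  rfl

theorem pointIdeal_induction {Ty : Mat4 K → Prop} (hTy : ConjInvariant Ty)
    (U : IsUniversalPair q φ₀ σ₀ F S) (P : (Mat4 (ResidueField O))ˣ) {motive : Ideal R → Prop}
    (h : ∀ {φ₁ σ₁ : Mat4 O} {F₁ S₁ : Mat4 R}, IsUniversalPair q φ₁ σ₁ F₁ S₁ →
      φ₁.map (residue O) = conjHom (ResidueField O) P (φ₀.map (residue O)) →
      (IsCongr σ₁ (1 : Mat4 O) ↔ IsCongr σ₀ (1 : Mat4 O)) → motive (pointIdeal c Ty S₁)) :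
    motive (pointIdeal c Ty S) := by
  obtain ⟨Q, hQ⟩ := exists_unit_lift P
  rw [← pointIdeal_conj hTy (extUnit R Q)]
  refine h (U.conj Q) (hQ φ₀) ?_
  rw [isCongr_iff_residue, isCongr_iff_residue, hQ]
  have h1 : (1 : Mat4 O).map (residue O) = 1 := map_one ((residue O).mapMatrix (m := Fin 4))
  rw [h1, conjHom_eq_iff]
  constructor
  · intro h2
    exact P.isUnit.mul_left_cancel (h2.trans (by rw [one_mul, mul_one]))
  · intro h2
    rw [h2, mul_one, one_mul]

theorem residual_charpoly (U : IsUniversalPair q φ₀ σ₀ F S)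
    (hsplit : (φ₀.map (residue O)).charpoly.Splits) (x : R →ₐ[O] K) {ι : Type} (n : Fin 4 → ℕ)
    (s : Fin 4 → ι) (hs : ∀ a, ∃ j, n j = 0 ∧ s j = a) {α : ι → K}
    (h : (x.mapMatrix F).charpoly =
      ∏ j, (Polynomial.X - Polynomial.C ((q : K) ^ n j * α (s j)))) :
    ∃ β : ι → ResidueField O, (φ₀.map (residue O)).charpoly =
      ∏ j, (Polynomial.X - Polynomial.C ((q : ResidueField O) ^ n j * β (s j))) := by
  have hR := U.cnl
  have hprime : (RingHom.ker x).IsPrime := RingHom.ker_isPrime x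
  have hloc : IsLocalRing (R ⧸ RingHom.ker x) :=
    IsLocalRing.of_surjective' (Ideal.Quotient.mk _) Ideal.Quotient.mk_surjective
  let A := R ⧸ RingHom.ker x
  let π : R →ₐ[O] A := Ideal.Quotient.mkₐ O _
  have hA : IsCNL O A := IsCNL.of_surjective π Ideal.Quotient.mk_surjective
  let i : A →ₐ[O] K := Ideal.kerLiftAlg x
  have hF := U.congr_frob.map π fun x hx => map_mem_maximalIdeal IsCNL.residue_surjective π hx
  refine exists_residual_roots (i : A →+* K) (Ideal.kerLiftAlg_injective x)
    (Matrix.charpoly_monic (π.mapMatrix F)) (ResidueField.map (algebraMap O A)) ?_ hsplit n s hs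
    (α := α) ?_
  · rw [← Matrix.charpoly_map, ← Matrix.charpoly_map, hF.map_residue]
  · rw [← h, ← Matrix.charpoly_map]; rfl

theorem label_ne_zero (hu : IsUnit (φ₀.map (residue O))) {e : Fin 4 → ResidueField O}
    (h : (φ₀.map (residue O)).charpoly = ∏ j, (Polynomial.X - Polynomial.C (e j))) (j : Fin 4) :
    e j ≠ 0 := by
  intro h0
  have h1 := ((Matrix.isUnit_iff_isUnit_det _).mp hu).ne_zero
  rw [Matrix.det_eq_sign_charpoly_coeff, h, Polynomial.coeff_zero_eq_eval_zero,
    Polynomial.eval_prod, Finset.prod_eq_zero (Finset.mem_univ j) (by simp [h0]), mul_zero] at h1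
  exact h1 rfl

theorem frob_mul_lg (hc : 6 * c = 1) (U : IsUniversalPair q φ₀ σ₀ F S) {x : R →ₐ[O] K}
    (hx : (x.mapMatrix S - 1) ^ 4 = 0) : x.mapMatrix F * lg c (x.mapMatrix S) =
      q • (lg c (x.mapMatrix S) * x.mapMatrix F) := by
  rw [← Nat.cast_smul_eq_nsmul O]
  exact mul_lg_eq hc hx (by rw [← map_mul, U.rel, map_mul, map_pow])

theorem zero_subsingleton_or_equiv_of_splits (hOK : Function.Injective (algebraMap O K))
    (hc : 6 * c = 1) (U : IsUniversalPair q φ₀ σ₀ F S)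
    (hsplit : (φ₀.map (residue O)).charpoly.Splits) :
    Subsingleton (R ⧸ pointIdeal c (TyZero (K := K)) S) ∨
      Nonempty ((R ⧸ pointIdeal c (TyZero (K := K)) S) ≃ₐ[O] MvPowerSeries (Fin 16) O) := by
  obtain ⟨e, he⟩ : ∃ e : Fin 4 → ResidueField O, (φ₀.map (residue O)).charpoly =
      ∏ j, (Polynomial.X - Polynomial.C (e j)) := by
    have h1 := hsplit.natDegree_eq_card_roots
    rw [Matrix.charpoly_natDegree_eq_dim, Fintype.card_fin] at h1
    obtain ⟨e, he⟩ : ∃ e : Fin 4 → ResidueField O,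
        (φ₀.map (residue O)).charpoly.roots = Multiset.ofList (List.ofFn e) := by
      obtain ⟨l, hl⟩ := Quot.exists_rep (φ₀.map (residue O)).charpoly.roots
      rw [← hl] at h1
      have h2 : 4 = l.length := h1
      refine ⟨fun i => l.get (i.cast h2), hl.symm.trans (congrArg _ ?_)⟩
      exact (List.ofFn_congr h2.symm l.get).symm.trans (List.ofFn_get l) |>.symm
    refine ⟨e, ?_⟩
    rw [hsplit.eq_prod_roots_of_monic (Matrix.charpoly_monic _), he, Multiset.map_coe,
      Multiset.prod_coe, List.map_ofFn, List.prod_ofFn]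
    rfl
  obtain ⟨P, hP⟩ := exists_isBlock_conj he
  exact pointIdeal_induction tyZero_conjInvariant U P
    (motive := fun I => Subsingleton (R ⧸ I) ∨ Nonempty ((R ⧸ I) ≃ₐ[O] MvPowerSeries (Fin 16) O))
    fun U' h1 _ => zero_subsingleton_or_equiv hOK hc U' (h1 ▸ hP)

theorem regular_subsingleton_or_equiv_of_splits (hOK : Function.Injective (algebraMap O K))
    (hc : 6 * c = 1) (U : IsUniversalPair q φ₀ σ₀ F S) (hq : IsBanalIn (ResidueField O) q)
    (hu : IsUnit (φ₀.map (residue O))) (hsplit : (φ₀.map (residue O)).charpoly.Splits) :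
    Subsingleton (R ⧸ pointIdeal c (TyRegular (K := K)) S) ∨
      Nonempty ((R ⧸ pointIdeal c (TyRegular (K := K)) S) ≃ₐ[O] MvPowerSeries (Fin 16) O) := by
  by_cases hx : ∃ x : R →ₐ[O] K, IsTypePoint c TyRegular S x
  swap
  · exact Or.inl (subsingleton_quotient_of_forall_not hx)
  obtain ⟨x, hx1, hx2⟩ := hx
  obtain ⟨α, hα⟩ := charpoly_of_tyRegular hx2 (frob_mul_lg hc U hx1)
  obtain ⟨β, hβ⟩ := residual_charpoly U hsplit x ![3, 2, 1, 0] (fun _ => ())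
    (fun _ => ⟨3, rfl, rfl⟩) (α := fun _ => α) (hα.trans (by simp only [powLabel, mul_comm]))
  replace hβ : (φ₀.map (residue O)).charpoly =
      ∏ i, (Polynomial.X - Polynomial.C (powLabel q (β ()) ![3, 2, 1, 0] i)) := by
    rw [hβ]; simp only [powLabel, mul_comm]
  have ht : β () ≠ 0 := by simpa [powLabel] using label_ne_zero hu hβ 3
  obtain ⟨P, hP⟩ := exists_isBlock_conj hβ
  exact pointIdeal_induction tyRegular_conjInvariant U P
    (motive := fun I => Subsingleton (R ⧸ I) ∨ Nonempty ((R ⧸ I) ≃ₐ[O] MvPowerSeries (Fin 16) O))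
    fun U' h1 _ => regular_subsingleton_or_equiv hOK hc U' hq ht (h1 ▸ hP)

/-- `M` is conjugate to a nonzero multiple of `diag (q ^ n i)`. -/
def IsPowConj {k : Type*} [Field k] (q : ℕ) (n : Fin 4 → ℕ) (M : Mat4 k) : Prop :=
  ∃ t : k, t ≠ 0 ∧ ∃ P : (Mat4 k)ˣ, conjHom k P M = Matrix.diagonal (powLabel q t n)

theorem square22_equiv_vertex_of_isPowConj (hOK : Function.Injective (algebraMap O K))
    (hc : 6 * c = 1) (U : IsUniversalPair q φ₀ σ₀ F S) (hq : IsBanalIn (ResidueField O) q)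
    {r : O} (hr : q * r = 1) (hσ : IsCongr σ₀ (1 : Mat4 O))
    (hφ : IsPowConj q ![1, 1, 0, 0] (φ₀.map (residue O))) :
    Nonempty ((R ⧸ pointIdeal c (TySquare (K := K)) S) ≃ₐ[O]
      MvPowerSeries (Fin 9) (Rhat22 O)) := by
  obtain ⟨t, ht, P, hP⟩ := hφ
  exact pointIdeal_induction tySquare_conjInvariant U P
    (motive := fun I => Nonempty ((R ⧸ I) ≃ₐ[O] MvPowerSeries (Fin 9) (Rhat22 O)))
    fun U' h1 h2 => square22_equiv_vertex hOK hc U' hq ht hr (h1.trans hP) (h2.mpr hσ)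

theorem square121_equiv_vertex_of_isPowConj (hOK : Function.Injective (algebraMap O K))
    (hc : 6 * c = 1) (U : IsUniversalPair q φ₀ σ₀ F S) (hq : IsBanalIn (ResidueField O) q)
    {r : O} (hr : q * r = 1) (hσ : IsCongr σ₀ (1 : Mat4 O))
    (hφ : IsPowConj q ![2, 1, 1, 0] (φ₀.map (residue O))) :
    Nonempty ((R ⧸ pointIdeal c (TySquare (K := K)) S) ≃ₐ[O]
      MvPowerSeries (Fin 11) (Rhat121 O)) := by
  obtain ⟨t, ht, P, hP⟩ := hφ
  exact pointIdeal_induction tySquare_conjInvariant U P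
    (motive := fun I => Nonempty ((R ⧸ I) ≃ₐ[O] MvPowerSeries (Fin 11) (Rhat121 O)))
    fun U' h1 h2 => square121_equiv_vertex hOK hc U' hq ht hr (h1.trans hP) (h2.mpr hσ)

theorem split_labels {k : Type*} [Field k] (hq : IsBanalIn k q) {a b : k} (ha : a ≠ 0)
    (hb : b ≠ 0) (h1 : a ≠ b) (h2 : b ≠ q * a) (h3 : a ≠ q * b) (h4 : b ≠ q * (q * a)) :
    (∀ i j, (![q * a, a, q * b, b] : Fin 4 → k) i = 1 * (![q * a, a, q * b, b] : Fin 4 → k) j →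
      i = j) ∧
    ∀ i j, (![q * a, a, q * b, b] : Fin 4 → k) i = q * (![q * a, a, q * b, b] : Fin 4 → k) j →
      (i, j) = (0, 1) ∨ (i, j) = (2, 3) ∨ (i, j) = (1, 2) := by
  have q0 := hq.1
  have q1 : ∀ x : k, x ≠ 0 → x ≠ q * x := fun x hx h => by
    have := hq.2 1 le_rfl (by norm_num)
    rw [pow_one] at this
    exact this (mul_right_cancel₀ hx (by rw [one_mul]; exact h.symm))
  have q2 : ∀ x : k, x ≠ 0 → x ≠ q * (q * x) := fun x hx h => by
    refine hq.2 2 (by norm_num) (by norm_num) (mul_right_cancel₀ hx ?_)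
    rw [one_mul, pow_two, mul_assoc]
    exact h.symm
  have qi : ∀ x y : k, (q : k) * x = q * y → x = y := fun x y h => mul_left_cancel₀ q0 h
  have ea := q1 a ha
  have eb := q1 b hb
  have fa := q2 a ha
  have fb := q2 b hb
  constructor
  · intro i j h
    rw [one_mul] at h
    fin_cases i <;> fin_cases j <;> first
      | rfl
      | exact absurd h ea
      | exact absurd h.symm ea
      | exact absurd h eb
      | exact absurd h.symm eb
      | exact absurd h h1
      | exact absurd h.symm h1
      | exact absurd h h2
      | exact absurd h.symm h2
      | exact absurd h h3
      | exact absurd h.symm h3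
      | exact absurd (qi _ _ h) h1
      | exact absurd (qi _ _ h).symm h1
  · intro i j h
    fin_cases i <;> fin_cases j <;> first
      | exact Or.inl rfl
      | exact Or.inr (Or.inl rfl)
      | exact Or.inr (Or.inr rfl)
      | exact absurd h ea
      | exact absurd h eb
      | exact absurd h fa
      | exact absurd h fb
      | exact absurd h h2
      | exact absurd h h3
      | exact absurd h h4
      | exact absurd (qi _ _ h) ea
      | exact absurd (qi _ _ h) eb
      | exact absurd (qi _ _ h) h1
      | exact absurd (qi _ _ h).symm h1
      | exact absurd (qi _ _ h) h2
      | exact absurd (qi _ _ h) h3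

theorem square_subsingleton_or_equiv_of_splits [IsAlgClosed K]
    (hOK : Function.Injective (algebraMap O K)) (hc : 6 * c = 1)
    (U : IsUniversalPair q φ₀ σ₀ F S) (hq : IsBanalIn (ResidueField O) q) {r : O} (hr : q * r = 1)
    (hu : IsUnit (φ₀.map (residue O))) (hsplit : (φ₀.map (residue O)).charpoly.Splits)
    (hns1 : ¬ (IsCongr σ₀ (1 : Mat4 O) ∧ IsPowConj q ![1, 1, 0, 0] (φ₀.map (residue O))))
    (hns2 : ¬ (IsCongr σ₀ (1 : Mat4 O) ∧ IsPowConj q ![2, 1, 1, 0] (φ₀.map (residue O)))) :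
    Subsingleton (R ⧸ pointIdeal c (TySquare (K := K)) S) ∨
      Nonempty ((R ⧸ pointIdeal c (TySquare (K := K)) S) ≃ₐ[O] MvPowerSeries (Fin 16) O) := by
  by_cases hx : ∃ x : R →ₐ[O] K, IsTypePoint c TySquare S x
  swap
  · exact Or.inl (subsingleton_quotient_of_forall_not hx)
  obtain ⟨x, hx1, hx2⟩ := hx
  obtain ⟨α, β, hα⟩ := charpoly_of_tySquare hx2 (frob_mul_lg hc U hx1)
  obtain ⟨γ, hγ⟩ := residual_charpoly U hsplit x ![1, 0, 1, 0] ![0, 0, 1, 1]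
    (by decide : ∀ a : Fin 2, _) (α := ![α, β])
    (hα.trans (by simp [Fin.prod_univ_succ]))
  obtain ⟨a, b, hab⟩ : ∃ a b : ResidueField O, (φ₀.map (residue O)).charpoly =
      ∏ i, (Polynomial.X - Polynomial.C ((![q * a, a, q * b, b] : Fin 4 → ResidueField O) i)) :=
    ⟨γ 0, γ 1, by rw [hγ]; simp [Fin.prod_univ_succ]⟩
  have hswap : ∀ a b : ResidueField O,
      ∏ i, (Polynomial.X - Polynomial.C ((![q * a, a, q * b, b] : Fin 4 → ResidueField O) i)) =
      ∏ i, (Polynomial.X - Polynomial.C ((![q * b, b, q * a, a] : Fin 4 → ResidueField O) i)) := by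
    intro a b
    simp only [Fin.prod_univ_four, Matrix.cons_val]
    ring
  have conj1 : ∀ t, t ≠ 0 → (φ₀.map (residue O)).charpoly =
      ∏ i, (Polynomial.X - Polynomial.C (powLabel q t ![1, 1, 0, 0] i)) →
      Subsingleton (R ⧸ pointIdeal c (TySquare (K := K)) S) ∨
      Nonempty ((R ⧸ pointIdeal c (TySquare (K := K)) S) ≃ₐ[O] MvPowerSeries (Fin 16) O) := by
    intro t ht h
    obtain ⟨P, hP⟩ := exists_isBlock_conj h
    exact pointIdeal_induction tySquare_conjInvariant U P
      (motive := fun I => Subsingleton (R ⧸ I) ∨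
        Nonempty ((R ⧸ I) ≃ₐ[O] MvPowerSeries (Fin 16) O))
      fun U' h1 h2 => square22_subsingleton_or_equiv hOK hc U' hq ht hr (h1 ▸ hP)
        fun h3 => hns1 ⟨h2.mp h3.2, t, ht, P, h1.symm.trans h3.1⟩
  have conj2 : ∀ t, t ≠ 0 → (φ₀.map (residue O)).charpoly =
      ∏ i, (Polynomial.X - Polynomial.C (powLabel q t ![2, 1, 1, 0] i)) →
      Subsingleton (R ⧸ pointIdeal c (TySquare (K := K)) S) ∨
      Nonempty ((R ⧸ pointIdeal c (TySquare (K := K)) S) ≃ₐ[O] MvPowerSeries (Fin 16) O) := by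
    intro t ht h
    obtain ⟨P, hP⟩ := exists_isBlock_conj h
    exact pointIdeal_induction tySquare_conjInvariant U P
      (motive := fun I => Subsingleton (R ⧸ I) ∨
        Nonempty ((R ⧸ I) ≃ₐ[O] MvPowerSeries (Fin 16) O))
      fun U' h1 h2 => square121_subsingleton_or_equiv hOK hc U' hq ht hr (h1 ▸ hP)
        fun h3 => hns2 ⟨h2.mp h3.2, t, ht, P, h1.symm.trans h3.1⟩
  have key : ∀ a b : ResidueField O, (φ₀.map (residue O)).charpoly =
      ∏ i, (Polynomial.X - Polynomial.C ((![q * a, a, q * b, b] : Fin 4 → ResidueField O) i)) →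
      b ≠ q * (q * a) → Subsingleton (R ⧸ pointIdeal c (TySquare (K := K)) S) ∨
      Nonempty ((R ⧸ pointIdeal c (TySquare (K := K)) S) ≃ₐ[O] MvPowerSeries (Fin 16) O) := by
    intro a b hab h4
    have ha : a ≠ 0 := label_ne_zero hu hab 1
    have hb : b ≠ 0 := label_ne_zero hu hab 3
    by_cases h1 : a = b
    · refine conj1 a ha (hab.trans ?_)
      simp only [← h1, Fin.prod_univ_four, Matrix.cons_val, powLabel, pow_one, pow_zero, mul_one]
      ring_nf
    by_cases h2 : b = q * a
    · refine conj2 a ha (hab.trans ?_)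
      simp only [h2, Fin.prod_univ_four, Matrix.cons_val, powLabel, pow_one, pow_zero, mul_one]
      ring_nf
    by_cases h3 : a = q * b
    · refine conj2 b hb (hab.trans ?_)
      simp only [h3, Fin.prod_univ_four, Matrix.cons_val, powLabel, pow_one, pow_zero, mul_one]
      ring_nf
    obtain ⟨he1, he2⟩ := split_labels hq ha hb h1 h2 h3 h4
    obtain ⟨P, hP⟩ := exists_isBlock_conj hab
    exact pointIdeal_induction tySquare_conjInvariant U P
      (motive := fun I => Subsingleton (R ⧸ I) ∨
        Nonempty ((R ⧸ I) ≃ₐ[O] MvPowerSeries (Fin 16) O))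
      fun U' h1 h2 => split_subsingleton_or_equiv hOK hc U' he1 he2 (h1 ▸ hP)
  by_cases h4 : b = q * (q * a)
  · refine key b a (hab.trans (hswap a b)) fun h5 => ?_
    have ha : a ≠ 0 := label_ne_zero hu hab 1
    refine hq.2 4 (by norm_num) le_rfl (mul_right_cancel₀ ha ?_)
    rw [h4] at h5
    linear_combination -h5
  · exact key a b hab h4

end Rings

theorem isConjScalarDiag_iff {k : Type u} [Field k] {M : Matrix.GeneralLinearGroup (Fin 4) k}
    (hsplit : M.val.charpoly.Splits) {q : ℕ} {n : Fin 4 → ℕ} (hn : n 3 = 0) :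
    IsConjScalarDiag M (fun i => (q : k) ^ n i) ↔ IsPowConj q n M.val := by
  classical
  let f : Mat4 k →ₐ[k] Mat4 (AlgebraicClosure k) := (Algebra.ofId k _).mapMatrix
  have hdiag : ∀ t : k, f (Matrix.diagonal (powLabel q t n)) = algebraMap k (AlgebraicClosure k) t •
      Matrix.diagonal fun i => algebraMap k (AlgebraicClosure k) ((q : k) ^ n i) := by
    intro t
    rw [← Matrix.diagonal_smul]
    refine (Matrix.diagonal_map (map_zero _)).trans (congrArg _ (funext fun i => ?_))
    simp [powLabel, Algebra.ofId_apply]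
  constructor
  · rintro ⟨c, hc, P, hP⟩
    replace hP : conjHom (AlgebraicClosure k) P (f M.val) = c •
      Matrix.diagonal fun i => algebraMap k (AlgebraicClosure k) ((q : k) ^ n i) := hP
    have hcp : M.val.charpoly.map (algebraMap k (AlgebraicClosure k)) =
        ∏ i, (Polynomial.X - Polynomial.C
          (c * algebraMap k (AlgebraicClosure k) ((q : k) ^ n i))) := by
      rw [← Matrix.charpoly_map]
      refine ((charpoly_conjHom (P := P) (M := f M.val)).symm.trans (congrArg _ hP)).trans ?_
      rw [← Matrix.diagonal_smul, Matrix.charpoly_diagonal]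
      simp
    obtain ⟨t, rfl⟩ : ∃ t, algebraMap k (AlgebraicClosure k) t = c := by
      refine hsplit.mem_range_of_isRoot (M.val.charpoly_monic.ne_zero) ?_
      rw [Polynomial.IsRoot.def, hcp, Polynomial.eval_prod]
      exact Finset.prod_eq_zero (Finset.mem_univ 3) (by simp [hn])
    have hcp' : M.val.charpoly = ∏ i, (Polynomial.X - Polynomial.C (powLabel q t n i)) := by
      apply Polynomial.map_injective _ (algebraMap k (AlgebraicClosure k)).injective
      rw [hcp, Polynomial.map_prod]
      refine Finset.prod_congr rfl fun i _ => ?_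
      rw [Polynomial.map_sub, Polynomial.map_X, Polynomial.map_C, powLabel,
        map_mul (algebraMap k (AlgebraicClosure k))]
    obtain ⟨Q, hQ⟩ := exists_isBlock_conj hcp'
    refine ⟨t, fun h => hc (by rw [h, map_zero]), Q, ?_⟩
    set p : Polynomial k := ∏ μ ∈ Finset.univ.image (powLabel q t n),
      (Polynomial.X - Polynomial.C μ) with hp
    refine hQ.eq_diagonal_of_squarefree (p := p) (Polynomial.Separable.squarefree
      (Polynomial.separable_prod_X_sub_C_iff'.mpr fun x _ y _ h => h)) ?_
    have hd : Polynomial.aeval (Matrix.diagonal (powLabel q t n)) p = 0 := by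
      change Polynomial.aeval (Matrix.diagonalAlgHom k (powLabel q t n)) p = 0
      rw [Polynomial.aeval_algHom_apply]
      have : Polynomial.aeval (powLabel q t n) p = 0 := by
        funext i
        have h1 := Polynomial.aeval_algHom_apply (Pi.evalAlgHom k (fun _ => k) i) (powLabel q t n) p
        rw [Pi.evalAlgHom_apply, Pi.evalAlgHom_apply] at h1
        rw [← h1, hp, map_prod]
        exact Finset.prod_eq_zero (Finset.mem_image_of_mem _ (Finset.mem_univ i)) (by simp)
      rw [this, map_zero]
    have hM : Polynomial.aeval M.val p = 0 := by
      have hf : Function.Injective f := fun X Y h => by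
        ext i j
        exact (algebraMap k (AlgebraicClosure k)).injective (congrFun (congrFun h i) j)
      have hg : Function.Injective (conjHom k P : Mat4 (AlgebraicClosure k) →ₐ[k] _) :=
        Function.LeftInverse.injective (conjHom_inv_conjHom k P)
      apply hf
      apply hg
      rw [← Polynomial.aeval_algHom_apply, ← Polynomial.aeval_algHom_apply]
      have h1 : conjHom k P (f M.val) = f (Matrix.diagonal (powLabel q t n)) :=
        hP.trans (hdiag t).symm
      rw [h1, Polynomial.aeval_algHom_apply, hd, map_zero, map_zero]
    rw [Polynomial.aeval_algHom_apply, hM, map_zero]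
  · rintro ⟨t, ht, P, hP⟩
    refine ⟨algebraMap _ _ t, fun h => ht ((map_eq_zero _).mp h),
      Units.map (f : Mat4 k →* Mat4 (AlgebraicClosure k)) P, ?_⟩
    have h1 := congrArg f hP
    rw [hdiag, conjHom_apply, map_mul, map_mul] at h1
    exact h1

theorem exists_pow_eq {k κ : Type*} [Field k] [Finite k] [Field κ] [Algebra k κ]
    [Algebra.IsIntegral k κ] (g : κ ≃ₐ[k] κ) {s : Set κ} (hs : s.Finite) :
    ∃ n : ℕ, ∀ x ∈ s, g x = x ^ Nat.card k ^ n := by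
  let k' : IntermediateField k κ := IntermediateField.adjoin k s
  have := hs.to_subtype
  have hfin : FiniteDimensional k k' :=
    IntermediateField.finiteDimensional_adjoin (S := s) fun x _ => Algebra.IsIntegral.isIntegral x
  have hfinite : Finite k' := Module.finite_of_finite k
  have := Fintype.ofFinite k
  obtain ⟨n, hn⟩ := (FiniteField.bijective_frobeniusAlgEquivOfAlgebraic_pow k k').2
    (g.restrictNormal k')
  refine ⟨n, fun x hx => ?_⟩
  have h1 := g.restrictNormal_commutes k' ⟨x, IntermediateField.subset_adjoin _ _ hx⟩
  rw [← hn] at h1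
  refine Eq.trans (h1.symm : g x = _) ?_
  rw [AlgEquiv.coe_pow, FiniteField.coe_frobeniusAlgEquivOfAlgebraic_iterate,
    Nat.card_eq_fintype_card]
  rfl

/-! ### The ring of integers of the algebraic closure of a local field -/

section Integers

variable {L : Type v} [Field L] [ValuativeRel L]

theorem isOpen_setOf_apply_mem (x : AlgebraicClosure L) (T : Set (AlgebraicClosure L)) :
    IsOpen {g : AbsGal L | g x ∈ T} := by
  rw [isOpen_iff_mem_nhds]
  intro g hg
  have h1 : IsOpen (MulAction.stabilizer (AbsGal L) x : Set (AbsGal L)) :=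
    stabilizer_isOpen_of_isIntegral x
  filter_upwards [(h1.leftCoset g).mem_nhds ⟨1, one_mem _, mul_one g⟩]
  rintro _ ⟨h, hh, rfl⟩
  have h2 : h x = x := hh
  change g (h x) ∈ T
  rwa [h2]

theorem isClosed_setOf_apply_mem (x : AlgebraicClosure L) (T : Set (AlgebraicClosure L)) :
    IsClosed {g : AbsGal L | g x ∈ T} := by
  rw [← isOpen_compl_iff]
  exact isOpen_setOf_apply_mem x Tᶜ

theorem isClosed_setOf_smul_mem (x : IntegersBar L) (T : Set (IntegersBar L)) :
    IsClosed {g : AbsGal L | g • x ∈ T} := by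
  convert isClosed_setOf_apply_mem (x : AlgebraicClosure L) (Subtype.val '' T) using 1
  ext g
  constructor
  · intro h; exact ⟨_, h, rfl⟩
  · rintro ⟨y, hy, h⟩
    have : g • x = y := Subtype.ext h.symm
    change g • x ∈ T
    rwa [this]

variable [TopologicalSpace L] [IsNonarchimedeanLocalField L]

theorem mem_integersBar_iff {x : AlgebraicClosure L} :
    x ∈ IntegersBar L ↔ ∀ n, (minpoly L x).coeff n ∈ 𝒪[L] := by
  have hx : IsIntegral L x := Algebra.IsIntegral.isIntegral x
  constructor
  · intro h n
    rw [minpoly.isIntegrallyClosed_eq_field_fractions' (R := 𝒪[L]) L h, Polynomial.coeff_map]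
    exact ((minpoly 𝒪[L] x).coeff n).2
  · intro h
    have h2 : ∀ n, (minpoly L x).coeff n ∈ Set.range (algebraMap 𝒪[L] L) := fun n => ⟨⟨_, h n⟩, rfl⟩
    obtain ⟨f, hf⟩ := (Polynomial.mem_lifts _).mp
      ((Polynomial.lifts_iff_coeff_lifts _).mpr h2)
    refine ⟨f, ?_, ?_⟩
    · exact Polynomial.monic_of_injective (IsFractionRing.injective 𝒪[L] L)
        (hf ▸ minpoly.monic hx)
    · rw [IsScalarTower.algebraMap_eq 𝒪[L] L, ← Polynomial.eval₂_map, hf]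
      exact minpoly.aeval L x

open scoped Valued in
theorem exists_integersBar_size : ∃ N : AlgebraicClosure L → ℝ,
    (∀ x y, N (x + y) ≤ max (N x) (N y)) ∧ (∀ x y, N (x * y) = N x * N y) ∧ N 1 = 1 ∧ N 0 = 0 ∧
    (∀ x, 0 ≤ N x) ∧ ∀ x, N x ≤ 1 ↔ x ∈ IntegersBar L := by
  let _ := IsTopologicalAddGroup.rightUniformSpace L
  have _ := isUniformAddGroup_of_addCommGroup (G := L)
  let _ : (Valued.v (R := L)).RankOne :=
  { hom' := IsRankLeOne.nonempty.some.emb (R := L).comp MonoidWithZeroHom.ValueGroup₀.embedding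
    strictMono' := IsRankLeOne.nonempty.some.strictMono.comp
        MonoidWithZeroHom.ValueGroup₀.embedding_strictMono }
  refine ⟨spectralNorm L (AlgebraicClosure L), isNonarchimedean_spectralNorm,
    fun x y => map_mul (spectralMulAlgNorm L (AlgebraicClosure L)) x y, spectralNorm_one,
    spectralNorm_zero, spectralNorm_nonneg, fun x => ?_⟩
  have hx : IsIntegral L x := Algebra.IsIntegral.isIntegral x
  rw [spectralNorm, spectralValue_le_one_iff (minpoly.monic hx)]
  rw [mem_integersBar_iff]
  exact forall_congr' fun n => Valued.toNormedField.norm_le_one_iff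

instance isLocalRing_integersBar : IsLocalRing (IntegersBar L) := by
  obtain ⟨N, hadd, hmul, h1, hz, h0, hInt⟩ := exists_integersBar_size (L := L)
  have hunit : ∀ a : IntegersBar L, IsUnit a ↔ N a = 1 := by
    intro a
    constructor
    · rintro ⟨u, rfl⟩
      have h2 := (hInt _).mpr u.val.2
      have h3 := (hInt _).mpr u⁻¹.val.2
      have h4 : N u.val * N u⁻¹.val = 1 := by
        rw [← hmul, ← h1, ← Subalgebra.coe_mul, Units.mul_inv]; rfl
      nlinarith [h0 u.val, h0 u⁻¹.val]
    · intro ha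
      have hne : (a : AlgebraicClosure L) ≠ 0 := by
        intro h
        rw [h, hz] at ha
        exact zero_ne_one ha
      have h2 : N (a : AlgebraicClosure L)⁻¹ = 1 := by
        have := hmul a (a : AlgebraicClosure L)⁻¹
        rw [mul_inv_cancel₀ hne, h1, ha, one_mul] at this
        exact this.symm
      refine IsUnit.of_mul_eq_one ⟨_, (hInt _).mp h2.le⟩ (Subtype.ext (mul_inv_cancel₀ hne))
  refine IsLocalRing.of_nonunits_add fun a b ha hb => ?_
  rw [mem_nonunits_iff, hunit] at *
  have h2 := lt_of_le_of_ne ((hInt _).mpr a.2) ha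
  have h3 := lt_of_le_of_ne ((hInt _).mpr b.2) hb
  exact ((hadd a b).trans_lt (max_lt h2 h3)).ne

theorem maxIdealBar_eq : maxIdealBar L = maximalIdeal (IntegersBar L) :=
  IsLocalRing.jacobson_eq_maximalIdeal ⊥ bot_ne_top

instance isLocalHom_integersBar : IsLocalHom (algebraMap 𝒪[L] (IntegersBar L)) :=
  (algebraMap_isIntegral_iff.mpr inferInstance :
    (algebraMap 𝒪[L] (IntegersBar L)).IsIntegral).isLocalHom
    fun _ _ h => Subtype.ext ((algebraMap L (AlgebraicClosure L)).injective
      (congrArg Subtype.val h))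

theorem exists_pow_congr (g : AbsGal L) (s : Finset (IntegersBar L)) :
    ∃ n : ℕ, ∀ x ∈ s, g • x - x ^ resCard L ^ n ∈ maxIdealBar L := by
  let B := IntegersBar L
  let κ := ResidueField B
  have hInt : Algebra.IsIntegral 𝒪[L] B := inferInstance
  have halg : Algebra.IsIntegral 𝓀[L] κ := by
    refine ⟨fun y => ?_⟩
    obtain ⟨x, rfl⟩ := residue_surjective y
    exact ((hInt.isIntegral x).map (IsScalarTower.toAlgHom 𝒪[L] B κ)).tower_top
  let gbar : κ ≃ₐ[𝓀[L]] κ := AlgEquiv.ofRingEquiv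
    (f := ResidueField.mapEquiv (MulSemiringAction.toRingEquiv (AbsGal L) B g)) fun y => by
      obtain ⟨x, rfl⟩ := residue_surjective y
      change residue B (g • algebraMap 𝒪[L] B x) = residue B (algebraMap 𝒪[L] B x)
      congr 1
      exact Subtype.ext (g.commutes (x : L))
  obtain ⟨n, hn⟩ := exists_pow_eq gbar (s.finite_toSet.image (residue B))
  refine ⟨n, fun x hx => ?_⟩
  rw [maxIdealBar_eq, ← residue_eq_zero_iff, map_sub, sub_eq_zero, map_pow]
  exact hn _ ⟨x, hx, rfl⟩

theorem smul_pow_card_pow {φ : AbsGal L} (hφ : IsFrobeniusLift L φ) (n : ℕ) (x : IntegersBar L) :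
    φ ^ n • x - x ^ resCard L ^ n ∈ maxIdealBar L := by
  induction n generalizing x with
  | zero => simp
  | succ n ih =>
    have h1 := ih (φ • x)
    have h2 := Ideal.mem_of_dvd _ (sub_dvd_pow_sub_pow (φ • x) (x ^ resCard L) (resCard L ^ n))
      (hφ x)
    have h3 := add_mem h1 h2
    rwa [smul_smul, ← pow_succ, sub_add_sub_cancel, ← pow_mul, ← pow_succ'] at h3

theorem mem_inertia_iff {g : AbsGal L} :
    g ∈ inertia L ↔ ∀ x : IntegersBar L, g • x - x ∈ maxIdealBar L := Iff.rfl

theorem isClosed_inertia : IsClosed (inertia L : Set (AbsGal L)) := by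
  have : (inertia L : Set (AbsGal L)) = ⋂ x : IntegersBar L,
      {g | g • x ∈ {y | y - x ∈ maxIdealBar L}} := by
    ext g
    simp only [Set.mem_iInter]
    rfl
  rw [this]
  exact isClosed_iInter fun x => isClosed_setOf_smul_mem x _

theorem smul_mem_maxIdealBar (g : AbsGal L) {x : IntegersBar L} (hx : x ∈ maxIdealBar L) :
    g • x ∈ maxIdealBar L := by
  rw [maxIdealBar_eq] at *
  intro h
  refine hx ?_
  have := h.map (MulSemiringAction.toRingHom (AbsGal L) (IntegersBar L) g⁻¹)
  rwa [MulSemiringAction.toRingHom_apply, inv_smul_smul] at this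

variable [CharZero L]

theorem dense_frobenius_inertia {φ : AbsGal L} (hφ : IsFrobeniusLift L φ) :
    Dense ((Subgroup.zpowers φ ⊔ inertia L : Subgroup (AbsGal L)) : Set (AbsGal L)) := by
  intro g
  have := (isClosed_closure (s := (Subgroup.zpowers φ : Set (AbsGal L)))).isCompact
  obtain ⟨z, hz, hzg⟩ := this.inter_iInter_nonempty
    (fun x : IntegersBar L => {z : AbsGal L | z • x ∈ {y | y - g • x ∈ maxIdealBar L}})
    (fun x => isClosed_setOf_smul_mem x _) (fun s => by
      obtain ⟨n, hn⟩ := exists_pow_congr g s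
      refine ⟨φ ^ n, subset_closure ⟨n, by simp⟩, ?_⟩
      simp only [Set.mem_iInter]
      intro x hx
      have h1 := sub_mem (smul_pow_card_pow hφ n x) (hn x hx)
      rwa [sub_sub_sub_cancel_right] at h1)
  have h1 : z⁻¹ * g ∈ inertia L := by
    rw [mem_inertia_iff]
    intro x
    have h2 : z • x - g • x ∈ maxIdealBar L := Set.mem_iInter.mp hzg x
    have h3 := smul_mem_maxIdealBar z⁻¹ (neg_mem h2)
    rwa [neg_sub, smul_sub, smul_smul, inv_smul_smul] at h3
  have h4 : z ∈ (Subgroup.zpowers φ ⊔ inertia L).topologicalClosure :=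
    closure_mono (SetLike.coe_subset_coe.mpr le_sup_left) hz
  have h5 := mul_mem h4 (subset_closure (SetLike.mem_coe.mpr (le_sup_right (a := Subgroup.zpowers φ)
    h1)) : _ ∈ (Subgroup.zpowers φ ⊔ inertia L).topologicalClosure)
  rwa [mul_inv_cancel_left] at h5

/-! ### Roots of unity and Kummer extensions -/

theorem resCard_mem_maxIdealBar : (resCard L : IntegersBar L) ∈ maxIdealBar L := by
  have h1 : (resCard L : 𝒪[L]) ∈ maximalIdeal 𝒪[L] := by
    rw [← residue_eq_zero_iff, map_natCast, resCard]
    have := Fintype.ofFinite 𝓀[L]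
    rw [Nat.card_eq_fintype_card, Nat.cast_card_eq_zero]
  have h2 := algebraMap_mem_maximalIdeal (IntegersBar L) h1
  rwa [map_natCast, ← maxIdealBar_eq] at h2

theorem eq_one_of_sub_mem {n : ℕ} (hn : n.Coprime (resCard L)) {x : IntegersBar L} (hx : x ^ n = 1)
    (h : x - 1 ∈ maxIdealBar L) : x = 1 := by
  rw [maxIdealBar_eq] at h
  have hq := resCard_mem_maxIdealBar (L := L)
  rw [maxIdealBar_eq] at hq
  have h1 : (∑ i ∈ Finset.range n, x ^ i) * (x - 1) = 0 := by rw [geom_sum_mul, hx, sub_self]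
  rcases mul_eq_zero.mp h1 with h2 | h2
  · exfalso
    have h3 : residue (IntegersBar L) x = 1 := by
      rw [← sub_eq_zero, ← map_one (residue (IntegersBar L)), ← map_sub]
      exact (residue_eq_zero_iff _).mpr h
    have h4 : (n : ResidueField (IntegersBar L)) = 0 := by
      have := congrArg (residue (IntegersBar L)) h2
      simpa [h3] using this
    have h5 : (resCard L : ResidueField (IntegersBar L)) = 0 := by
      rw [← map_natCast (residue (IntegersBar L))]
      exact (residue_eq_zero_iff _).mpr hq
    have h6 := Nat.Coprime.isCoprime hn
    obtain ⟨a, b, hab⟩ := h6.map (Int.castRingHom (ResidueField (IntegersBar L)))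
    simp [h4, h5] at hab
  · exact sub_eq_zero.mp h2

theorem apply_eq_of_congr {n : ℕ} (hn : n.Coprime (resCard L)) {g : AbsGal L} {m : ℕ}
    {ζ : AlgebraicClosure L} (hζ : ζ ^ n = 1)
    (hg : ∀ x : IntegersBar L, (x : AlgebraicClosure L) = ζ → g • x - x ^ m ∈ maxIdealBar L) :
    g ζ = ζ ^ m := by
  have hn0 : 0 < n := by
    rcases Nat.eq_zero_or_pos n with rfl | h
    · rw [Nat.coprime_zero_left] at hn
      have h1 : 1 < Nat.card 𝓀[L] := Finite.one_lt_card
      exact absurd hn h1.ne'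
    · exact h
  have hz : ζ ≠ 0 := by
    rintro rfl
    rw [zero_pow hn0.ne'] at hζ
    exact zero_ne_one hζ
  have hInt : ∀ y : AlgebraicClosure L, y ^ n = 1 → y ∈ IntegersBar L := fun y hy =>
    IsIntegral.of_pow hn0 (by rw [hy]; exact isIntegral_one)
  let z : IntegersBar L := ⟨ζ, hInt ζ hζ⟩
  let w : IntegersBar L := ⟨ζ⁻¹, hInt _ (by rw [inv_pow, hζ, inv_one])⟩
  have hzw : z * w = 1 := Subtype.ext (mul_inv_cancel₀ hz)
  have h1 : (g • z) * w ^ m = 1 := by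
    refine eq_one_of_sub_mem hn ?_ ?_
    · apply Subtype.ext
      change (g ζ * ζ⁻¹ ^ m) ^ n = 1
      rw [mul_pow, ← map_pow, hζ, ← pow_mul, mul_comm m, pow_mul, inv_pow, hζ]
      simp
    · have h2 := Ideal.mul_mem_right (w ^ m) _ (hg z rfl)
      rwa [sub_mul, ← mul_pow, hzw, one_pow] at h2
  have h3 : g ζ * ζ⁻¹ ^ m = 1 := congrArg Subtype.val h1
  rw [inv_pow] at h3
  exact (mul_inv_eq_one₀ (pow_ne_zero _ hz)).mp h3

theorem exists_ne_pow : ∃ π : L, π ≠ 0 ∧ ∀ ℓ : ℕ, 2 ≤ ℓ → ∀ x : L, x ^ ℓ ≠ π := by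
  obtain ⟨π, hπ⟩ := IsDiscreteValuationRing.exists_irreducible 𝒪[L]
  refine ⟨π, fun h => hπ.ne_zero (Subtype.ext h), fun ℓ hℓ x hx => ?_⟩
  have hInt : IsIntegral 𝒪[L] x := IsIntegral.of_pow (by omega : 0 < ℓ) (by
    rw [hx]; exact isIntegral_algebraMap)
  obtain ⟨y, rfl⟩ := IsIntegrallyClosed.isIntegral_iff.mp hInt
  have h1 : y ^ ℓ = π := Subtype.ext hx
  exact not_irreducible_pow (by omega : ℓ ≠ 1) (h1 ▸ hπ)

end Integers

/-! ### Tame homomorphisms of the absolute Galois group -/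

section Tame

variable {L : Type v} [Field L] [ValuativeRel L] {ℓ : ℕ}

instance normal_proEllKernel : (proEllKernel L ℓ).Normal := by
  rw [proEllKernel, sInf_eq_iInf]
  exact Subgroup.normal_iInf_normal fun U => Subgroup.normal_iInf_normal fun hU => hU.1

theorem exists_eq_zpow_mul {σ : inertia L} (hσ : IsTameGenerator L ℓ σ) {V : Subgroup (inertia L)}
    (hV : IsOpen (V : Set (inertia L))) (g : inertia L) :
    ∃ m : ℤ, ∃ p ∈ proEllKernel L ℓ, ∃ v ∈ V, g = σ ^ m * p * v := by
  obtain ⟨x, ⟨v, hv, rfl⟩, hx⟩ := hσ.inter_open_nonempty _ (hV.leftCoset g) ⟨_, 1, one_mem V, rfl⟩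
  obtain ⟨_, ⟨m, rfl⟩, p, hp, h⟩ := Subgroup.mem_sup_of_normal_right.mp hx
  exact ⟨m, p, hp, v⁻¹, inv_mem hv, by rw [eq_mul_inv_iff_mul_eq]; exact h.symm⟩

theorem proEllKernel_le_ker [Fact ℓ.Prime] {Γ : Type*} [Group Γ] [Finite Γ] {f : inertia L →* Γ}
    (hf : IsOpen (f.ker : Set (inertia L))) (hp : IsPGroup ℓ f.range) : proEllKernel L ℓ ≤ f.ker := by
  obtain ⟨k, hk⟩ := IsPGroup.iff_card.mp hp
  exact sInf_le ⟨inferInstance, hf, k, by rw [Subgroup.index_ker, hk]⟩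

/-- A homomorphism with open kernel that is trivial on the kernel of the maximal pro-`ℓ` quotient
of inertia. -/
structure IsTame (ℓ : ℕ) {Γ : Type*} [Group Γ] (f : AbsGal L →* Γ) : Prop where
  isOpen_ker : IsOpen (f.ker : Set (AbsGal L))
  eq_one : ∀ g ∈ proEllKernel L ℓ, f g = 1

theorem isOpen_subgroupOf {H : Subgroup (AbsGal L)} (hH : IsOpen (H : Set (AbsGal L))) :
    IsOpen (H.subgroupOf (inertia L) : Set (inertia L)) := hH.preimage continuous_subtype_val

theorem IsTame.of_isPGroup [Fact ℓ.Prime] {Γ : Type*} [Group Γ] [Finite Γ] {f : AbsGal L →* Γ}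
    (hf : IsOpen (f.ker : Set (AbsGal L)))
    (hp : IsPGroup ℓ (f.comp (inertia L).subtype).range) : IsTame ℓ f :=
  ⟨hf, fun _ hg => proEllKernel_le_ker (f := f.comp (inertia L).subtype) (isOpen_subgroupOf hf) hp hg⟩

theorem IsTame.exists_zpow {Γ : Type*} [Group Γ] {f : AbsGal L →* Γ} (hf : IsTame ℓ f)
    {σ : inertia L} (hσ : IsTameGenerator L ℓ σ) (g : inertia L) : ∃ m : ℤ, f g = f σ ^ m := by
  obtain ⟨m, p, hp, v, hv, rfl⟩ := exists_eq_zpow_mul hσ (isOpen_subgroupOf hf.isOpen_ker) g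
  refine ⟨m, ?_⟩
  rw [Subgroup.coe_mul, Subgroup.coe_mul, map_mul, map_mul, hf.eq_one p hp, (show f (v : AbsGal L) = 1 from hv),
    mul_one, mul_one, Subgroup.coe_zpow, map_zpow]

theorem IsTame.prod {Γ Γ' : Type*} [Group Γ] [Group Γ'] {f : AbsGal L →* Γ} {f' : AbsGal L →* Γ'}
    (hf : IsTame ℓ f) (hf' : IsTame ℓ f') : IsTame ℓ (f.prod f') :=
  ⟨by rw [MonoidHom.ker_prod]; exact hf.1.inter hf'.1,
    fun g hg => Prod.ext (hf.2 g hg) (hf'.2 g hg)⟩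

theorem IsTame.comp {Γ Γ' : Type*} [Group Γ] [Group Γ'] {f : AbsGal L →* Γ} (hf : IsTame ℓ f)
    (h : Γ →* Γ') : IsTame ℓ (h.comp f) :=
  ⟨Subgroup.isOpen_mono (fun _ hx => (congrArg h hx).trans (map_one h)) hf.1,
    fun g hg => (congrArg h (hf.2 g hg)).trans (map_one h)⟩

variable [TopologicalSpace L] [IsNonarchimedeanLocalField L] [CharZero L]

theorem IsTame.ext {Γ : Type*} [Group Γ] {f f' : AbsGal L →* Γ} (hf : IsTame ℓ f)
    (hf' : IsTame ℓ f') {φ : AbsGal L} (hφ : IsFrobeniusLift L φ) {σ : inertia L}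
    (hσ : IsTameGenerator L ℓ σ) (h1 : f φ = f' φ) (h2 : f σ = f' σ) : f = f' := by
  let H := f.eqLocus f'
  have hH : IsOpen (H : Set (AbsGal L)) :=
    Subgroup.isOpen_mono (H₁ := f.ker ⊓ f'.ker) (fun x hx => hx.1.trans hx.2.symm)
      (hf.1.inter hf'.1)
  have hle : Subgroup.zpowers φ ⊔ inertia L ≤ H := by
    refine sup_le ((Subgroup.zpowers_le).mpr h1) fun g hg => ?_
    obtain ⟨m, hm⟩ := (hf.prod hf').exists_zpow hσ ⟨g, hg⟩
    have h3 := Prod.ext_iff.mp hm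
    exact (h3.1.trans (congrArg (· ^ m) h2)).trans h3.2.symm
  ext g
  have h4 := (dense_frobenius_inertia hφ).mono (SetLike.coe_subset_coe.mpr hle)
  have h5 := h4.closure_eq
  rw [(Subgroup.isClosed_of_isOpen H hH).closure_eq] at h5
  exact (h5 ▸ Set.mem_univ g : g ∈ (H : Set (AbsGal L)))

theorem conj_mem_inertia (g : AbsGal L) {h : AbsGal L} (hh : h ∈ inertia L) :
    g * h * g⁻¹ ∈ inertia L := by
  rw [mem_inertia_iff] at *
  intro x
  have := smul_mem_maxIdealBar g (hh (g⁻¹ • x))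
  rwa [smul_sub, smul_inv_smul, smul_smul, smul_smul] at this

theorem frobenius_apply_of_pow_eq_one {φ : AbsGal L} (hφ : IsFrobeniusLift L φ) {n : ℕ}
    (hn : n.Coprime (resCard L)) {ζ : AlgebraicClosure L} (hζ : ζ ^ n = 1) :
    φ ζ = ζ ^ resCard L := apply_eq_of_congr hn hζ fun x _ => hφ x

theorem inertia_apply_of_pow_eq_one {g : AbsGal L} (hg : g ∈ inertia L) {n : ℕ}
    (hn : n.Coprime (resCard L)) {ζ : AlgebraicClosure L} (hζ : ζ ^ n = 1) : g ζ = ζ :=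
  (apply_eq_of_congr (m := 1) hn hζ fun x _ => by rw [pow_one]; exact hg x).trans (pow_one ζ)

section Kummer

variable {n : ℕ} [NeZero n] (hn : n.Coprime (resCard L)) {π : L} (hπ : π ≠ 0)
  {ϖ : AlgebraicClosure L} (hϖ : ϖ ^ n = algebraMap L _ π)

theorem kummer_ne_zero {n : ℕ} [NeZero n] {π : L} (hπ : π ≠ 0) {ϖ : AlgebraicClosure L}
    (hϖ : ϖ ^ n = algebraMap L _ π) : ϖ ≠ 0 := by
  rintro rfl
  rw [zero_pow (NeZero.ne n), eq_comm, map_eq_zero] at hϖ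
  exact hπ hϖ

theorem kummer_pow_eq_one {n : ℕ} [NeZero n] {π : L} (hπ : π ≠ 0) {ϖ : AlgebraicClosure L}
    (hϖ : ϖ ^ n = algebraMap L _ π) (g : AbsGal L) : (g ϖ / ϖ) ^ n = 1 := by
  rw [div_pow, ← map_pow, hϖ, g.commutes, div_self]
  exact (map_ne_zero _).mpr hπ

/-- The Kummer character `g ↦ g ϖ / ϖ` of the inertia group. -/
def kummer : inertia L →* rootsOfUnity n (AlgebraicClosure L) where
  toFun g := rootsOfUnity.mkOfPowEq ((g : AbsGal L) ϖ / ϖ) (kummer_pow_eq_one hπ hϖ g)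
  map_one' := by
    ext
    simp [kummer_ne_zero hπ hϖ]
  map_mul' g h := by
    ext
    have h0 := kummer_ne_zero hπ hϖ
    have h1 := inertia_apply_of_pow_eq_one g.2 hn (kummer_pow_eq_one hπ hϖ h)
    rw [map_div₀, div_eq_iff ((map_ne_zero _).mpr h0)] at h1
    simp only [rootsOfUnity.coe_mkOfPowEq, Subgroup.coe_mul, Units.val_mul]
    change (g : AbsGal L) ((h : AbsGal L) ϖ) / ϖ = _
    rw [h1]
    field_simp

theorem coe_kummer (g : inertia L) :
    ((kummer hn hπ hϖ g : (AlgebraicClosure L)ˣ) : AlgebraicClosure L) = (g : AbsGal L) ϖ / ϖ :=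
  rootsOfUnity.coe_mkOfPowEq _

theorem kummer_eq_one_iff {g : inertia L} : kummer hn hπ hϖ g = 1 ↔ (g : AbsGal L) ϖ = ϖ := by
  rw [← div_eq_one_iff_eq (kummer_ne_zero hπ hϖ), ← coe_kummer hn hπ hϖ, Subtype.ext_iff,
    Units.ext_iff]
  rfl

theorem isOpen_ker_kummer : IsOpen ((kummer hn hπ hϖ).ker : Set (inertia L)) := by
  have : ((kummer hn hπ hϖ).ker : Set (inertia L)) =
      Subtype.val ⁻¹' {g : AbsGal L | g ϖ ∈ ({ϖ} : Set (AlgebraicClosure L))} := by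
    ext g
    exact kummer_eq_one_iff hn hπ hϖ
  rw [this]
  exact (isOpen_setOf_apply_mem ϖ _).preimage continuous_subtype_val

end Kummer

variable [Fact ℓ.Prime]

instance neZero_prime_pow {k : ℕ} : NeZero (ℓ ^ k) := ⟨pow_ne_zero _ (Fact.out : ℓ.Prime).ne_zero⟩

theorem proEllKernel_le_ker_kummer {k : ℕ} (hn : (ℓ ^ k).Coprime (resCard L)) {π : L} (hπ : π ≠ 0)
    {ϖ : AlgebraicClosure L} (hϖ : ϖ ^ ℓ ^ k = algebraMap L _ π) :
    proEllKernel L ℓ ≤ (kummer hn hπ hϖ).ker := by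
  refine proEllKernel_le_ker (isOpen_ker_kummer hn hπ hϖ) fun x => ⟨k, ?_⟩
  ext1
  exact Subtype.ext ((mem_rootsOfUnity _ _).mp x.val.2)

theorem exists_mul_add_one_modEq {q : ℕ} (hq : ¬ q ≡ 1 [MOD ℓ]) : ∃ u : ℕ, u * q + 1 ≡ u [MOD ℓ] := by
  have h0 : (1 - q : ZMod ℓ) ≠ 0 := fun h => hq (by
    rw [← ZMod.natCast_eq_natCast_iff, Nat.cast_one]
    exact (sub_eq_zero.mp h).symm)
  refine ⟨((1 - q : ZMod ℓ)⁻¹).val, ?_⟩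
  rw [← ZMod.natCast_eq_natCast_iff]
  push_cast
  rw [ZMod.natCast_val, ZMod.cast_id]
  field_simp
  ring

theorem modEq_of_pow_eq {F : Type*} [Field F] {ζ : F} {n a b : ℕ} [NeZero n]
    (h : IsPrimitiveRoot ζ n) (hab : ζ ^ a = ζ ^ b) : a ≡ b [MOD n] := by
  rw [pow_eq_pow_mod a h.pow_eq_one, pow_eq_pow_mod b h.pow_eq_one] at hab
  exact h.pow_inj (Nat.mod_lt _ (NeZero.pos n)) (Nat.mod_lt _ (NeZero.pos n)) hab

theorem tameGenerator_apply_ne {φ : AbsGal L} (hφ : IsFrobeniusLift L φ) {σ : inertia L}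
    (hσ : IsTameGenerator L ℓ σ) (hℓ : ℓ.Coprime (resCard L)) (hq : ¬ resCard L ≡ 1 [MOD ℓ])
    {π : L} (hπ : π ≠ 0) (hπ' : ∀ x : L, x ^ ℓ ≠ π) {ϖ : AlgebraicClosure L}
    (hϖ : ϖ ^ ℓ = algebraMap L _ π) : (σ : AbsGal L) ϖ ≠ ϖ := by
  intro hσϖ
  have hϖ1 : ϖ ^ ℓ ^ 1 = algebraMap L _ π := by rw [pow_one, hϖ]
  have hℓ1 : (ℓ ^ 1).Coprime (resCard L) := by rwa [pow_one]
  have hI : ∀ g ∈ inertia L, g ϖ = ϖ := fun g hg => by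
    rw [← kummer_eq_one_iff hℓ1 hπ hϖ1 (g := ⟨g, hg⟩)]
    obtain ⟨m, p, hp, v, hv, h⟩ := exists_eq_zpow_mul hσ (isOpen_ker_kummer hℓ1 hπ hϖ1) ⟨g, hg⟩
    rw [h, map_mul, map_mul, map_zpow, (kummer_eq_one_iff hℓ1 hπ hϖ1).mpr hσϖ, one_zpow, one_mul,
      proEllKernel_le_ker_kummer hℓ1 hπ hϖ1 hp, one_mul]
    exact hv
  have h0 := kummer_ne_zero hπ hϖ1
  obtain ⟨u, hu⟩ := exists_mul_add_one_modEq hq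
  set ξ := φ ϖ / ϖ with hξ
  have hξ1 : ξ ^ ℓ = 1 := by
    have := kummer_pow_eq_one hπ hϖ1 φ
    rwa [pow_one] at this
  have hφϖ : φ ϖ = ξ * ϖ := by rw [hξ, div_mul_cancel₀ _ h0]
  have hfix : Subgroup.zpowers φ ⊔ inertia L ≤ MulAction.stabilizer (AbsGal L) (ξ ^ u * ϖ) := by
    refine sup_le (Subgroup.zpowers_le.mpr ?_) fun g hg => ?_
    · change φ (ξ ^ u * ϖ) = ξ ^ u * ϖ
      rw [map_mul, map_pow, frobenius_apply_of_pow_eq_one hφ hℓ hξ1, hφϖ, ← mul_assoc, ← pow_mul,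
        ← pow_succ, mul_comm (resCard L), pow_eq_pow_of_modEq hu hξ1]
    · change g (ξ ^ u * ϖ) = ξ ^ u * ϖ
      rw [map_mul, map_pow, inertia_apply_of_pow_eq_one hg hℓ hξ1, hI g hg]
  have hall : ∀ g : AbsGal L, g (ξ ^ u * ϖ) = ξ ^ u * ϖ := fun g => by
    have h4 := ((dense_frobenius_inertia hφ).mono (SetLike.coe_subset_coe.mpr hfix)).closure_eq
    rw [(Subgroup.isClosed_of_isOpen _ (stabilizer_isOpen_of_isIntegral _)).closure_eq] at h4
    exact (h4 ▸ Set.mem_univ g : g ∈ (MulAction.stabilizer (AbsGal L) (ξ ^ u * ϖ) : Set _))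
  obtain ⟨y, hy⟩ := (InfiniteGalois.mem_range_algebraMap_iff_fixed (k := L) _).mpr hall
  refine hπ' y ((algebraMap L (AlgebraicClosure L)).injective ?_)
  rw [map_pow, hy, mul_pow, ← pow_mul, mul_comm u, pow_mul, hξ1, one_pow, one_mul, hϖ]

theorem isPrimitiveRoot_tameGenerator {φ : AbsGal L} (hφ : IsFrobeniusLift L φ) {σ : inertia L}
    (hσ : IsTameGenerator L ℓ σ) (hℓ : ℓ.Coprime (resCard L)) (hq : ¬ resCard L ≡ 1 [MOD ℓ])
    {π : L} (hπ : π ≠ 0) (hπ' : ∀ x : L, x ^ ℓ ≠ π) {k : ℕ} {ϖ : AlgebraicClosure L}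
    (hϖ : ϖ ^ ℓ ^ k = algebraMap L _ π) : IsPrimitiveRoot ((σ : AbsGal L) ϖ / ϖ) (ℓ ^ k) := by
  have h1 := kummer_pow_eq_one hπ hϖ (σ : AbsGal L)
  rw [IsPrimitiveRoot.iff_orderOf]
  rcases k with _ | k
  · rw [pow_zero, pow_one] at h1
    rw [h1, orderOf_one, pow_zero]
  · refine orderOf_eq_prime_pow (fun h => ?_) h1
    have h2 : (ϖ ^ ℓ ^ k) ^ ℓ = algebraMap L _ π := by rw [← pow_mul, ← pow_succ, hϖ]
    refine tameGenerator_apply_ne hφ hσ hℓ hq hπ hπ' h2 ?_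
    rw [div_pow, ← map_pow] at h
    exact (div_eq_one_iff_eq (pow_ne_zero _ (kummer_ne_zero hπ hϖ))).mp h

theorem IsTame.rel {Γ : Type*} [Group Γ] {f : AbsGal L →* Γ} (hf : IsTame ℓ f) {φ : AbsGal L}
    (hφ : IsFrobeniusLift L φ) {σ : inertia L} (hσ : IsTameGenerator L ℓ σ)
    (hℓ : ℓ.Coprime (resCard L)) (hq : ¬ resCard L ≡ 1 [MOD ℓ]) {k : ℕ} (hk : f σ ^ ℓ ^ k = 1) :
    f φ * f σ = f σ ^ resCard L * f φ := by
  obtain ⟨π, hπ, hπ'⟩ := exists_ne_pow (L := L)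
  obtain ⟨ϖ, hϖ⟩ := IsAlgClosed.exists_pow_nat_eq (algebraMap L (AlgebraicClosure L) π)
    (pow_pos (Fact.out : ℓ.Prime).pos k)
  have hn : (ℓ ^ k).Coprime (resCard L) := hℓ.pow_left k
  have h0 := kummer_ne_zero hπ hϖ
  have hprim := isPrimitiveRoot_tameGenerator hφ hσ hℓ hq hπ (hπ' ℓ (Fact.out : ℓ.Prime).two_le) hϖ
  set ζ := (σ : AbsGal L) ϖ / ϖ with hζ
  have hσϖ : (σ : AbsGal L) ϖ = ζ * ϖ := by rw [hζ, div_mul_cancel₀ _ h0]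
  let τ : inertia L := σ ^ resCard L
  let τ' : inertia L := ⟨φ * σ * φ⁻¹, conj_mem_inertia φ σ.2⟩
  have hpow : ∀ m : ℕ, ((σ ^ m : inertia L) : AbsGal L) ϖ = ζ ^ m * ϖ := by
    intro m
    have h1 := congrArg (fun x : rootsOfUnity (ℓ ^ k) (AlgebraicClosure L) =>
      ((x : (AlgebraicClosure L)ˣ) : AlgebraicClosure L)) (map_pow (kummer hn hπ hϖ) σ m)
    simp only [SubmonoidClass.coe_pow, Units.val_pow_eq_pow_val, coe_kummer] at h1
    rw [← hζ, div_eq_iff h0] at h1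
    rw [← h1]; rfl
  have hτ : (τ' : AbsGal L) ϖ = (τ : AbsGal L) ϖ := by
    rw [hpow]
    change φ ((σ : AbsGal L) (φ⁻¹ ϖ)) = _
    have h1 := inertia_apply_of_pow_eq_one σ.2 hn (kummer_pow_eq_one hπ hϖ φ⁻¹)
    rw [map_div₀, div_eq_iff ((map_ne_zero _).mpr h0), hσϖ] at h1
    have h2 : φ⁻¹ ϖ / ϖ * (ζ * ϖ) = ζ * φ⁻¹ ϖ := by field_simp
    rw [h1, h2, map_mul, frobenius_apply_of_pow_eq_one hφ hn hprim.pow_eq_one]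
    congr 1
    exact φ.apply_symm_apply ϖ
  have hker : kummer hn hπ hϖ (τ⁻¹ * τ') = 1 := by
    rw [map_mul, map_inv, inv_mul_eq_one]
    ext1
    ext1
    rw [coe_kummer, coe_kummer, hτ]
  obtain ⟨m, p, hp, v, hv, h⟩ := exists_eq_zpow_mul hσ
    (V := f.ker.subgroupOf (inertia L) ⊓ (kummer hn hπ hϖ).ker)
    ((isOpen_subgroupOf hf.isOpen_ker).inter (isOpen_ker_kummer hn hπ hϖ)) (τ⁻¹ * τ')
  have hm : (ℓ ^ k : ℤ) ∣ m := by
    rw [h, map_mul, map_mul, map_zpow, proEllKernel_le_ker_kummer hn hπ hϖ hp, mul_one, hv.2,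
      mul_one] at hker
    have h3 : orderOf (kummer hn hπ hϖ σ) = ℓ ^ k := by
      rw [← Subgroup.orderOf_coe, ← orderOf_units, coe_kummer, ← hζ]
      exact hprim.eq_orderOf.symm
    have h4 := orderOf_dvd_iff_zpow_eq_one.mpr hker
    rw [h3] at h4
    exact_mod_cast h4
  have hfm : f ((τ⁻¹ * τ' : inertia L) : AbsGal L) = 1 := by
    rw [h, Subgroup.coe_mul, Subgroup.coe_mul, map_mul, map_mul, hf.eq_one p hp, (show f (v : AbsGal L) = 1 from hv.1),
      mul_one, mul_one, Subgroup.coe_zpow, map_zpow]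
    obtain ⟨c, rfl⟩ := hm
    rw [zpow_mul, ← Nat.cast_pow, zpow_natCast, hk, one_zpow]
  have h5 : f φ * f σ * (f φ)⁻¹ = f σ ^ resCard L := by
    have h6 : (f (τ : AbsGal L))⁻¹ * f (τ' : AbsGal L) = 1 := by
      have h7 := map_mul f ((τ⁻¹ : inertia L) : AbsGal L) (τ' : AbsGal L)
      rw [Subgroup.coe_inv, map_inv] at h7
      exact h7.symm.trans hfm
    rw [inv_mul_eq_one] at h6
    rw [← map_pow]
    refine Eq.trans ?_ h6.symm
    rw [← map_inv, ← map_mul, ← map_mul]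
  rw [← h5, inv_mul_cancel_right]

theorem pow_mul_pow_of_rel {Γ : Type*} [Group Γ] {Φ S : Γ} {q : ℕ} (h : Φ * S = S ^ q * Φ)
    (a c : ℕ) : Φ ^ a * S ^ c = S ^ (q ^ a * c) * Φ ^ a := by
  induction a generalizing c with
  | zero => simp
  | succ a ih =>
    have h1 : Φ * S ^ c = S ^ (q * c) * Φ := by
      have : SemiconjBy Φ (S ^ c) ((S ^ q) ^ c) := SemiconjBy.pow_right h c
      rw [pow_mul]; exact this
    rw [pow_succ, mul_assoc, h1, ← mul_assoc, ih, mul_assoc, ← mul_assoc (q ^ a), ← pow_succ]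

theorem modEq_of_pow_modEq {q M a b : ℕ} (hq : 2 ≤ q) (hM : 2 ≤ M)
    (h : q ^ a ≡ q ^ b [MOD q ^ M - 1]) : a ≡ b [MOD M] := by
  have h1 : q ^ M ≡ 1 [MOD q ^ M - 1] :=
    ((Nat.modEq_iff_dvd' (Nat.one_le_pow _ _ (by omega))).mpr dvd_rfl).symm
  have hred : ∀ a, q ^ a ≡ q ^ (a % M) [MOD q ^ M - 1] := fun a => by
    conv_lhs => rw [← Nat.mod_add_div a M, pow_add, pow_mul]
    simpa using (h1.pow (a / M)).mul_left (q ^ (a % M))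
  have hlt : ∀ a, q ^ (a % M) < q ^ M - 1 := fun a => by
    have h2 : q ^ (a % M) ≤ q ^ (M - 1) :=
      Nat.pow_le_pow_right (by omega) (Nat.le_sub_one_of_lt (Nat.mod_lt a (by omega)))
    have h3 : q ^ M = q ^ (M - 1) * q := by rw [← pow_succ]; congr 1; omega
    have h4 : q ^ 1 ≤ q ^ (M - 1) := Nat.pow_le_pow_right (by omega) (by omega)
    have h5 : q ^ (M - 1) * 2 ≤ q ^ (M - 1) * q := Nat.mul_le_mul_left _ hq
    rw [pow_one] at h4
    omega
  exact Nat.pow_right_injective hq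
    (((hred a).symm.trans (h.trans (hred b))).eq_of_lt_of_lt (hlt a) (hlt b))

theorem exists_isTame {Γ : Type*} [Group Γ] [Finite Γ] {φ : AbsGal L} (hφ : IsFrobeniusLift L φ)
    {σ : inertia L} (hσ : IsTameGenerator L ℓ σ) (hℓ : ℓ.Coprime (resCard L))
    (hq : ¬ resCard L ≡ 1 [MOD ℓ]) {Φ S : Γ} (h : Φ * S = S ^ resCard L * Φ) {k : ℕ}
    (hk : S ^ ℓ ^ k = 1) : ∃ f : AbsGal L →* Γ, IsTame ℓ f ∧ f φ = Φ ∧ f σ = S := by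
  obtain ⟨π, hπ, hπ'⟩ := exists_ne_pow (L := L)
  obtain ⟨ϖ, hϖ⟩ := IsAlgClosed.exists_pow_nat_eq (algebraMap L (AlgebraicClosure L) π)
    (pow_pos (Fact.out : ℓ.Prime).pos k)
  have hn : (ℓ ^ k).Coprime (resCard L) := hℓ.pow_left k
  have h0 := kummer_ne_zero hπ hϖ
  have hprim := isPrimitiveRoot_tameGenerator hφ hσ hℓ hq hπ (hπ' ℓ (Fact.out : ℓ.Prime).two_le) hϖ
  set ζ := (σ : AbsGal L) ϖ / ϖ with hζ
  have hq2 : 2 ≤ resCard L := Finite.one_lt_card (α := 𝓀[L])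
  set M := 2 * Nat.card Γ with hM
  have hM2 : 2 ≤ M := by have := Nat.card_pos (α := Γ); omega
  have hqM : 1 < resCard L ^ M := Nat.one_lt_pow (by omega) (by omega)
  set N := ℓ ^ k * (resCard L ^ M - 1) with hN
  have hN0 : NeZero N := ⟨mul_ne_zero (NeZero.ne _) (by omega)⟩
  have hNq : N.Coprime (resCard L) := by
    refine Nat.Coprime.mul_left hn ?_
    have h1 : (resCard L ^ M - 1).Coprime (resCard L ^ M) := by
      have := Nat.coprime_self_sub_left (m := 1) (n := resCard L ^ M) hqM.le
      exact (this.mpr (Nat.coprime_one_left _))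
    exact Nat.Coprime.of_dvd_right (dvd_pow_self _ (by omega)) h1
  obtain ⟨η, hη⟩ := HasEnoughRootsOfUnity.exists_primitiveRoot (AlgebraicClosure L) N
  have hc : ∀ g : AbsGal L, ∃ c : ℕ, g ϖ = ζ ^ c * ϖ := fun g => by
    obtain ⟨c, -, hc⟩ := hprim.eq_pow_of_pow_eq_one (kummer_pow_eq_one hπ hϖ g)
    exact ⟨c, by rw [hc, div_mul_cancel₀ _ h0]⟩
  have ha : ∀ g : AbsGal L, ∃ a : ℕ, g η = η ^ resCard L ^ a := fun g => by
    let z : IntegersBar L := ⟨η, IsIntegral.of_pow (NeZero.pos N) (by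
      rw [hη.pow_eq_one]; exact isIntegral_one)⟩
    obtain ⟨a, ha⟩ := exists_pow_congr g {z}
    refine ⟨a, apply_eq_of_congr hNq hη.pow_eq_one fun x hx => ?_⟩
    have : x = z := Subtype.ext hx
    exact this ▸ ha z (Finset.mem_singleton_self z)
  obtain ⟨i, -, hi⟩ := hη.eq_pow_of_pow_eq_one (ξ := ζ) (by
    rw [hN, pow_mul, hprim.pow_eq_one, one_pow])
  have hgζ : ∀ (g : AbsGal L) (a : ℕ), g η = η ^ resCard L ^ a → g ζ = ζ ^ resCard L ^ a := by
    intro g a hg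
    rw [← hi, map_pow, hg, ← pow_mul, ← pow_mul, mul_comm]
  obtain ⟨c₀, hc₀⟩ := hc φ
  set Ψ := (S ^ c₀)⁻¹ * Φ with hΨ
  have hΨS : Ψ * S = S ^ resCard L * Ψ := by
    rw [hΨ, mul_assoc, h, ← mul_assoc, ← mul_assoc]
    congr 1
    exact ((Commute.pow_pow (Commute.refl S) c₀ _).inv_left).eq
  have hΨM : Ψ ^ M = 1 := by rw [hM, mul_comm, pow_mul, pow_card_eq_one', one_pow]
  choose c hc using hc
  choose a ha using ha
  have key : ∀ (g : AbsGal L) (c' a' : ℕ), g ϖ = ζ ^ c' * ϖ → g η = η ^ resCard L ^ a' →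
      S ^ c g * Ψ ^ a g = S ^ c' * Ψ ^ a' := by
    intro g c' a' h1 h2
    rw [hc g] at h1
    rw [ha g] at h2
    congr 1
    · exact pow_eq_pow_of_modEq (modEq_of_pow_eq hprim (mul_right_cancel₀ h0 h1)) hk
    · refine pow_eq_pow_of_modEq (modEq_of_pow_modEq hq2 hM2 ?_) hΨM
      exact (modEq_of_pow_eq hη h2).of_dvd (Dvd.intro_left _ rfl)
  let f : AbsGal L →* Γ := MonoidHom.mk' (fun g => S ^ c g * Ψ ^ a g) fun g g' => by
    rw [key (g * g') (c g + resCard L ^ a g * c g') (a g + a g')]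
    · rw [pow_add, pow_add, mul_assoc (S ^ c g), ← mul_assoc (S ^ _) (Ψ ^ _),
        ← pow_mul_pow_of_rel hΨS, mul_assoc, mul_assoc]
    · change g (g' ϖ) = _
      rw [hc g', map_mul, map_pow, hgζ g _ (ha g), hc g, ← mul_assoc, ← pow_mul, ← pow_add,
        add_comm]
    · change g (g' η) = _
      rw [ha g', map_pow, ha g, ← pow_mul, ← pow_add]
  have hf : ∀ (g : AbsGal L) (c' a' : ℕ), g ϖ = ζ ^ c' * ϖ → g η = η ^ resCard L ^ a' →
      f g = S ^ c' * Ψ ^ a' := key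
  have hI : ∀ g : inertia L, f g = S ^ c g := fun g => by
    rw [hf g (c g) 0 (hc g), pow_zero, mul_one]
    rw [inertia_apply_of_pow_eq_one g.2 hNq hη.pow_eq_one, pow_zero, pow_one]
  refine ⟨f, IsTame.of_isPGroup ?_ ?_, ?_, ?_⟩
  · refine Subgroup.isOpen_mono (H₁ := MulAction.stabilizer (AbsGal L) ϖ ⊓
      MulAction.stabilizer (AbsGal L) η) (fun g hg => ?_)
      ((stabilizer_isOpen_of_isIntegral ϖ).inter (stabilizer_isOpen_of_isIntegral η))
    rw [MonoidHom.mem_ker, hf g 0 0, pow_zero, pow_zero, mul_one]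
    · rw [pow_zero, one_mul]; exact hg.1
    · rw [pow_zero, pow_one]; exact hg.2
  · rintro ⟨_, g, rfl⟩
    refine ⟨k, Subtype.ext ?_⟩
    change (f g) ^ ℓ ^ k = 1
    rw [hI, ← pow_mul, mul_comm, pow_mul, hk, one_pow]
  · rw [hf φ c₀ 1 hc₀, pow_one, hΨ, mul_inv_cancel_left]
    rw [pow_one, frobenius_apply_of_pow_eq_one hφ hNq hη.pow_eq_one]
  · rw [hf σ 1 0, pow_one, pow_zero, mul_one]
    · rw [pow_one, hζ, div_mul_cancel₀ _ h0]
    · rw [inertia_apply_of_pow_eq_one σ.2 hNq hη.pow_eq_one, pow_zero, pow_one]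

end Tame

/-! ### Reduction modulo powers of the maximal ideal -/

/-- Invertible matrices of size four. -/
abbrev GL4 (A : Type*) [CommRing A] := Matrix.GeneralLinearGroup (Fin 4) A

local notation "GLMap" => Matrix.GeneralLinearGroup.map

section RedPow

variable {A : Type u} [CommRing A] [IsLocalRing A]

/-- Reduction modulo a power of the maximal ideal. -/
def redPow (A : Type u) [CommRing A] [IsLocalRing A] (k : ℕ) : GL4 A →* GL4 (A ⧸ maximalIdeal A ^ k) :=
  GLMap (Ideal.Quotient.mk _)

theorem redPow_eq_iff {k : ℕ} {x y : GL4 A} :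
    redPow A k x = redPow A k y ↔ ∀ i j, x.val i j - y.val i j ∈ maximalIdeal A ^ k := by
  rw [Units.ext_iff, ← Matrix.ext_iff]
  exact forall_congr' fun i => forall_congr' fun j => Ideal.Quotient.eq

theorem redPow_eq_of_le {k m : ℕ} (h : m ≤ k) {x y : GL4 A} (hx : redPow A k x = redPow A k y) :
    redPow A m x = redPow A m y := by
  rw [redPow_eq_iff] at *
  exact fun i j => Ideal.pow_le_pow_right h (hx i j)

theorem mul_apply_mem {I J : Ideal A} {X Y : Mat4 A} (hX : ∀ i j, X i j ∈ I)
    (hY : ∀ i j, Y i j ∈ J) (i j : Fin 4) : (X * Y) i j ∈ I * J := by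
  rw [Matrix.mul_apply]
  exact sum_mem fun k _ => Ideal.mul_mem_mul (hX i k) (hY k j)

theorem exists_one_add_pow {S : Type*} [Ring S] (Y : S) (n : ℕ) :
    ∃ Z, (1 + Y) ^ n = 1 + (n : S) * Y + Y * Y * Z := by
  induction n with
  | zero => exact ⟨0, by simp⟩
  | succ n ih =>
    obtain ⟨Z, hZ⟩ := ih
    refine ⟨n + Z + Z * Y, ?_⟩
    rw [pow_succ, hZ, Nat.cast_succ]
    have h := (Nat.cast_commute n Y).eq
    have h2 : Y * Y * (n : S) = n * Y * Y := by rw [mul_assoc, ← h, ← mul_assoc, ← h]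
    simp only [mul_add, add_mul, mul_one, one_mul, h2, ← mul_assoc]
    abel

theorem exists_redPow_pow_eq_one {ℓ : ℕ} (hℓ : (ℓ : A) ∈ maximalIdeal A) {x : GL4 A} {j : ℕ}
    (hx : GLMap (residue A) x ^ ℓ ^ j = 1) (k : ℕ) :
    ∃ i, redPow A k x ^ ℓ ^ i = 1 := by
  have hbase : redPow A 1 (x ^ ℓ ^ j) = redPow A 1 1 := by
    rw [redPow_eq_iff]
    intro i' j'
    rw [pow_one, ← residue_eq_zero_iff, map_sub, sub_eq_zero]
    have := congrArg (fun y : GL4 _ => y.val i' j') (hx.trans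
      (map_one (GLMap (residue A))).symm)
    rwa [← map_pow] at this
  have key : ∀ n, redPow A (n + 1) (x ^ ℓ ^ (j + n)) = redPow A (n + 1) 1 := by
    intro n
    induction n with
    | zero => exact hbase
    | succ n ih =>
      rw [redPow_eq_iff] at ih ⊢
      set Y := (x ^ ℓ ^ (j + n)).val - 1 with hY
      have hY' : ∀ i j, Y i j ∈ maximalIdeal A ^ (n + 1) := ih
      obtain ⟨Z, hZ⟩ := exists_one_add_pow Y ℓ
      intro i' j'
      have : (x ^ ℓ ^ (j + (n + 1))).val = 1 + ((ℓ : ℕ) : Mat4 A) * Y + Y * Y * Z := by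
        rw [← hZ, hY, add_sub_cancel, ← Units.val_pow_eq_pow_val, ← pow_mul, ← pow_succ, add_assoc]
      have h2 : (x ^ ℓ ^ (j + (n + 1))).val - 1 = ((ℓ : ℕ) : Mat4 A) * Y + Y * Y * Z := by
        rw [this]; abel
      rw [Units.val_one, ← Matrix.sub_apply, h2, Matrix.add_apply]
      refine add_mem ?_ ?_
      · rw [← nsmul_eq_mul, Matrix.smul_apply, nsmul_eq_mul, pow_succ']
        exact Ideal.mul_mem_mul hℓ (hY' _ _)
      · have h1 := mul_apply_mem (J := ⊤) (mul_apply_mem hY' hY') (Y := Z) (fun _ _ => trivial) i' j'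
        rw [Ideal.mul_top, ← pow_add] at h1
        exact Ideal.pow_le_pow_right (by lia) h1
  refine ⟨j + k, ?_⟩
  rw [← map_pow, ← map_one (redPow A k)]
  exact redPow_eq_of_le k.le_succ (key k)

end RedPow

/-! ### Tame representations over complete local rings -/

section TameRep

variable {L : Type v} [Field L] [ValuativeRel L] [TopologicalSpace L]
  [IsNonarchimedeanLocalField L] [CharZero L] {ℓ : ℕ} [Fact ℓ.Prime]
variable {O : Type u} [CommRing O] [IsLocalRing O]
variable {A : Type u} [CommRing A] [IsLocalRing A] [Algebra O A]

/-- All reductions of `ρ` modulo powers of the maximal ideal are tame. -/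
def IsTameRep (ℓ : ℕ) (ρ : AbsGal L →* GL4 A) : Prop := ∀ k, IsTame ℓ ((redPow A k).comp ρ)

theorem ker_redPow_comp (ρ : AbsGal L →* GL4 A) (k : ℕ) :
    (((redPow A k).comp ρ).ker : Set (AbsGal L)) =
      {g | ∀ i j, (ρ g).val i j - (1 : Mat4 A) i j ∈ maximalIdeal A ^ k} := by
  ext g
  rw [SetLike.mem_coe, MonoidHom.mem_ker, MonoidHom.comp_apply, ← map_one (redPow A k), redPow_eq_iff]
  rfl

theorem IsTameRep.isAdicContinuous {ρ : AbsGal L →* GL4 A} (h : IsTameRep ℓ ρ) :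
    IsAdicContinuous ρ := fun k => by
  rw [← ker_redPow_comp]; exact (h k).isOpen_ker

theorem eq_of_redPow [IsCNL O A] {x y : GL4 A} (h : ∀ k, redPow A k x = redPow A k y) : x = y := by
  ext i j
  exact IsCNL.eq_of_forall_sub_mem (O := O) fun k => redPow_eq_iff.mp (h k) i j

theorem finite_quotient_pow [Finite (ResidueField O)] [IsCNL O A] (k : ℕ) :
    Finite (A ⧸ maximalIdeal A ^ k) := by
  have := IsCNL.noetherian (O := O) (A := A)
  have : Finite (A ⧸ maximalIdeal A) := by
    have hs := IsCNL.residue_surjective (O := O) (A := A)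
    rw [IsScalarTower.algebraMap_eq O (ResidueField O) (ResidueField A), RingHom.coe_comp] at hs
    exact Finite.of_surjective _ hs.of_comp
  exact Ideal.finite_quotient_pow (IsNoetherian.noetherian _) k

theorem IsTameRep.map {B : Type u} [CommRing B] [IsLocalRing B] {ρ : AbsGal L →* GL4 A}
    (h : IsTameRep ℓ ρ) (f : A →+* B) (hf : ∀ x ∈ maximalIdeal A, f x ∈ maximalIdeal B) :
    IsTameRep ℓ ((GLMap f).comp ρ) := fun k => by
  have hle : maximalIdeal A ^ k ≤ (maximalIdeal B ^ k).comap f :=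
    (Ideal.pow_right_mono (fun x hx => hf x hx) k).trans (Ideal.le_comap_pow f k)
  exact (h k).comp (GLMap (Ideal.quotientMap _ f hle))

theorem IsTameRep.residue {ρ : AbsGal L →* GL4 A} (h : IsTameRep ℓ ρ) :
    IsTame ℓ ((GLMap (residue A)).comp ρ) :=
  (h 1).comp (GLMap (Ideal.Quotient.factor (pow_one _).le))

variable {φ : AbsGal L} {σ : inertia L}

theorem IsTameRep.ext [IsCNL O A] {ρ ρ' : AbsGal L →* GL4 A} (h : IsTameRep ℓ ρ)
    (h' : IsTameRep ℓ ρ') (hφ : IsFrobeniusLift L φ) (hσ : IsTameGenerator L ℓ σ)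
    (h1 : ρ φ = ρ' φ) (h2 : ρ σ = ρ' σ) : ρ = ρ' := by
  ext1 g
  refine eq_of_redPow (O := O) fun k => ?_
  exact DFunLike.congr_fun (IsTame.ext (h k) (h' k) hφ hσ (by simp [h1]) (by simp [h2])) g

theorem IsTameRep.rel [IsCNL O A] {ρ : AbsGal L →* GL4 A} (h : IsTameRep ℓ ρ)
    (hφ : IsFrobeniusLift L φ) (hσ : IsTameGenerator L ℓ σ) (hℓ : ℓ.Coprime (resCard L))
    (hq : ¬ resCard L ≡ 1 [MOD ℓ]) (hk : ∀ k, ∃ i, redPow A k (ρ σ) ^ ℓ ^ i = 1) :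
    ρ φ * ρ σ = ρ σ ^ resCard L * ρ φ := by
  refine eq_of_redPow (O := O) fun k => ?_
  obtain ⟨i, hi⟩ := hk k
  simpa using (h k).rel hφ hσ hℓ hq hi

theorem exists_isTameRep [Finite (ResidueField O)] [IsCNL O A] (hφ : IsFrobeniusLift L φ)
    (hσ : IsTameGenerator L ℓ σ) (hℓ : ℓ.Coprime (resCard L)) (hq : ¬ resCard L ≡ 1 [MOD ℓ])
    {F S : GL4 A} (h : F * S = S ^ resCard L * F) (hk : ∀ k, ∃ i, redPow A k S ^ ℓ ^ i = 1) :
    ∃ ρ : AbsGal L →* GL4 A, IsTameRep ℓ ρ ∧ ρ φ = F ∧ ρ σ = S := by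
  have hfin := finite_quotient_pow (O := O) (A := A)
  have hex : ∀ k, ∃ f : AbsGal L →* GL4 (A ⧸ maximalIdeal A ^ k),
      IsTame ℓ f ∧ f φ = redPow A k F ∧ f σ = redPow A k S := fun k => by
    obtain ⟨i, hi⟩ := hk k
    exact exists_isTame hφ hσ hℓ hq (by rw [← map_mul, h, map_mul, map_pow]) hi
  choose f hf hfφ hfσ using hex
  have hcomp : ∀ {m n} (hmn : m ≤ n), (GLMap
      (Ideal.Quotient.factor (Ideal.pow_le_pow_right hmn))).comp (f n) = f m := fun {m n} hmn =>
    IsTame.ext ((hf n).comp _) (hf m) hφ hσ (by rw [hfφ m, MonoidHom.comp_apply, hfφ n]; rfl)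
      (by rw [hfσ m, MonoidHom.comp_apply, hfσ n]; rfl)
  have hc : IsAdicComplete (maximalIdeal A) A := IsCNL.complete (O := O)
  have hlim : ∀ g i j, ∃ a : A, ∀ k, Ideal.Quotient.mk (maximalIdeal A ^ k) a = (f k g).val i j := by
    intro g i j
    choose a ha using fun k => Ideal.Quotient.mk_surjective ((f k g).val i j)
    obtain ⟨b, hb⟩ := IsPrecomplete.prec hc.toIsPrecomplete (f := a) (fun {m n} hmn => by
      rw [SModEq.sub_mem, smul_eq_mul, Ideal.mul_top, ← Ideal.Quotient.eq, ha m, ← hcomp hmn]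
      change Ideal.Quotient.factor (Ideal.pow_le_pow_right hmn) ((f n g).val i j) = _
      rw [← ha n]; rfl)
    refine ⟨b, fun k => ?_⟩
    rw [← ha k, eq_comm, Ideal.Quotient.eq]
    simpa [SModEq.sub_mem] using hb k
  choose a ha using hlim
  have hM : ∀ g k, (Matrix.of (a g)).map (Ideal.Quotient.mk (maximalIdeal A ^ k)) = (f k g).val :=
    fun g k => by ext i j; exact ha g i j k
  have hext : ∀ {M N : Mat4 A}, (∀ k, M.map (Ideal.Quotient.mk (maximalIdeal A ^ k)) =
      N.map (Ideal.Quotient.mk (maximalIdeal A ^ k))) → M = N := fun {M N} h => by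
    ext i j
    exact IsCNL.eq_of_forall_sub_mem (O := O) fun k =>
      Ideal.Quotient.eq.mp (congrFun (congrFun (h k) i) j)
  let r : AbsGal L →* Mat4 A :=
    { toFun := fun g => Matrix.of (a g)
      map_one' := hext fun k => by
        rw [hM, map_one, Matrix.map_one _ (map_zero _) (map_one _)]; rfl
      map_mul' := fun g g' => hext fun k => by
        rw [Matrix.map_mul, hM, hM, hM, map_mul]; rfl }
  have hr : ∀ k, (redPow A k).comp r.toHomUnits = f k := fun k => by
    ext1 g; exact Units.ext (hM g k)
  refine ⟨r.toHomUnits, fun k => by rw [hr]; exact hf k, eq_of_redPow (O := O) fun k => ?_,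
    eq_of_redPow (O := O) fun k => ?_⟩
  · rw [← hfφ, ← hr]; rfl
  · rw [← hfσ, ← hr]; rfl

end TameRep

/-! ### Framed deformations and pairs of matrices -/

section Lift

variable {L : Type v} [Field L] [ValuativeRel L] [TopologicalSpace L]
  [IsNonarchimedeanLocalField L] [CharZero L] {ℓ : ℕ} [Fact ℓ.Prime]
variable {O : Type u} [CommRing O] [IsLocalRing O]
variable {A : Type u} [CommRing A] [IsLocalRing A] [Algebra O A]

theorem isCongr_iff_map_eq [IsLocalHom (algebraMap O A)] {X₀ : Mat4 O}
    {y : GL4 (ResidueField O)} (h : X₀.map (residue O) = y.val) {x : GL4 A} :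
    IsCongr x.val X₀ ↔ GLMap (residue A) x =
      GLMap (ResidueField.map (algebraMap O A)) y := by
  rw [isCongr_iff, Units.ext_iff]
  change _ ↔ x.val.map (residue A) = y.val.map (ResidueField.map (algebraMap O A))
  rw [← h, Matrix.map_map]
  rfl

theorem IsCongr.isUnit [IsLocalHom (algebraMap O A)] {X₀ : Mat4 O}
    {y : GL4 (ResidueField O)} (h : X₀.map (residue O) = y.val) {M : Mat4 A} (hM : IsCongr M X₀) :
    IsUnit M := by
  rw [Matrix.isUnit_iff_isUnit_det, ← IsLocalRing.residue_ne_zero_iff_isUnit, RingHom.map_det]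
  have : (residue A).mapMatrix M =
      (GLMap (ResidueField.map (algebraMap O A)) y).val := by
    change M.map _ = y.val.map _
    rw [isCongr_iff.mp hM, ← h, Matrix.map_map]
    rfl
  rw [this]
  exact ((Matrix.isUnit_iff_isUnit_det _).mp (Units.isUnit _)).ne_zero

variable {φ : AbsGal L} {σ : inertia L} {rbar : AbsGal L →* GL4 (ResidueField O)}

theorem exists_redPow_pow_eq_one_of_isLift [IsLocalHom (algebraMap O A)]
    (hℓO : (ℓ : O) ∈ maximalIdeal O) (hbar : IsTame ℓ rbar) (hσ : IsTameGenerator L ℓ σ) {j : ℕ}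
    (hj : rbar σ ^ ℓ ^ j = 1) {ρ : AbsGal L →* GL4 A} (hρ : IsLift rbar ρ) (g : inertia L) (k : ℕ) :
    ∃ i, redPow A k (ρ g) ^ ℓ ^ i = 1 := by
  refine exists_redPow_pow_eq_one ?_ (j := j) ?_ k
  · have := algebraMap_mem_maximalIdeal A hℓO
    rwa [map_natCast] at this
  · obtain ⟨m, hm⟩ := hbar.exists_zpow hσ g
    rw [hρ, hm, ← map_pow, ← zpow_natCast, ← zpow_mul, mul_comm, zpow_mul, zpow_natCast, hj, one_zpow,
      map_one]

theorem IsLift.isTameRep [Finite (ResidueField O)] [IsCNL O A] (hℓO : (ℓ : O) ∈ maximalIdeal O)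
    (hbar : IsTame ℓ rbar) (hσ : IsTameGenerator L ℓ σ) {j : ℕ} (hj : rbar σ ^ ℓ ^ j = 1)
    {ρ : AbsGal L →* GL4 A} (hρ : IsLift rbar ρ) (hc : IsAdicContinuous ρ) : IsTameRep ℓ ρ :=
  fun k => by
  have := finite_quotient_pow (O := O) (A := A) k
  refine IsTame.of_isPGroup (by rw [ker_redPow_comp]; exact hc k) ?_
  rintro ⟨_, g, rfl⟩
  obtain ⟨i, hi⟩ := exists_redPow_pow_eq_one_of_isLift hℓO hbar hσ hj hρ g k
  exact ⟨i, Subtype.ext hi⟩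

theorem exists_isLift [Finite (ResidueField O)] [IsCNL O A] (hℓO : (ℓ : O) ∈ maximalIdeal O)
    (hbar : IsTame ℓ rbar) (hφ : IsFrobeniusLift L φ) (hσ : IsTameGenerator L ℓ σ) {j : ℕ}
    (hj : rbar σ ^ ℓ ^ j = 1) (hℓ : ℓ.Coprime (resCard L)) (hq : ¬ resCard L ≡ 1 [MOD ℓ])
    {φ₀ σ₀ : Mat4 O} (hφ₀ : φ₀.map (residue O) = (rbar φ).val)
    (hσ₀ : σ₀.map (residue O) = (rbar σ).val) {F S : Mat4 A} (hF : IsCongr F φ₀)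
    (hS : IsCongr S σ₀) (h : F * S = S ^ resCard L * F) :
    ∃ ρ : AbsGal L →* GL4 A, IsTameRep ℓ ρ ∧ IsLift rbar ρ ∧ (ρ φ).val = F ∧ (ρ σ).val = S := by
  obtain ⟨F, rfl⟩ := hF.isUnit hφ₀
  obtain ⟨S, rfl⟩ := hS.isUnit hσ₀
  rw [isCongr_iff_map_eq hφ₀] at hF
  rw [isCongr_iff_map_eq hσ₀] at hS
  obtain ⟨ρ, hρ, h1, h2⟩ := exists_isTameRep (O := O) hφ hσ hℓ hq (Units.ext h)
    (exists_redPow_pow_eq_one (j := j) (by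
      have := algebraMap_mem_maximalIdeal A hℓO
      rwa [map_natCast] at this) (by rw [hS, ← map_pow, hj, map_one]))
  refine ⟨ρ, hρ, fun g => ?_, by rw [h1], by rw [h2]⟩
  exact DFunLike.congr_fun (hρ.residue.ext (hbar.comp (GLMap
    (ResidueField.map (algebraMap O A)))) hφ hσ (by simpa [h1] using hF) (by simpa [h2] using hS)) g

theorem IsLift.map {B : Type u} [CommRing B] [IsLocalRing B] [Algebra O B]
    [IsLocalHom (algebraMap O A)] [IsLocalHom (algebraMap O B)] {ρ : AbsGal L →* GL4 A}
    (h : IsLift rbar ρ) (f : A →ₐ[O] B) [IsLocalHom (f : A →+* B)] :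
    IsLift rbar ((GLMap (f : A →+* B)).comp ρ) := fun g => by
  ext i j
  have h1 := congrArg (fun y : GL4 _ => ResidueField.map (f : A →+* B) (y.val i j)) (h g)
  refine Eq.trans (h1 : residue B (f ((ρ g).val i j)) = _) ?_
  obtain ⟨x, hx⟩ := IsLocalRing.residue_surjective ((rbar g).val i j)
  change ResidueField.map (f : A →+* B) (ResidueField.map (algebraMap O A) ((rbar g).val i j)) =
    ResidueField.map (algebraMap O B) ((rbar g).val i j)
  rw [← hx]
  exact congrArg (residue B) (f.commutes x)

instance isLocalRing_quotient_pow (n : ℕ) : IsLocalRing (A ⧸ maximalIdeal A ^ (n + 1)) := by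
  have : Nontrivial (A ⧸ maximalIdeal A ^ (n + 1)) := Ideal.Quotient.nontrivial_iff.mpr fun h =>
    (maximalIdeal.isMaximal A).ne_top (top_le_iff.mp (h ▸ Ideal.pow_le_self n.succ_ne_zero))
  exact IsLocalRing.of_surjective' _ Ideal.Quotient.mk_surjective

instance isCNL_quotient_pow [IsCNL O A] (n : ℕ) : IsCNL O (A ⧸ maximalIdeal A ^ (n + 1)) :=
  IsCNL.of_surjective (Ideal.Quotient.mkₐ O _) (Ideal.Quotient.mkₐ_surjective O _)

variable [Finite (ResidueField O)]
variable {R : Type u} [CommRing R] [IsLocalRing R] [Algebra O R] [IsLocalHom (algebraMap O R)]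
  {runiv : AbsGal L →* GL4 R}

theorem IsFramedDeformationRing.isCNL (h : IsFramedDeformationRing rbar R runiv) : IsCNL O R :=
  ⟨h.noetherian, h.complete, inferInstance, h.sameResidueField⟩

theorem IsFramedDeformationRing.existsUnique_quotient (h : IsFramedDeformationRing rbar R runiv)
    [IsCNL O A] {ρ : AbsGal L →* GL4 A}
    (hρ : IsTameRep ℓ ρ) (hl : IsLift rbar ρ) (n : ℕ) :
    ∃! f : R →ₐ[O] A ⧸ maximalIdeal A ^ (n + 1),
      (GLMap (f : R →+* A ⧸ maximalIdeal A ^ (n + 1))).comp runiv =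
        (redPow A (n + 1)).comp ρ := by
  have := finite_quotient_pow (O := O) (A := A) (n + 1)
  have hloc : IsLocalHom (Ideal.Quotient.mkₐ O (maximalIdeal A ^ (n + 1)) :
      A →+* A ⧸ maximalIdeal A ^ (n + 1)) := IsLocalHom.of_surjective _ Ideal.Quotient.mk_surjective
  refine h.universal _ (IsCNL.residue_surjective (O := O)) _ ?_ (hl.map (Ideal.Quotient.mkₐ O _))
  exact (hρ.map _ fun x hx => map_mem_maximalIdeal (IsCNL.residue_surjective (O := O))
    (Ideal.Quotient.mkₐ O (maximalIdeal A ^ (n + 1))) hx).isAdicContinuous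

theorem IsFramedDeformationRing.exists_hom (h : IsFramedDeformationRing rbar R runiv)
    [IsCNL O A] {ρ : AbsGal L →* GL4 A}
    (hρ : IsTameRep ℓ ρ) (hl : IsLift rbar ρ) :
    ∃ f : R →ₐ[O] A, (GLMap (f : R →+* A)).comp runiv = ρ := by
  have hA : IsAdicComplete (maximalIdeal A) A := IsCNL.complete (O := O)
  choose g hg hg' using fun n => h.existsUnique_quotient hρ hl n
  have hcomp : ∀ {m n : ℕ} (hle : m ≤ n),
      (Ideal.Quotient.factorₐ O (Ideal.pow_le_pow_right (Nat.succ_le_succ hle))).comp (g n) = g m := by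
    intro m n hle
    refine hg' m _ ?_
    have h1 := congrArg (GLMap (Ideal.Quotient.factor
      (Ideal.pow_le_pow_right (I := maximalIdeal A) (Nat.succ_le_succ hle)))).comp (hg n)
    exact h1
  let f : (n : ℕ) → R →ₐ[O] A ⧸ maximalIdeal A ^ n := fun n =>
    (Ideal.Quotient.factorₐ O (Ideal.pow_le_pow_right n.le_succ)).comp (g n)
  have hf : ∀ {m n : ℕ} (hle : m ≤ n),
      (Ideal.Quotient.factorₐ O (Ideal.pow_le_pow_right hle)).comp (f n) = f m := by
    intro m n hle
    simp only [f]
    rw [← hcomp hle]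
    ext x
    obtain ⟨y, hy⟩ := Ideal.Quotient.mk_surjective (g n x)
    simp [← hy]
  refine ⟨IsAdicComplete.liftAlgHom _ f hf, ?_⟩
  ext1 x
  refine eq_of_redPow (O := O) fun k => ?_
  ext i j
  change Ideal.Quotient.mk _ (IsAdicComplete.liftAlgHom (maximalIdeal A) f hf ((runiv x).val i j)) = _
  rw [IsAdicComplete.mk_liftAlgHom]
  have h1 := congrArg (fun y : GL4 _ => Ideal.Quotient.factor
    (Ideal.pow_le_pow_right (I := maximalIdeal A) k.le_succ) (y.val i j)) (DFunLike.congr_fun (hg k) x)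
  exact h1

theorem IsFramedDeformationRing.isUniversalPair (h : IsFramedDeformationRing rbar R runiv)
    (hℓO : (ℓ : O) ∈ maximalIdeal O) (hbar : IsTame ℓ rbar) (hφ : IsFrobeniusLift L φ)
    (hσ : IsTameGenerator L ℓ σ) {j : ℕ} (hj : rbar σ ^ ℓ ^ j = 1) (hℓ : ℓ.Coprime (resCard L))
    (hq : ¬ resCard L ≡ 1 [MOD ℓ]) {φ₀ σ₀ : Mat4 O} (hφ₀ : φ₀.map (residue O) = (rbar φ).val)
    (hσ₀ : σ₀.map (residue O) = (rbar σ).val) :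
    IsUniversalPair (resCard L) φ₀ σ₀ (runiv φ).val (runiv σ).val := by
  have := h.isCNL
  have ht := h.lift.isTameRep hℓO hbar hσ hj h.continuous
  refine ⟨h.isCNL, (isCongr_iff_map_eq hφ₀).mpr (h.lift φ), (isCongr_iff_map_eq hσ₀).mpr (h.lift σ),
    ?_, ?_, ?_⟩
  · exact congrArg Units.val (ht.rel (O := O) hφ hσ hℓ hq
      (exists_redPow_pow_eq_one_of_isLift hℓO hbar hσ hj h.lift σ))
  · intro A _ _ _ _ F' S' hF hS hr
    obtain ⟨ρ, h1, h2, rfl, rfl⟩ := exists_isLift hℓO hbar hφ hσ hj hℓ hq hφ₀ hσ₀ hF hS hr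
    obtain ⟨f, rfl⟩ := h.exists_hom h1 h2
    exact ⟨f, rfl, rfl⟩
  · intro A _ _ _ _ f g h1 h2
    have hres := IsCNL.residue_surjective (O := O) (A := A)
    have hf := ht.map (f : R →+* A) fun x hx => map_mem_maximalIdeal hres f hx
    have hg := ht.map (g : R →+* A) fun x hx => map_mem_maximalIdeal hres g hx
    have e : (GLMap (f : R →+* A)).comp runiv =
        (GLMap (g : R →+* A)).comp runiv :=
      hf.ext (O := O) hg hφ hσ (Units.ext h1) (Units.ext h2)
    have hloc : IsLocalHom (f : R →+* A) :=
      ⟨fun x hx => by_contra fun hn => map_mem_maximalIdeal hres f hn hx⟩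
    ext x
    refine IsCNL.eq_of_forall_sub_mem (O := O) fun n => Ideal.pow_le_pow_right n.le_succ ?_
    rw [← Ideal.Quotient.eq]
    have hu := (h.existsUnique_quotient hf (h.lift.map f) n).unique
      (y₁ := (Ideal.Quotient.mkₐ O _).comp f) (y₂ := (Ideal.Quotient.mkₐ O _).comp g) rfl (by
        rw [e]; rfl)
    exact DFunLike.congr_fun hu x

theorem isCNL_of_isArtinianRing [IsArtinianRing A] [IsLocalHom (algebraMap O A)] (h : SameResidueField O A) : IsCNL O A := by
  obtain ⟨n, hn⟩ := IsArtinianRing.isNilpotent_jacobson_bot (R := A)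
  rw [IsLocalRing.jacobson_eq_maximalIdeal ⊥ bot_ne_top] at hn
  have h0 : ∀ m, n ≤ m → maximalIdeal A ^ m = ⊥ := fun m hm =>
    le_bot_iff.mp ((Ideal.pow_le_pow_right hm).trans hn.le)
  refine ⟨inferInstance, { haus' := fun x hx => ?_, prec' := fun f hf => ⟨f n, fun m => ?_⟩ },
    inferInstance, h⟩
  · simpa [SModEq.sub_mem, h0 n le_rfl] using hx n
  · rcases le_total m n with hm | hm
    · exact hf hm
    · have := hf hm
      simp only [SModEq.sub_mem, h0 n le_rfl, smul_eq_mul, Ideal.mul_top] at this ⊢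
      have := neg_mem this
      rw [neg_sub] at this
      exact bot_le (a := maximalIdeal A ^ m) this

theorem exists_isUniversalPair [IsCNL O O] {q : ℕ} {φ₀ σ₀ : Mat4 O}
    (h : (φ₀ * σ₀).map (residue O) = (σ₀ ^ q * φ₀).map (residue O)) :
    ∃ (R : Type u) (_ : CommRing R) (_ : IsLocalRing R) (_ : Algebra O R) (F S : Mat4 R),
      IsUniversalPair q φ₀ σ₀ F S := by
  let P := MvPowerSeries (Fin 2 × Fin 4 × Fin 4) O
  let M : Fin 2 → Mat4 O → Mat4 P := fun a M₀ =>
    extMat P M₀ + Matrix.of fun i j => MvPowerSeries.X (a, i, j)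
  have hM : ∀ a M₀, IsCongr (M a M₀) M₀ := fun a M₀ i j => by
    have : M a M₀ i j - algebraMap O P (M₀ i j) = MvPowerSeries.X (a, i, j) := by
      simp [M, extMat, Algebra.ofId_apply]
    rw [this]
    exact X_mem_maximalIdeal _
  let D := M 0 φ₀ * M 1 σ₀ - M 1 σ₀ ^ q * M 0 φ₀
  have hD : ∀ i j, D i j ∈ maximalIdeal P := by
    have e : redMat (O := O) P D = redMat (O := O) P (extMat P (φ₀ * σ₀ - σ₀ ^ q * φ₀)) := by
      simp only [D, map_sub, map_mul, map_pow, isCongr_iff_redMat.mp (hM _ _)]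
    have h2 : ∀ i j, (φ₀ * σ₀ - σ₀ ^ q * φ₀) i j ∈ maximalIdeal O := fun i j => by
      rw [← residue_eq_zero_iff, Matrix.sub_apply, map_sub, sub_eq_zero]
      exact congrFun (congrFun h i) j
    intro i j
    have h3 := add_mem (isCongr_iff_redMat.mpr e i j) (algebraMap_mem_maximalIdeal P (h2 i j))
    rwa [sub_add_cancel] at h3
  let I : Ideal P := Ideal.span {x | ∃ i j, x = D i j}
  have hI : I ≤ maximalIdeal P := Ideal.span_le.mpr (by rintro _ ⟨i, j, rfl⟩; exact hD i j)
  have : Nontrivial (P ⧸ I) := Ideal.Quotient.nontrivial_iff.mpr fun h =>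
    (maximalIdeal.isMaximal P).ne_top (top_le_iff.mp (h ▸ hI))
  have hloc : IsLocalRing (P ⧸ I) := IsLocalRing.of_surjective' _ Ideal.Quotient.mk_surjective
  let p : P →ₐ[O] P ⧸ I := Ideal.Quotient.mkₐ O I
  have hp : Function.Surjective p := Ideal.Quotient.mkₐ_surjective O I
  have hcnl : IsCNL O (P ⧸ I) := IsCNL.of_surjective p hp
  have hm : ∀ x ∈ maximalIdeal P, p x ∈ maximalIdeal (P ⧸ I) := fun x hx =>
    map_mem_maximalIdeal (IsCNL.residue_surjective (O := O)) p hx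
  refine ⟨P ⧸ I, inferInstance, hloc, inferInstance, p.mapMatrix (M 0 φ₀), p.mapMatrix (M 1 σ₀),
    hcnl, (hM _ _).map p hm, (hM _ _).map p hm, ?_, ?_, ?_⟩
  · rw [← map_mul, ← map_pow, ← map_mul, ← sub_eq_zero, ← map_sub]
    ext i j
    exact Ideal.Quotient.eq_zero_iff_mem.mpr (Ideal.subset_span ⟨i, j, rfl⟩)
  · intro A _ _ _ _ F' S' hF hS hr
    let N : Fin 2 → Mat4 A := ![F' - extMat A φ₀, S' - extMat A σ₀]
    obtain ⟨f, hf⟩ := exists_powerSeries_lift_local (O := O)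
      (fun x : Fin 2 × Fin 4 × Fin 4 => N x.1 x.2.1 x.2.2) (by
        rintro ⟨a, i, j⟩
        fin_cases a
        · exact hF i j
        · exact hS i j)
    have hf' : ∀ a M₀, f.mapMatrix (M a M₀) = extMat A M₀ + N a := fun a M₀ => by
      ext i j
      simp only [M, extMat, map_add, AlgHom.mapMatrix_apply, Matrix.add_apply, Matrix.map_apply,
        Matrix.of_apply, hf, Algebra.ofId_apply]
      rw [show f (algebraMap O P (M₀ i j)) = algebraMap O A (M₀ i j) from f.commutes _]
    have h0 : f.mapMatrix (M 0 φ₀) = F' := by rw [hf']; simp [N]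
    have h1 : f.mapMatrix (M 1 σ₀) = S' := by rw [hf']; simp [N]
    have hfD : f.mapMatrix D = 0 := by
      simp only [D, map_sub, map_mul, map_pow, h0, h1, hr, sub_self]
    refine ⟨Ideal.Quotient.liftₐ I f fun x hx => ?_, h0, h1⟩
    exact (Ideal.span_le (I := RingHom.ker f)).mpr (by
      rintro _ ⟨i, j, rfl⟩; exact congrFun (congrFun hfD i) j) hx
  · intro A _ _ _ _ f g h0 h1
    refine AlgHom.cancel_right hp |>.mp
      (generates_X.algHom_ext (fun x => X_mem_maximalIdeal x) ?_)
    have key : ∀ a M₀, f.mapMatrix (p.mapMatrix (M a M₀)) = g.mapMatrix (p.mapMatrix (M a M₀)) →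
        ∀ i j, f (p (MvPowerSeries.X (a, i, j))) = g (p (MvPowerSeries.X (a, i, j))) :=
      fun a M₀ h i j => by
        have := congrFun (congrFun h i) j
        simpa [M, extMat, Algebra.ofId_apply] using this
    rintro ⟨a, i, j⟩
    fin_cases a
    · exact key 0 _ h0 i j
    · exact key 1 _ h1 i j

theorem exists_isFramedDeformationRing [IsCNL O O] (hℓO : (ℓ : O) ∈ maximalIdeal O)
    (hbar : IsTame ℓ rbar) (hφ : IsFrobeniusLift L φ) (hσ : IsTameGenerator L ℓ σ) {j : ℕ}
    (hj : rbar σ ^ ℓ ^ j = 1) (hℓ : ℓ.Coprime (resCard L)) (hq : ¬ resCard L ≡ 1 [MOD ℓ]) {φ₀ σ₀ : Mat4 O}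
    (hφ₀ : φ₀.map (residue O) = (rbar φ).val) (hσ₀ : σ₀.map (residue O) = (rbar σ).val) :
    ∃ (R : Type u) (_ : CommRing R) (_ : IsLocalRing R) (_ : Algebra O R)
      (_ : IsLocalHom (algebraMap O R)) (runiv : AbsGal L →* GL4 R),
      IsFramedDeformationRing rbar R runiv := by
  obtain ⟨R, _, _, _, F, S, U⟩ := exists_isUniversalPair (q := resCard L) (φ₀ := φ₀) (σ₀ := σ₀) (by
    have := congrArg Units.val (hbar.rel hφ hσ hℓ hq hj)
    rw [Units.val_mul, Units.val_mul, Units.val_pow_eq_pow_val, ← hφ₀, ← hσ₀] at this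
    change (residue O).mapMatrix (φ₀ * σ₀) = (residue O).mapMatrix (σ₀ ^ resCard L * φ₀)
    rw [map_mul, map_mul, map_pow]
    exact this)
  have := U.cnl
  obtain ⟨ρ, hρ, hl, rfl, rfl⟩ :=
    exists_isLift hℓO hbar hφ hσ hj hℓ hq hφ₀ hσ₀ U.congr_frob U.congr_tame U.rel
  refine ⟨R, inferInstance, inferInstance, inferInstance, inferInstance, ρ,
    U.cnl.noetherian, U.cnl.complete, U.cnl.residue_surjective, hρ.isAdicContinuous, hl, ?_⟩
  intro A _ _ _ _ _ hA ρ' hc hl'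
  have := isCNL_of_isArtinianRing hA
  have ht := hl'.isTameRep hℓO hbar hσ hj hc
  obtain ⟨f, h1, h2⟩ := U.exists_hom A (ρ' φ).val (ρ' σ).val
    ((isCongr_iff_map_eq hφ₀).mpr (hl' φ)) ((isCongr_iff_map_eq hσ₀).mpr (hl' σ))
    (congrArg Units.val (ht.rel (O := O) hφ hσ hℓ hq
      (exists_redPow_pow_eq_one_of_isLift hℓO hbar hσ hj hl' σ)))
  refine ⟨f, ?_, fun g hg => U.hom_ext A g f ?_ ?_⟩
  · exact (hρ.map (f : R →+* A) fun x hx => map_mem_maximalIdeal hA f hx).ext (O := O) ht hφ hσ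
      (Units.ext h1) (Units.ext h2)
  · rw [h1, ← hg]; rfl
  · rw [h2, ← hg]; rfl

end Lift

/-! ### Inertial types and tame generators -/

section Monodromy

variable {L : Type v} [Field L] [ValuativeRel L] [TopologicalSpace L]
  [IsNonarchimedeanLocalField L] [CharZero L] {ℓ : ℕ} [Fact ℓ.Prime]
variable {O : Type u} [CommRing O] [IsLocalRing O] [Finite (ResidueField O)] [IsCNL O O]
variable {φ : AbsGal L} {σ : inertia L}

/-- The elementary unipotent matrix `1 + E₀₁`. -/
def unipotent01 (O : Type u) [CommRing O] : GL4 O where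
  val := 1 + Matrix.single 0 1 1
  inv := 1 - Matrix.single 0 1 1
  val_inv := by simp [add_mul, mul_sub]
  inv_val := by simp [sub_mul, mul_add]

theorem unipotent01_pow (n : ℕ) : (unipotent01 O ^ n).val = 1 + Matrix.single 0 1 (n : O) := by
  induction n with
  | zero => simp
  | succ n ih =>
    rw [pow_succ, Units.val_mul, ih]
    simp only [unipotent01, add_mul, mul_add, Nat.cast_succ, Matrix.single_add, one_mul, mul_one,
      Matrix.single_mul_single_of_ne, ne_eq, one_ne_zero, not_false_eq_true]
    abel

theorem exists_tame_unipotent01 (hℓO : (ℓ : O) ∈ maximalIdeal O) (hφ : IsFrobeniusLift L φ)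
    (hσ : IsTameGenerator L ℓ σ) (hℓ : ℓ.Coprime (resCard L)) (hq : ¬ resCard L ≡ 1 [MOD ℓ])
    {r : O} (hr : resCard L * r = 1) :
    ∃ ρ : AbsGal L →* GL4 O, IsTameRep ℓ ρ ∧ ρ σ = unipotent01 O := by
  let F : GL4 O := ⟨Matrix.diagonal ![resCard L, 1, 1, 1], Matrix.diagonal ![r, 1, 1, 1], by
    rw [Matrix.diagonal_mul_diagonal, ← Matrix.diagonal_one]
    congr 1; ext i; fin_cases i <;> simp [hr], by
    rw [Matrix.diagonal_mul_diagonal, ← Matrix.diagonal_one]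
    congr 1; ext i; fin_cases i <;> simp [mul_comm r, hr]⟩
  obtain ⟨ρ, h1, -, h2⟩ := exists_isTameRep (O := O) (F := F) (S := unipotent01 O) hφ hσ hℓ hq
    (by
      ext1
      rw [Units.val_mul, Units.val_mul, unipotent01_pow]
      simp only [F, unipotent01, add_mul, mul_add, one_mul, mul_one, add_right_inj]
      ext i j
      rw [Matrix.diagonal_mul, Matrix.mul_diagonal, Matrix.single_apply, Matrix.single_apply]
      split_ifs with h
      · rw [← h.1, ← h.2]; simp
      · simp)
    (exists_redPow_pow_eq_one hℓO (j := 1) (by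
      rw [← map_pow, pow_one]
      ext i j
      change residue O ((unipotent01 O ^ ℓ).val i j) = _
      rw [unipotent01_pow, Matrix.add_apply, map_add, Matrix.single_apply]
      have : residue O (ℓ : O) = 0 := (residue_eq_zero_iff _).mpr hℓO
      split_ifs <;> simp [this, Matrix.one_apply, apply_ite]))
  exact ⟨ρ, h1, h2⟩

theorem eq_ex_smul_lg {A : Type u} [CommRing A] [IsLocalRing A] [Algebra O A] [IsCNL O A]
    {c : O} (hc : 6 * c = 1) (hσ : IsTameGenerator L ℓ σ) {ρt : AbsGal L →* GL4 O}
    (ht : IsTameRep ℓ ρt) (htσ : ρt σ = unipotent01 O) {ρ : AbsGal L →* GL4 A}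
    (h : IsTameRep ℓ ρ) (h4 : ((ρ σ).val - 1) ^ 4 = 0) (g : inertia L) :
    (ρ g).val = ex c ((ρt g).val 0 1 • lg c (ρ σ).val) := by
  ext i j
  refine IsCNL.eq_of_forall_sub_mem (O := O) fun k => ?_
  have := finite_quotient_pow (O := O) (A := O) k
  have := finite_quotient_pow (O := O) (A := A) k
  obtain ⟨m, hm⟩ := ((ht k).prod (h k)).exists_zpow hσ g
  obtain ⟨n, hn⟩ := mem_powers_iff_mem_zpowers.mpr ⟨m, hm.symm⟩
  have h1 := congrArg Prod.fst hn
  have h2 := congrArg Prod.snd hn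
  have h1 : redPow O k (ρt σ ^ n) = redPow O k (ρt g) := (map_pow _ _ _).trans h1
  have h2 : redPow A k (ρ σ ^ n) = redPow A k (ρ g) := (map_pow _ _ _).trans h2
  have h3 : (n : O) - (ρt g).val 0 1 ∈ maximalIdeal O ^ k := by
    have := redPow_eq_iff.mp h1 0 1
    rwa [htσ, unipotent01_pow, Matrix.add_apply, Matrix.single_apply_same, Matrix.one_apply_ne
      (by decide), zero_add] at this
  have h5 : algebraMap O A ((n : O) - (ρt g).val 0 1) ∈ maximalIdeal A ^ k :=
    ((Ideal.pow_right_mono (J := (maximalIdeal A).comap (algebraMap O A))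
      (fun x hx => algebraMap_mem_maximalIdeal A hx) k).trans
      (Ideal.le_comap_pow (algebraMap O A) k)) h3
  let p := (Ideal.Quotient.mkₐ O (maximalIdeal A ^ k)).mapMatrix (m := Fin 4)
  have h7 : (n : O) • p (lg c (ρ σ).val) = (ρt g).val 0 1 • p (lg c (ρ σ).val) := by
    rw [← sub_eq_zero, ← sub_smul, ← map_smul]
    ext i j
    refine Ideal.Quotient.eq_zero_iff_mem.mpr ?_
    rw [Matrix.smul_apply, Algebra.smul_def]
    exact Ideal.mul_mem_right _ _ h5
  have h8 : p (ρ g).val = p (ex c ((ρt g).val 0 1 • lg c (ρ σ).val)) := by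
    rw [map_ex, map_smul, ← h7, ← map_smul, ← map_ex, ← ex_pow hc (lg_pow h4), ex_lg hc h4]
    exact (congrArg Units.val h2).symm
  exact Ideal.Quotient.eq.mp (congrFun (congrFun h8 i) j)

end Monodromy

section LocalField

variable {E : Type u} [Field E] [ValuativeRel E] [TopologicalSpace E] [IsNonarchimedeanLocalField E]

instance mulArchimedean_valueGroupWithZero : MulArchimedean (ValueGroupWithZero E) :=
  ValuativeRel.isRankLeOne_iff_mulArchimedean.mp inferInstance

theorem isCNL_integers : IsCNL 𝒪[E] 𝒪[E] := by
  let := IsTopologicalAddGroup.rightUniformSpace E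
  have := isUniformAddGroup_of_addCommGroup (G := E)
  have : IsAdicComplete (maximalIdeal 𝒪[E]) 𝒪[E] := inferInstanceAs (IsAdicComplete 𝓂[E] 𝒪[E])
  exact self_isCNL

theorem valuation_lt_one {x : 𝒪[E]} (hx : x ∈ maximalIdeal 𝒪[E]) : valuation E (x : E) < 1 :=
  Valuation.Integer.not_isUnit_iff_valuation_lt_one.mp hx

theorem exists_pow_subset {U : Set E} (hU : U ∈ nhds (0 : E)) :
    ∃ k, ∀ x ∈ maximalIdeal 𝒪[E] ^ k, (x : E) ∈ U := by
  obtain ⟨r, hr, h⟩ := (IsValuativeTopology.hasBasis_nhds_zero' E).mem_iff.mp hU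
  obtain ⟨ϖ, hϖ⟩ := IsDiscreteValuationRing.exists_irreducible 𝒪[E]
  have hm := hϖ.maximalIdeal_eq
  obtain ⟨k, hk⟩ := exists_pow_lt₀ (valuation_lt_one (hm ▸ Ideal.mem_span_singleton_self ϖ))
    (Units.mk0 r hr)
  refine ⟨k, fun x hx => h ?_⟩
  rw [hm, Ideal.span_singleton_pow, Ideal.mem_span_singleton] at hx
  obtain ⟨y, rfl⟩ := hx
  change valuation E ((ϖ : E) ^ k * y) < r
  rw [map_mul, map_pow]
  exact lt_of_le_of_lt (mul_le_of_le_one_right' y.2) hk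

variable {L : Type v} [Field L] [ValuativeRel L] [TopologicalSpace L]
  [IsNonarchimedeanLocalField L] [CharZero L] {ℓ : ℕ} [Fact ℓ.Prime] {φ : AbsGal L} {σ : inertia L}

theorem apply_tameGenerator_ne_one (hℓE : (ℓ : 𝒪[E]) ∈ maximalIdeal 𝒪[E])
    (hσ : IsTameGenerator L ℓ σ) {t : inertia L →* Multiplicative E} (ht : Continuous t)
    (ht1 : t ≠ 1) : t σ ≠ 1 := by
  intro h
  apply ht1
  ext1 g
  by_contra hg
  have ha : (t g).toAdd ≠ 0 := hg
  have hv : valuation E (t g).toAdd ≠ 0 := (map_ne_zero _).mpr ha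
  let B := ((valuation E).ltAddSubgroup (Units.mk0 _ hv)).toSubgroup
  have hB : IsOpen (B : Set (Multiplicative E)) := by
    refine Subgroup.isOpen_of_mem_nhds B (g := 1) ?_
    exact (IsValuativeTopology.hasBasis_nhds_zero' E).mem_of_mem hv
  let V := B.comap t
  have hV : IsOpen (V : Set (inertia L)) := hB.preimage ht
  have : CompactSpace (inertia L) := isCompact_iff_compactSpace.mp isClosed_inertia.isCompact
  have : V.Normal := inferInstance
  have : Finite (inertia L ⧸ V) := V.quotient_finite_of_isOpen hV
  have hle : proEllKernel L ℓ ≤ V := by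
    have := proEllKernel_le_ker (f := QuotientGroup.mk' V) (ℓ := ℓ)
      (by rw [QuotientGroup.ker_mk']; exact hV) ?_
    · rwa [QuotientGroup.ker_mk'] at this
    rintro ⟨_, x, rfl⟩
    by_cases hx : (t x).toAdd = 0
    · refine ⟨0, Subtype.ext ?_⟩
      rw [pow_zero, pow_one]
      refine (QuotientGroup.eq_one_iff x).mpr ?_
      change valuation E (t x).toAdd < valuation E (t g).toAdd
      rw [hx, map_zero]
      exact zero_lt_iff.mpr hv
    have hx0 : valuation E (t x).toAdd ≠ 0 := (map_ne_zero _).mpr hx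
    obtain ⟨j, hj⟩ := exists_pow_lt₀ (valuation_lt_one hℓE)
      (Units.mk0 _ hv / Units.mk0 _ hx0)
    refine ⟨j, Subtype.ext ?_⟩
    change QuotientGroup.mk' V x ^ ℓ ^ j = 1
    rw [← map_pow]
    refine (QuotientGroup.eq_one_iff _).mpr ?_
    change valuation E (t (x ^ ℓ ^ j)).toAdd < valuation E (t g).toAdd
    rw [map_pow, toAdd_pow, nsmul_eq_mul, map_mul, Nat.cast_pow, map_pow]
    rw [Units.val_div_eq_div_val, Units.val_mk0, Units.val_mk0, lt_div_iff₀ (zero_lt_iff.mpr hx0)] at hj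
    exact hj
  obtain ⟨m, p, hp, y, hy, rfl⟩ := exists_eq_zpow_mul hσ hV g
  have hσV : σ ∈ V := by
    change t σ ∈ B
    rw [h]
    exact one_mem B
  have hmem : σ ^ m * p * y ∈ V := mul_mem (mul_mem (zpow_mem hσV m) (hle hp)) hy
  exact lt_irrefl (valuation E (t (σ ^ m * p * y)).toAdd) hmem

theorem nilExp_eq_ex [CharZero E] {c : 𝒪[E]} (hc : 6 * c = 1) {N : Mat4 (AlgebraicClosure E)}
    (hN : N ^ 4 = 0) : nilExp N = ex c N := by
  have : CharZero (AlgebraicClosure E) := charZero_of_injective_algebraMap (algebraMap E _).injective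
  have h1 : algebraMap 𝒪[E] (AlgebraicClosure E) c = 6⁻¹ := by
    have := congrArg (algebraMap 𝒪[E] (AlgebraicClosure E)) hc
    rw [map_mul, map_one, map_ofNat] at this
    exact eq_inv_of_mul_eq_one_right this
  have h2 : algebraMap 𝒪[E] (AlgebraicClosure E) (3 * c) = 2⁻¹ := by
    rw [map_mul, h1, map_ofNat]; norm_num
  rw [nilExp, ex_eq, ← algebraMap_smul (AlgebraicClosure E) (3 * c),
    ← algebraMap_smul (AlgebraicClosure E) c, h1, h2]
  simp [Finset.sum_range_succ, hN, Nat.factorial]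

variable [CharZero E] {R : Type u} [CommRing R] [IsLocalRing R] [Algebra 𝒪[E] R] [IsCNL 𝒪[E] R]

theorem hasUnipotentType_iff (hℓE : (ℓ : 𝒪[E]) ∈ maximalIdeal 𝒪[E]) (hφ : IsFrobeniusLift L φ)
    (hσ : IsTameGenerator L ℓ σ) (hℓ : ℓ.Coprime (resCard L)) (hq : ¬ resCard L ≡ 1 [MOD ℓ])
    {r c : 𝒪[E]} (hr : resCard L * r = 1) (hc : 6 * c = 1) {m : List ℕ}
    {Ty : Mat4 (AlgebraicClosure E) → Prop} (hTy : ∀ M, Ty M ↔ ∃ P : (Mat4 (AlgebraicClosure E))ˣ,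
      M = conjHom (AlgebraicClosure E) P (jordanNilpotent 4 m (AlgebraicClosure E)))
    (hTy4 : ∀ M, Ty M → M ^ 4 = 0) (hsmul : ∀ M, Ty M → ∀ a : AlgebraicClosure E, a ≠ 0 → Ty (a • M))
    {ρ : AbsGal L →* GL4 R} (h : IsTameRep ℓ ρ) (x : R →ₐ[𝒪[E]] AlgebraicClosure E) :
    HasUnipotentType m ((GLMap (x : R →+* AlgebraicClosure E)).comp ρ) ↔
      IsTypePoint c Ty (ρ σ).val x := by
  constructor
  · rintro ⟨t, ht, ht1, N, -, -, P, h1, h2⟩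
    have hN : Ty N := (hTy N).mpr ⟨P, h2⟩
    have h0 : algebraMap E (AlgebraicClosure E) (t σ).toAdd ≠ 0 :=
      (map_ne_zero _).mpr (apply_tameGenerator_ne_one hℓE hσ ht ht1)
    have hN' := hsmul N hN _ h0
    have h4 := hTy4 _ hN'
    have h3 := h1 σ
    rw [MonoidHom.one_apply, mul_one, mul_inv_cancel, ← algebraMap_smul (AlgebraicClosure E) (t σ).toAdd,
      nilExp_eq_ex hc (by rw [neg_pow, h4, mul_zero])] at h3
    have h5 := ex_smul_mul_ex_smul hc h4 (-1) 1
    rw [neg_one_smul, one_smul, neg_add_cancel] at h5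
    replace h5 := h5.trans ((congrArg (ex c) (zero_smul _ _)).trans (ex_zero c))
    have h6 : x.mapMatrix (ρ σ).val = ex c (algebraMap E (AlgebraicClosure E) (t σ).toAdd • N) :=
      left_inv_eq_right_inv h3 h5
    rw [IsTypePoint, h6, lg_ex hc h4]
    exact ⟨ex_sub_one_pow h4, hN'⟩
  · rintro ⟨h4, hN⟩
    have := isCNL_integers (E := E)
    obtain ⟨ρt, hρt, hρtσ⟩ := exists_tame_unipotent01 hℓE hφ hσ hℓ hq hr
    have hnt : Nontrivial (R ⧸ RingHom.ker x) :=
      Ideal.Quotient.nontrivial_iff.mpr (RingHom.ker_ne_top _)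
    have hloc : IsLocalRing (R ⧸ RingHom.ker x) :=
      IsLocalRing.of_surjective' _ Ideal.Quotient.mk_surjective
    let p : R →ₐ[𝒪[E]] R ⧸ RingHom.ker x := Ideal.Quotient.mkₐ _ _
    have hcnl : IsCNL 𝒪[E] (R ⧸ RingHom.ker x) :=
      IsCNL.of_surjective p (Ideal.Quotient.mkₐ_surjective _ _)
    let y : R ⧸ RingHom.ker x →ₐ[𝒪[E]] AlgebraicClosure E := Ideal.kerLiftAlg x
    have hy : Function.Injective (y.mapMatrix (m := Fin 4)) := fun M M' hM =>
      Matrix.map_injective (Ideal.kerLiftAlg_injective x) hM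
    have hyp : ∀ M : Mat4 R, y.mapMatrix (p.mapMatrix M) = x.mapMatrix M := fun M => rfl
    have hp := h.map (p : R →+* R ⧸ RingHom.ker x) fun a ha =>
      map_mem_maximalIdeal (IsCNL.residue_surjective (O := 𝒪[E])) p ha
    have h4' : (p.mapMatrix (ρ σ).val - 1) ^ 4 = 0 := hy (by
      rw [map_pow, map_sub, map_one, hyp, h4, map_zero])
    have key : ∀ g : inertia L, x.mapMatrix (ρ g).val =
        ex c ((ρt g).val 0 1 • lg c (x.mapMatrix (ρ σ).val)) := fun g => by
      have := congrArg y.mapMatrix (eq_ex_smul_lg hc hσ hρt hρtσ hp h4' g)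
      rw [map_ex, map_smul, map_lg] at this
      exact this
    have hU : ∀ g : inertia L, (ρt g).val = 1 + Matrix.single 0 1 ((ρt g).val 0 1) := fun g => by
      have hs : (Matrix.single 0 1 1 : Mat4 𝒪[E]) ^ 2 = 0 := by
        rw [pow_two]; exact Matrix.single_mul_single_of_ne _ _ _ _ (by decide) _
      have hs' : (unipotent01 𝒪[E]).val = 1 + Matrix.single 0 1 1 := rfl
      have := eq_ex_smul_lg hc hσ hρt hρtσ hρt (by
        rw [hρtσ, hs', add_sub_cancel_left, pow_mul _ 2 2, hs, zero_pow two_ne_zero]) g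
      have hs2 : ((ρt g).val 0 1 • Matrix.single 0 1 1 : Mat4 𝒪[E]) ^ 2 = 0 := by
        rw [smul_pow, hs, smul_zero]
      rw [hρtσ, hs', lg_of_sq hs, ex_eq, pow_succ _ 2, hs2] at this
      conv_lhs => rw [this]
      simp
    let t : inertia L →* Multiplicative E :=
      { toFun := fun g => Multiplicative.ofAdd ((ρt g).val 0 1 : E)
        map_one' := by
          rw [Subgroup.coe_one, map_one, Units.val_one, Matrix.one_apply_ne (by decide)]; rfl
        map_mul' := fun g g' => by
          rw [Subgroup.coe_mul, map_mul, Units.val_mul, hU g, hU g', ← ofAdd_add]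
          simp [mul_add, add_mul, add_comm] }
    have h4N := hTy4 _ hN
    have hsm : ∀ g, (t g).toAdd • lg c (x.mapMatrix (ρ σ).val) =
        (ρt g).val 0 1 • lg c (x.mapMatrix (ρ σ).val) := fun g =>
      algebraMap_smul E ((ρt g).val 0 1) _
    refine ⟨t, ?_, ?_, lg c (x.mapMatrix (ρ σ).val), ⟨4, h4N⟩, ⟨⊤, isOpen_univ, fun g _ => ?_⟩, ?_⟩
    · refine continuous_of_continuousAt_one t (fun U hU' => ?_)
      rw [map_one] at hU'
      obtain ⟨k, hk⟩ := exists_pow_subset (E := E) (U := Multiplicative.ofAdd ⁻¹' U) hU'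
      refine Filter.mem_map.mpr (Filter.mem_of_superset
        (((hρt.isAdicContinuous k).preimage continuous_subtype_val).mem_nhds ?_) fun g hg => ?_)
      · intro i j
        simp
      · have := hk _ (hg 0 1)
        rwa [Matrix.one_apply_ne (by decide), sub_zero] at this
    · intro h0
      have := DFunLike.congr_fun h0 σ
      have : ((ρt σ).val 0 1 : E) = 0 := this
      rw [hρtσ] at this
      simp [unipotent01] at this
    · rw [hsm, nilExp_eq_ex hc (by rw [smul_pow, h4N, smul_zero])]
      exact key g
    · obtain ⟨P, hP⟩ := (hTy _).mp hN
      refine ⟨P, fun g => ?_, hP⟩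
      rw [MonoidHom.one_apply, mul_one, mul_inv_cancel, hsm, ← neg_smul,
        nilExp_eq_ex hc (by rw [smul_pow, h4N, smul_zero])]
      refine (congrArg (· * _) (key g)).trans ?_
      rw [ex_smul_mul_ex_smul hc h4N, add_neg_cancel]
      exact (congrArg (ex c) (zero_smul _ _)).trans (ex_zero c)

theorem typeIdeal_eq_pointIdeal (hℓE : (ℓ : 𝒪[E]) ∈ maximalIdeal 𝒪[E]) (hφ : IsFrobeniusLift L φ)
    (hσ : IsTameGenerator L ℓ σ) (hℓ : ℓ.Coprime (resCard L)) (hq : ¬ resCard L ≡ 1 [MOD ℓ])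
    {r c : 𝒪[E]} (hr : resCard L * r = 1) (hc : 6 * c = 1) {ρ : AbsGal L →* GL4 R}
    (h : IsTameRep ℓ ρ) :
    typeIdeal E [1, 1, 1, 1] ρ = pointIdeal c (TyZero (K := AlgebraicClosure E)) (ρ σ).val ∧
    typeIdeal E [2, 2] ρ = pointIdeal c (TySquare (K := AlgebraicClosure E)) (ρ σ).val ∧
    typeIdeal E [4] ρ = pointIdeal c (TyRegular (K := AlgebraicClosure E)) (ρ σ).val := by
  have key := fun m Ty h1 h2 h3 =>
    hasUnipotentType_iff (m := m) (Ty := Ty) hℓE hφ hσ hℓ hq hr hc h1 h2 h3 h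
  simp only [typeIdeal, pointIdeal]
  simp only [key _ _ (fun _ => tyZero_iff) (fun M hM => by rw [hM, zero_pow four_ne_zero])
      fun M hM a _ => hM.smul a,
    key _ _ (fun _ => tySquare_iff) (fun M hM => by rw [pow_mul M 2 2, pow_two M, hM.1, zero_pow two_ne_zero])
      fun M hM a ha => hM.smul ha,
    key _ _ (fun _ => tyRegular_iff) (fun M hM => hM.1) fun M hM a ha => hM.smul ha, and_self]

end LocalField

/-! ### Banal primes -/

section Arithmetic

theorem IsBanal.coprime {ℓ q : ℕ} (h : IsBanal 4 ℓ q) (hℓ : ℓ.Prime) : ℓ.Coprime q :=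
  hℓ.coprime_iff_not_dvd.mpr fun hd => h.1 (Nat.modEq_zero_iff_dvd.mpr hd)

theorem IsBanal.lt {ℓ q : ℕ} (h : IsBanal 4 ℓ q) (hℓ : ℓ.Prime) : 5 < ℓ := by
  by_contra! h5
  refine h.2 (ℓ - 1) (Finset.mem_Icc.mpr ?_) ?_
  · have := hℓ.two_le
    lia
  · simpa [Nat.totient_prime hℓ] using Nat.ModEq.pow_totient (h.coprime hℓ).symm

theorem IsBanal.isBanalIn {ℓ q : ℕ} (h : IsBanal 4 ℓ q) (k : Type*) [Field k] [CharP k ℓ] :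
    IsBanalIn k q := by
  have key : ∀ a b : ℕ, (a : k) = b → a ≡ b [MOD ℓ] := fun a b => (CharP.natCast_eq_natCast k ℓ).mp
  refine ⟨fun h0 => h.1 (key _ _ (by simpa using h0)), fun i h1 h4 h0 => ?_⟩
  exact h.2 i (Finset.mem_Icc.mpr ⟨h1, h4⟩) (key _ _ (by simpa using h0))

end Arithmetic

end Banal

end

theorem mainTheorem8
    {L : Type v} [Field L] [ValuativeRel L] [TopologicalSpace L] [IsNonarchimedeanLocalField L]
    [CharZero L]
    {E : Type u} [Field E] [ValuativeRel E] [TopologicalSpace E] [IsNonarchimedeanLocalField E]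
    [CharZero E]
    (ℓ : ℕ) [Fact ℓ.Prime] [CharP 𝓀[E] ℓ] (hq : IsBanal 4 ℓ (resCard L))
    (φ : AbsGal L) (hφ : IsFrobeniusLift L φ)
    (σ : inertia L) (hσ : IsTameGenerator L ℓ σ)
    (rbar : AbsGal L →* Matrix.GeneralLinearGroup (Fin 4) 𝓀[E])
    (hcont : IsAdicContinuous rbar)
    (hP : ∀ g ∈ proEllKernel L ℓ, rbar g = 1)
    (hunip : IsNilpotent ((rbar σ).val - 1))
    (hsplit : (rbar φ).val.charpoly.Splits) :
    (∃ (R : Type u) (_ : CommRing R) (_ : IsLocalRing R) (_ : Algebra 𝒪[E] R)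
      (_ : IsLocalHom (algebraMap 𝒪[E] R))
      (runiv : AbsGal L →* Matrix.GeneralLinearGroup (Fin 4) R),
      IsFramedDeformationRing rbar R runiv) ∧
    ∀ (R : Type u) [CommRing R] [IsLocalRing R] [Algebra 𝒪[E] R]
      [IsLocalHom (algebraMap 𝒪[E] R)]
      (runiv : AbsGal L →* Matrix.GeneralLinearGroup (Fin 4) R),
      IsFramedDeformationRing rbar R runiv →
      (Subsingleton (FixedTypeRing E [1, 1, 1, 1] runiv) ∨
        Nonempty (FixedTypeRing E [1, 1, 1, 1] runiv ≃ₐ[𝒪[E]] MvPowerSeries (Fin 16) 𝒪[E])) ∧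
      (Subsingleton (FixedTypeRing E [4] runiv) ∨
        Nonempty (FixedTypeRing E [4] runiv ≃ₐ[𝒪[E]] MvPowerSeries (Fin 16) 𝒪[E])) ∧
      (rbar σ = 1 ∧ IsConjScalarDiag (rbar φ) ![(resCard L : 𝓀[E]), resCard L, 1, 1] →
        Nonempty (FixedTypeRing E [2, 2] runiv ≃ₐ[𝒪[E]]
          MvPowerSeries (Fin 9) (Rhat22 𝒪[E]))) ∧
      (rbar σ = 1 ∧
          IsConjScalarDiag (rbar φ) ![(resCard L : 𝓀[E]) ^ 2, resCard L, resCard L, 1] →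
        Nonempty (FixedTypeRing E [2, 2] runiv ≃ₐ[𝒪[E]]
          MvPowerSeries (Fin 11) (Rhat121 𝒪[E]))) ∧
      (¬ (rbar σ = 1 ∧ IsConjScalarDiag (rbar φ) ![(resCard L : 𝓀[E]), resCard L, 1, 1]) →
        ¬ (rbar σ = 1 ∧
          IsConjScalarDiag (rbar φ) ![(resCard L : 𝓀[E]) ^ 2, resCard L, resCard L, 1]) →
        Subsingleton (FixedTypeRing E [2, 2] runiv) ∨
        Nonempty (FixedTypeRing E [2, 2] runiv ≃ₐ[𝒪[E]] MvPowerSeries (Fin 16) 𝒪[E])) := by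
  have hℓ : ℓ.Prime := Fact.out
  have hcnl := isCNL_integers (E := E)
  have hcomp : IsAdicComplete (maximalIdeal 𝒪[E]) 𝒪[E] := hcnl.complete
  have hinf : Infinite 𝒪[E] := Infinite.of_injective (fun n : ℕ => (n : 𝒪[E])) fun a b h =>
    Nat.cast_injective (R := E) (congrArg Subtype.val h)
  have hfin : Finite (ResidueField 𝒪[E]) := inferInstanceAs (Finite 𝓀[E])
  have hcast : ∀ n : ℕ, residue 𝒪[E] (n : 𝒪[E]) = (n : 𝓀[E]) := fun n => map_natCast _ n
  have hℓE : (ℓ : 𝒪[E]) ∈ maximalIdeal 𝒪[E] := by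
    rw [← residue_eq_zero_iff, hcast, CharP.cast_eq_zero]
  have hcop := hq.coprime hℓ
  have hq1 : ¬ resCard L ≡ 1 [MOD ℓ] := by simpa using hq.2 1 (by simp)
  have hbanal : IsBanalIn 𝓀[E] (resCard L) := hq.isBanalIn 𝓀[E]
  obtain ⟨r, hr⟩ : ∃ r : 𝒪[E], (resCard L : 𝒪[E]) * r = 1 := by
    refine ((IsLocalRing.residue_ne_zero_iff_isUnit _).mp ?_).exists_right_inv
    rw [hcast]
    exact hbanal.1
  obtain ⟨c, hc⟩ : ∃ c : 𝒪[E], 6 * c = 1 := by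
    refine ((IsLocalRing.residue_ne_zero_iff_isUnit _).mp fun h6 => ?_).exists_right_inv
    have h7 := (CharP.cast_eq_zero_iff 𝓀[E] ℓ 6).mp ((hcast 6).symm.trans h6)
    have h8 : ℓ = 6 := le_antisymm (Nat.le_of_dvd (by norm_num) h7) (hq.lt hℓ)
    rw [h8] at hℓ
    exact absurd hℓ (by norm_num)
  have hbar : IsTame ℓ rbar := by
    refine ⟨?_, hP⟩
    convert! hcont 1 using 1
    ext g
    rw [SetLike.mem_coe, MonoidHom.mem_ker, Units.ext_iff, ← Matrix.ext_iff]
    simp only [pow_one, maximalIdeal_eq_bot, Ideal.mem_bot, sub_eq_zero]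
    rfl
  obtain ⟨j, hj⟩ : ∃ j, rbar σ ^ ℓ ^ j = 1 := by
    obtain ⟨n, hn⟩ := hunip
    refine ⟨n, Units.ext ?_⟩
    rw [Units.val_pow_eq_pow_val, Units.val_one, ← sub_eq_zero, ← one_pow (ℓ ^ n),
      ← sub_pow_char_pow_of_commute ℓ n (Commute.one_right _)]
    exact pow_eq_zero_of_le (Nat.lt_pow_self hℓ.one_lt).le hn
  have hlift : ∀ M : Mat4 𝓀[E], ∃ M₀ : Mat4 𝒪[E], M₀.map (residue 𝒪[E]) = M := fun M => by
    choose M₀ hM₀ using fun i j => IsLocalRing.residue_surjective (M i j)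
    exact ⟨Matrix.of M₀, by ext i j; exact hM₀ i j⟩
  obtain ⟨φ₀, hφ₀⟩ := hlift (rbar φ).val
  obtain ⟨σ₀, hσ₀⟩ := hlift (rbar σ).val
  refine ⟨exists_isFramedDeformationRing hℓE hbar hφ hσ hj hcop hq1 hφ₀ hσ₀, ?_⟩
  intro R _ _ _ _ runiv hR
  have U := hR.isUniversalPair hℓE hbar hφ hσ hj hcop hq1 hφ₀ hσ₀
  have hRcnl := hR.isCNL
  obtain ⟨hT1, hT2, hT4⟩ := typeIdeal_eq_pointIdeal hℓE hφ hσ hcop hq1 hr hc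
    (hR.lift.isTameRep hℓE hbar hσ hj hR.continuous)
  have hOK : Function.Injective (algebraMap 𝒪[E] (AlgebraicClosure E)) :=
    (algebraMap E (AlgebraicClosure E)).injective.comp Subtype.val_injective
  have hsplit' : (φ₀.map (residue 𝒪[E])).charpoly.Splits := by rw [hφ₀]; exact hsplit
  have hu : IsUnit (φ₀.map (residue 𝒪[E])) := by rw [hφ₀]; exact (rbar φ).isUnit
  have hσ1 : rbar σ = 1 ↔ IsCongr σ₀ (1 : Mat4 𝒪[E]) := by
    rw [isCongr_iff_residue, hσ₀, Matrix.map_one _ (map_zero _) (map_one _), Units.ext_iff,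
      Units.val_one]
  have hc22 : IsConjScalarDiag (rbar φ) ![(resCard L : 𝓀[E]), resCard L, 1, 1] ↔
      IsPowConj (resCard L) ![1, 1, 0, 0] (φ₀.map (residue 𝒪[E])) := by
    rw [hφ₀, ← isConjScalarDiag_iff hsplit rfl]
    refine iff_of_eq (congrArg _ ?_)
    ext i; fin_cases i <;> simp
  have hc121 : IsConjScalarDiag (rbar φ) ![(resCard L : 𝓀[E]) ^ 2, resCard L, resCard L, 1] ↔
      IsPowConj (resCard L) ![2, 1, 1, 0] (φ₀.map (residue 𝒪[E])) := by
    rw [hφ₀, ← isConjScalarDiag_iff hsplit rfl]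
    refine iff_of_eq (congrArg _ ?_)
    ext i; fin_cases i <;> simp
  simp only [FixedTypeRing]
  rw [hT1, hT2, hT4, hσ1, hc22, hc121]
  exact ⟨zero_subsingleton_or_equiv_of_splits hOK hc U hsplit',
    regular_subsingleton_or_equiv_of_splits hOK hc U hbanal hu hsplit',
    fun h => square22_equiv_vertex_of_isPowConj hOK hc U hbanal hr h.1 h.2,
    fun h => square121_equiv_vertex_of_isPowConj hOK hc U hbanal hr h.1 h.2,
    square_subsingleton_or_equiv_of_splits hOK hc U hbanal hr hu hsplit'⟩
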